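/- Let $\mathcal N$ be a von Neumann algebra with a normal semifinite faithful trace $\tau$, and let $(T_t)_{t\ge 0}$ be a standard semigroup on $\mathcal N$: a semigroup, $T_0=\mathrm{id}$, of normal completely positive maps with $T_t(1)=1$ and $\tau(T_t(f)g)=\tau(fT_t(g))$, such that $T_tf\to f$ strongly as $t\to0$ for every $f\in\mathcal N$. Its extensions to the spaces $L_p(\mathcal N)$, $1\le p<\infty$, are also denoted by $T_t$. Let $A$ be the generator, $Af=\lim_{t\to0}t^{-1}(f-T_tf)$, with $\mathrm{dom}(A)=\bigcup_{1\le p\le\infty}\mathrm{dom}_p(A)$, where $\mathrm{dom}_p(A)$ is the set of $f\in L_p(\mathcal N)$ for which this limit exists in $L_p(\mathcal N)$ (in operator norm for $p=\infty$). Let $$P_t=e^{-tA^{1/2}}=\frac1{2\sqrt\pi}\int_0^\infty t\,e^{-t^2/4u}u^{-3/2}\,T_u\,du ,\qquad t>0,$$ be the subordinated Poisson semigroup, and let $$2\Gamma(f,g)=A(f^*)g+f^*A(g)-A(f^*g),\qquad \hat\Gamma(P_sf,P_sf)=\Gamma(P_sf,P_sf)+|\partial_sP_sf|^2 .$$ Assume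 that $\Gamma^2\ge 0$, i.e. that there is a weak$^*$ dense $*$-subalgebra $\mathcal A\subset\mathcal N$ with $T_s(\mathcal A)\subset\mathcal A\subset\mathrm{dom}(A)$ for all $s\ge0$, such that $\Gamma(T_vf,T_vf)\le T_v\Gamma(f,f)$ for all $v>0$ and $f\in\mathcal A$. For $f\in\mathcal N\cup L_2(\mathcal N)$ put, with $|x|^2=x^*x$ and with values in $[0,\infty]$, $$\|f\|_{bmo^c(\mathcal P)}=\sup_{t>0}\big\|P_t|f|^2-|P_tf|^2\big\|^{1/2},\qquad \|f\|_{BMO^c(\mathcal P)}=\sup_{t>0}\big\|P_t|f-P_tf|^2\big\|^{1/2},$$ $$\|f\|_{BMO^c(\hat\Gamma)}=\sup_{t>0}\Big\|P_t\int_0^t\hat\Gamma(P_sf,P_sf)\,s\,ds\Big\|^{1/2},$$ where $\|\cdot\|$ is the operator norm (equal to $\infty$ at an unbounded operator in $L_1(\mathcal N)$) and, in the last line, the integral is the weak integral over $(0,t)$ of the positive elements $$P_t\Gamma(P_sf,P_sf)=\lim_{r\to0^+}\tfrac12P_t\big(A_r((P_sf)^*)\,P_sf+(P_sf)^*A_r(P_sf)-A_r(|P_sf|^2)\big),\quad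 A_r=r^{-1}(1-T_r),$$ plus $P_t|\partial_sP_sf|^2$, multiplied by $s$. Then these three seminorms are equivalent on $\mathcal N\cup L_2(\mathcal N)$, with absolute constants: there is a universal constant $C>0$, independent of $\mathcal N$, $\tau$, $(T_t)$ and $f$, such that each of the three quantities is at most $C$ times each of the other two, for all $f\in\mathcal N\cup L_2(\mathcal N)$. -/

import Mathlib

open Set Filter Topology MeasureTheory
open scoped ENNReal NNReal InnerProductSpace CStarAlgebra

universe u

noncomputable section

namespace SemigroupBMO

variable {H : Type u} [NormedAddCommGroup H] [InnerProductSpace ℂ H] [CompleteSpace H]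

/-! ### A von Neumann algebra as a C⋆-algebra with the Loewner order -/

instance instSMulMemClass : SMulMemClass (VonNeumannAlgebra H) ℂ (H →L[ℂ] H) where
  smul_mem {s} c _ hx := s.toStarSubalgebra.smul_mem hx c

instance instIsClosed (N : VonNeumannAlgebra H) : IsClosed (N : Set (H →L[ℂ] H)) := by
  rw [← N.centralizer_centralizer]
  exact Set.isClosed_centralizer _

/-- The order of a von Neumann algebra is the one of the operators on the Hilbert space. -/
instance instPartialOrder (N : VonNeumannAlgebra H) : PartialOrder N :=
  Subtype.partialOrder _

instance instStarOrderedRing (N : VonNeumannAlgebra H) : StarOrderedRing N :=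
  StarOrderedRing.of_le_iff fun x y => by
    have key : x ≤ y ↔ 0 ≤ y - x := by
      change (x : H →L[ℂ] H) ≤ y ↔ 0 ≤ ((y - x : N) : H →L[ℂ] H)
      rw [AddSubgroupClass.coe_sub, sub_nonneg]
    rw [key]
    constructor
    · intro h
      have h' : (0 : H →L[ℂ] H) ≤ ((y - x : N) : H →L[ℂ] H) := h
      have hmem : CFC.sqrt ((y - x : N) : H →L[ℂ] H) ∈ N := by
        rw [← SetLike.mem_coe, ← N.centralizer_centralizer, Set.mem_centralizer_iff]
        intro m hm
        have hc : Commute ((y - x : N) : H →L[ℂ] H) m :=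
          (Set.mem_centralizer_iff.1 hm _ (y - x).2)
        exact (hc.cfcₙ_nnreal NNReal.sqrt).eq.symm
      refine ⟨⟨_, hmem⟩, ?_⟩
      rw [← sub_eq_iff_eq_add']
      apply Subtype.ext
      change _ = star (CFC.sqrt ((y - x : N) : H →L[ℂ] H)) * CFC.sqrt ((y - x : N) : H →L[ℂ] H)
      rw [(CFC.sqrt_nonneg _).isSelfAdjoint.star_eq, CFC.sqrt_mul_sqrt_self _ h']
    · rintro ⟨s, hs⟩
      rw [hs, add_sub_cancel_left]
      change (0 : H →L[ℂ] H) ≤ star (s : H →L[ℂ] H) * s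
      exact star_mul_self_nonneg _

/-! ### Normal semifinite faithful traces -/

/-- A normal semifinite faithful trace on `N`: an additive, positively homogeneous, tracial map on
the positive cone with values in `[0, ∞]`. Only the values at positive elements have a meaning. -/
structure NSFTrace (N : VonNeumannAlgebra H) where
  toFun : N → ℝ≥0∞
  map_add' : ∀ x y : N, 0 ≤ x → 0 ≤ y → toFun (x + y) = toFun x + toFun y
  map_smul' : ∀ (c : ℝ≥0) (x : N), 0 ≤ x → toFun ((c : ℂ) • x) = c * toFun x
  tracial' : ∀ x : N, toFun (star x * x) = toFun (x * star x)
  faithful' : ∀ x : N, 0 ≤ x → toFun x = 0 → x = 0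
  semifinite' : ∀ x : N, 0 ≤ x → x ≠ 0 → ∃ y : N, 0 ≤ y ∧ y ≤ x ∧ y ≠ 0 ∧ toFun y < ∞
  normal' : ∀ D : Set N, D.Nonempty → DirectedOn (· ≤ ·) D → (∀ x ∈ D, 0 ≤ x) →
    ∀ x : N, IsLUB D x → toFun x = ⨆ d ∈ D, toFun d

variable {N : VonNeumannAlgebra H}

instance : CoeFun (NSFTrace N) fun _ => N → ℝ≥0∞ := ⟨NSFTrace.toFun⟩

namespace NSFTrace

variable (τ : NSFTrace N)

/-- The norm of `L_p(N)` at an element of `N`: `‖x‖_p = τ(|x|^p)^{1/p}` for `1 ≤ p < ∞`, and the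
operator norm for `p = ∞`. -/
def lpNorm (p : ℝ≥0∞) (x : N) : ℝ≥0∞ :=
  if p = ∞ then ‖x‖ₑ else (τ (CFC.abs x ^ p.toNNReal)) ^ (1 / p.toReal)

/-! ### The Hilbert space `L_2(N)` -/

lemma map_zero : τ 0 = 0 := by
  have := τ.map_smul' 0 0 le_rfl
  simpa using this

lemma mono {x y : N} (hx : 0 ≤ x) (hxy : x ≤ y) : τ x ≤ τ y := by
  have h := τ.map_add' x (y - x) hx (sub_nonneg.2 hxy)
  rw [add_sub_cancel] at h
  rw [h]
  exact le_self_add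

lemma parallelogram (x y : N) :
    τ (star (x + y) * (x + y)) + τ (star (x - y) * (x - y)) =
      2 * (τ (star x * x) + τ (star y * y)) := by
  rw [← τ.map_add' _ _ (star_mul_self_nonneg _) (star_mul_self_nonneg _),
    ← τ.map_add' _ _ (star_mul_self_nonneg _) (star_mul_self_nonneg _), two_mul,
    ← τ.map_add' _ _ ?_ ?_]
  · congr 1
    simp only [star_add, star_sub]
    noncomm_ring
  all_goals exact add_nonneg (star_mul_self_nonneg _) (star_mul_self_nonneg _)


lemma map_smul_sq (c : ℂ) (x : N) :
    τ (star (c • x) * (c • x)) = ENNReal.ofReal (‖c‖ * ‖c‖) * τ (star x * x) := by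
  have h : star (c • x) * (c • x) = (((‖c‖₊ * ‖c‖₊ : ℝ≥0) : ℝ) : ℂ) • (star x * x) := by
    rw [star_smul, smul_mul_smul_comm]
    congr 1
    rw [Complex.star_def, Complex.conj_mul']
    push_cast
    simp [sq]
  rw [h]
  refine (τ.map_smul' _ _ (star_mul_self_nonneg _)).trans ?_
  congr 1
  rw [ENNReal.ofReal_mul (norm_nonneg _), ENNReal.coe_mul, ofReal_norm]
  rfl

/-- `N ∩ L_2(N) = {x ∈ N : τ(x⋆x) < ∞}`. -/
def finSq : Submodule ℂ N where
  carrier := {x | τ (star x * x) < ∞}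
  zero_mem' := by simp [τ.map_zero]
  add_mem' {x y} hx hy := by
    have h := τ.parallelogram x y
    refine lt_of_le_of_lt (le_self_add.trans h.le) ?_
    exact ENNReal.mul_lt_top (by simp) (ENNReal.add_lt_top.2 ⟨hx, hy⟩)
  smul_mem' c x hx := by
    rw [Set.mem_ofPred_eq, τ.map_smul_sq]
    exact ENNReal.mul_lt_top ENNReal.ofReal_lt_top hx

/-- A copy of `N ∩ L_2(N)`, to be equipped with the norm `‖x‖_2 = τ(x⋆x)^{1/2}`. -/
def PreL2 : Type u := τ.finSq

instance : AddCommGroup τ.PreL2 := inferInstanceAs (AddCommGroup τ.finSq)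
instance : Module ℂ τ.PreL2 := inferInstanceAs (Module ℂ τ.finSq)

/-- The element of `N` underlying an element of `N ∩ L_2(N)`. -/
def PreL2.val {τ : NSFTrace N} (x : τ.PreL2) : N := Subtype.val (p := (· ∈ τ.finSq)) x

instance : Norm τ.PreL2 := ⟨fun x => Real.sqrt (τ (star x.val * x.val)).toReal⟩

lemma PreL2.norm_def {τ : NSFTrace N} (x : τ.PreL2) :
    ‖x‖ = Real.sqrt (τ (star x.val * x.val)).toReal := rfl

lemma PreL2.norm_sq {τ : NSFTrace N} (x : τ.PreL2) :
    ‖x‖ * ‖x‖ = (τ (star x.val * x.val)).toReal :=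
  Real.mul_self_sqrt ENNReal.toReal_nonneg

lemma PreL2.lt_top {τ : NSFTrace N} (x : τ.PreL2) : τ (star x.val * x.val) < ∞ :=
  Subtype.prop (p := (· ∈ τ.finSq)) x

lemma PreL2.val_add {τ : NSFTrace N} (x y : τ.PreL2) : (x + y).val = x.val + y.val := rfl

lemma PreL2.val_sub {τ : NSFTrace N} (x y : τ.PreL2) : (x - y).val = x.val - y.val := rfl

lemma PreL2.val_smul {τ : NSFTrace N} (c : ℂ) (x : τ.PreL2) : (c • x).val = c • x.val := rfl

lemma PreL2.norm_smul' {τ : NSFTrace N} (c : ℂ) (x : τ.PreL2) : ‖c • x‖ = ‖c‖ * ‖x‖ := by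
  rw [PreL2.norm_def, PreL2.norm_def, PreL2.val_smul, τ.map_smul_sq, ENNReal.toReal_mul,
    Real.sqrt_mul ENNReal.toReal_nonneg]
  simp

lemma PreL2.eq_zero_of_norm {τ : NSFTrace N} (x : τ.PreL2) (hx : ‖x‖ = 0) : x = 0 := by
  have h := x.norm_sq
  rw [hx, mul_zero, eq_comm, ENNReal.toReal_eq_zero_iff] at h
  have h0 := τ.faithful' _ (star_mul_self_nonneg x.val) (h.resolve_right x.lt_top.ne)
  exact Subtype.ext ((CStarRing.star_mul_self_eq_zero_iff _).1 h0)

lemma PreL2.add_sq_le {τ : NSFTrace N} (x y : τ.PreL2) {s : ℝ} (hs : 0 < s) :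
    ‖x + y‖ * ‖x + y‖ ≤ ‖x‖ * ‖x‖ + ‖y‖ * ‖y‖ + (s * ‖x‖) * (s * ‖x‖) +
      (s⁻¹ * ‖y‖) * (s⁻¹ * ‖y‖) := by
  have hs' : ‖((s : ℝ) : ℂ)‖ = s := by simp [abs_of_pos hs]
  have hs'' : ‖((s⁻¹ : ℝ) : ℂ)‖ = s⁻¹ := by simp [abs_of_pos hs]
  have e : star (x + y).val * (x + y).val +
      star (((s : ℝ) : ℂ) • x - ((s⁻¹ : ℝ) : ℂ) • y).val *
        (((s : ℝ) : ℂ) • x - ((s⁻¹ : ℝ) : ℂ) • y).val =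
      star x.val * x.val + star y.val * y.val +
      star (((s : ℝ) : ℂ) • x).val * (((s : ℝ) : ℂ) • x).val +
      star (((s⁻¹ : ℝ) : ℂ) • y).val * (((s⁻¹ : ℝ) : ℂ) • y).val := by
    have h1 : ((s : ℂ)) * ((s : ℂ))⁻¹ = 1 := by
      rw [mul_inv_cancel₀]; exact_mod_cast hs.ne'
    simp only [PreL2.val_add, PreL2.val_sub, PreL2.val_smul, star_add, star_sub, star_smul,
      mul_add, add_mul, mul_sub, sub_mul, smul_mul_smul_comm, Complex.star_def,
      Complex.conj_ofReal, Complex.ofReal_inv, map_inv₀, h1, mul_comm ((s : ℂ))⁻¹ (s : ℂ), one_smul]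
    abel
  have hτ := congrArg τ.toFun e
  have p := fun z : τ.PreL2 => star_mul_self_nonneg z.val
  rw [τ.map_add' _ _ (p _) (p _),
    τ.map_add' _ _ (add_nonneg (add_nonneg (p _) (p _)) (p _)) (p _),
    τ.map_add' _ _ (add_nonneg (p _) (p _)) (p _), τ.map_add' _ _ (p _) (p _)] at hτ
  have hr := congrArg ENNReal.toReal hτ
  have f := fun z : τ.PreL2 => z.lt_top.ne
  rw [ENNReal.toReal_add (f _) (f _),
    ENNReal.toReal_add (by simp [ENNReal.add_eq_top, f]) (f _),
    ENNReal.toReal_add (by simp [ENNReal.add_eq_top, f]) (f _),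
    ENNReal.toReal_add (f _) (f _)] at hr
  simp only [← PreL2.norm_sq, PreL2.norm_smul', hs', hs''] at hr
  rw [← hr]
  exact le_add_of_nonneg_right (mul_self_nonneg _)

lemma PreL2.norm_add_le' {τ : NSFTrace N} (x y : τ.PreL2) : ‖x + y‖ ≤ ‖x‖ + ‖y‖ := by
  have hx0 : 0 ≤ ‖x‖ := Real.sqrt_nonneg _
  have hy0 : 0 ≤ ‖y‖ := Real.sqrt_nonneg _
  rcases hx0.eq_or_lt with hx | hx
  · rw [x.eq_zero_of_norm hx.symm, zero_add]
    exact le_add_of_nonneg_left (Real.sqrt_nonneg _)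
  rcases hy0.eq_or_lt with hy | hy
  · rw [y.eq_zero_of_norm hy.symm, add_zero]
    exact le_add_of_nonneg_right (Real.sqrt_nonneg _)
  have hs : 0 < Real.sqrt (‖y‖ / ‖x‖) := Real.sqrt_pos.2 (div_pos hy hx)
  have h := PreL2.add_sq_le x y hs
  have hs2 : Real.sqrt (‖y‖ / ‖x‖) * Real.sqrt (‖y‖ / ‖x‖) = ‖y‖ / ‖x‖ :=
    Real.mul_self_sqrt (div_pos hy hx).le
  have h1 : Real.sqrt (‖y‖ / ‖x‖) * ‖x‖ * (Real.sqrt (‖y‖ / ‖x‖) * ‖x‖) = ‖x‖ * ‖y‖ := by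
    rw [mul_mul_mul_comm, hs2]; field_simp
  have h2 : (Real.sqrt (‖y‖ / ‖x‖))⁻¹ * ‖y‖ * ((Real.sqrt (‖y‖ / ‖x‖))⁻¹ * ‖y‖) = ‖x‖ * ‖y‖ := by
    rw [mul_mul_mul_comm, ← mul_inv, hs2]; field_simp
  rw [h1, h2] at h
  exact abs_le_of_sq_le_sq' (by nlinarith) (by positivity) |>.2

instance : NormedAddCommGroup τ.PreL2 :=
  NormedAddCommGroup.ofCore (𝕜 := ℂ)
    { norm_nonneg := fun _ => Real.sqrt_nonneg _
      norm_smul := PreL2.norm_smul'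
      norm_triangle := PreL2.norm_add_le'
      norm_eq_zero_iff := fun x => ⟨x.eq_zero_of_norm, fun h => by
        rw [h, PreL2.norm_def]
        change Real.sqrt (τ (star (0 : N) * 0)).toReal = 0
        simp [τ.map_zero]⟩ }

instance : NormedSpace ℂ τ.PreL2 := ⟨fun c x => (PreL2.norm_smul' c x).le⟩

/-- The inner product `⟪x, y⟫ = τ(x⋆y)` of `N ∩ L_2(N)`, obtained from the norm by
polarization. -/
instance : InnerProductSpace ℂ τ.PreL2 :=
  InnerProductSpace.ofNorm ℂ fun x y => by
    have h := congrArg ENNReal.toReal (τ.parallelogram x.val y.val)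
    rw [← PreL2.val_add, ← PreL2.val_sub,
      ENNReal.toReal_add (x + y).lt_top.ne (x - y).lt_top.ne, ENNReal.toReal_mul,
      ENNReal.toReal_add x.lt_top.ne y.lt_top.ne] at h
    simp only [PreL2.norm_sq]
    simpa using h

/-- The Hilbert space `L_2(N)`, the completion of `N ∩ L_2(N)`. -/
abbrev L2 : Type u := UniformSpace.Completion τ.PreL2

open Classical in
/-- The inclusion of `N ∩ L_2(N)` into `L_2(N)` (with value `0` at the other elements of `N`). -/
def toL2 (x : N) : τ.L2 :=
  if h : x ∈ τ.finSq then ((show τ.PreL2 from ⟨x, h⟩ : τ.PreL2) : τ.L2) else 0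

/-- The right multiplication `f ↦ f y` of `L_2(N)` by `y ∈ N`: the continuous extension of
`x ↦ x y`, `x ∈ N ∩ L_2(N)`. -/
def rmul (f : τ.L2) (y : N) : τ.L2 :=
  UniformSpace.Completion.extension (fun x : τ.PreL2 => τ.toL2 (x.val * y)) f

/-! ### The space `L_1(N)`

`L_1(N)` is identified with the predual of `N`: a measurable operator `φ ∈ L_1(N)` is viewed as
the functional `y ↦ τ(φ y)` on `N`. -/

/-- The element `f⋆ g ∈ L_1(N)` for `f, g ∈ L_2(N)`, i.e. `y ↦ τ(f⋆ g y) = ⟪f, g y⟫`. -/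
def starMul (f g : τ.L2) (y : N) : ℂ := ⟪f, τ.rmul g y⟫_ℂ

/-- The operator norm (possibly `∞`) of `φ ∈ L_1(N)`: the supremum of
`|⟪b, φ c⟫| = |τ(b⋆ φ c)| = |φ(c b⋆)|` over the `b, c` in the unit ball of `L_2(N)` that belong
to `N`. -/
def opNorm (φ : N → ℂ) : ℝ≥0∞ :=
  ⨆ (b : N) (_ : τ (star b * b) ≤ 1) (c : N) (_ : τ (star c * c) ≤ 1), ‖φ (c * star b)‖ₑ

end NSFTrace

/-! ### Standard semigroups -/

/-- The `σ`-weak (i.e. weak⋆) topology of `N`, induced by the functionals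
`x ↦ ∑ k, ⟪ξ k, x (η k)⟫` with `ξ, η ∈ ℓ²(ℕ, H)`. -/
@[reducible]
def weakStarTopology (N : VonNeumannAlgebra H) : TopologicalSpace N :=
  TopologicalSpace.induced
    (fun (x : N) (p : lp (fun _ : ℕ => H) 2 × lp (fun _ : ℕ => H) 2) =>
      ∑' k, ⟪p.1 k, (x : H →L[ℂ] H) (p.2 k)⟫_ℂ) Pi.topologicalSpace

/-- A standard semigroup `(T_t)_{t ≥ 0}` on `(N, τ)`: a semigroup of normal unital completely
positive maps, selfadjoint with respect to `τ` and strongly continuous at `0`. Only the values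
`T t` with `t ≥ 0` have a meaning. -/
structure StandardSemigroup (τ : NSFTrace N) where
  T : ℝ → (N →CP N)
  map_zero' : ∀ f : N, T 0 f = f
  map_add' : ∀ s t : ℝ, 0 ≤ s → 0 ≤ t → ∀ f : N, T (s + t) f = T s (T t f)
  map_one' : ∀ t : ℝ, 0 ≤ t → T t 1 = 1
  normal' : ∀ t : ℝ, 0 ≤ t → ∀ D : Set N, D.Nonempty → DirectedOn (· ≤ ·) D → ∀ x : N,
    IsLUB D x → IsLUB (T t '' D) (T t x)
  /-- `τ(T_t(f) g) = τ(f T_t(g))` for positive `f = a⋆a` and `g = b⋆b`, where traciality is used to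
  write `τ(x b⋆b) = τ(b x b⋆)` and `τ(a⋆a x) = τ(a x a⋆)` for `x ≥ 0`. -/
  selfadjoint' : ∀ t : ℝ, 0 ≤ t → ∀ a b : N,
    τ (b * T t (star a * a) * star b) = τ (a * T t (star b * b) * star a)
  continuous' : ∀ (f : N) (ξ : H),
    Tendsto (fun t => (T t f : H →L[ℂ] H) ξ) (𝓝[>] 0) (𝓝 ((f : H →L[ℂ] H) ξ))

namespace StandardSemigroup

variable {τ : NSFTrace N} (S : StandardSemigroup τ)

/-- The extension of `T_t` to `L_2(N)`. -/
def T2 (t : ℝ) : τ.L2 → τ.L2 :=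
  UniformSpace.Completion.extension fun x : τ.PreL2 => τ.toL2 (S.T t x.val)

/-- The density `u ↦ t e^{-t²/(4u)} u^{-3/2} / (2 √π)` of the subordination formula. -/
def subDensity (t u : ℝ) : ℝ :=
  t / (2 * Real.sqrt Real.pi) * Real.exp (-t ^ 2 / (4 * u)) * u ^ (-(3 / 2) : ℝ)

open Classical in
/-- The subordinated Poisson semigroup `P_t = exp(-t A^{1/2})`, `t > 0`, on `N`: `P_t f` is the
element of `N` given by the strong integral `∫_0^∞ subDensity t u • T_u f du`. -/
def P (t : ℝ) (f : N) : N :=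
  if h : ∃ g : N, ∀ ξ : H, (g : H →L[ℂ] H) ξ =
      ∫ u in Ioi (0 : ℝ), (subDensity t u : ℂ) • (S.T u f : H →L[ℂ] H) ξ
  then h.choose else 0

/-- The subordinated Poisson semigroup on `L_2(N)`, `t > 0`. -/
def P2 (t : ℝ) (f : τ.L2) : τ.L2 :=
  ∫ u in Ioi (0 : ℝ), (subDensity t u : ℂ) • S.T2 u f

/-! ### The generator, the gradient form and the condition `Γ² ≥ 0` -/

/-- The difference quotient `r⁻¹ (f - T_r f)`, whose limit as `r → 0` is `A f`. -/
def diffQuot (r : ℝ) (f : N) : N := ((r⁻¹ : ℝ) : ℂ) • (f - S.T r f)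

/-- `f ∈ N` belongs to `dom_p(A)`: `f ∈ L_p(N)` and `r⁻¹ (f - T_r f)` converges in `L_p(N)` as
`r → 0⁺`, i.e. it is Cauchy for the norm of `L_p(N)`. -/
def InDomain (p : ℝ≥0∞) (f : N) : Prop :=
  τ.lpNorm p f < ∞ ∧ ∀ ε : ℝ≥0∞, 0 < ε → ∃ δ : ℝ, 0 < δ ∧ ∀ r ∈ Ioo 0 δ, ∀ s ∈ Ioo 0 δ,
    τ.lpNorm p (S.diffQuot r f - S.diffQuot s f) < ε

/-- The form `½ (A_r(f⋆) g + f⋆ A_r(g) - A_r(f⋆ g))` with `A_r = r⁻¹ (1 - T_r)`; its limit as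
`r → 0` is the gradient form `Γ(f, g) = ½ (A(f⋆) g + f⋆ A(g) - A(f⋆ g))`. -/
def gradApprox (r : ℝ) (f g : N) : N :=
  (1 / 2 : ℂ) • (S.diffQuot r (star f) * g + star f * S.diffQuot r g - S.diffQuot r (star f * g))

/-- The pairing of `Γ(f, f)` with `b b⋆`, i.e. `τ(b⋆ Γ(f, f) b)`. -/
def gradPairing (f b : N) : ℝ≥0∞ :=
  limUnder (𝓝[>] 0) fun r => τ (star b * S.gradApprox r f f * b)

/-- The pairing of `T_v Γ(f, f)` with `b b⋆`, i.e. `τ(b⋆ T_v(Γ(f, f)) b)`. -/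
def semigroupGradPairing (v : ℝ) (f b : N) : ℝ≥0∞ :=
  limUnder (𝓝[>] 0) fun r => τ (star b * S.T v (S.gradApprox r f f) * b)

/-- The condition `Γ² ≥ 0`, with the standing assumption that makes sense of it: there is a weak⋆
dense ⋆-algebra `𝒜` with `T_s 𝒜 ⊆ 𝒜 ⊆ dom(A) = ⋃_p dom_p(A)`, and
`Γ(T_v f, T_v f) ≤ T_v Γ(f, f)` for `v > 0` and `f ∈ 𝒜`. Both sides lie in `L_1(N) + N`, where the
order is tested against the positive elements `b b⋆` of `L_1(N) ∩ N`. -/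
def GammaSqNonneg : Prop :=
  ∃ 𝒜 : NonUnitalStarSubalgebra ℂ N,
    @Dense N (weakStarTopology N) (𝒜 : Set N) ∧
    (∀ s : ℝ, 0 ≤ s → ∀ f ∈ 𝒜, S.T s f ∈ 𝒜) ∧
    (∀ f ∈ 𝒜, ∃ p : ℝ≥0∞, 1 ≤ p ∧ S.InDomain p f) ∧
    ∀ v : ℝ, 0 < v → ∀ f ∈ 𝒜, ∀ b ∈ τ.finSq,
      S.gradPairing (S.T v f) b ≤ S.semigroupGradPairing v f b

/-! ### The seminorms on `N` -/

/-- `‖f‖_{bmo^c(P)} = sup_t ‖P_t|f|² - |P_t f|²‖^{1/2}` for `f ∈ N`. -/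
def bmo (f : N) : ℝ≥0∞ :=
  ⨆ (t : ℝ) (_ : 0 < t), ‖S.P t (star f * f) - star (S.P t f) * S.P t f‖ₑ ^ (1 / 2 : ℝ)

/-- `‖f‖_{BMO^c(P)} = sup_t ‖P_t|f - P_t f|²‖^{1/2}` for `f ∈ N`. -/
def BMO (f : N) : ℝ≥0∞ :=
  ⨆ (t : ℝ) (_ : 0 < t), ‖S.P t (star (f - S.P t f) * (f - S.P t f))‖ₑ ^ (1 / 2 : ℝ)

/-- `P_t Γ(P_s f, P_s f)` for `f ∈ N` and `s, t > 0`, a limit in the norm of `N`. -/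
def PGrad (t s : ℝ) (f : N) : N :=
  limUnder (𝓝[>] 0) fun r => S.P t (S.gradApprox r (S.P s f) (S.P s f))

/-- `P_t Γ̂(P_s f, P_s f) = P_t Γ(P_s f, P_s f) + P_t |∂_s P_s f|²` for `f ∈ N`. -/
def PGradHat (t s : ℝ) (f : N) : N :=
  S.PGrad t s f + S.P t (star (deriv (fun s' => S.P s' f) s) * deriv (fun s' => S.P s' f) s)

/-- `‖f‖_{BMO^c(Γ̂)} = sup_t ‖P_t ∫_0^t Γ̂(P_s f, P_s f) s ds‖^{1/2}` for `f ∈ N`. The integral of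
positive operators is a weak one and its norm is the supremum of its quadratic form. -/
def BMOGammaHat (f : N) : ℝ≥0∞ :=
  ⨆ (t : ℝ) (_ : 0 < t), (⨆ (ξ : H) (_ : ‖ξ‖ ≤ 1),
    ∫⁻ s in Ioo 0 t, ENNReal.ofReal
      ((⟪ξ, (S.PGradHat t s f : H →L[ℂ] H) ξ⟫_ℂ).re * s)) ^ (1 / 2 : ℝ)

/-! ### The seminorms on `L_2(N)`

For `φ ∈ L_1(N)` the functional of `T_t φ` is `y ↦ τ(T_t(φ) y) = τ(φ T_t(y)) = φ(T_t y)`, and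
similarly for `P_t φ`. -/

/-- `‖f‖_{bmo^c(P)}` for `f ∈ L_2(N)`. -/
def bmo2 (f : τ.L2) : ℝ≥0∞ :=
  ⨆ (t : ℝ) (_ : 0 < t), τ.opNorm (fun y =>
    τ.starMul f f (S.P t y) - τ.starMul (S.P2 t f) (S.P2 t f) y) ^ (1 / 2 : ℝ)

/-- `‖f‖_{BMO^c(P)}` for `f ∈ L_2(N)`. -/
def BMO2 (f : τ.L2) : ℝ≥0∞ :=
  ⨆ (t : ℝ) (_ : 0 < t), τ.opNorm (fun y =>
    τ.starMul (f - S.P2 t f) (f - S.P2 t f) (S.P t y)) ^ (1 / 2 : ℝ)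

/-- The difference quotient `r⁻¹ (f - T_r f)` in `L_2(N)`. -/
def diffQuot2 (r : ℝ) (f : τ.L2) : τ.L2 := ((r⁻¹ : ℝ) : ℂ) • (f - S.T2 r f)

/-- The element `½ (A_r(f⋆) g + f⋆ A_r(g) - A_r(f⋆ g))` of `L_1(N)` for `f, g ∈ L_2(N)`, where
`A_r = r⁻¹ (1 - T_r)`. -/
def gradApprox2 (r : ℝ) (f g : τ.L2) (y : N) : ℂ :=
  (1 / 2 : ℂ) * (τ.starMul (S.diffQuot2 r f) g y + τ.starMul f (S.diffQuot2 r g) y -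
    ((r⁻¹ : ℝ) : ℂ) * (τ.starMul f g y - τ.starMul f g (S.T r y)))

/-- `P_t Γ(P_s f, P_s f) ∈ L_1(N)` for `f ∈ L_2(N)` and `s, t > 0`. -/
def PGrad2 (t s : ℝ) (f : τ.L2) (y : N) : ℂ :=
  limUnder (𝓝[>] 0) fun r => S.gradApprox2 r (S.P2 s f) (S.P2 s f) (S.P t y)

/-- `P_t Γ̂(P_s f, P_s f) = P_t Γ(P_s f, P_s f) + P_t |∂_s P_s f|² ∈ L_1(N)` for `f ∈ L_2(N)`. -/
def PGradHat2 (t s : ℝ) (f : τ.L2) (y : N) : ℂ :=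
  S.PGrad2 t s f y +
    τ.starMul (deriv (fun s' => S.P2 s' f) s) (deriv (fun s' => S.P2 s' f) s) (S.P t y)

/-- `‖f‖_{BMO^c(Γ̂)}` for `f ∈ L_2(N)`. As the integral is positive, its operator norm is the
supremum of its quadratic form `b ↦ τ(b⋆ · b)` over the unit ball of `L_2(N)`. -/
def BMOGammaHat2 (f : τ.L2) : ℝ≥0∞ :=
  ⨆ (t : ℝ) (_ : 0 < t), (⨆ (b : N) (_ : τ (star b * b) ≤ 1),
    ∫⁻ s in Ioo 0 t, ENNReal.ofReal
      ((S.PGradHat2 t s f (b * star b)).re * s)) ^ (1 / 2 : ℝ)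

end StandardSemigroup

end SemigroupBMO

end

/-! Everything is read off the function u(t,v) = ω(P_t|P_v f|²), where ω runs over positive
functionals that compute operator norms. Since ∂_t² P_t = A P_t, the function u satisfies the wave
equation (∂_v² − ∂_t²)u = 2G with G(t,v) = ω(P_t Γ̂(P_v f, P_v f)) ≥ 0. Integrating along the
characteristics gives an exact formula for the variance (`ofReal_variance`): ω(P_t|f|² − |P_t f|²) =
∫_0^t ∫_a^∞ 2G(t+v−2a, v) dv da. So bmo is governed by this double integral, while BMO(Γ̂) is
governed by ∫_0^t G(t,v) v dv.

Two inequalities for G suffice to compare them. The subordination formula gives P_t ≤ (t/s)P_s on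
positive elements for s ≤ t, hence G(t,v) ≤ (t/s)G(s,v). The condition Γ² ≥ 0 gives Γ̂(P_w h, P_w h)
≤ P_w Γ̂(h,h), hence G(t,w+v) ≤ G(t+w,v). With these two rules, `areaIntegral_le` bounds the area
integral by the wave integral pointwise in t, and `waveIntegral_le` bounds the wave integral by the
supremum of the area integrals, the part v > t being summed over dyadic blocks.

For BMO ≤ C bmo one writes P_t|f−P_t f|² = var_t(f−P_t f) + |P_t f−P_{2t} f|². The second term is at
most var_t(f), because 2P_t − P_{2t} is again an average of the T_u and satisfies the
Kadison–Schwarz inequality (`form_P_sub_le`). For bmo ≤ C BMO the key is the decay var_t(P_{2T}h) ≤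
48(t/T) var_T(h) (`variance_P_decay`), also a consequence of the two rules for G. It allows f to be
telescoped along T_k = (3/2)^k t with a geometric series as the bound (`bmoSq_le_BMOSq`).

This argument only needs a few order properties, collected in `GradientSystem`. It is then applied
twice: to N with the form f⋆g in N, and to L_2(N) with f⋆g in the dual of N, where P_t acts by
transposition.

The remaining work verifies these properties. Taylor expansions of the subordination density in an
integrable majorant make P_t differentiable in operator norm on any space where the orbits of T can
be integrated weakly (`toPoissonSystem`). The trace only yields functionals that are normal in the
order sense; `exists_state_le` dominates them on the unit ball by finitely many vector states up to
ε, so that bounded strong convergence can be used throughout (`tendsto_lmul`).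

The condition Γ² ≥ 0 is available only infinitesimally and on a weak⋆ dense algebra. It is first
integrated in time to the discrete inequality T_v|T_a g|² − |T_{v+a}g|² ≤ T_a(T_v|g|² − |T_v g|²)
(`state_dev_T_le`). This form contains no generator and is continuous in g, so it passes to all of N
by a resolvent version of Kaplansky's density theorem. Jensen's inequality for positive forms
(`form_integral_le`) replaces T_a by P_a, and density of N ∩ L_2(N) carries the inequalities over to
L_2(N). -/

noncomputable section

namespace SemigroupBMO

/-! ### Poisson semigroups on normed spaces and their gradient forms -/

/-- A contraction semigroup `P` on `E` that is differentiable in operator norm, whose second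
derivative is the generator of the maps `T r`. -/
structure PoissonSystem (E : Type*) [NormedAddCommGroup E] [NormedSpace ℝ E] where
  T : ℝ → E →L[ℝ] E
  P : ℝ → E →L[ℝ] E
  dP : ℝ → E →L[ℝ] E
  ddP : ℝ → E →L[ℝ] E
  norm_P_le : ∀ t, 0 < t → ‖P t‖ ≤ 1
  P_add : ∀ s t, 0 < s → 0 < t → P (s + t) = (P s).comp (P t)
  comm : ∀ r t, 0 ≤ r → 0 < t → (T r).comp (P t) = (P t).comp (T r)
  hasDerivAt_P : ∀ t, 0 < t → HasDerivAt P (dP t) t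
  hasDerivAt_dP : ∀ t, 0 < t → HasDerivAt dP (ddP t) t
  tendsto_dP : Tendsto dP atTop (𝓝 0)
  tendsto_gen : ∀ t, 0 < t →
    Tendsto (fun r : ℝ => r⁻¹ • (P t - (T r).comp (P t))) (𝓝[>] 0) (𝓝 (ddP t))

namespace PoissonSystem

variable {E : Type*} [NormedAddCommGroup E] [NormedSpace ℝ E] (S : PoissonSystem E)

lemma P_add_apply {s t : ℝ} (hs : 0 < s) (ht : 0 < t) (x : E) : S.P (s + t) x = S.P s (S.P t x) := by
  rw [S.P_add s t hs ht]; rfl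

lemma dP_add {s t : ℝ} (hs : 0 < s) (ht : 0 < t) : S.dP (s + t) = (S.P s).comp (S.dP t) := by
  have h1 : HasDerivAt (fun a => S.P (s + a)) (S.dP (s + t)) t :=
    (S.hasDerivAt_P (s + t) (by positivity)).comp_const_add s t
  have h2 : HasDerivAt (fun a => (S.P s).comp (S.P a)) ((S.P s).comp (S.dP t)) t := by
    simpa using (hasDerivAt_const t (S.P s)).clm_comp (S.hasDerivAt_P t ht)
  refine h1.unique (h2.congr_of_eventuallyEq ?_)
  filter_upwards [lt_mem_nhds ht] with a ha using S.P_add s a hs ha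

lemma dP_add_apply {s t : ℝ} (hs : 0 < s) (ht : 0 < t) (x : E) :
    S.dP (s + t) x = S.P s (S.dP t x) := by
  rw [S.dP_add hs ht]; rfl

lemma hasDerivAt_P_apply {t : ℝ} (ht : 0 < t) (x : E) :
    HasDerivAt (fun s => S.P s x) (S.dP t x) t := by
  simpa using (S.hasDerivAt_P t ht).clm_apply (hasDerivAt_const t x)

lemma hasDerivAt_dP_apply {t : ℝ} (ht : 0 < t) (x : E) :
    HasDerivAt (fun s => S.dP s x) (S.ddP t x) t := by
  simpa using (S.hasDerivAt_dP t ht).clm_apply (hasDerivAt_const t x)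

lemma ddP_add {s t : ℝ} (hs : 0 < s) (ht : 0 < t) : S.ddP (s + t) = (S.P s).comp (S.ddP t) := by
  have h1 : HasDerivAt (fun a => S.dP (s + a)) (S.ddP (s + t)) t :=
    (S.hasDerivAt_dP (s + t) (by positivity)).comp_const_add s t
  have h2 : HasDerivAt (fun a => (S.P s).comp (S.dP a)) ((S.P s).comp (S.ddP t)) t := by
    simpa using (hasDerivAt_const t (S.P s)).clm_comp (S.hasDerivAt_dP t ht)
  refine h1.unique (h2.congr_of_eventuallyEq ?_)
  filter_upwards [lt_mem_nhds ht] with a ha using S.dP_add hs ha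

lemma continuousAt_P {t : ℝ} (ht : 0 < t) : ContinuousAt S.P t := (S.hasDerivAt_P t ht).continuousAt

lemma continuousAt_dP {t : ℝ} (ht : 0 < t) : ContinuousAt S.dP t :=
  (S.hasDerivAt_dP t ht).continuousAt

/-- No third derivative is assumed. Continuity comes from the factorization of `ddP a` as P_{a−t/2}
composed with the fixed operator `ddP (t / 2)`. -/
lemma continuousAt_ddP {t : ℝ} (ht : 0 < t) : ContinuousAt S.ddP t := by
  have hc : ContinuousAt (fun a => (S.P (a - t / 2)).comp (S.ddP (t / 2))) t := by
    refine ContinuousAt.clm_comp ?_ continuousAt_const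
    refine ContinuousAt.comp (f := fun a => a - t / 2) (g := S.P) ?_ (by fun_prop)
    exact S.continuousAt_P (by linarith)
  refine hc.congr ?_
  filter_upwards [lt_mem_nhds (half_lt_self ht)] with a ha
  rw [← S.ddP_add (by linarith) (half_pos ht)]
  congr 1; ring

lemma P_apply_norm_le {t : ℝ} (ht : 0 < t) (x : E) : ‖S.P t x‖ ≤ ‖x‖ := by
  simpa using (S.P t).le_of_opNorm_le (S.norm_P_le t ht) x

end PoissonSystem

/-- Two Poisson systems joined by a positive form `B`, together with the order properties that
are used to compare the `BMO` seminorms. -/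
structure GradientSystem (V X : Type*) [NormedAddCommGroup V] [NormedSpace ℝ V]
    [NormedAddCommGroup X] [NormedSpace ℝ X] where
  dom : PoissonSystem V
  val : PoissonSystem X
  B : V →L[ℝ] V →L[ℝ] X
  Pos : X → Prop
  Ω : Set (X →L[ℝ] ℝ)
  pos_add : ∀ x y, Pos x → Pos y → Pos (x + y)
  pos_smul : ∀ (c : ℝ) x, 0 ≤ c → Pos x → Pos (c • x)
  pos_P : ∀ t x, 0 < t → Pos x → Pos (val.P t x)
  nonneg : ∀ ω ∈ Ω, ∀ x, Pos x → 0 ≤ ω x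
  pos_B : ∀ f, Pos (B f f)
  schwarz_P : ∀ t f, 0 < t → Pos (val.P t (B f f) - B (dom.P t f) (dom.P t f))
  schwarz_T : ∀ r f, 0 < r → Pos (val.T r (B f f) - B (dom.T r f) (dom.T r f))
  -- The operators 2P_t − P_{2t} are positive averages of the semigroup, so they too obey the
  -- Kadison–Schwarz inequality. This controls P_t f − P_{2t} f by the variance.
  schwarz_R : ∀ t f, 0 < t → Pos ((2 : ℝ) • val.P t (B f f) - val.P (2 * t) (B f f) -
    B ((2 : ℝ) • dom.P t f - dom.P (2 * t) f) ((2 : ℝ) • dom.P t f - dom.P (2 * t) f))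
  quasi_mono : ∀ s t y, 0 < s → s ≤ t → Pos y → Pos ((t / s) • val.P s y - val.P t y)
  -- The condition Γ² ≥ 0 in a form free of generators: with D_r h = T_r|h|² − |T_r h|², it says
  -- D_r(P_w h) ≤ P_w(D_r h).
  gamma_two : ∀ w r h, 0 < w → 0 < r →
    Pos (val.P w (val.T r (B h h) - B (dom.T r h) (dom.T r h)) -
      (val.T r (B (dom.P w h) (dom.P w h)) -
        B (dom.T r (dom.P w h)) (dom.T r (dom.P w h))))
  tendsto_B : ∀ ω ∈ Ω, ∀ t f, 0 < t →
    Tendsto (fun ε => ω (val.P t (B (dom.P ε f) (dom.P ε f)))) (𝓝[>] 0) (𝓝 (ω (val.P t (B f f))))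
  tendsto_P : ∀ ω ∈ Ω, ∀ f,
    Tendsto (fun ε => ω (val.P ε (B f f))) (𝓝[>] 0) (𝓝 (ω (B f f)))

namespace GradientSystem

variable {V X : Type*} [NormedAddCommGroup V] [NormedSpace ℝ V]
  [NormedAddCommGroup X] [NormedSpace ℝ X] (S : GradientSystem V X)

/-- The difference quotients of the gradient form. -/
def gradQuot (r : ℝ) (h : V) : X :=
  (1 / 2 : ℝ) • (S.B (r⁻¹ • (h - S.dom.T r h)) h + S.B h (r⁻¹ • (h - S.dom.T r h)) -
    r⁻¹ • (S.B h h - S.val.T r (S.B h h)))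

/-- `P_t Γ(P_v f, P_v f)`. -/
def grad (f : V) (t v : ℝ) : X :=
  (1 / 2 : ℝ) • (S.val.P t (S.B (S.dom.ddP v f) (S.dom.P v f) + S.B (S.dom.P v f) (S.dom.ddP v f)) -
    S.val.ddP t (S.B (S.dom.P v f) (S.dom.P v f)))

/-- `P_t Γ̂(P_v f, P_v f)`. -/
def gradHat (f : V) (t v : ℝ) : X :=
  S.grad f t v + S.val.P t (S.B (S.dom.dP v f) (S.dom.dP v f))

/-- Expanding the squares exhibits the difference quotient as a positive multiple of the Schwarz
defect of T_r plus the square of h − T_r h. Both positivity and the Γ² inequality are proved summand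
by summand from this. -/
lemma gradQuot_eq (r : ℝ) (h : V) : S.gradQuot r h = (r⁻¹ / 2) •
    ((S.val.T r (S.B h h) - S.B (S.dom.T r h) (S.dom.T r h)) +
      S.B (h - S.dom.T r h) (h - S.dom.T r h)) := by
  simp only [gradQuot, map_smul, map_sub, sub_apply,
    smul_apply]
  module

lemma pos_gradQuot {r : ℝ} (hr : 0 < r) (h : V) : S.Pos (S.gradQuot r h) := by
  rw [gradQuot_eq]
  exact S.pos_smul _ _ (by positivity) (S.pos_add _ _ (S.schwarz_T r h hr) (S.pos_B _))

/-- In the decomposition `gradQuot_eq`, the Schwarz defects are compared by `gamma_two`, and the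
squares by Kadison–Schwarz for P_w applied to h − T_r h. -/
lemma pos_gradQuot_sub {w r : ℝ} (hw : 0 < w) (hr : 0 < r) (h : V) :
    S.Pos (S.val.P w (S.gradQuot r h) - S.gradQuot r (S.dom.P w h)) := by
  have h1 := S.gamma_two w r h hw hr
  have h2 := S.schwarz_P w (h - S.dom.T r h) hw
  have hc : S.dom.T r (S.dom.P w h) = S.dom.P w (S.dom.T r h) :=
    DFunLike.congr_fun (S.dom.comm r w hr.le hw) h
  have h3 := S.pos_smul (r⁻¹ / 2) _ (by positivity) (S.pos_add _ _ h1 h2)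
  convert h3 using 1
  rw [gradQuot_eq, gradQuot_eq, hc]
  simp only [map_smul, map_sub, map_add]
  module

/-- In the first two terms the generator falls on P_v f. In the third it is moved onto P_t, which
commutes with T_r. In each case the quotient converges in norm to `ddP`. -/
lemma tendsto_gradQuot (f : V) {t v : ℝ} (ht : 0 < t) (hv : 0 < v) :
    Tendsto (fun r => S.val.P t (S.gradQuot r (S.dom.P v f))) (𝓝[>] 0) (𝓝 (S.grad f t v)) := by
  have h1 : Tendsto (fun r : ℝ => r⁻¹ • (S.dom.P v f - S.dom.T r (S.dom.P v f))) (𝓝[>] 0)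
      (𝓝 (S.dom.ddP v f)) :=
    ((ContinuousLinearMap.apply ℝ V f).continuous.tendsto _).comp (S.dom.tendsto_gen v hv)
  have h2 : Tendsto (fun r : ℝ => r⁻¹ • (S.val.P t (S.B (S.dom.P v f) (S.dom.P v f)) -
      S.val.P t (S.val.T r (S.B (S.dom.P v f) (S.dom.P v f))))) (𝓝[>] 0)
      (𝓝 (S.val.ddP t (S.B (S.dom.P v f) (S.dom.P v f)))) := by
    refine (((ContinuousLinearMap.apply ℝ X (S.B (S.dom.P v f) (S.dom.P v f))).continuous.tendsto
      _).comp (S.val.tendsto_gen t ht)).congr' ?_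
    filter_upwards [self_mem_nhdsWithin] with r hr
    have := DFunLike.congr_fun (S.val.comm r t (le_of_lt hr) ht) (S.B (S.dom.P v f) (S.dom.P v f))
    simp only [ContinuousLinearMap.comp_apply] at this
    simp [this]
  have h3 : Tendsto (fun r : ℝ => S.val.P t (S.B (r⁻¹ • (S.dom.P v f - S.dom.T r (S.dom.P v f)))
      (S.dom.P v f))) (𝓝[>] 0) (𝓝 (S.val.P t (S.B (S.dom.ddP v f) (S.dom.P v f)))) := by
    have hc : Continuous fun x => S.val.P t (S.B x (S.dom.P v f)) := by fun_prop
    exact (hc.tendsto _).comp h1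
  have h4 : Tendsto (fun r : ℝ => S.val.P t (S.B (S.dom.P v f)
      (r⁻¹ • (S.dom.P v f - S.dom.T r (S.dom.P v f))))) (𝓝[>] 0)
      (𝓝 (S.val.P t (S.B (S.dom.P v f) (S.dom.ddP v f)))) := by
    have hc : Continuous fun x => S.val.P t (S.B (S.dom.P v f) x) := by fun_prop
    exact (hc.tendsto _).comp h1
  refine ((((h3.add h4).sub h2).const_smul (1 / 2 : ℝ)).congr fun r => ?_).trans
    (by rw [grad, map_add])
  simp only [gradQuot, map_smul, map_sub, map_add]

variable {S}
variable {ω : X →L[ℝ] ℝ}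

lemma map_gradHat_tendsto (f : V) {t v : ℝ} (ht : 0 < t) (hv : 0 < v) (ω : X →L[ℝ] ℝ) :
    Tendsto (fun r => ω (S.val.P t (S.gradQuot r (S.dom.P v f) +
      S.B (S.dom.dP v f) (S.dom.dP v f)))) (𝓝[>] 0) (𝓝 (ω (S.gradHat f t v))) := by
  simp only [map_add, gradHat]
  exact ((ω.continuous.tendsto _).comp (S.tendsto_gradQuot f ht hv)).add_const _

lemma pos_gradQuotHat (f : V) {r v : ℝ} (hr : 0 < r) :
    S.Pos (S.gradQuot r (S.dom.P v f) + S.B (S.dom.dP v f) (S.dom.dP v f)) :=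
  S.pos_add _ _ (S.pos_gradQuot hr _) (S.pos_B _)

lemma map_gradHat_nonneg (hω : ω ∈ S.Ω) (f : V) {t v : ℝ} (ht : 0 < t) (hv : 0 < v) :
    0 ≤ ω (S.gradHat f t v) := by
  refine ge_of_tendsto (map_gradHat_tendsto f ht hv ω) ?_
  filter_upwards [self_mem_nhdsWithin] with r hr
  exact S.nonneg ω hω _ (S.pos_P _ _ ht (pos_gradQuotHat f hr))

lemma map_gradHat_quasi_mono (hω : ω ∈ S.Ω) (f : V) {s t v : ℝ} (hs : 0 < s) (hst : s ≤ t)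
    (hv : 0 < v) : ω (S.gradHat f t v) ≤ (t / s) * ω (S.gradHat f s v) := by
  refine le_of_tendsto_of_tendsto (map_gradHat_tendsto f (hs.trans_le hst) hv ω)
    ((map_gradHat_tendsto f hs hv ω).const_mul (t / s)) ?_
  filter_upwards [self_mem_nhdsWithin] with r hr
  have := S.nonneg ω hω _ (S.quasi_mono s t _ hs hst (pos_gradQuotHat (S := S) (v := v) f hr))
  simp only [map_sub, map_smul, smul_eq_mul] at this
  linarith

/-- For Γ this is `pos_gradQuot_sub` followed by P_t, in the limit r → 0. For the time derivative it
is Kadison–Schwarz, since the derivative at w + v is P_w of that at v. -/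
lemma map_gradHat_shift (hω : ω ∈ S.Ω) (f : V) {t v w : ℝ} (ht : 0 < t) (hv : 0 < v)
    (hw : 0 < w) : ω (S.gradHat f t (w + v)) ≤ ω (S.gradHat f (t + w) v) := by
  refine le_of_tendsto_of_tendsto (map_gradHat_tendsto f ht (add_pos hw hv) ω)
    (map_gradHat_tendsto f (add_pos ht hw) hv ω) ?_
  filter_upwards [self_mem_nhdsWithin] with r hr
  have h1 := S.pos_gradQuot_sub hw hr (S.dom.P v f)
  have h2 := S.schwarz_P w (S.dom.dP v f) hw
  have h3 := S.nonneg ω hω _ (S.pos_P _ _ ht (S.pos_add _ _ h1 h2))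
  rw [S.dom.P_add_apply hw hv, S.dom.dP_add_apply hw hv, S.val.P_add_apply ht hw]
  simp only [map_sub, map_add] at h3 ⊢
  linarith

/-- `gradHat` of `P_s f` is a translate of that of `f`. -/
lemma gradHat_P (f : V) {t v s : ℝ} (hv : 0 < v) (hs : 0 < s) :
    S.gradHat (S.dom.P s f) t v = S.gradHat f t (v + s) := by
  have h1 : S.dom.P v (S.dom.P s f) = S.dom.P (v + s) f := (S.dom.P_add_apply hv hs f).symm
  have hc : ∀ a, 0 < a → (S.dom.P a).comp (S.dom.P s) = S.dom.P (a + s) := fun a ha =>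
    (S.dom.P_add a s ha hs).symm
  have h2 : ∀ a, 0 < a → (S.dom.dP a).comp (S.dom.P s) = S.dom.dP (a + s) := fun a ha => by
    have h1 : HasDerivAt (fun b => S.dom.P (b + s)) (S.dom.dP (a + s)) a :=
      (S.dom.hasDerivAt_P (a + s) (by positivity)).comp_add_const a s
    have h2 : HasDerivAt (fun b => (S.dom.P b).comp (S.dom.P s)) ((S.dom.dP a).comp (S.dom.P s)) a := by
      simpa using (S.dom.hasDerivAt_P a ha).clm_comp (hasDerivAt_const a (S.dom.P s))
    refine (h2.congr_of_eventuallyEq ?_).unique h1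
    filter_upwards [lt_mem_nhds ha] with b hb using (hc b hb).symm
  have h3 : (S.dom.ddP v).comp (S.dom.P s) = S.dom.ddP (v + s) := by
    have h1 : HasDerivAt (fun b => S.dom.dP (b + s)) (S.dom.ddP (v + s)) v :=
      (S.dom.hasDerivAt_dP (v + s) (by positivity)).comp_add_const v s
    have h2' : HasDerivAt (fun b => (S.dom.dP b).comp (S.dom.P s))
        ((S.dom.ddP v).comp (S.dom.P s)) v := by
      simpa using (S.dom.hasDerivAt_dP v hv).clm_comp (hasDerivAt_const v (S.dom.P s))
    refine (h2'.congr_of_eventuallyEq ?_).unique h1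
    filter_upwards [lt_mem_nhds hv] with b hb using (h2 b hb).symm
  have h2' : S.dom.dP v (S.dom.P s f) = S.dom.dP (v + s) f := DFunLike.congr_fun (h2 v hv) f
  have h3' : S.dom.ddP v (S.dom.P s f) = S.dom.ddP (v + s) f := DFunLike.congr_fun h3 f
  simp only [gradHat, grad, h1, h2', h3']

lemma continuousOn_gradHat (f : V) :
    ContinuousOn (fun p : ℝ × ℝ => S.gradHat f p.1 p.2) (Ioi 0 ×ˢ Ioi 0) := by
  rintro ⟨t, v⟩ ⟨ht, hv⟩
  refine ContinuousAt.continuousWithinAt ?_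
  simp only [mem_Ioi] at ht hv
  have a1 : ContinuousAt (fun p : ℝ × ℝ => S.val.P p.1) (t, v) :=
    ContinuousAt.comp (g := S.val.P) (S.val.continuousAt_P ht) continuousAt_fst
  have a2 : ContinuousAt (fun p : ℝ × ℝ => S.val.ddP p.1) (t, v) :=
    ContinuousAt.comp (g := S.val.ddP) (S.val.continuousAt_ddP ht) continuousAt_fst
  have b0 : ContinuousAt (fun p : ℝ × ℝ => S.dom.P p.2 f) (t, v) :=
    (ContinuousAt.comp (g := S.dom.P) (S.dom.continuousAt_P hv) continuousAt_snd).clm_apply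
      continuousAt_const
  have b1 : ContinuousAt (fun p : ℝ × ℝ => S.dom.dP p.2 f) (t, v) :=
    (ContinuousAt.comp (g := S.dom.dP) (S.dom.continuousAt_dP hv) continuousAt_snd).clm_apply
      continuousAt_const
  have b2 : ContinuousAt (fun p : ℝ × ℝ => S.dom.ddP p.2 f) (t, v) :=
    (ContinuousAt.comp (g := S.dom.ddP) (S.dom.continuousAt_ddP hv) continuousAt_snd).clm_apply
      continuousAt_const
  have hB : ∀ x y : ℝ × ℝ → V, ContinuousAt x (t, v) → ContinuousAt y (t, v) →
      ContinuousAt (fun p => S.B (x p) (y p)) (t, v) := fun x y hx hy =>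
    (S.B.continuous.continuousAt.comp hx).clm_apply hy
  unfold gradHat grad
  exact (((a1.clm_apply ((hB _ _ b2 b0).add (hB _ _ b0 b2))).sub
    (a2.clm_apply (hB _ _ b0 b0))).const_smul _).add (a1.clm_apply (hB _ _ b1 b1))

end GradientSystem
end SemigroupBMO

namespace SemigroupBMO

/-! ### Integral inequalities for quasi-monotone kernels -/

/-- The substitution w = (v + T)/2. It undoes the halving of the second variable produced when half
of it is shifted into the first. -/
lemma lintegral_comp_half_add (F : ℝ → ℝ≥0∞) (T : ℝ) :
    ∫⁻ v, F ((v + T) / 2) = 2 * ∫⁻ w, F w := by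
  have h1 : ∫⁻ v, F ((v + T) / 2) = ∫⁻ v, F (v / 2) :=
    lintegral_add_right_eq_self (fun v => F (v / 2)) T
  have h2 : ∫⁻ v, F v ∂(Measure.map ((2⁻¹ : ℝ) * ·) volume) = ∫⁻ v, F (2⁻¹ * v) :=
    (Homeomorph.mulLeft₀ (2⁻¹ : ℝ) (by norm_num)).measurableEmbedding.lintegral_map F
  rw [Real.map_volume_mul_left (by norm_num : (2⁻¹ : ℝ) ≠ 0), lintegral_smul_measure] at h2
  rw [h1]
  simp only [div_eq_inv_mul]
  rw [← h2]
  norm_num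

lemma setLIntegral_comp_half_add (F : ℝ → ℝ≥0∞) (T : ℝ) {s : Set ℝ} (hs : MeasurableSet s) :
    ∫⁻ v in (fun v => (v + T) / 2) ⁻¹' s, F ((v + T) / 2) = 2 * ∫⁻ w in s, F w := by
  rw [← lintegral_indicator hs, ← lintegral_comp_half_add _ T,
    ← lintegral_indicator ((by fun_prop : Measurable fun v : ℝ => (v + T) / 2) hs)]
  rfl

/-- Kernels `g t v` which are increasing in `t` up to the factor `t / s` after reversal, and which
decrease under a shift of mass from `v` to `t`. -/
structure IsQuasiMonotone (g : ℝ → ℝ → ℝ≥0∞) : Prop where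
  measurable : Measurable (Function.uncurry g)
  quasi : ∀ s t v, 0 < s → s ≤ t → 0 < v → g t v ≤ ENNReal.ofReal (t / s) * g s v
  shift : ∀ t v w, 0 < t → 0 < v → 0 < w → g t (w + v) ≤ g (t + w) v

/-- The solution at time `t` of the wave equation with right-hand side `2 g`. -/
def waveIntegral (g : ℝ → ℝ → ℝ≥0∞) (t : ℝ) : ℝ≥0∞ :=
  ∫⁻ a in Ioo 0 t, ∫⁻ v in Ioi a, 2 * g (t + v - 2 * a) v

/-- The weighted area integral `∫_0^t g(t, v) v dv`. -/
def areaIntegral (g : ℝ → ℝ → ℝ≥0∞) (t : ℝ) : ℝ≥0∞ :=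
  ∫⁻ v in Ioo 0 t, g t v * ENNReal.ofReal v

/-- Tonelli on the region 0 < a < t, a < v. For fixed v the a-integral runs over an interval of
length min(t, v), which explains the weight v of the area integral when v < t. -/
lemma waveIntegral_eq {g : ℝ → ℝ → ℝ≥0∞} (hg : Measurable (Function.uncurry g)) (t : ℝ) :
    waveIntegral g t = ∫⁻ v in Ioi 0, ∫⁻ a in Ioo 0 (min t v), 2 * g (t + v - 2 * a) v := by
  have hF : Measurable (Function.uncurry fun a v : ℝ => 2 * g (t + v - 2 * a) v) := by
    have : Measurable fun p : ℝ × ℝ => Function.uncurry g (t + p.2 - 2 * p.1, p.2) :=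
      hg.comp (by fun_prop)
    exact this.const_mul 2
  have e1 : waveIntegral g t = ∫⁻ a, ∫⁻ v,
      ({p : ℝ × ℝ | 0 < p.1 ∧ p.1 < t ∧ p.1 < p.2}.indicator
        (Function.uncurry fun a v : ℝ => 2 * g (t + v - 2 * a) v)) (a, v) := by
    rw [waveIntegral, ← lintegral_indicator measurableSet_Ioo]
    refine lintegral_congr fun a => ?_
    by_cases ha : a ∈ Ioo 0 t
    · rw [indicator_of_mem ha, ← lintegral_indicator measurableSet_Ioi]
      refine lintegral_congr fun v => ?_
      by_cases hv : a < v
      · rw [indicator_of_mem (by exact hv), indicator_of_mem (by exact ⟨ha.1, ha.2, hv⟩)]; rfl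
      · rw [indicator_of_notMem (by exact hv), indicator_of_notMem (by exact fun h => hv h.2.2)]
    · rw [indicator_of_notMem ha]
      refine (lintegral_zero.symm.trans (lintegral_congr fun v => ?_))
      rw [indicator_of_notMem (by exact fun h => ha ⟨h.1, h.2.1⟩)]
  have e2 : ∫⁻ v in Ioi 0, ∫⁻ a in Ioo 0 (min t v), 2 * g (t + v - 2 * a) v = ∫⁻ v, ∫⁻ a,
      ({p : ℝ × ℝ | 0 < p.1 ∧ p.1 < t ∧ p.1 < p.2}.indicator
        (Function.uncurry fun a v : ℝ => 2 * g (t + v - 2 * a) v)) (a, v) := by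
    rw [← lintegral_indicator measurableSet_Ioi]
    refine lintegral_congr fun v => ?_
    by_cases hv : v ∈ Ioi (0 : ℝ)
    · rw [indicator_of_mem hv, ← lintegral_indicator measurableSet_Ioo]
      refine lintegral_congr fun a => ?_
      by_cases ha : a ∈ Ioo 0 (min t v)
      · rw [indicator_of_mem ha, indicator_of_mem
          (by exact ⟨ha.1, ha.2.trans_le (min_le_left _ _), ha.2.trans_le (min_le_right _ _)⟩)]; rfl
      · rw [indicator_of_notMem ha, indicator_of_notMem
          (by exact fun h => ha ⟨h.1, lt_min h.2.1 h.2.2⟩)]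
    · rw [indicator_of_notMem hv]
      refine (lintegral_zero.symm.trans (lintegral_congr fun a => ?_))
      rw [indicator_of_notMem (by exact fun h => hv (h.1.trans h.2.2))]
  rw [e1, e2, lintegral_lintegral_swap]
  refine (hF.indicator ?_).aemeasurable
  exact (measurableSet_lt measurable_const measurable_fst).inter
    ((measurableSet_lt measurable_fst measurable_const).inter
      (measurableSet_lt measurable_fst measurable_snd))

namespace IsQuasiMonotone

variable {g : ℝ → ℝ → ℝ≥0∞} (hg : IsQuasiMonotone g)
include hg

lemma quasi' {s t v c : ℝ} (hs : 0 < s) (hst : s ≤ t) (hv : 0 < v) (hc : t ≤ c * s) :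
    g t v ≤ ENNReal.ofReal c * g s v := by
  refine (hg.quasi s t v hs hst hv).trans ?_
  gcongr
  rwa [div_le_iff₀ hs]

/-- A lower bound of the inner integral of the wave integral. -/
lemma mul_le_inner {t s v r : ℝ} (hr : 0 < r) (hrt : r ≤ t) (hrv : r ≤ v)
    (h1 : ∀ a ∈ Ioo (r / 2) (3 * r / 4), 0 < t + v - 2 * a ∧ t + v - 2 * a ≤ s ∧
      s ≤ 2 * (t + v - 2 * a)) (hv : 0 < v) :
    ENNReal.ofReal (r / 4) * g s v ≤ ∫⁻ a in Ioo 0 (min t v), 2 * g (t + v - 2 * a) v := by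
  calc ENNReal.ofReal (r / 4) * g s v = ∫⁻ _ in Ioo (r / 2) (3 * r / 4), g s v := by
        rw [lintegral_const, Measure.restrict_apply_univ, Real.volume_Ioo, mul_comm]
        congr 2; ring
    _ ≤ ∫⁻ a in Ioo (r / 2) (3 * r / 4), 2 * g (t + v - 2 * a) v := by
        refine setLIntegral_mono' measurableSet_Ioo fun a ha => ?_
        obtain ⟨h2, h3, h4⟩ := h1 a ha
        simpa using hg.quasi' h2 h3 hv h4
    _ ≤ _ := by
        refine lintegral_mono_set (Ioo_subset_Ioo (by positivity) ?_)
        rw [le_min_iff]; constructor <;> linarith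

/-- For v < t, keep only a between v/2 and 3v/4, a window of length v/4. There t + v − 2a lies
between t/2 and t, so quasi-monotonicity compares the integrand with g(t, v). -/
lemma areaIntegral_le (t : ℝ) (ht : 0 < t) : areaIntegral g t ≤ 4 * waveIntegral g t := by
  rw [waveIntegral_eq hg.measurable, areaIntegral]
  have h4 : (4 : ℝ≥0∞) = ENNReal.ofReal 4 := by simp
  rw [h4, ← lintegral_const_mul' _ _ ENNReal.ofReal_ne_top]
  refine (lintegral_mono_set (Ioo_subset_Ioi_self : Ioo 0 t ⊆ Ioi 0)).trans' ?_
  refine setLIntegral_mono' measurableSet_Ioo fun v hv => ?_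
  have := hg.mul_le_inner (t := t) (s := t) hv.1 hv.2.le le_rfl
    (fun a ha => ⟨by linarith [ha.1, ha.2, hv.1, hv.2], by linarith [ha.1],
      by linarith [ha.1, ha.2, hv.1, hv.2]⟩) hv.1
  refine (mul_le_mul_right this (ENNReal.ofReal 4)).trans' ?_
  rw [← mul_assoc, ← ENNReal.ofReal_mul (by norm_num), mul_comm]
  gcongr
  linarith

/-- The same window argument for v > t, now with a between t/2 and 3t/4, where t + v − 2a lies
between v/2 and v. The diagonal value g(v, v) results. -/
lemma tail_le_waveIntegral (t : ℝ) (ht : 0 < t) :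
    ENNReal.ofReal t * ∫⁻ v in Ioi t, g v v ≤ 4 * waveIntegral g t := by
  rw [waveIntegral_eq hg.measurable]
  have h4 : (4 : ℝ≥0∞) = ENNReal.ofReal 4 := by simp
  rw [h4, ← lintegral_const_mul' _ _ ENNReal.ofReal_ne_top,
    ← lintegral_const_mul' _ _ ENNReal.ofReal_ne_top]
  refine (lintegral_mono_set (Ioi_subset_Ioi ht.le)).trans' ?_
  refine setLIntegral_mono' measurableSet_Ioi fun v hv => ?_
  have hv' : t < v := hv
  have := hg.mul_le_inner (t := t) (s := v) (v := v) (r := t) ht le_rfl hv'.le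
    (fun a ha => ⟨by linarith [ha.1, ha.2], by linarith [ha.1],
      by linarith [ha.1, ha.2]⟩) (ht.trans hv')
  refine (mul_le_mul_right this (ENNReal.ofReal 4)).trans' ?_
  rw [← mul_assoc, ← ENNReal.ofReal_mul (by norm_num)]
  gcongr
  linarith

/-- Shifting half of the second variable gives g(w,w) ≤ g(3w/2, w/2) ≤ 3 g(t, w/2) for t < w ≤ 2t.
Here w/2 > t/2, so the weight v in the area integral is comparable to t. The constant is 3 · 2 · 2.
-/
lemma dyadic_le {M : ℝ≥0∞} (hM : ∀ t, 0 < t → areaIntegral g t ≤ M) (t : ℝ) (ht : 0 < t) :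
    ENNReal.ofReal t * ∫⁻ w in Ioc t (2 * t), g w w ≤ 12 * M := by
  have h1 : ∫⁻ w in Ioc t (2 * t), g w w ≤ ∫⁻ w in Ioc t (2 * t), 3 * g t ((w + 0) / 2) := by
    refine setLIntegral_mono' measurableSet_Ioc fun w hw => ?_
    have hw0 : 0 < w := ht.trans hw.1
    calc g w w = g w (w / 2 + w / 2) := by rw [add_halves]
      _ ≤ g (w + w / 2) (w / 2) := hg.shift _ _ _ hw0 (by positivity) (by positivity)
      _ ≤ ENNReal.ofReal 3 * g t (w / 2) :=
          hg.quasi' ht (by linarith [hw.1]) (by positivity) (by linarith [hw.2])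
      _ = 3 * g t ((w + 0) / 2) := by simp
  have h2 : ∫⁻ w in Ioc t (2 * t), 3 * g t ((w + 0) / 2) =
      3 * (2 * ∫⁻ x in Ioc (t / 2) t, g t x) := by
    rw [lintegral_const_mul' _ _ (by simp), ← setLIntegral_comp_half_add _ 0 measurableSet_Ioc]
    congr 3
    ext w
    simp only [mem_Ioc, mem_preimage, add_zero]
    constructor <;> rintro ⟨a, b⟩ <;> constructor <;> linarith
  have h3 : ENNReal.ofReal t * ∫⁻ x in Ioc (t / 2) t, g t x ≤ 2 * areaIntegral g t := by
    rw [areaIntegral, ← lintegral_const_mul' _ _ ENNReal.ofReal_ne_top,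
      ← lintegral_const_mul' _ _ (by simp : (2 : ℝ≥0∞) ≠ ∞),
      setLIntegral_congr (Ioo_ae_eq_Ioc (μ := volume) (a := (0 : ℝ)) (b := t))]
    refine (lintegral_mono_set (Ioc_subset_Ioc_left (half_pos ht).le : Ioc (t / 2) t ⊆ Ioc 0 t)).trans' ?_
    refine setLIntegral_mono' measurableSet_Ioc fun x hx => ?_
    rw [mul_comm (g t x), ← mul_assoc]
    gcongr
    have : (2 : ℝ≥0∞) = ENNReal.ofReal 2 := by simp
    rw [this, ← ENNReal.ofReal_mul (by norm_num)]
    gcongr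
    linarith [hx.1]
  calc _ ≤ ENNReal.ofReal t * (3 * (2 * ∫⁻ x in Ioc (t / 2) t, g t x)) := by
        rw [← h2]; gcongr
    _ = 6 * (ENNReal.ofReal t * ∫⁻ x in Ioc (t / 2) t, g t x) := by ring
    _ ≤ 6 * (2 * M) := by
        refine mul_le_mul_right (h3.trans ?_) _
        exact mul_le_mul_right (hM t ht) _
    _ = 12 * M := by ring

/-- The block from 2^k t to 2^{k+1} t contributes at most 12 M / 2^k after multiplication by t, and
the geometric series doubles the constant. -/
lemma tail_le_area {M : ℝ≥0∞} (hM : ∀ t, 0 < t → areaIntegral g t ≤ M) (t : ℝ) (ht : 0 < t) :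
    ENNReal.ofReal t * ∫⁻ w in Ioi t, g w w ≤ 24 * M := by
  have hU : Ioi t ⊆ ⋃ k : ℕ, Ioc (2 ^ k * t) (2 * (2 ^ k * t)) := by
    intro w hw
    have hw' : t < w := hw
    obtain ⟨n, hn1, hn2⟩ := exists_nat_pow_near (x := w / t) (y := 2)
      (by rw [le_div_iff₀ ht]; linarith) (by norm_num)
    rw [le_div_iff₀ ht] at hn1
    rw [div_lt_iff₀ ht] at hn2
    rw [mem_iUnion]
    rcases hn1.eq_or_lt with h | h
    · rcases n with _ | n
      · simp at h; linarith
      · exact ⟨n, by rw [← h, pow_succ]; nlinarith [pow_pos (two_pos (α := ℝ)) n],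
          by rw [← h, pow_succ]; linarith⟩
    · exact ⟨n, h, by rw [pow_succ] at hn2; linarith⟩
  calc _ ≤ ENNReal.ofReal t * ∑' k : ℕ, ∫⁻ w in Ioc (2 ^ k * t) (2 * (2 ^ k * t)), g w w := by
        gcongr
        exact (lintegral_mono_set hU).trans (lintegral_iUnion_le _ _)
    _ = ∑' k : ℕ, (2⁻¹ : ℝ≥0∞) ^ k * (ENNReal.ofReal (2 ^ k * t) *
          ∫⁻ w in Ioc (2 ^ k * t) (2 * (2 ^ k * t)), g w w) := by
        rw [← ENNReal.tsum_mul_left]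
        refine tsum_congr fun k => ?_
        rw [← mul_assoc ((2⁻¹ : ℝ≥0∞) ^ k)]
        congr 1
        rw [ENNReal.ofReal_mul (by positivity), ← mul_assoc, ENNReal.ofReal_pow (by norm_num),
          ← mul_pow, ENNReal.ofReal_ofNat, ENNReal.inv_mul_cancel (by simp) (by simp), one_pow,
          one_mul]
    _ ≤ ∑' k : ℕ, (2⁻¹ : ℝ≥0∞) ^ k * (12 * M) :=
        ENNReal.tsum_le_tsum fun k => mul_le_mul_right (hg.dyadic_le hM _ (by positivity)) _
    _ = 24 * M := by
        rw [ENNReal.tsum_mul_right, ENNReal.tsum_geometric, ENNReal.one_sub_inv_two, inv_inv,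
          ← mul_assoc]
        norm_num

lemma waveIntegral_le {M : ℝ≥0∞} (hM : ∀ t, 0 < t → areaIntegral g t ≤ M) (t : ℝ) (ht : 0 < t) :
    waveIntegral g t ≤ 1000 * M := by
  rw [waveIntegral_eq hg.measurable, ← Ioc_union_Ioi_eq_Ioi ht.le]
  refine (lintegral_union_le _ _ _).trans ?_
  have key : ∀ c x : ℝ, ∀ y : ℝ≥0∞, (∫⁻ _ in Ioo 0 c, 2 * (ENNReal.ofReal 5 * y)) =
      10 * (ENNReal.ofReal c * y) := fun c x y => by
    rw [lintegral_const, Measure.restrict_apply_univ, Real.volume_Ioo, sub_zero]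
    have : ENNReal.ofReal 5 = 5 := by simp
    rw [this]; ring
  -- Region v ≤ t: after shifting v/2, the first variable t + 3v/2 − 2a lies between t/2 and 5t/2.
  -- The inner integral is therefore at most 10 v g(t/2, v/2), an area integrand at time t/2.
  have h1 : ∫⁻ v in Ioc 0 t, ∫⁻ a in Ioo 0 (min t v), 2 * g (t + v - 2 * a) v ≤ 40 * M := by
    calc _ ≤ ∫⁻ v in Ioc 0 t, 20 * (g (t / 2) ((v + 0) / 2) * ENNReal.ofReal ((v + 0) / 2)) := by
          refine setLIntegral_mono' measurableSet_Ioc fun v hv => ?_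
          calc _ ≤ ∫⁻ a in Ioo 0 v, 2 * (ENNReal.ofReal 5 * g (t / 2) (v / 2)) := by
                rw [min_eq_right hv.2]
                refine setLIntegral_mono' measurableSet_Ioo fun a ha => ?_
                gcongr
                calc g (t + v - 2 * a) v = g (t + v - 2 * a) (v / 2 + v / 2) := by rw [add_halves]
                  _ ≤ g (t + v - 2 * a + v / 2) (v / 2) := hg.shift _ _ _
                      (by linarith [ha.1, ha.2, hv.2]) (half_pos hv.1) (half_pos hv.1)
                  _ ≤ _ := hg.quasi' (half_pos ht) (by linarith [ha.2, hv.2]) (half_pos hv.1)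
                      (by linarith [ha.1, hv.2])
            _ = 20 * (g (t / 2) ((v + 0) / 2) * ENNReal.ofReal ((v + 0) / 2)) := by
                rw [key v v, add_zero]
                have : ENNReal.ofReal v = 2 * ENNReal.ofReal (v / 2) := by
                  rw [show (2 : ℝ≥0∞) = ENNReal.ofReal 2 by simp, ← ENNReal.ofReal_mul (by norm_num)]
                  congr 1; ring
                rw [this]; ring
      _ = 40 * areaIntegral g (t / 2) := by
          have hs : Ioc 0 t = (fun v => (v + 0) / 2) ⁻¹' Ioc 0 (t / 2) := by
            ext v
            simp only [mem_Ioc, mem_preimage, add_zero]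
            constructor <;> rintro ⟨a, b⟩ <;> constructor <;> linarith
          rw [lintegral_const_mul' _ _ (by simp), hs, setLIntegral_comp_half_add
            (fun x => g (t / 2) x * ENNReal.ofReal x) 0 measurableSet_Ioc, areaIntegral,
            setLIntegral_congr Ioo_ae_eq_Ioc]
          ring
      _ ≤ 40 * M := by gcongr; exact hM _ (half_pos ht)
  -- Region v > t: after the same shift, the first variable lies between v/2 and 5v/2. What remains
  -- is t times a diagonal tail, estimated by `tail_le_area`.
  have h2 : ∫⁻ v in Ioi t, ∫⁻ a in Ioo 0 (min t v), 2 * g (t + v - 2 * a) v ≤ 960 * M := by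
    calc _ ≤ ∫⁻ v in Ioi t, 10 * (ENNReal.ofReal t * g ((v + 0) / 2) ((v + 0) / 2)) := by
          refine setLIntegral_mono' measurableSet_Ioi fun v hv => ?_
          have hv' : t < v := hv
          calc _ ≤ ∫⁻ a in Ioo 0 t, 2 * (ENNReal.ofReal 5 * g (v / 2) (v / 2)) := by
                rw [min_eq_left hv'.le]
                refine setLIntegral_mono' measurableSet_Ioo fun a ha => ?_
                gcongr
                calc g (t + v - 2 * a) v = g (t + v - 2 * a) (v / 2 + v / 2) := by rw [add_halves]
                  _ ≤ g (t + v - 2 * a + v / 2) (v / 2) := hg.shift _ _ _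
                      (by linarith [ha.1, ha.2]) (by linarith) (by linarith)
                  _ ≤ _ := hg.quasi' (by linarith) (by linarith [ha.2]) (by linarith)
                      (by linarith [ha.1])
            _ = _ := by rw [key t v, add_zero]
      _ = 40 * (ENNReal.ofReal (t / 2) * ∫⁻ w in Ioi (t / 2), g w w) := by
          have hs : Ioi t = (fun v => (v + 0) / 2) ⁻¹' Ioi (t / 2) := by
            ext v
            simp only [mem_Ioi, mem_preimage, add_zero]
            constructor <;> intro h <;> linarith
          rw [lintegral_const_mul' _ _ (by simp), lintegral_const_mul' _ _ ENNReal.ofReal_ne_top,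
            hs, setLIntegral_comp_half_add (fun x => g x x) 0 measurableSet_Ioi]
          have : ENNReal.ofReal t = 2 * ENNReal.ofReal (t / 2) := by
            rw [show (2 : ℝ≥0∞) = ENNReal.ofReal 2 by simp, ← ENNReal.ofReal_mul (by norm_num)]
            congr 1; ring
          rw [this]; ring
      _ ≤ 40 * (24 * M) := by exact mul_le_mul_right (hg.tail_le_area hM _ (half_pos ht)) _
      _ = 960 * M := by ring
  calc _ ≤ 40 * M + 960 * M := add_le_add h1 h2
    _ = 1000 * M := by ring

/-- The a-interval has length at most t however large T is, and half of v + T can be shifted into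
time. So the bound keeps the short time t as prefactor, while the diagonal tail starts at T/2. -/
lemma waveIntegral_shift_le {t T : ℝ} (ht : 0 < t) (htT : t ≤ T) :
    waveIntegral (fun s v => g s (v + T)) t ≤
      12 * (ENNReal.ofReal t * ∫⁻ w in Ioi (T / 2), g w w) := by
  have hm : Measurable (Function.uncurry fun s v => g s (v + T)) :=
    hg.measurable.comp (by fun_prop : Measurable fun p : ℝ × ℝ => (p.1, p.2 + T))
  rw [waveIntegral_eq hm]
  calc _ ≤ ∫⁻ v in Ioi 0, 6 * (ENNReal.ofReal t * g ((v + T) / 2) ((v + T) / 2)) := by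
        refine setLIntegral_mono' measurableSet_Ioi fun v hv => ?_
        have hv' : 0 < v := hv
        calc _ ≤ ∫⁻ a in Ioo 0 t, 2 * (ENNReal.ofReal 3 * g ((v + T) / 2) ((v + T) / 2)) := by
              refine (lintegral_mono_set (Ioo_subset_Ioo_right (min_le_left t v))).trans' ?_
              refine setLIntegral_mono' measurableSet_Ioo fun a ha => ?_
              have ha' := lt_min_iff.1 ha.2
              gcongr
              calc g (t + v - 2 * a) (v + T) = g (t + v - 2 * a) ((v + T) / 2 + (v + T) / 2) := by
                    rw [add_halves]
                _ ≤ g (t + v - 2 * a + (v + T) / 2) ((v + T) / 2) := hg.shift _ _ _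
                    (by linarith [ha.1]) (by linarith) (by linarith)
                _ ≤ _ := hg.quasi' (by linarith) (by linarith) (by linarith)
                    (by linarith [ha.1])
          _ = _ := by
              rw [lintegral_const, Measure.restrict_apply_univ, Real.volume_Ioo, sub_zero,
                show ENNReal.ofReal 3 = 3 by simp]
              ring
    _ = _ := by
        have hs : Ioi 0 = (fun v => (v + T) / 2) ⁻¹' Ioi (T / 2) := by
          ext v
          simp only [mem_Ioi, mem_preimage]
          constructor <;> intro h <;> linarith
        rw [lintegral_const_mul' _ _ (by simp), lintegral_const_mul' _ _ ENNReal.ofReal_ne_top,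
          hs, setLIntegral_comp_half_add (fun x => g x x) T measurableSet_Ioi]
        ring

/-- The diagonal tail beyond T/2 is at most 4/(T/2) times the wave integral at T/2. Against the
prefactor t this leaves the gain t/T that makes the later telescoping sum converge. -/
lemma waveIntegral_shift_le' {t T : ℝ} (ht : 0 < t) (htT : t ≤ T) :
    waveIntegral (fun s v => g s (v + T)) t ≤
      ENNReal.ofReal (96 * (t / T)) * waveIntegral g (T / 2) := by
  have hT : 0 < T := ht.trans_le htT
  refine (hg.waveIntegral_shift_le ht htT).trans ?_
  calc _ = ENNReal.ofReal (24 * (t / T)) *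
        (ENNReal.ofReal (T / 2) * ∫⁻ w in Ioi (T / 2), g w w) := by
        rw [← mul_assoc, ← mul_assoc, ← ENNReal.ofReal_mul (by positivity),
          show (12 : ℝ≥0∞) = ENNReal.ofReal 12 by simp, ← ENNReal.ofReal_mul (by norm_num)]
        congr 2
        field_simp; norm_num
    _ ≤ ENNReal.ofReal (24 * (t / T)) * (4 * waveIntegral g (T / 2)) := by
        exact mul_le_mul_right (hg.tail_le_waveIntegral _ (half_pos hT)) _
    _ = _ := by
        rw [← mul_assoc, show (4 : ℝ≥0∞) = ENNReal.ofReal 4 by simp,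
          ← ENNReal.ofReal_mul (by positivity)]
        congr 2; ring

end IsQuasiMonotone
end SemigroupBMO

/-! ### The variance as an integral along characteristics of the wave equation -/

namespace SemigroupBMO

/-- The fundamental theorem of calculus with only one-sided limits at the endpoints. The sign of the
derivative supplies integrability. -/
lemma lintegral_Ioo_of_hasDerivAt {f f' : ℝ → ℝ} {a b la lb : ℝ} (hab : a < b)
    (hd : ∀ x ∈ Ioo a b, HasDerivAt f (f' x) x) (hn : ∀ x ∈ Ioo a b, 0 ≤ f' x)
    (ha : Tendsto f (𝓝[>] a) (𝓝 la)) (hb : Tendsto f (𝓝[<] b) (𝓝 lb)) :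
    ∫⁻ x in Ioo a b, ENNReal.ofReal (f' x) = ENNReal.ofReal (lb - la) := by
  have hc : ContinuousOn (extendFrom (Ioo a b) f) (Icc a b) :=
    continuousOn_Icc_extendFrom_Ioo (fun x hx => (hd x hx).continuousAt.continuousWithinAt) ha hb
  have hd' : ∀ x ∈ Ioo a b, HasDerivAt (extendFrom (Ioo a b) f) (f' x) x := fun x hx => by
    refine (hd x hx).congr_of_eventuallyEq ?_
    filter_upwards [isOpen_Ioo.mem_nhds hx] with y hy
    exact extendFrom_eq (subset_closure hy)
      ((hd y hy).continuousAt.tendsto.mono_left nhdsWithin_le_nhds)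
  have hi := intervalIntegral.integrableOn_deriv_of_nonneg hc hd' hn
  have h1 := intervalIntegral.integral_eq_sub_of_hasDerivAt_of_tendsto hab hd
    ((intervalIntegrable_iff_integrableOn_Ioc_of_le hab.le).2 hi) ha hb
  rw [← h1, intervalIntegral.integral_of_le hab.le, integral_Ioc_eq_integral_Ioo,
    ofReal_integral_eq_lintegral_ofReal (hi.mono_set Ioo_subset_Ioc_self)]
  exact (ae_restrict_iff' measurableSet_Ioo).2 (ae_of_all _ hn)

lemma lintegral_Ioi_of_hasDerivAt {f f' : ℝ → ℝ} {a l : ℝ}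
    (hd : ∀ x ∈ Ici a, HasDerivAt f (f' x) x) (hn : ∀ x ∈ Ioi a, 0 ≤ f' x)
    (hl : Tendsto f atTop (𝓝 l)) :
    ∫⁻ x in Ioi a, ENNReal.ofReal (f' x) = ENNReal.ofReal (l - f a) := by
  rw [← integral_Ioi_of_hasDerivAt_of_nonneg' hd hn hl,
    ofReal_integral_eq_lintegral_ofReal (integrableOn_Ioi_deriv_of_nonneg' hd hn hl)]
  exact (ae_restrict_iff' measurableSet_Ioi).2 (ae_of_all _ hn)

/-- The triangle inequality for the seminorm of a positive bilinear form. -/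
lemma sqrt_form_add_le {V : Type*} [AddCommGroup V] [Module ℝ V] (b : V →ₗ[ℝ] V →ₗ[ℝ] ℝ)
    (hb : ∀ f, 0 ≤ b f f) (f g : V) :
    √(b (f + g) (f + g)) ≤ √(b f f) + √(b g g) := by
  have hd : discrim (b f f) (b f g + b g f) (b g g) ≤ 0 := by
    refine discrim_le_zero fun s => ?_
    have := hb (s • f + g)
    simp only [map_add, map_smul, LinearMap.add_apply, LinearMap.smul_apply, smul_eq_mul] at this
    linarith
  have hc : b f g + b g f ≤ 2 * (√(b f f) * √(b g g)) := by
    refine abs_le_of_sq_le_sq' ?_ (by positivity) |>.2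
    rw [mul_pow, mul_pow, Real.sq_sqrt (hb f), Real.sq_sqrt (hb g)]
    rw [discrim] at hd
    linarith
  refine Real.sqrt_le_iff.2 ⟨by positivity, ?_⟩
  rw [add_sq, Real.sq_sqrt (hb f), Real.sq_sqrt (hb g)]
  simp only [map_add, LinearMap.add_apply]
  linarith

namespace GradientSystem

variable {V X : Type*} [NormedAddCommGroup V] [NormedSpace ℝ V]
  [NormedAddCommGroup X] [NormedSpace ℝ X] (S : GradientSystem V X)

/-- `P_t |f|² - |P_t f|²`. -/
def variance (t : ℝ) (f : V) : X := S.val.P t (S.B f f) - S.B (S.dom.P t f) (S.dom.P t f)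

/-- The difference `(∂_v - ∂_t) P_t |P_v f|²` of partial derivatives. -/
def waveSlope (f : V) (t v : ℝ) : X :=
  S.val.P t (S.B (S.dom.dP v f) (S.dom.P v f) + S.B (S.dom.P v f) (S.dom.dP v f)) -
    S.val.dP t (S.B (S.dom.P v f) (S.dom.P v f))

/-- The kernel `(t, v) ↦ ω(P_t Γ̂(P_v f, P_v f))` on the positive quadrant. -/
def kernel (ω : X →L[ℝ] ℝ) (f : V) (t v : ℝ) : ℝ≥0∞ :=
  (Ioi (0 : ℝ) ×ˢ Ioi (0 : ℝ)).indicator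
    (fun p : ℝ × ℝ => ENNReal.ofReal (ω (S.gradHat f p.1 p.2))) (t, v)

variable {S}

lemma hasDerivAt_form {x y : ℝ → V} {x' y' : V} {a : ℝ} (hx : HasDerivAt x x' a)
    (hy : HasDerivAt y y' a) : HasDerivAt (fun b => S.B (x b) (y b)) (S.B x' (y a) + S.B (x a) y') a :=
  (S.B.hasFDerivAt.comp_hasDerivAt a hx).clm_apply hy

lemma hasDerivAt_square (f : V) {t a : ℝ} (ha : a ∈ Ioo 0 t) :
    HasDerivAt (fun b => S.val.P (t - b) (S.B (S.dom.P b f) (S.dom.P b f)))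
      (S.waveSlope f (t - a) a) a := by
  have h1 : HasDerivAt (fun b => S.val.P (t - b)) (-S.val.dP (t - a)) a :=
    (S.val.hasDerivAt_P (t - a) (sub_pos.2 ha.2)).comp_const_sub t a
  have h2 := S.dom.hasDerivAt_P_apply ha.1 f
  convert h1.clm_apply (hasDerivAt_form h2 h2) using 1
  rw [waveSlope, neg_apply]
  abel

/-- The diagonal derivative ∂_t + ∂_v of (∂_v − ∂_t)P_t|P_v f|² is (∂_v² − ∂_t²)P_t|P_v f|². The
mixed terms cancel. As second derivatives are generators, the rest is twice P_t Γ̂(P_v f, P_v f). -/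
lemma hasDerivAt_waveSlope (f : V) {c v : ℝ} (hv : 0 < v) (hc : 0 < c + v) :
    HasDerivAt (fun b => S.waveSlope f (c + b) b) ((2 : ℝ) • S.gradHat f (c + v) v) v := by
  have h1 := S.dom.hasDerivAt_P_apply hv f
  have h2 := S.dom.hasDerivAt_dP_apply hv f
  have h3 : HasDerivAt (fun b => S.val.P (c + b)) (S.val.dP (c + v)) v :=
    (S.val.hasDerivAt_P _ hc).comp_const_add c v
  have h4 : HasDerivAt (fun b => S.val.dP (c + b)) (S.val.ddP (c + v)) v :=
    (S.val.hasDerivAt_dP _ hc).comp_const_add c v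
  refine ((h3.clm_apply ((hasDerivAt_form (S := S) h2 h1).add
    (hasDerivAt_form (S := S) h1 h2))).sub
      (h4.clm_apply (hasDerivAt_form (S := S) h1 h1))).congr_deriv ?_
  simp only [gradHat, grad, map_add, Pi.add_apply]
  module

lemma norm_form_le (x y : V) : ‖S.B x y‖ ≤ ‖S.B‖ * ‖x‖ * ‖y‖ := S.B.le_opNorm₂ x y

/-- Every term contains a factor `dP` at a time tending to infinity, while all other factors stay
bounded by contractivity. -/
lemma tendsto_waveSlope (f : V) (c : ℝ) :
    Tendsto (fun b => S.waveSlope f (c + b) b) atTop (𝓝 0) := by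
  have hd : Tendsto (fun b => ‖S.dom.dP b‖) atTop (𝓝 0) := by
    simpa using S.dom.tendsto_dP.norm
  have hd' : Tendsto (fun b => ‖S.val.dP (c + b)‖) atTop (𝓝 0) := by
    simpa using (S.val.tendsto_dP.comp (tendsto_atTop_add_const_left _ c tendsto_id)).norm
  have hlim : Tendsto (fun b => 2 * (‖S.B‖ * ‖f‖ * ‖f‖) * ‖S.dom.dP b‖ +
      ‖S.val.dP (c + b)‖ * (‖S.B‖ * ‖f‖ * ‖f‖)) atTop (𝓝 0) := by
    simpa using (hd.const_mul (2 * (‖S.B‖ * ‖f‖ * ‖f‖))).add (hd'.mul_const _)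
  refine squeeze_zero_norm' ?_ hlim
  filter_upwards [eventually_gt_atTop 0, eventually_gt_atTop (-c)] with b hb hcb
  have h0 : ‖S.dom.P b f‖ ≤ ‖f‖ := S.dom.P_apply_norm_le hb f
  have h1 : ‖S.dom.dP b f‖ ≤ ‖S.dom.dP b‖ * ‖f‖ := (S.dom.dP b).le_opNorm f
  refine (norm_sub_le _ _).trans (add_le_add ?_ ?_)
  · refine (S.val.P_apply_norm_le (by linarith) _).trans ((norm_add_le _ _).trans ?_)
    have e1 : ‖S.B (S.dom.dP b f) (S.dom.P b f)‖ ≤ ‖S.B‖ * (‖S.dom.dP b‖ * ‖f‖) * ‖f‖ :=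
      (norm_form_le _ _).trans (by gcongr)
    have e2 : ‖S.B (S.dom.P b f) (S.dom.dP b f)‖ ≤ ‖S.B‖ * ‖f‖ * (‖S.dom.dP b‖ * ‖f‖) :=
      (norm_form_le _ _).trans (by gcongr)
    linarith
  · refine ((S.val.dP _).le_opNorm _).trans ?_
    gcongr
    exact (norm_form_le _ _).trans (by gcongr)

variable {ω : X →L[ℝ] ℝ}

lemma kernel_eq (f : V) {t v : ℝ} (ht : 0 < t) (hv : 0 < v) :
    S.kernel ω f t v = ENNReal.ofReal (ω (S.gradHat f t v)) :=
  indicator_of_mem (by exact ⟨ht, hv⟩) _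

lemma isQuasiMonotone_kernel (hω : ω ∈ S.Ω) (f : V) : IsQuasiMonotone (S.kernel ω f) where
  measurable := by
    have hs : MeasurableSet (Ioi (0 : ℝ) ×ˢ Ioi (0 : ℝ)) := measurableSet_Ioi.prod measurableSet_Ioi
    have hc : ContinuousOn (fun p : ℝ × ℝ => ENNReal.ofReal (ω (S.gradHat f p.1 p.2)))
        (Ioi (0 : ℝ) ×ˢ Ioi (0 : ℝ)) :=
      (ENNReal.continuous_ofReal.comp ω.continuous).comp_continuousOn (continuousOn_gradHat f)
    classical
    have := hc.measurable_piecewise (g := 0) continuousOn_const hs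
    rwa [piecewise_eq_indicator] at this
  quasi s t v hs hst hv := by
    rw [kernel_eq f (hs.trans_le hst) hv, kernel_eq f hs hv, ← ENNReal.ofReal_mul (div_pos (hs.trans_le hst) hs).le]
    exact ENNReal.ofReal_le_ofReal (map_gradHat_quasi_mono hω f hs hst hv)
  shift t v w ht hv hw := by
    rw [kernel_eq f ht (add_pos hw hv), kernel_eq f (add_pos ht hw) hv]
    exact ENNReal.ofReal_le_ofReal (map_gradHat_shift hω f ht hv hw)

lemma kernel_P (f : V) {t v s : ℝ} (ht : 0 < t) (hv : 0 < v) (hs : 0 < s) :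
    S.kernel ω (S.dom.P s f) t v = S.kernel ω f t (v + s) := by
  rw [kernel_eq _ ht hv, kernel_eq _ ht (add_pos hv hs), gradHat_P f hv hs]

/-- P_b f need not converge to f in norm as b → 0. The variation of P_{t−b} is handled in operator
norm, leaving the scalar convergence `tendsto_B` at fixed t. -/
lemma tendsto_square_zero (hω : ω ∈ S.Ω) (f : V) {t : ℝ} (ht : 0 < t) :
    Tendsto (fun b => ω (S.val.P (t - b) (S.B (S.dom.P b f) (S.dom.P b f)))) (𝓝[>] 0)
      (𝓝 (ω (S.val.P t (S.B f f)))) := by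
  have h1 := S.tendsto_B ω hω t f ht
  have hP : Tendsto (fun b => S.val.P (t - b) - S.val.P t) (𝓝[>] 0) (𝓝 0) := by
    have : Tendsto (fun b : ℝ => t - b) (𝓝[>] 0) (𝓝 t) :=
      ((continuous_const.sub continuous_id).tendsto' (0 : ℝ) t (by simp)).mono_left
        nhdsWithin_le_nhds
    simpa using ((S.val.continuousAt_P ht).tendsto.comp this).sub_const (S.val.P t)
  have h2 : Tendsto (fun b => ω ((S.val.P (t - b) - S.val.P t)
      (S.B (S.dom.P b f) (S.dom.P b f)))) (𝓝[>] 0) (𝓝 0) := by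
    have hlim : Tendsto (fun b => ‖ω‖ * (‖S.val.P (t - b) - S.val.P t‖ * (‖S.B‖ * ‖f‖ * ‖f‖)))
        (𝓝[>] 0) (𝓝 0) := by
      simpa using (hP.norm.mul_const (‖S.B‖ * ‖f‖ * ‖f‖)).const_mul ‖ω‖
    refine squeeze_zero_norm' ?_ hlim
    filter_upwards [self_mem_nhdsWithin] with b hb
    have h0 : ‖S.dom.P b f‖ ≤ ‖f‖ := S.dom.P_apply_norm_le hb f
    refine (ω.le_opNorm _).trans ?_
    gcongr
    refine (ContinuousLinearMap.le_opNorm _ _).trans ?_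
    gcongr
    exact (norm_form_le _ _).trans (by gcongr)
  have h3 := h1.add h2
  rw [add_zero] at h3
  refine h3.congr fun b => ?_
  rw [sub_apply, map_sub]
  ring

/-- The roles are reversed at this endpoint: P_b f is norm continuous at b = t > 0, and P_{t−b}
tends to the identity only in the scalar sense of `tendsto_P`. -/
lemma tendsto_square_end (hω : ω ∈ S.Ω) (f : V) {t : ℝ} (ht : 0 < t) :
    Tendsto (fun b => ω (S.val.P (t - b) (S.B (S.dom.P b f) (S.dom.P b f)))) (𝓝[<] t)
      (𝓝 (ω (S.B (S.dom.P t f) (S.dom.P t f)))) := by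
  have hsub : Tendsto (fun b : ℝ => t - b) (𝓝[<] t) (𝓝[>] 0) := by
    refine tendsto_nhdsWithin_iff.2 ⟨?_, ?_⟩
    · exact ((continuous_const.sub continuous_id).tendsto' t (0 : ℝ) (by simp)).mono_left
        nhdsWithin_le_nhds
    · filter_upwards [self_mem_nhdsWithin] with b hb using sub_pos.2 (mem_Iio.1 hb)
  have h1 := (S.tendsto_P ω hω (S.dom.P t f)).comp hsub
  have hB : Tendsto (fun b => S.B (S.dom.P b f) (S.dom.P b f) - S.B (S.dom.P t f) (S.dom.P t f))
      (𝓝[<] t) (𝓝 0) := by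
    have hc : ContinuousAt (fun b => S.B (S.dom.P b f) (S.dom.P b f)) t :=
      (hasDerivAt_form (S.dom.hasDerivAt_P_apply ht f) (S.dom.hasDerivAt_P_apply ht f)).continuousAt
    simpa using (hc.tendsto.mono_left nhdsWithin_le_nhds).sub_const
      (S.B (S.dom.P t f) (S.dom.P t f))
  have h2 : Tendsto (fun b => ω (S.val.P (t - b) (S.B (S.dom.P b f) (S.dom.P b f) -
      S.B (S.dom.P t f) (S.dom.P t f)))) (𝓝[<] t) (𝓝 0) := by
    have hlim := (hB.norm.const_mul ‖ω‖)
    rw [norm_zero, mul_zero] at hlim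
    refine squeeze_zero_norm' ?_ hlim
    filter_upwards [self_mem_nhdsWithin] with b hb
    refine (ω.le_opNorm _).trans ?_
    gcongr
    exact S.val.P_apply_norm_le (sub_pos.2 hb) _
  have h3 := h1.add h2
  rw [add_zero] at h3
  refine h3.congr fun b => ?_
  simp only [Function.comp, map_sub]
  ring

/-- Integration along the characteristic v ↦ (t − 2a + v, v) from v = a to infinity, where the slope
vanishes. -/
lemma waveSlope_integral (hω : ω ∈ S.Ω) (f : V) {t a : ℝ} (ha : a ∈ Ioo 0 t) :
    ∫⁻ v in Ioi a, 2 * S.kernel ω f (t + v - 2 * a) v =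
      ENNReal.ofReal (-ω (S.waveSlope f (t - a) a)) := by
  have hpos : ∀ v ∈ Ici a, 0 < v ∧ 0 < (t - 2 * a) + v := fun v hv =>
    ⟨ha.1.trans_le hv, by linarith [ha.2, mem_Ici.1 hv]⟩
  have h := lintegral_Ioi_of_hasDerivAt (f := fun v => ω (S.waveSlope f ((t - 2 * a) + v) v))
    (f' := fun v => ω ((2 : ℝ) • S.gradHat f ((t - 2 * a) + v) v)) (a := a) (l := 0)
    (fun v hv => ω.hasFDerivAt.comp_hasDerivAt v
      (hasDerivAt_waveSlope f (hpos v hv).1 (hpos v hv).2))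
    (fun v hv => by
      have := map_gradHat_nonneg hω f (hpos v (Ioi_subset_Ici_self hv)).2
        (hpos v (Ioi_subset_Ici_self hv)).1
      simpa using this)
    ((ω.continuous.tendsto' _ _ (map_zero ω)).comp (tendsto_waveSlope f (t - 2 * a)))
  rw [zero_sub, show t - 2 * a + a = t - a by ring] at h
  rw [← h]
  refine setLIntegral_congr_fun measurableSet_Ioi fun v hv => ?_
  have hp := hpos v (Ioi_subset_Ici_self hv)
  rw [show t + v - 2 * a = t - 2 * a + v by ring, kernel_eq f hp.2 hp.1, map_smul, smul_eq_mul,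
    ENNReal.ofReal_mul (by norm_num)]
  simp

/-- The variance `P_t |f|² - |P_t f|²` solves the wave equation. -/
lemma ofReal_variance (hω : ω ∈ S.Ω) (f : V) {t : ℝ} (ht : 0 < t) :
    ENNReal.ofReal (ω (S.variance t f)) = waveIntegral (S.kernel ω f) t := by
  -- Along each characteristic the slope increases to its limit 0, hence is nonpositive. The sign is
  -- needed for an equality of integrals with values in [0, ∞].
  have hslope : ∀ a ∈ Ioo 0 t, 0 ≤ -ω (S.waveSlope f (t - a) a) := fun a ha => by
    have hpos : ∀ v ∈ Ici a, 0 < v ∧ 0 < (t - 2 * a) + v := fun v hv =>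
      ⟨ha.1.trans_le hv, by linarith [ha.2, mem_Ici.1 hv]⟩
    have hmono : MonotoneOn (fun v => ω (S.waveSlope f ((t - 2 * a) + v) v)) (Ici a) := by
      have hd : ∀ v ∈ Ici a, HasDerivAt (fun v => ω (S.waveSlope f ((t - 2 * a) + v) v))
          (ω ((2 : ℝ) • S.gradHat f ((t - 2 * a) + v) v)) v := fun v hv =>
        ω.hasFDerivAt.comp_hasDerivAt v (hasDerivAt_waveSlope f (hpos v hv).1 (hpos v hv).2)
      refine monotoneOn_of_deriv_nonneg (convex_Ici a)
        (fun v hv => (hd v hv).continuousAt.continuousWithinAt)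
        (fun v hv => (hd v (interior_subset hv)).differentiableAt.differentiableWithinAt)
        fun v hv => ?_
      rw [(hd v (interior_subset hv)).deriv, map_smul]
      have hp := hpos v (interior_subset hv)
      exact smul_nonneg zero_le_two (map_gradHat_nonneg hω f hp.2 hp.1)
    have hl : Tendsto (fun v => ω (S.waveSlope f ((t - 2 * a) + v) v)) atTop (𝓝 0) :=
      (ω.continuous.tendsto' _ _ (map_zero ω)).comp (tendsto_waveSlope f (t - 2 * a))
    have : ω (S.waveSlope f ((t - 2 * a) + a) a) ≤ 0 := by
      refine ge_of_tendsto hl ?_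
      filter_upwards [eventually_ge_atTop a] with v hv using hmono self_mem_Ici hv hv
    rw [show t - 2 * a + a = t - a by ring] at this
    linarith
  have h := lintegral_Ioo_of_hasDerivAt
    (f := fun b => -ω (S.val.P (t - b) (S.B (S.dom.P b f) (S.dom.P b f))))
    (f' := fun a => -ω (S.waveSlope f (t - a) a)) ht
    (fun a ha => (ω.hasFDerivAt.comp_hasDerivAt a (hasDerivAt_square f ha)).neg) hslope
    (tendsto_square_zero hω f ht).neg (tendsto_square_end hω f ht).neg
  rw [waveIntegral, setLIntegral_congr_fun measurableSet_Ioo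
    (fun a ha => waveSlope_integral hω f ha), h, variance, map_sub]
  congr 1; ring

end GradientSystem
end SemigroupBMO

/-! ### Comparison of the three seminorms of a gradient system -/

namespace SemigroupBMO
namespace GradientSystem

variable {V X : Type*} [NormedAddCommGroup V] [NormedSpace ℝ V]
  [NormedAddCommGroup X] [NormedSpace ℝ X] (S : GradientSystem V X)

/-- The square of the `bmo` seminorm. -/
def bmoSq (f : V) : ℝ≥0∞ :=
  ⨆ (t : ℝ) (_ : 0 < t), ⨆ ω ∈ S.Ω, ENNReal.ofReal (ω (S.variance t f))

/-- The square of the `BMO` seminorm. -/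
def BMOSq (f : V) : ℝ≥0∞ :=
  ⨆ (t : ℝ) (_ : 0 < t), ⨆ ω ∈ S.Ω,
    ENNReal.ofReal (ω (S.val.P t (S.B (f - S.dom.P t f) (f - S.dom.P t f))))

/-- The square of the `BMO(Γ̂)` seminorm. -/
def areaSq (f : V) : ℝ≥0∞ :=
  ⨆ (t : ℝ) (_ : 0 < t), ⨆ ω ∈ S.Ω,
    ∫⁻ v in Ioo 0 t, ENNReal.ofReal (ω (S.gradHat f t v) * v)

/-- The bilinear form of the variance. -/
def varianceForm (ω : X →L[ℝ] ℝ) (t : ℝ) : V →ₗ[ℝ] V →ₗ[ℝ] ℝ :=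
  LinearMap.mk₂ ℝ (fun f g => ω (S.val.P t (S.B f g) - S.B (S.dom.P t f) (S.dom.P t g)))
    (fun f f' g => by simp only [map_add, add_apply, map_sub]; ring)
    (fun c f g => by simp only [map_smul, smul_apply, map_sub, smul_eq_mul]; ring)
    (fun f g g' => by simp only [map_add, map_sub]; ring)
    (fun c f g => by simp only [map_smul, map_sub, smul_eq_mul]; ring)

lemma varianceForm_self (ω : X →L[ℝ] ℝ) (t : ℝ) (f : V) :
    S.varianceForm ω t f f = ω (S.variance t f) := rfl

variable {S} {ω : X →L[ℝ] ℝ}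

lemma variance_nonneg (hω : ω ∈ S.Ω) {t : ℝ} (ht : 0 < t) (f : V) : 0 ≤ ω (S.variance t f) :=
  S.nonneg ω hω _ (S.schwarz_P t f ht)

lemma variance_le (hω : ω ∈ S.Ω) (t : ℝ) (f : V) :
    ω (S.variance t f) ≤ ω (S.val.P t (S.B f f)) := by
  have := S.nonneg ω hω _ (S.pos_B (S.dom.P t f))
  rw [variance, map_sub]
  linarith

lemma variance_sub_le (hω : ω ∈ S.Ω) {t : ℝ} (ht : 0 < t) (f g : V) :
    ω (S.variance t (f - g)) ≤ 2 * ω (S.variance t f) + 2 * ω (S.variance t g) := by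
  have h := variance_nonneg hω ht (f + g)
  simp only [← varianceForm_self, map_add, map_sub, LinearMap.add_apply,
    LinearMap.sub_apply] at h ⊢
  linarith

lemma sqrt_variance_add_le (hω : ω ∈ S.Ω) {t : ℝ} (ht : 0 < t) (f g : V) :
    √(ω (S.variance t (f + g))) ≤ √(ω (S.variance t f)) + √(ω (S.variance t g)) :=
  sqrt_form_add_le (S.varianceForm ω t) (fun f => variance_nonneg hω ht f) f g

/-- The subtracted terms agree, and P_t|P_t f|² ≤ P_t P_t|f|² = P_{2t}|f|². -/
lemma variance_P_le (hω : ω ∈ S.Ω) {t : ℝ} (ht : 0 < t) (f : V) :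
    ω (S.variance t (S.dom.P t f)) ≤ ω (S.variance (2 * t) f) := by
  have h := S.nonneg ω hω _ (S.pos_P t _ ht (S.schwarz_P t f ht))
  rw [variance, variance, two_mul, S.dom.P_add_apply ht ht, S.val.P_add_apply ht ht]
  simp only [map_sub] at h ⊢
  linarith

/-- Add the Schwarz inequalities for 2P_t − P_{2t} and for P_{2t}. The terms P_{2t}|f|² cancel, and
half of the sum is the claim. -/
lemma form_P_sub_le (hω : ω ∈ S.Ω) {t : ℝ} (ht : 0 < t) (f : V) :
    ω (S.B (S.dom.P t f - S.dom.P (2 * t) f) (S.dom.P t f - S.dom.P (2 * t) f)) ≤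
      ω (S.variance t f) := by
  have h1 := S.nonneg ω hω _ (S.schwarz_R t f ht)
  have h2 := S.nonneg ω hω _ (S.schwarz_P (2 * t) f (by positivity))
  rw [variance]
  simp only [map_sub, map_smul, sub_apply, smul_apply, smul_eq_mul] at h1 h2 ⊢
  linarith

lemma areaIntegral_kernel (f : V) (t : ℝ) (hω : ω ∈ S.Ω) :
    areaIntegral (S.kernel ω f) t = ∫⁻ v in Ioo 0 t, ENNReal.ofReal (ω (S.gradHat f t v) * v) := by
  refine setLIntegral_congr_fun measurableSet_Ioo fun v hv => ?_
  have ht := hv.1.trans hv.2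
  rw [kernel_eq f ht hv.1, ENNReal.ofReal_mul (map_gradHat_nonneg hω f ht hv.1)]

lemma areaSq_le_bmoSq (f : V) : S.areaSq f ≤ 4 * S.bmoSq f := by
  refine iSup₂_le fun t ht => iSup₂_le fun ω hω => ?_
  rw [← areaIntegral_kernel f t hω]
  refine ((isQuasiMonotone_kernel hω f).areaIntegral_le t ht).trans ?_
  rw [← ofReal_variance hω f ht]
  exact mul_le_mul_right ((le_iSup₂_of_le ω hω le_rfl).trans
    (le_iSup₂ (f := fun (t : ℝ) (_ : 0 < t) => ⨆ ω ∈ S.Ω, ENNReal.ofReal (ω (S.variance t f)))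
      t ht)) _

lemma bmoSq_le_areaSq (f : V) : S.bmoSq f ≤ 1000 * S.areaSq f := by
  refine iSup₂_le fun t ht => iSup₂_le fun ω hω => ?_
  rw [ofReal_variance hω f ht]
  refine (isQuasiMonotone_kernel hω f).waveIntegral_le (fun s hs => ?_) t ht
  rw [areaIntegral_kernel f s hω]
  exact (le_iSup₂_of_le ω hω le_rfl).trans (le_iSup₂ (f := fun (t : ℝ) (_ : 0 < t) => ⨆ ω ∈ S.Ω,
    ∫⁻ v in Ioo 0 t, ENNReal.ofReal (ω (S.gradHat f t v) * v)) s hs)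

/-- By definition of the variance, P_t|f−P_t f|² = var_t(f−P_t f) + |P_t f−P_{2t}f|². The first term
is at most 2 var_t(f) + 2 var_{2t}(f) and the second at most var_t(f), whence 5 = 3 + 2. -/
lemma BMOSq_le_bmoSq (f : V) : S.BMOSq f ≤ 5 * S.bmoSq f := by
  refine iSup₂_le fun t ht => iSup₂_le fun ω hω => ?_
  have hM : ∀ s, 0 < s → ENNReal.ofReal (ω (S.variance s f)) ≤ S.bmoSq f := fun s hs =>
    (le_iSup₂_of_le ω hω le_rfl).trans
      (le_iSup₂ (f := fun (t : ℝ) (_ : 0 < t) => ⨆ ω ∈ S.Ω, ENNReal.ofReal (ω (S.variance t f)))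
      s hs)
  have h0 : ω (S.val.P t (S.B (f - S.dom.P t f) (f - S.dom.P t f))) ≤
      3 * ω (S.variance t f) + 2 * ω (S.variance (2 * t) f) := by
    have h1 := variance_sub_le hω ht f (S.dom.P t f)
    have h2 := variance_P_le hω ht f
    have h3 := form_P_sub_le hω ht f
    have h4 : ω (S.val.P t (S.B (f - S.dom.P t f) (f - S.dom.P t f))) =
        ω (S.variance t (f - S.dom.P t f)) +
          ω (S.B (S.dom.P t f - S.dom.P (2 * t) f) (S.dom.P t f - S.dom.P (2 * t) f)) := by
      rw [variance, map_sub (S.dom.P t), ← S.dom.P_add_apply ht ht, ← two_mul, map_sub ω]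
      ring
    linarith
  calc _ ≤ ENNReal.ofReal (3 * ω (S.variance t f) + 2 * ω (S.variance (2 * t) f)) :=
        ENNReal.ofReal_le_ofReal h0
    _ ≤ 3 * ENNReal.ofReal (ω (S.variance t f)) + 2 * ENNReal.ofReal (ω (S.variance (2 * t) f)) := by
        refine ENNReal.ofReal_add_le.trans ?_
        rw [ENNReal.ofReal_mul (by norm_num), ENNReal.ofReal_mul (by norm_num)]
        simp
    _ ≤ 3 * S.bmoSq f + 2 * S.bmoSq f := by
        gcongr
        · exact hM t ht
        · exact hM _ (by positivity)
    _ = 5 * S.bmoSq f := by ring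

/-- The kernel of P_{2T}h is that of h translated by 2T in v, so the wave formula turns
`waveIntegral_shift_le'` into a statement about variances. -/
lemma variance_P_decay (hω : ω ∈ S.Ω) {t T : ℝ} (ht : 0 < t) (htT : t ≤ T) (h : V) :
    ω (S.variance t (S.dom.P (2 * T) h)) ≤ 48 * (t / T) * ω (S.variance T h) := by
  have hT : 0 < T := ht.trans_le htT
  have h1 : waveIntegral (S.kernel ω (S.dom.P (2 * T) h)) t =
      waveIntegral (fun s v => S.kernel ω h s (v + 2 * T)) t := by
    refine setLIntegral_congr_fun measurableSet_Ioo fun a ha => ?_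
    refine setLIntegral_congr_fun measurableSet_Ioi fun v hv => ?_
    have hv' : a < v := hv
    simp only
    rw [kernel_P h (by linarith [ha.2]) (ha.1.trans hv') (by positivity)]
  have h2 := (isQuasiMonotone_kernel hω h).waveIntegral_shift_le' ht (by linarith : t ≤ 2 * T)
  rw [← h1, ← ofReal_variance hω _ ht, show 2 * T / 2 = T by ring, ← ofReal_variance hω _ hT,
    ← ENNReal.ofReal_mul (by positivity), ENNReal.ofReal_le_ofReal_iff
      (mul_nonneg (by positivity) (variance_nonneg hω hT h))] at h2
  refine h2.trans_eq ?_
  congr 1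
  field_simp
  norm_num

/-- Decompose f = (f−P_t f) + P_t(f−P_t f) + P_{2t}f and use the seminorm √var_t. With m the BMO
seminorm, the pieces cost m, 2m and 42m, and 45² = 2025. -/
lemma bmoSq_le_BMOSq (f : V) : S.bmoSq f ≤ 2025 * S.BMOSq f := by
  rcases eq_or_ne (S.BMOSq f) ∞ with htop | htop
  · rw [htop, ENNReal.mul_top (by norm_num)]; exact le_top
  refine iSup₂_le fun t ht => iSup₂_le fun ω hω => ?_
  obtain ⟨m, hm0, hm⟩ : ∃ m : ℝ, 0 ≤ m ∧ ENNReal.ofReal (m ^ 2) = S.BMOSq f :=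
    ⟨√(S.BMOSq f).toReal, Real.sqrt_nonneg _, by
      rw [Real.sq_sqrt ENNReal.toReal_nonneg, ENNReal.ofReal_toReal htop]⟩
  have hM : ∀ s, 0 < s → ω (S.val.P s (S.B (f - S.dom.P s f) (f - S.dom.P s f))) ≤ m ^ 2 :=
    fun s hs => by
      rw [← ENNReal.ofReal_le_ofReal_iff (by positivity), hm]
      exact (le_iSup₂_of_le ω hω le_rfl).trans (le_iSup₂ (f := fun (t : ℝ) (_ : 0 < t) =>
        ⨆ ω ∈ S.Ω, ENNReal.ofReal (ω (S.val.P t (S.B (f - S.dom.P t f) (f - S.dom.P t f))))) s hs)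
  set p : V → ℝ := fun h => √(ω (S.variance t h)) with hp
  -- The ratio 3/2 makes 2T_k + T_k = 2T_{k+1}, so that P_{2T_k}f = P_{2T_k}(f − P_{T_k}f) +
  -- P_{2T_{k+1}}f telescopes.
  set T : ℕ → ℝ := fun k => (3 / 2) ^ k * t with hT
  have hT0 : ∀ k, 0 < T k := fun k => by positivity
  have hTt : ∀ k, t ≤ T k := fun k => le_mul_of_one_le_left ht.le (one_le_pow₀ (by norm_num))
  have hTk : ∀ k, t / T k = (2 / 3) ^ k := fun k => by
    rw [hT]; simp only
    rw [div_mul_cancel_right₀ ht.ne', ← inv_pow]; norm_num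
  have hstep : ∀ k, p (S.dom.P (2 * T k) f) ≤
      7 * (5 / 6) ^ k * m + p (S.dom.P (2 * T (k + 1)) f) := fun k => by
    have e : S.dom.P (2 * T k) f = S.dom.P (2 * T k) (f - S.dom.P (T k) f) +
        S.dom.P (2 * T (k + 1)) f := by
      rw [map_sub, ← S.dom.P_add_apply (by have := hT0 k; positivity) (hT0 k),
        show 2 * T k + T k = 2 * T (k + 1) by simp only [hT, pow_succ]; ring]
      abel
    have h1 := sqrt_variance_add_le hω ht (S.dom.P (2 * T k) (f - S.dom.P (T k) f))
      (S.dom.P (2 * T (k + 1)) f)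
    rw [← e] at h1
    refine h1.trans (add_le_add ?_ le_rfl)
    refine Real.sqrt_le_iff.2 ⟨by positivity, ?_⟩
    refine (variance_P_decay hω ht (hTt k) _).trans ?_
    rw [hTk]
    calc 48 * (2 / 3) ^ k * ω (S.variance (T k) (f - S.dom.P (T k) f)) ≤
          48 * (2 / 3) ^ k * m ^ 2 := by
          gcongr
          exact (variance_le hω _ _).trans (hM _ (hT0 k))
      -- Rounding 48 and 2/3 up to the squares 7² and (5/6)² gives a rational square root.
      _ ≤ 49 * (25 / 36) ^ k * m ^ 2 := by
          have : (2 / 3 : ℝ) ^ k ≤ (25 / 36) ^ k := pow_le_pow_left₀ (by norm_num) (by norm_num) k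
          gcongr
          norm_num
      _ = (7 * (5 / 6) ^ k * m) ^ 2 := by
          rw [mul_pow, mul_pow, ← pow_mul, mul_comm k 2, pow_mul]; norm_num
  -- Partial sums of 7 ∑ (5/6)^k, whose total is 42.
  have hsum : ∀ n, p (S.dom.P (2 * t) f) ≤
      42 * (1 - (5 / 6) ^ n) * m + p (S.dom.P (2 * T n) f) := fun n => by
    induction n with
    | zero => simp [hT]
    | succ n ih =>
      refine ih.trans ?_
      have := hstep n
      rw [pow_succ]
      nlinarith
  -- The remainder of the telescoping is bounded crudely by the norm of f. It tends to zero by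
  -- `variance_P_decay`, so the norm of f does not enter the final constant.
  have hdecay : Tendsto (fun n => √(48 * (2 / 3) ^ n * (‖ω‖ * (‖S.B‖ * ‖f‖ * ‖f‖)))) atTop (𝓝 0) := by
    have : Tendsto (fun n : ℕ => 48 * (2 / 3 : ℝ) ^ n * (‖ω‖ * (‖S.B‖ * ‖f‖ * ‖f‖))) atTop (𝓝 0) := by
      simpa using ((tendsto_pow_atTop_nhds_zero_of_lt_one (r := (2 / 3 : ℝ)) (by norm_num)
        (by norm_num)).const_mul 48).mul_const (‖ω‖ * (‖S.B‖ * ‖f‖ * ‖f‖))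
    simpa using this.sqrt
  have htail : p (S.dom.P (2 * t) f) ≤ 42 * m := by
    refine ge_of_tendsto' (a := 42 * m + 0) (b := p (S.dom.P (2 * t) f)) (f := fun n => 42 * m +
      √(48 * (2 / 3) ^ n * (‖ω‖ * (‖S.B‖ * ‖f‖ * ‖f‖)))) (x := atTop)
      (hdecay.const_add (42 * m)) (fun n => (hsum n).trans ?_) |>.trans_eq (add_zero _)
    refine add_le_add ?_ (Real.sqrt_le_sqrt ?_)
    · have : (0 : ℝ) ≤ (5 / 6) ^ n * m := by positivity
      linarith
    · refine (variance_P_decay hω ht (hTt n) _).trans ?_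
      rw [hTk]
      gcongr
      refine (variance_le hω _ _).trans ((le_abs_self _).trans ((ω.le_opNorm _).trans ?_))
      gcongr
      exact (S.val.P_apply_norm_le (hT0 n) _).trans (norm_form_le _ _)
  have h1 : p (f - S.dom.P t f) ≤ m :=
    Real.sqrt_le_iff.2 ⟨hm0, (variance_le hω _ _).trans (hM t ht)⟩
  -- With g = f − P_t f, one has P_t|P_t g|² ≤ P_{2t}|g|² ≤ 2P_t|g|² ≤ 2m².
  have h2 : p (S.dom.P t (f - S.dom.P t f)) ≤ 2 * m := by
    refine Real.sqrt_le_iff.2 ⟨by positivity, ?_⟩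
    have e1 := S.nonneg ω hω _ (S.pos_P t _ ht (S.schwarz_P t (f - S.dom.P t f) ht))
    have e2 := S.nonneg ω hω _ (S.quasi_mono t (2 * t) _ ht (by linarith)
      (S.pos_B (f - S.dom.P t f)))
    have e3 := hM t ht
    have e4 := variance_le hω t (S.dom.P t (f - S.dom.P t f))
    rw [two_mul, S.val.P_add_apply ht ht, ← two_mul, mul_div_assoc, div_self ht.ne', mul_one] at e2
    rw [map_sub (S.val.P t), map_sub ω] at e1
    rw [map_sub ω, map_smul, smul_eq_mul] at e2
    nlinarith
  have h3 : p f ≤ 45 * m := by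
    have e : f = (f - S.dom.P t f) + (S.dom.P t (f - S.dom.P t f) + S.dom.P (2 * t) f) := by
      rw [map_sub, ← S.dom.P_add_apply ht ht, ← two_mul]; abel
    have e1 := sqrt_variance_add_le hω ht (f - S.dom.P t f)
      (S.dom.P t (f - S.dom.P t f) + S.dom.P (2 * t) f)
    have e2 := sqrt_variance_add_le hω ht (S.dom.P t (f - S.dom.P t f)) (S.dom.P (2 * t) f)
    rw [← e] at e1
    linarith
  rw [← hm, show (2025 : ℝ≥0∞) = ENNReal.ofReal 2025 by simp, ← ENNReal.ofReal_mul (by norm_num)]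
  refine ENNReal.ofReal_le_ofReal ((Real.sqrt_le_iff.1 h3).2.trans_eq (by ring))

end GradientSystem
end SemigroupBMO

namespace SemigroupBMO

/-! ### The subordination density -/

/-- The primitive of the Gaussian `exp (-w² / 4)`. -/
def gaussPrim (y : ℝ) : ℝ := ∫ w in (0 : ℝ)..y, Real.exp (-w ^ 2 / 4)

lemma hasDerivAt_gaussPrim (y : ℝ) : HasDerivAt gaussPrim (Real.exp (-y ^ 2 / 4)) y :=
  ((by fun_prop : Continuous fun w : ℝ => Real.exp (-w ^ 2 / 4)).integral_hasStrictDerivAt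
    0 y).hasDerivAt

lemma gaussPrim_neg (y : ℝ) : gaussPrim (-y) = -gaussPrim y := by
  have h := intervalIntegral.integral_comp_neg (a := 0) (b := y)
    (fun w : ℝ => Real.exp (-w ^ 2 / 4))
  rw [gaussPrim, intervalIntegral.integral_symm, gaussPrim]
  simp only [neg_sq, neg_zero] at h
  rw [← h]

lemma tendsto_gaussPrim_atTop : Tendsto gaussPrim atTop (𝓝 (√Real.pi)) := by
  have hi : Integrable fun w : ℝ => Real.exp (-(1 / 4) * w ^ 2) := integrable_exp_neg_mul_sq (by norm_num)
  have h := intervalIntegral_tendsto_integral_Ioi 0 hi.integrableOn tendsto_id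
  rw [integral_gaussian_Ioi, show √(Real.pi / (1 / 4)) / 2 = √Real.pi by
    rw [div_div_eq_mul_div, div_one, Real.sqrt_mul Real.pi_pos.le,
      show (4 : ℝ) = 2 ^ 2 by norm_num, Real.sqrt_sq (by norm_num)]; ring] at h
  refine h.congr fun y => ?_
  simp only [gaussPrim, id]
  congr 1; ext w; congr 1; ring

lemma tendsto_gaussPrim_atBot : Tendsto gaussPrim atBot (𝓝 (-√Real.pi)) := by
  have := (tendsto_gaussPrim_atTop.comp tendsto_neg_atBot_atTop).neg
  refine this.congr fun y => ?_
  simp [gaussPrim_neg]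

lemma lintegral_Ioi_of_hasDerivAt_of_tendsto {f f' : ℝ → ℝ} {a la l : ℝ}
    (hd : ∀ x ∈ Ioi a, HasDerivAt f (f' x) x) (hn : ∀ x ∈ Ioi a, 0 ≤ f' x)
    (ha : Tendsto f (𝓝[>] a) (𝓝 la)) (hl : Tendsto f atTop (𝓝 l)) :
    ∫⁻ x in Ioi a, ENNReal.ofReal (f' x) = ENNReal.ofReal (l - la) := by
  have hd' : ∀ x ∈ Ioi a, HasDerivAt (Function.update f a la) (f' x) x := fun x hx => by
    refine (hd x hx).congr_of_eventuallyEq ?_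
    filter_upwards [isOpen_Ioi.mem_nhds hx] with y hy
    exact Function.update_of_ne (ne_of_gt hy) _ _
  have hc : ContinuousWithinAt (Function.update f a la) (Ici a) a :=
    continuousWithinAt_update_same.2 (by
      rwa [show Ici a \ {a} = Ioi a by ext y; simp [lt_iff_le_and_ne]])
  have hl' : Tendsto (Function.update f a la) atTop (𝓝 l) := by
    refine hl.congr' ?_
    filter_upwards [eventually_gt_atTop a] with y hy
    exact (Function.update_of_ne (ne_of_gt hy) _ _).symm
  have h := integral_Ioi_of_hasDerivAt_of_nonneg hc hd' hn hl'
  rw [Function.update_self] at h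
  rw [← h, ofReal_integral_eq_lintegral_ofReal (integrableOn_Ioi_deriv_of_nonneg hc hd' hn hl')]
  exact (ae_restrict_iff' measurableSet_Ioi).2 (ae_of_all _ hn)

namespace StandardSemigroup

lemma rpow_neg_three_halves {u : ℝ} (hu : 0 < u) : u ^ (-(3 / 2) : ℝ) = (u * √u)⁻¹ := by
  rw [Real.rpow_neg hu.le, Real.sqrt_eq_rpow, show (3 / 2 : ℝ) = 1 + 1 / 2 by norm_num,
    Real.rpow_add hu, Real.rpow_one]

lemma subDensity_eq (t : ℝ) {u : ℝ} (hu : 0 < u) :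
    subDensity t u = t / (2 * √Real.pi) * Real.exp (-t ^ 2 / (4 * u)) * (u * √u)⁻¹ := by
  rw [subDensity, rpow_neg_three_halves hu]

lemma subDensity_nonneg {t : ℝ} (ht : 0 ≤ t) {u : ℝ} (hu : 0 < u) : 0 ≤ subDensity t u := by
  rw [subDensity_eq t hu]; positivity

lemma measurable_subDensity : Measurable (Function.uncurry subDensity) := by
  have : Measurable fun p : ℝ × ℝ => p.1 / (2 * √Real.pi) *
      Real.exp (-p.1 ^ 2 / (4 * p.2)) * p.2 ^ (-(3 / 2) : ℝ) := by fun_prop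
  exact this

lemma measurable_subDensity_right (t : ℝ) : Measurable (subDensity t) :=
  measurable_subDensity.comp (measurable_const.prodMk measurable_id)

/-- In the variable t/√u the density is a Gaussian: its primitive in u is −π^{−1/2} `gaussPrim`
(t/√u), which runs from −1 at u = 0 to 0 at infinity. -/
lemma lintegral_subDensity {t : ℝ} (ht : 0 < t) :
    ∫⁻ u in Ioi 0, ENNReal.ofReal (subDensity t u) = 1 := by
  have hpi : 0 < √Real.pi := Real.sqrt_pos.2 Real.pi_pos
  have h := lintegral_Ioi_of_hasDerivAt_of_tendsto (a := 0)
    (f := fun u => -(√Real.pi)⁻¹ * gaussPrim (t * (√u)⁻¹)) (f' := subDensity t)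
    (la := -(√Real.pi)⁻¹ * √Real.pi) (l := -(√Real.pi)⁻¹ * gaussPrim (t * 0))
    (fun u hu => by
      have hu' : 0 < u := hu
      have hs : 0 < √u := Real.sqrt_pos.2 hu'
      have h1 : HasDerivAt (fun u => t * (√u)⁻¹) (t * (-(1 / (2 * √u)) / √u ^ 2)) u :=
        ((Real.hasDerivAt_sqrt hu'.ne').inv hs.ne').const_mul t
      refine (((hasDerivAt_gaussPrim (t * (√u)⁻¹)).comp u h1).const_mul
        (-(√Real.pi)⁻¹)).congr_deriv ?_
      rw [subDensity_eq t hu', mul_pow, inv_pow, Real.sq_sqrt hu'.le]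
      have e : -(t ^ 2 * u⁻¹) / 4 = -t ^ 2 / (4 * u) := by field_simp
      rw [e]
      field_simp)
    (fun u hu => subDensity_nonneg ht.le hu)
    (by
      refine Tendsto.const_mul _ (tendsto_gaussPrim_atTop.comp ?_)
      refine Tendsto.const_mul_atTop ht ?_
      refine tendsto_inv_nhdsGT_zero.comp (tendsto_nhdsWithin_iff.2 ⟨?_, ?_⟩)
      · exact (Real.continuous_sqrt.tendsto' 0 0 (by simp)).mono_left nhdsWithin_le_nhds
      · filter_upwards [self_mem_nhdsWithin] with u hu using Real.sqrt_pos.2 hu)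
    (by
      refine Tendsto.const_mul _ ((hasDerivAt_gaussPrim _).continuousAt.tendsto.comp ?_)
      exact Tendsto.const_mul _ (tendsto_inv_atTop_zero.comp Real.tendsto_sqrt_atTop))
  rw [h]
  have h0 : gaussPrim (t * 0) = 0 := by simp [gaussPrim]
  rw [h0]
  rw [mul_zero, neg_mul, inv_mul_cancel₀ hpi.ne']
  simp

lemma integrableOn_subDensity {t : ℝ} (ht : 0 < t) : IntegrableOn (subDensity t) (Ioi 0) := by
  refine ⟨(measurable_subDensity_right t).aestronglyMeasurable, ?_⟩
  rw [hasFiniteIntegral_iff_ofReal, lintegral_subDensity ht]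
  · simp
  · exact (ae_restrict_iff' measurableSet_Ioi).2 (ae_of_all _ fun u hu => subDensity_nonneg ht.le hu)

lemma integral_subDensity {t : ℝ} (ht : 0 < t) : ∫ u in Ioi 0, subDensity t u = 1 := by
  rw [integral_eq_lintegral_of_nonneg_ae, lintegral_subDensity ht]
  · simp
  · exact (ae_restrict_iff' measurableSet_Ioi).2 (ae_of_all _ fun u hu => subDensity_nonneg ht.le hu)
  · exact (measurable_subDensity_right t).aestronglyMeasurable

/-- The exponential decreases in t, so only the prefactor t grows. This yields P_t ≤ (t/s)P_s on
positive elements. -/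
lemma subDensity_le {s t u : ℝ} (hs : 0 < s) (hst : s ≤ t) (hu : 0 < u) :
    subDensity t u ≤ t / s * subDensity s u := by
  rw [subDensity_eq t hu, subDensity_eq s hu]
  have h1 : Real.exp (-t ^ 2 / (4 * u)) ≤ Real.exp (-s ^ 2 / (4 * u)) := by
    gcongr
  have h2 : t / s * (s / (2 * √Real.pi) * Real.exp (-s ^ 2 / (4 * u)) * (u * √u)⁻¹) =
      t / (2 * √Real.pi) * Real.exp (-s ^ 2 / (4 * u)) * (u * √u)⁻¹ := by
    field_simp
  rw [h2]
  have : 0 < t := hs.trans_le hst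
  gcongr

/-- The densities `subDensity t` form a convolution semigroup. -/
lemma lintegral_subDensity_mul {s t u : ℝ} (hs : 0 < s) (ht : 0 < t) (hu : 0 < u) :
    ∫⁻ v in Ioo 0 u, ENNReal.ofReal (subDensity s v * subDensity t (u - v)) =
      ENNReal.ofReal (subDensity (s + t) u) := by
  have hpi : 0 < √Real.pi := Real.sqrt_pos.2 Real.pi_pos
  have hr : 0 < √u := Real.sqrt_pos.2 hu
  -- With A = √(1/v − 1/u), completing the square gives s²/v + t²/(u−v) = (s+t)²/u + (sA − t/(uA))².
  -- The same holds for sA + t/(uA) up to the constant 4st/u.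
  set A : ℝ → ℝ := fun v => √(v⁻¹ - u⁻¹) with hA
  set c : ℝ := s * t / (2 * Real.pi) * (u * √u)⁻¹ * Real.exp (-(s + t) ^ 2 / (4 * u)) with hc
  set α : ℝ := (s⁻¹ + t⁻¹) / 2 with hα
  set β : ℝ := (s⁻¹ - t⁻¹) / 2 with hβ
  have hAcont : ∀ v₀ ≠ 0, ContinuousAt A v₀ := fun v₀ h =>
    Real.continuous_sqrt.continuousAt.comp ((continuousAt_inv₀ h).sub continuousAt_const)
  have hA0 : ∀ v ∈ Ioo 0 u, 0 < v⁻¹ - u⁻¹ := fun v hv =>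
    sub_pos.2 ((inv_lt_inv₀ hu hv.1).2 hv.2)
  have hApos : ∀ v ∈ Ioo 0 u, 0 < A v := fun v hv => Real.sqrt_pos.2 (hA0 v hv)
  have hAzero : Tendsto A (𝓝[>] 0) atTop := by
    refine Real.tendsto_sqrt_atTop.comp ?_
    exact tendsto_atTop_add_const_right _ (-u⁻¹) tendsto_inv_nhdsGT_zero
  have hAu : Tendsto A (𝓝[<] u) (𝓝[>] 0) := by
    refine tendsto_nhdsWithin_iff.2 ⟨?_, ?_⟩
    · have := (hAcont u hu.ne').tendsto
      simp only [hA, sub_self, Real.sqrt_zero] at this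
      exact this.mono_left nhdsWithin_le_nhds
    · filter_upwards [Ioo_mem_nhdsLT hu] with v hv using hApos v hv
  have hy0 : Tendsto (fun v => s * A v - t * (u * A v)⁻¹) (𝓝[>] 0) atTop := by
    have h1 : Tendsto (fun v => t * (u * A v)⁻¹) (𝓝[>] 0) (𝓝 (t * 0)) :=
      (tendsto_inv_atTop_zero.comp (hAzero.const_mul_atTop hu)).const_mul t
    exact (hAzero.const_mul_atTop hs).atTop_add h1.neg
  have hz0 : Tendsto (fun v => s * A v + t * (u * A v)⁻¹) (𝓝[>] 0) atTop := by
    have h1 : Tendsto (fun v => t * (u * A v)⁻¹) (𝓝[>] 0) (𝓝 (t * 0)) :=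
      (tendsto_inv_atTop_zero.comp (hAzero.const_mul_atTop hu)).const_mul t
    exact (hAzero.const_mul_atTop hs).atTop_add h1
  have hinv : Tendsto (fun v => t * (u * A v)⁻¹) (𝓝[<] u) atTop := by
    refine Tendsto.const_mul_atTop ht (tendsto_inv_nhdsGT_zero.comp ?_)
    refine tendsto_nhdsWithin_iff.2 ⟨?_, ?_⟩
    · simpa using (hAu.mono_right nhdsWithin_le_nhds).const_mul u
    · filter_upwards [Ioo_mem_nhdsLT hu] with v hv using mul_pos hu (hApos v hv)
  have hAu' : Tendsto (fun v => s * A v) (𝓝[<] u) (𝓝 (s * 0)) :=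
    (hAu.mono_right nhdsWithin_le_nhds).const_mul s
  have hyu : Tendsto (fun v => s * A v - t * (u * A v)⁻¹) (𝓝[<] u) atBot :=
    hAu'.add_atBot (tendsto_neg_atTop_atBot.comp hinv)
  have hzu : Tendsto (fun v => s * A v + t * (u * A v)⁻¹) (𝓝[<] u) atTop := hAu'.add_atTop hinv
  -- The product of densities has a primitive built from `gaussPrim` at sA ∓ t/(uA). At v = 0 both
  -- arguments tend to +∞. At v = u the first tends to −∞ and the second to +∞, so only the
  -- coefficient α contributes to the total mass.
  have hmain := lintegral_Ioo_of_hasDerivAt (a := 0) (b := u)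
    (f := fun v => -c * (α * gaussPrim (s * A v - t * (u * A v)⁻¹) +
      β * Real.exp (s * t / u) * gaussPrim (s * A v + t * (u * A v)⁻¹)))
    (f' := fun v => subDensity s v * subDensity t (u - v)) hu
    (fun v hv => by
      have hv0 : 0 < v := hv.1
      have hw0 : 0 < u - v := sub_pos.2 hv.2
      have hAv := hApos v hv
      have hd : HasDerivAt A (-(v ^ 2)⁻¹ / (2 * A v)) v :=
        ((hasDerivAt_inv hv0.ne').sub_const u⁻¹).sqrt (hA0 v hv).ne'
      have hdi : HasDerivAt (fun v => t * (u * A v)⁻¹)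
          (t * (-(u * (-(v ^ 2)⁻¹ / (2 * A v))) / (u * A v) ^ 2)) v :=
        ((hd.const_mul u).inv (by positivity)).const_mul t
      have hy := (hd.const_mul s).sub hdi
      have hz := (hd.const_mul s).add hdi
      have hF := ((((hasDerivAt_gaussPrim _).comp v hy).const_mul α).add
        (((hasDerivAt_gaussPrim _).comp v hz).const_mul (β * Real.exp (s * t / u)))).const_mul (-c)
      refine hF.congr_deriv ?_
      have hA2 : A v ^ 2 = v⁻¹ - u⁻¹ := Real.sq_sqrt (hA0 v hv).le
      have e1 : -(s * A v - t * (u * A v)⁻¹) ^ 2 / 4 =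
          -s ^ 2 / (4 * v) + -t ^ 2 / (4 * (u - v)) - -(s + t) ^ 2 / (4 * u) := by
        have : (s * A v - t * (u * A v)⁻¹) ^ 2 =
            s ^ 2 * A v ^ 2 - 2 * s * t / u + t ^ 2 * (u ^ 2 * A v ^ 2)⁻¹ := by
          field_simp
          ring
        rw [this, hA2]
        have h3 : v⁻¹ - u⁻¹ = (u - v) / (u * v) := by field_simp
        rw [h3]
        field_simp
        ring
      have e2 : -(s * A v + t * (u * A v)⁻¹) ^ 2 / 4 =
          -(s * A v - t * (u * A v)⁻¹) ^ 2 / 4 - s * t / u := by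
        field_simp
        ring
      have e3 : β * Real.exp (s * t / u) * (Real.exp (-(s * A v + t * (u * A v)⁻¹) ^ 2 / 4) *
          (s * (-(v ^ 2)⁻¹ / (2 * A v)) + t * (-(u * (-(v ^ 2)⁻¹ / (2 * A v))) / (u * A v) ^ 2))) =
          β * (Real.exp (-(s * A v - t * (u * A v)⁻¹) ^ 2 / 4) *
          (s * (-(v ^ 2)⁻¹ / (2 * A v)) +
            t * (-(u * (-(v ^ 2)⁻¹ / (2 * A v))) / (u * A v) ^ 2))) := by
        rw [e2, Real.exp_sub]
        field_simp
      have hAq : A v = √(u - v) / (√u * √v) := by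
        rw [hA]; simp only
        rw [show v⁻¹ - u⁻¹ = (u - v) / (u * v) by field_simp, Real.sqrt_div hw0.le,
          Real.sqrt_mul hu.le]
      simp only [Pi.sub_apply, Pi.add_apply]
      rw [e3, e1, subDensity_eq s hv0, subDensity_eq t hw0, Real.exp_sub, Real.exp_add, hc]
      have hE : Real.exp (-(s + t) ^ 2 / (4 * u)) ≠ 0 := (Real.exp_pos _).ne'
      have hq : 0 < √(u - v) := Real.sqrt_pos.2 hw0
      have hp : 0 < √v := Real.sqrt_pos.2 hv0
      have hpi2 : √Real.pi ^ 2 = Real.pi := Real.sq_sqrt Real.pi_pos.le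
      have hfac : α * (s * (-(v ^ 2)⁻¹ / (2 * A v)) -
            t * (-(u * (-(v ^ 2)⁻¹ / (2 * A v))) / (u * A v) ^ 2)) +
          β * (s * (-(v ^ 2)⁻¹ / (2 * A v)) +
            t * (-(u * (-(v ^ 2)⁻¹ / (2 * A v))) / (u * A v) ^ 2)) =
          -(u * √u) / (2 * (v * √v) * ((u - v) * √(u - v))) := by
        have h4 : α * (s * (-(v ^ 2)⁻¹ / (2 * A v)) -
            t * (-(u * (-(v ^ 2)⁻¹ / (2 * A v))) / (u * A v) ^ 2)) +
          β * (s * (-(v ^ 2)⁻¹ / (2 * A v)) +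
            t * (-(u * (-(v ^ 2)⁻¹ / (2 * A v))) / (u * A v) ^ 2)) =
            -(v ^ 2)⁻¹ / (2 * A v) * (1 + (u * A v ^ 2)⁻¹) := by
          rw [hα, hβ]
          field_simp
          ring
        rw [h4, hA2, hAq, show v⁻¹ - u⁻¹ = (u - v) / (u * v) by field_simp]
        have hv2 : √v ^ 2 = v := Real.sq_sqrt hv0.le
        field_simp
        rw [hv2]
        ring
      set Es := Real.exp (-s ^ 2 / (4 * v))
      set Et := Real.exp (-t ^ 2 / (4 * (u - v)))
      set Eu := Real.exp (-(s + t) ^ 2 / (4 * u))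
      set d1 := (s * (-(v ^ 2)⁻¹ / (2 * A v)) -
            t * (-(u * (-(v ^ 2)⁻¹ / (2 * A v))) / (u * A v) ^ 2))
      set d2 := (s * (-(v ^ 2)⁻¹ / (2 * A v)) +
            t * (-(u * (-(v ^ 2)⁻¹ / (2 * A v))) / (u * A v) ^ 2))
      calc -(s * t / (2 * Real.pi) * (u * √u)⁻¹ * Eu) *
            (α * (Es * Et / Eu * d1) + β * (Es * Et / Eu * d2)) =
            -(s * t / (2 * Real.pi) * (u * √u)⁻¹) * (Es * Et) * (α * d1 + β * d2) := by
            field_simp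
        _ = _ := by
            rw [hfac]
            nth_rewrite 1 [← hpi2]
            field_simp)
    (fun v hv => mul_nonneg (subDensity_nonneg hs.le hv.1)
      (subDensity_nonneg ht.le (sub_pos.2 hv.2)))
    (Tendsto.const_mul _ (((tendsto_gaussPrim_atTop.comp hy0).const_mul α).add
      ((tendsto_gaussPrim_atTop.comp hz0).const_mul _)))
    (Tendsto.const_mul _ (((tendsto_gaussPrim_atBot.comp hyu).const_mul α).add
      ((tendsto_gaussPrim_atTop.comp hzu).const_mul _)))
  rw [hmain, subDensity_eq _ hu]
  congr 1
  have hpi2 : √Real.pi ^ 2 = Real.pi := Real.sq_sqrt Real.pi_pos.le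
  rw [hc, hα]
  field_simp
  rw [hpi2]
  ring

end StandardSemigroup
end SemigroupBMO

/-! ### Derivatives and majorants of the subordination density -/

namespace SemigroupBMO

lemma abs_taylor_le {f f' f'' : ℝ → ℝ} {s : Set ℝ} (hs : Convex ℝ s) {M x y : ℝ}
    (hf : ∀ z ∈ s, HasDerivAt f (f' z) z) (hf' : ∀ z ∈ s, HasDerivAt f' (f'' z) z)
    (hM : ∀ z ∈ s, |f'' z| ≤ M) (hx : x ∈ s) (hy : y ∈ s) :
    |f y - f x - (y - x) * f' x| ≤ M * (y - x) ^ 2 := by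
  have hsub : uIcc x y ⊆ s := (convex_iff_ordConnected.1 hs).uIcc_subset hx hy
  have h1 : ∀ z ∈ uIcc x y, |f' z - f' x| ≤ M * |y - x| := fun z hz => by
    have := (convex_uIcc x y).norm_image_sub_le_of_norm_hasDerivWithin_le
      (fun w hw => (hf' w (hsub hw)).hasDerivWithinAt) (fun w hw => hM w (hsub hw))
      left_mem_uIcc hz
    refine this.trans ?_
    have hM0 : 0 ≤ M := (abs_nonneg _).trans (hM x hx)
    exact mul_le_mul_of_nonneg_left (abs_sub_left_of_mem_uIcc hz) hM0
  have h2 := (convex_uIcc x y).norm_image_sub_le_of_norm_hasDerivWithin_le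
    (f := fun z => f z - z * f' x) (f' := fun z => f' z - 1 * f' x)
    (fun w hw => ((hf w (hsub hw)).sub ((hasDerivAt_id w).mul_const _)).hasDerivWithinAt)
    (C := M * |y - x|) (fun w hw => by simpa using h1 w hw) left_mem_uIcc right_mem_uIcc
  rw [Real.norm_eq_abs, Real.norm_eq_abs] at h2
  calc |f y - f x - (y - x) * f' x| = |f y - y * f' x - (f x - x * f' x)| := by
        congr 1; ring
    _ ≤ M * |y - x| * |y - x| := h2
    _ = M * (y - x) ^ 2 := by rw [mul_assoc, ← sq, sq_abs]

/-- The functions `exp (-t² / (4 u)) u ^ (-3/2 - j)`. -/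
def heatKernel (j : ℕ) (t u : ℝ) : ℝ := Real.exp (-t ^ 2 / (4 * u)) * (u * √u)⁻¹ * (u⁻¹) ^ j

lemma heatKernel_nonneg (j : ℕ) (t : ℝ) {u : ℝ} (hu : 0 < u) : 0 ≤ heatKernel j t u := by
  unfold heatKernel; positivity

lemma hasDerivAt_heatKernel_left (j : ℕ) (t : ℝ) {u : ℝ} (hu : 0 < u) :
    HasDerivAt (fun t => heatKernel j t u) (-(t / 2) * heatKernel (j + 1) t u) t := by
  have h1 : HasDerivAt (fun t : ℝ => -t ^ 2 / (4 * u)) (-(2 * t) / (4 * u)) t := by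
    have := ((hasDerivAt_pow 2 t).neg).div_const (4 * u)
    simpa using this
  refine ((h1.exp.mul_const ((u * √u)⁻¹)).mul_const ((u⁻¹) ^ j)).congr_deriv ?_
  unfold heatKernel
  simp only [inv_pow]
  field_simp
  ring

lemma hasDerivAt_heatKernel_right (j : ℕ) (t : ℝ) {u : ℝ} (hu : 0 < u) :
    HasDerivAt (heatKernel j t)
      (-(3 / 2 + j) * heatKernel (j + 1) t u + t ^ 2 / 4 * heatKernel (j + 2) t u) u := by
  have hs : 0 < √u := Real.sqrt_pos.2 hu
  have hs2 : √u ^ 2 = u := Real.sq_sqrt hu.le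
  have h1 : HasDerivAt (fun u : ℝ => -t ^ 2 / (4 * u)) (t ^ 2 / (4 * u ^ 2)) u := by
    refine ((((hasDerivAt_id u).const_mul 4).fun_inv (by simpa using hu.ne')).const_mul
      (-t ^ 2)).congr_deriv ?_
    simp only [id]
    field_simp
  have h2 : HasDerivAt (fun u : ℝ => (u * √u)⁻¹) (-(3 / 2) * (u * √u)⁻¹ * u⁻¹) u := by
    refine (((hasDerivAt_id u).mul (Real.hasDerivAt_sqrt hu.ne')).fun_inv
      (by simpa using ⟨hu.ne', hs.ne'⟩)).congr_deriv ?_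
    simp only [id, Pi.mul_apply]
    field_simp
    rw [hs2]
    ring
  have h3 : HasDerivAt (fun u : ℝ => (u⁻¹) ^ j) (-j * (u⁻¹) ^ (j + 1)) u := by
    refine ((hasDerivAt_inv hu.ne').pow j).congr_deriv ?_
    rcases j with _ | j
    · simp
    · simp only [Nat.add_sub_cancel, inv_pow]
      field_simp
      ring
  refine ((h1.exp.mul h2).mul h3).congr_deriv ?_
  simp only [Pi.mul_apply]
  unfold heatKernel
  simp only [inv_pow]
  field_simp
  ring

lemma inv_pow_mul_exp_le (n : ℕ) {a u : ℝ} (ha : 0 < a) (hu : 0 < u) :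
    (u⁻¹) ^ n * Real.exp (-a / u) ≤ n.factorial / a ^ n := by
  have h := Real.pow_div_factorial_le_exp (a / u) (by positivity) n
  rw [neg_div, Real.exp_neg, ← div_eq_mul_inv, div_le_div_iff₀ (Real.exp_pos _) (by positivity)]
  rw [div_le_iff₀ (by positivity)] at h
  calc (u⁻¹) ^ n * a ^ n = (a / u) ^ n := by rw [← mul_pow]; congr 1; field_simp
    _ ≤ _ := by linarith

/-- For t ≥ 2s the exponent t²/(4u) exceeds s²/(4u) by at least 3s²/(4u), and this surplus absorbs
the power u^{−j}. One integrable function thus dominates all derivatives for t ≥ 2s. -/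
lemma heatKernel_le_heatKernel (j : ℕ) {s : ℝ} (hs : 0 < s) :
    ∃ C, 0 ≤ C ∧ ∀ t u, 2 * s ≤ t → 0 < u → heatKernel j t u ≤ C * heatKernel 0 s u := by
  refine ⟨j.factorial / (3 * s ^ 2 / 4) ^ j, by positivity, fun t u ht hu => ?_⟩
  have h := inv_pow_mul_exp_le j (a := 3 * s ^ 2 / 4) (by positivity) hu
  have h1 : Real.exp (-t ^ 2 / (4 * u)) ≤
      Real.exp (-(3 * s ^ 2 / 4) / u) * Real.exp (-s ^ 2 / (4 * u)) := by
    rw [← Real.exp_add, Real.exp_le_exp]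
    have : -(3 * s ^ 2 / 4) / u + -s ^ 2 / (4 * u) = -(2 * s) ^ 2 / (4 * u) := by
      field_simp; ring
    rw [this]
    gcongr
  unfold heatKernel
  calc _ ≤ Real.exp (-(3 * s ^ 2 / 4) / u) * Real.exp (-s ^ 2 / (4 * u)) * (u * √u)⁻¹ * u⁻¹ ^ j := by
        gcongr
    _ = (u⁻¹ ^ j * Real.exp (-(3 * s ^ 2 / 4) / u)) *
        (Real.exp (-s ^ 2 / (4 * u)) * (u * √u)⁻¹ * u⁻¹ ^ 0) := by ring
    _ ≤ _ := by gcongr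

/-- Replaces the half-integer power u^{−3/2} by integer ones, so that `inv_pow_mul_exp_le` applies.
-/
lemma inv_mul_sqrt_le {u : ℝ} (hu : 0 < u) : (u * √u)⁻¹ ≤ u⁻¹ + u⁻¹ ^ 2 := by
  have hs : 0 < √u := Real.sqrt_pos.2 hu
  have hs2 : √u ^ 2 = u := Real.sq_sqrt hu.le
  have h : (√u)⁻¹ ≤ 1 + u⁻¹ := by
    have e : u⁻¹ = (√u)⁻¹ ^ 2 := by rw [inv_pow, hs2]
    rw [e]; nlinarith [sq_nonneg ((√u)⁻¹ - 1), inv_pos.2 hs]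
  rw [mul_inv]
  nlinarith [inv_pos.2 hu]

/-- Behaviour at u = 0: the Gaussian factor beats every negative power, leaving room for any
positive power of u. -/
lemma heatKernel_le_pow (j n : ℕ) {t : ℝ} (ht : 0 < t) :
    ∃ C, 0 ≤ C ∧ ∀ u, 0 < u → heatKernel j t u ≤ C * u ^ n := by
  refine ⟨((j + n + 1).factorial / (t ^ 2 / 4) ^ (j + n + 1) +
    (j + n + 2).factorial / (t ^ 2 / 4) ^ (j + n + 2)), by positivity, fun u hu => ?_⟩
  have h1 := inv_pow_mul_exp_le (j + n + 1) (a := t ^ 2 / 4) (by positivity) hu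
  have h2 := inv_pow_mul_exp_le (j + n + 2) (a := t ^ 2 / 4) (by positivity) hu
  have e : -t ^ 2 / (4 * u) = -(t ^ 2 / 4) / u := by field_simp
  unfold heatKernel
  rw [e]
  calc _ ≤ Real.exp (-(t ^ 2 / 4) / u) * (u⁻¹ + u⁻¹ ^ 2) * u⁻¹ ^ j := by
        gcongr; exact inv_mul_sqrt_le hu
    _ = (u⁻¹ ^ (j + n + 1) * Real.exp (-(t ^ 2 / 4) / u) +
        u⁻¹ ^ (j + n + 2) * Real.exp (-(t ^ 2 / 4) / u)) * u ^ n := by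
        simp only [inv_pow]
        field_simp
        ring
    _ ≤ _ := by gcongr

/-- Behaviour at infinity: the power is at most u^{−5/2}, which is o(u^{−2}). Together with
boundedness near 0 this gives the majorant (1+u²)^{−1}. -/
lemma heatKernel_mul_sq_le (j : ℕ) {t : ℝ} (ht : 0 < t) :
    ∃ C, 0 ≤ C ∧ ∀ u, 0 < u → heatKernel (j + 1) t u * u ^ 2 ≤ C := by
  refine ⟨(j.factorial / (t ^ 2 / 4) ^ j +
    (j + 1).factorial / (t ^ 2 / 4) ^ (j + 1)), by positivity, fun u hu => ?_⟩
  have h1 := inv_pow_mul_exp_le j (a := t ^ 2 / 4) (by positivity) hu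
  have h2 := inv_pow_mul_exp_le (j + 1) (a := t ^ 2 / 4) (by positivity) hu
  have e : -t ^ 2 / (4 * u) = -(t ^ 2 / 4) / u := by field_simp
  unfold heatKernel
  rw [e]
  calc _ ≤ Real.exp (-(t ^ 2 / 4) / u) * (u⁻¹ + u⁻¹ ^ 2) * u⁻¹ ^ (j + 1) * u ^ 2 := by
        gcongr; exact inv_mul_sqrt_le hu
    _ = (u⁻¹ ^ j * Real.exp (-(t ^ 2 / 4) / u) +
        u⁻¹ ^ (j + 1) * Real.exp (-(t ^ 2 / 4) / u)) := by
        simp only [inv_pow]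
        field_simp
        ring
    _ ≤ _ := by gcongr

namespace StandardSemigroup

lemma subDensity_eq_heatKernel (t : ℝ) {u : ℝ} (hu : 0 < u) :
    subDensity t u = (2 * √Real.pi)⁻¹ * (t * heatKernel 0 t u) := by
  rw [subDensity_eq t hu, heatKernel]; ring

/-- The derivative of `subDensity` in `t`. -/
def subDensityD (t u : ℝ) : ℝ :=
  (2 * √Real.pi)⁻¹ * (heatKernel 0 t u - t ^ 2 / 2 * heatKernel 1 t u)

/-- The second derivative of `subDensity` in `t`, which is also its derivative in `u`. -/
def subDensityDD (t u : ℝ) : ℝ :=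
  (2 * √Real.pi)⁻¹ * (-(3 * t / 2) * heatKernel 1 t u + t ^ 3 / 4 * heatKernel 2 t u)

/-- The third derivative of `subDensity` in t. -/
def subDensityDDD (t u : ℝ) : ℝ :=
  (2 * √Real.pi)⁻¹ * (-(3 / 2) * heatKernel 1 t u + 3 * t ^ 2 / 2 * heatKernel 2 t u -
    t ^ 4 / 8 * heatKernel 3 t u)

/-- The derivative in u of `subDensityDD`, hence the second u-derivative of `subDensity`. -/
def subDensityDR (t u : ℝ) : ℝ :=
  (2 * √Real.pi)⁻¹ * (15 * t / 4 * heatKernel 2 t u - 5 * t ^ 3 / 4 * heatKernel 3 t u +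
    t ^ 5 / 16 * heatKernel 4 t u)

lemma hasDerivAt_subDensity (t : ℝ) {u : ℝ} (hu : 0 < u) :
    HasDerivAt (fun t => subDensity t u) (subDensityD t u) t := by
  have h := ((hasDerivAt_id t).mul (hasDerivAt_heatKernel_left 0 t hu)).const_mul
    ((2 * √Real.pi)⁻¹)
  refine (h.congr_of_eventuallyEq (Eventually.of_forall fun s =>
    subDensity_eq_heatKernel s hu)).congr_deriv ?_
  simp only [id, subDensityD]; ring

lemma hasDerivAt_subDensityD (t : ℝ) {u : ℝ} (hu : 0 < u) :
    HasDerivAt (fun t => subDensityD t u) (subDensityDD t u) t := by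
  have h := ((hasDerivAt_heatKernel_left 0 t hu).sub
    (((hasDerivAt_pow 2 t).div_const 2).mul (hasDerivAt_heatKernel_left 1 t hu))).const_mul
    ((2 * √Real.pi)⁻¹)
  refine h.congr_deriv ?_
  simp only [subDensityDD]; push_cast; ring

lemma hasDerivAt_subDensityDD (t : ℝ) {u : ℝ} (hu : 0 < u) :
    HasDerivAt (fun t => subDensityDD t u) (subDensityDDD t u) t := by
  have h := (((((hasDerivAt_id t).const_mul 3).div_const 2).neg.mul
    (hasDerivAt_heatKernel_left 1 t hu)).add
    (((hasDerivAt_pow 3 t).div_const 4).mul (hasDerivAt_heatKernel_left 2 t hu))).const_mul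
    ((2 * √Real.pi)⁻¹)
  refine h.congr_deriv ?_
  simp only [subDensityDDD, id, Pi.neg_apply]; push_cast; ring

/-- The density solves the heat equation ∂_u k = ∂_t² k. Because of this the second derivative of
P_t is the generator of (T_r) applied to P_t. -/
lemma hasDerivAt_subDensity_right (t : ℝ) {u : ℝ} (hu : 0 < u) :
    HasDerivAt (subDensity t) (subDensityDD t u) u := by
  have h := ((hasDerivAt_heatKernel_right 0 t hu).const_mul t).const_mul ((2 * √Real.pi)⁻¹)
  refine (h.congr_of_eventuallyEq ?_).congr_deriv ?_
  · filter_upwards [lt_mem_nhds hu] with v hv using subDensity_eq_heatKernel t hv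
  · simp only [subDensityDD]; push_cast; ring

lemma hasDerivAt_subDensityDD_right (t : ℝ) {u : ℝ} (hu : 0 < u) :
    HasDerivAt (subDensityDD t) (subDensityDR t u) u := by
  have h := (((hasDerivAt_heatKernel_right 1 t hu).const_mul (-(3 * t / 2))).add
    ((hasDerivAt_heatKernel_right 2 t hu).const_mul (t ^ 3 / 4))).const_mul ((2 * √Real.pi)⁻¹)
  refine h.congr_deriv ?_
  simp only [subDensityDR]; push_cast; ring

lemma measurable_heatKernel (j : ℕ) (t : ℝ) : Measurable (heatKernel j t) := by
  unfold heatKernel; fun_prop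

lemma measurable_subDensityD (t : ℝ) : Measurable (subDensityD t) := by
  have := measurable_heatKernel
  unfold subDensityD; fun_prop

lemma measurable_subDensityDD (t : ℝ) : Measurable (subDensityDD t) := by
  have := measurable_heatKernel
  unfold subDensityDD; fun_prop

lemma integrableOn_heatKernel_zero {t : ℝ} (ht : 0 < t) :
    IntegrableOn (heatKernel 0 t) (Ioi 0) := by
  have := (integrableOn_subDensity ht).const_mul (2 * √Real.pi / t)
  refine (integrableOn_congr_fun (fun u hu => ?_) measurableSet_Ioi).1 this
  have hpi : 0 < √Real.pi := Real.sqrt_pos.2 Real.pi_pos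
  simp only [subDensity_eq_heatKernel t hu]
  field_simp

lemma abs_mul_heatKernel_le {a b : ℝ} (h : |a| ≤ b) (j : ℕ) (t : ℝ) {u : ℝ} (hu : 0 < u) :
    |a * heatKernel j t u| ≤ b * heatKernel j t u := by
  rw [abs_mul, abs_of_nonneg (heatKernel_nonneg j t hu)]
  exact mul_le_mul_of_nonneg_right h (heatKernel_nonneg j t hu)

lemma abs_subDensityD_le (t : ℝ) {u : ℝ} (hu : 0 < u) : |subDensityD t u| ≤
    (2 * √Real.pi)⁻¹ * (heatKernel 0 t u + t ^ 2 / 2 * heatKernel 1 t u) := by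
  rw [subDensityD, abs_mul, abs_of_nonneg (by positivity : (0 : ℝ) ≤ (2 * √Real.pi)⁻¹)]
  have h0 := heatKernel_nonneg 0 t hu
  have h1 := mul_nonneg (by positivity : 0 ≤ t ^ 2 / 2) (heatKernel_nonneg 1 t hu)
  refine mul_le_mul_of_nonneg_left ?_ (by positivity)
  rw [abs_le]; constructor <;> linarith

lemma abs_subDensityDD_le {t T : ℝ} (ht : 0 < t) (hT : t ≤ T) {u : ℝ} (hu : 0 < u) :
    |subDensityDD t u| ≤ (2 * √Real.pi)⁻¹ *
      (3 * T / 2 * heatKernel 1 t u + T ^ 3 / 4 * heatKernel 2 t u) := by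
  rw [subDensityDD, abs_mul, abs_of_nonneg (by positivity : (0 : ℝ) ≤ (2 * √Real.pi)⁻¹)]
  refine mul_le_mul_of_nonneg_left ((abs_add_le _ _).trans (add_le_add ?_ ?_)) (by positivity)
  · exact abs_mul_heatKernel_le (by rw [abs_neg, abs_of_pos (by positivity)]; gcongr) _ _ hu
  · exact abs_mul_heatKernel_le (by rw [abs_of_pos (by positivity)]; gcongr) _ _ hu

lemma abs_subDensityDDD_le {t T : ℝ} (ht : 0 < t) (hT : t ≤ T) {u : ℝ} (hu : 0 < u) :
    |subDensityDDD t u| ≤ (2 * √Real.pi)⁻¹ *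
      (3 / 2 * heatKernel 1 t u + 3 * T ^ 2 / 2 * heatKernel 2 t u + T ^ 4 / 8 * heatKernel 3 t u) := by
  rw [subDensityDDD, abs_mul, abs_of_nonneg (by positivity : (0 : ℝ) ≤ (2 * √Real.pi)⁻¹)]
  refine mul_le_mul_of_nonneg_left ((abs_sub _ _).trans (add_le_add
    ((abs_add_le _ _).trans (add_le_add ?_ ?_)) ?_)) (by positivity)
  · exact abs_mul_heatKernel_le (by rw [abs_neg, abs_of_pos (by positivity)]) _ _ hu
  · exact abs_mul_heatKernel_le (by rw [abs_of_pos (by positivity)]; gcongr) _ _ hu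
  · exact abs_mul_heatKernel_le (by rw [abs_of_pos (by positivity)]; gcongr) _ _ hu

lemma abs_subDensityDR_le {t : ℝ} (ht : 0 < t) {u : ℝ} (hu : 0 < u) :
    |subDensityDR t u| ≤ (2 * √Real.pi)⁻¹ *
      (15 * t / 4 * heatKernel 2 t u + 5 * t ^ 3 / 4 * heatKernel 3 t u +
        t ^ 5 / 16 * heatKernel 4 t u) := by
  rw [subDensityDR, abs_mul, abs_of_nonneg (by positivity : (0 : ℝ) ≤ (2 * √Real.pi)⁻¹)]
  refine mul_le_mul_of_nonneg_left ((abs_add_le _ _).trans (add_le_add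
    ((abs_sub _ _).trans (add_le_add ?_ ?_)) ?_)) (by positivity)
  all_goals exact abs_mul_heatKernel_le (by rw [abs_of_pos (by positivity)]) _ _ hu

lemma exists_bound_subDensityD {s T : ℝ} (hs : 0 < s) : ∃ C, ∀ t u, 2 * s ≤ t → t ≤ T → 0 < u →
    |subDensityD t u| ≤ C * heatKernel 0 s u ∧ |subDensityDD t u| ≤ C * heatKernel 0 s u ∧
      |subDensityDDD t u| ≤ C * heatKernel 0 s u := by
  obtain ⟨C0, h0, H0⟩ := heatKernel_le_heatKernel 0 hs
  obtain ⟨C1, h1, H1⟩ := heatKernel_le_heatKernel 1 hs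
  obtain ⟨C2, h2, H2⟩ := heatKernel_le_heatKernel 2 hs
  obtain ⟨C3, h3, H3⟩ := heatKernel_le_heatKernel 3 hs
  refine ⟨(2 * √Real.pi)⁻¹ * (C0 + T ^ 2 / 2 * C1) + (2 * √Real.pi)⁻¹ *
    (3 * |T| / 2 * C1 + |T| ^ 3 / 4 * C2) + (2 * √Real.pi)⁻¹ *
    (3 / 2 * C1 + 3 * T ^ 2 / 2 * C2 + T ^ 4 / 8 * C3), fun t u ht hT hu => ?_⟩
  have h := heatKernel_nonneg 0 s hu
  have ht0 : 0 < t := by linarith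
  have hT0 : 0 < T := by linarith
  rw [abs_of_pos hT0]
  have k1 : |subDensityD t u| ≤ (2 * √Real.pi)⁻¹ * (C0 + T ^ 2 / 2 * C1) * heatKernel 0 s u := by
    refine (abs_subDensityD_le t hu).trans ?_
    rw [mul_assoc, add_mul, mul_assoc]
    gcongr
    exacts [H0 t u ht hu, heatKernel_nonneg 1 t hu, H1 t u ht hu]
  have k2 : |subDensityDD t u| ≤ (2 * √Real.pi)⁻¹ * (3 * T / 2 * C1 + T ^ 3 / 4 * C2) *
      heatKernel 0 s u := by
    refine (abs_subDensityDD_le ht0 hT hu).trans ?_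
    rw [mul_assoc, add_mul, mul_assoc (3 * T / 2), mul_assoc (T ^ 3 / 4)]
    gcongr
    exacts [H1 t u ht hu, H2 t u ht hu]
  have k3 : |subDensityDDD t u| ≤ (2 * √Real.pi)⁻¹ * (3 / 2 * C1 + 3 * T ^ 2 / 2 * C2 +
      T ^ 4 / 8 * C3) * heatKernel 0 s u := by
    refine (abs_subDensityDDD_le ht0 hT hu).trans ?_
    rw [mul_assoc, add_mul, add_mul, mul_assoc (3 / 2), mul_assoc (3 * T ^ 2 / 2),
      mul_assoc (T ^ 4 / 8)]
    gcongr
    exacts [H1 t u ht hu, H2 t u ht hu, H3 t u ht hu]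
  have p1 : 0 ≤ (2 * √Real.pi)⁻¹ * (C0 + T ^ 2 / 2 * C1) * heatKernel 0 s u := by positivity
  have p2 : 0 ≤ (2 * √Real.pi)⁻¹ * (3 * T / 2 * C1 + T ^ 3 / 4 * C2) * heatKernel 0 s u := by
    positivity
  have p3 : 0 ≤ (2 * √Real.pi)⁻¹ * (3 / 2 * C1 + 3 * T ^ 2 / 2 * C2 + T ^ 4 / 8 * C3) *
      heatKernel 0 s u := by positivity
  simp only [add_mul (_ + _), add_mul ((2 * √Real.pi)⁻¹ * _)]
  refine ⟨by linarith, by linarith, by linarith⟩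

lemma integrableOn_subDensityD {t : ℝ} (ht : 0 < t) : IntegrableOn (subDensityD t) (Ioi 0) := by
  obtain ⟨C, hC⟩ := exists_bound_subDensityD (s := t / 2) (T := t) (by positivity)
  refine ((integrableOn_heatKernel_zero (half_pos ht)).const_mul C).mono'
    (measurable_subDensityD t).aestronglyMeasurable ?_
  exact (ae_restrict_iff' measurableSet_Ioi).2 (ae_of_all _ fun u hu =>
    (hC t u (by linarith) le_rfl hu).1)

lemma integrableOn_subDensityDD {t : ℝ} (ht : 0 < t) : IntegrableOn (subDensityDD t) (Ioi 0) := by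
  obtain ⟨C, hC⟩ := exists_bound_subDensityD (s := t / 2) (T := t) (by positivity)
  refine ((integrableOn_heatKernel_zero (half_pos ht)).const_mul C).mono'
    (measurable_subDensityDD t).aestronglyMeasurable ?_
  exact (ae_restrict_iff' measurableSet_Ioi).2 (ae_of_all _ fun u hu =>
    (hC t u (by linarith) le_rfl hu).2.1)

/-- First order expansions of `subDensity` and of its derivative in `t`, dominated by an
integrable function. -/
lemma exists_integrable_taylor_left {t : ℝ} (ht : 0 < t) : ∃ g : ℝ → ℝ, IntegrableOn g (Ioi 0) ∧
    ∀ s u, t / 2 ≤ s → s ≤ 2 * t → 0 < u →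
      |subDensity s u - subDensity t u - (s - t) * subDensityD t u| ≤ g u * (s - t) ^ 2 ∧
      |subDensityD s u - subDensityD t u - (s - t) * subDensityDD t u| ≤ g u * (s - t) ^ 2 := by
  obtain ⟨C, hC⟩ := exists_bound_subDensityD (s := t / 4) (T := 2 * t) (by positivity)
  refine ⟨fun u => C * heatKernel 0 (t / 4) u,
    (integrableOn_heatKernel_zero (by positivity)).const_mul C, fun s u hs hs' hu => ⟨?_, ?_⟩⟩
  · exact abs_taylor_le (f := fun t => subDensity t u) (f' := fun t => subDensityD t u)
      (f'' := fun t => subDensityDD t u)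
      (convex_Icc (t / 2) (2 * t)) (fun z _ => hasDerivAt_subDensity z hu)
      (fun z _ => hasDerivAt_subDensityD z hu)
      (fun z hz => (hC z u (by linarith [hz.1]) hz.2 hu).2.1) ⟨by linarith, by linarith⟩ ⟨hs, hs'⟩
  · exact abs_taylor_le (f := fun t => subDensityD t u) (f' := fun t => subDensityDD t u)
      (f'' := fun t => subDensityDDD t u)
      (convex_Icc (t / 2) (2 * t)) (fun z _ => hasDerivAt_subDensityD z hu)
      (fun z _ => hasDerivAt_subDensityDD z hu)
      (fun z hz => (hC z u (by linarith [hz.1]) hz.2 hu).2.2) ⟨by linarith, by linarith⟩ ⟨hs, hs'⟩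

/-- The first order expansion of a translate of `subDensity`, dominated by an integrable
function. -/
lemma exists_integrable_taylor_right {t : ℝ} (ht : 0 < t) : ∃ g : ℝ → ℝ, IntegrableOn g (Ioi 0) ∧
    ∀ r u, 0 < r → r < 1 → 0 < u →
      |subDensity t u - (if r < u then subDensity t (u - r) else 0) - r * subDensityDD t u| ≤
        g u * r ^ 2 := by
  obtain ⟨A0, a0, hA0⟩ := heatKernel_le_pow 0 2 ht
  obtain ⟨A1, a1, hA1⟩ := heatKernel_le_pow 1 1 ht
  obtain ⟨A2, a2, hA2⟩ := heatKernel_le_pow 2 1 ht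
  obtain ⟨B2, b2, hB2⟩ := heatKernel_le_pow 2 0 ht
  obtain ⟨B3, b3, hB3⟩ := heatKernel_le_pow 3 0 ht
  obtain ⟨B4, b4, hB4⟩ := heatKernel_le_pow 4 0 ht
  obtain ⟨D2, d2, hD2⟩ := heatKernel_mul_sq_le 1 ht
  obtain ⟨D3, d3, hD3⟩ := heatKernel_mul_sq_le 2 ht
  obtain ⟨D4, d4, hD4⟩ := heatKernel_mul_sq_le 3 ht
  set c := (2 * √Real.pi)⁻¹ with hc
  have hc0 : 0 ≤ c := by positivity
  set E := c * (t * A0)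
  set F := c * (3 * t / 2 * A1 + t ^ 3 / 4 * A2)
  set K := c * (15 * t / 4 * B2 + 5 * t ^ 3 / 4 * B3 + t ^ 5 / 16 * B4)
  set L := c * (15 * t / 4 * D2 + 5 * t ^ 3 / 4 * D3 + t ^ 5 / 16 * D4)
  have hE0 : 0 ≤ E := by positivity
  have hF0 : 0 ≤ F := by positivity
  have hK0 : 0 ≤ K := by positivity
  have hL0 : 0 ≤ L := by positivity
  have hE : ∀ u, 0 < u → |subDensity t u| ≤ E * u ^ 2 := fun u hu => by
    rw [abs_of_nonneg (subDensity_nonneg ht.le hu), subDensity_eq_heatKernel t hu]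
    calc _ ≤ c * (t * (A0 * u ^ 2)) := by gcongr; exact hA0 u hu
      _ = _ := by ring
  have hF : ∀ u, 0 < u → |subDensityDD t u| ≤ F * u := fun u hu => by
    refine (abs_subDensityDD_le ht le_rfl hu).trans ?_
    calc _ ≤ c * (3 * t / 2 * (A1 * u ^ 1) + t ^ 3 / 4 * (A2 * u ^ 1)) := by
          gcongr
          exacts [hA1 u hu, hA2 u hu]
      _ = _ := by ring
  have hK : ∀ u, 0 < u → |subDensityDR t u| ≤ K := fun u hu => by
    refine (abs_subDensityDR_le ht hu).trans (mul_le_mul_of_nonneg_left ?_ hc0)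
    gcongr
    exacts [by simpa using hB2 u hu, by simpa using hB3 u hu, by simpa using hB4 u hu]
  have hL : ∀ u, 0 < u → |subDensityDR t u| * u ^ 2 ≤ L := fun u hu => by
    refine (mul_le_mul_of_nonneg_right (abs_subDensityDR_le ht hu) (sq_nonneg u)).trans ?_
    calc _ = c * (15 * t / 4 * (heatKernel 2 t u * u ^ 2) +
          5 * t ^ 3 / 4 * (heatKernel 3 t u * u ^ 2) +
          t ^ 5 / 16 * (heatKernel 4 t u * u ^ 2)) := by ring
      _ ≤ _ := by
          refine mul_le_mul_of_nonneg_left ?_ hc0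
          gcongr
          exacts [hD2 u hu, hD3 u hu, hD4 u hu]
  -- The term with K and L bounds the Taylor remainder when r < u; the term with E and F serves the
  -- range u ≤ r, where the translate is zero.
  refine ⟨fun u => (2 * (E + F) + 8 * (K + L)) * (1 + u ^ 2)⁻¹,
    (integrable_inv_one_add_sq.const_mul _).integrableOn, fun r u hr hr1 hu => ?_⟩
  have hden : 0 < 1 + u ^ 2 := by positivity
  split_ifs with hru
  · have hx : 0 < u - r := sub_pos.2 hru
    have hb : ∀ z ∈ Icc (u - r) u, |subDensityDR t z| ≤ 8 * (K + L) * (1 + u ^ 2)⁻¹ := by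
      intro z hz
      have hz0 : 0 < z := hx.trans_le hz.1
      rw [← div_eq_mul_inv, le_div_iff₀ hden]
      have hu1 : u ≤ z + 1 := by linarith [hz.1]
      have : 1 + u ^ 2 ≤ 3 + 2 * z ^ 2 := by nlinarith [sq_nonneg (z - 1)]
      have k := hK z hz0
      have l := hL z hz0
      have h0 := abs_nonneg (subDensityDR t z)
      nlinarith
    have h := abs_taylor_le (convex_Icc (u - r) u)
      (fun z hz => hasDerivAt_subDensity_right t (hx.trans_le hz.1))
      (fun z hz => hasDerivAt_subDensityDD_right t (hx.trans_le hz.1)) hb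
      (right_mem_Icc.2 (by linarith)) (left_mem_Icc.2 (by linarith))
    rw [abs_sub_comm] at h
    have e : subDensity t u - subDensity t (u - r) - r * subDensityDD t u =
        (u - r - u) * subDensityDD t u - (subDensity t (u - r) - subDensity t u) := by ring
    rw [e]
    refine h.trans ?_
    rw [show (u - r - u) ^ 2 = r ^ 2 by ring]
    have : 0 ≤ 2 * (E + F) * (1 + u ^ 2)⁻¹ := by positivity
    refine mul_le_mul_of_nonneg_right ?_ (sq_nonneg r)
    linarith
  -- Here the density is O(u²) and its derivative O(u), so everything is O(r²). Moreover u < 1, so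
  -- (1+u²)^{−1} is at least 1/2.
  · have hur : u ≤ r := not_lt.1 hru
    rw [sub_zero]
    have h1 : |subDensity t u - r * subDensityDD t u| ≤ (E + F) * r ^ 2 := by
      refine (abs_sub _ _).trans ?_
      rw [abs_mul, abs_of_pos hr]
      have e1 : E * u ^ 2 ≤ E * r ^ 2 := by gcongr
      have e2 : r * |subDensityDD t u| ≤ r * (F * r) := by
        gcongr
        exact (hF u hu).trans (by gcongr)
      have := hE u hu
      nlinarith
    refine h1.trans (mul_le_mul_of_nonneg_right ?_ (sq_nonneg r))
    have hi : 1 / 2 ≤ (1 + u ^ 2)⁻¹ := by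
      rw [one_div]
      exact inv_anti₀ hden (by nlinarith)
    have : 0 ≤ 8 * (K + L) * (1 + u ^ 2)⁻¹ := by positivity
    nlinarith

/-- Passing from t to t/2 in the Gaussian frees a factor exp(−3t²/(16u)), which absorbs t²/u. Since
`subDensity (t / 2)` has mass one, the derivative of P_t has norm at most 20/t. -/
lemma abs_subDensityD_le_div {t u : ℝ} (ht : 0 < t) (hu : 0 < u) :
    |subDensityD t u| ≤ 20 / t * subDensity (t / 2) u := by
  refine (abs_subDensityD_le t hu).trans ?_
  rw [subDensity_eq_heatKernel _ hu]
  have h0 := inv_pow_mul_exp_le 0 (a := 3 * t ^ 2 / 16) (by positivity) hu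
  have h1 := inv_pow_mul_exp_le 1 (a := 3 * t ^ 2 / 16) (by positivity) hu
  have e : Real.exp (-t ^ 2 / (4 * u)) =
      Real.exp (-(3 * t ^ 2 / 16) / u) * Real.exp (-(t / 2) ^ 2 / (4 * u)) := by
    rw [← Real.exp_add]; congr 1; field_simp; ring
  have k : ∀ j, heatKernel j t u = (u⁻¹ ^ j * Real.exp (-(3 * t ^ 2 / 16) / u)) *
      heatKernel 0 (t / 2) u := fun j => by
    unfold heatKernel; rw [e]; ring
  rw [k 0, k 1]
  have hh := heatKernel_nonneg 0 (t / 2) hu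
  have h2 : (u⁻¹ ^ 0 * Real.exp (-(3 * t ^ 2 / 16) / u)) * heatKernel 0 (t / 2) u +
      t ^ 2 / 2 * ((u⁻¹ ^ 1 * Real.exp (-(3 * t ^ 2 / 16) / u)) * heatKernel 0 (t / 2) u) ≤
      (1 : ℕ).factorial / 1 * heatKernel 0 (t / 2) u +
      t ^ 2 / 2 * ((1 : ℕ).factorial / (3 * t ^ 2 / 16) ^ 1 * heatKernel 0 (t / 2) u) := by
    gcongr
    simpa using h0
  refine (mul_le_mul_of_nonneg_left h2 (by positivity)).trans ?_
  have e2 : 20 / t * ((2 * √Real.pi)⁻¹ * (t / 2 * heatKernel 0 (t / 2) u)) =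
      (2 * √Real.pi)⁻¹ * (10 * heatKernel 0 (t / 2) u) := by field_simp; ring
  rw [e2]
  refine mul_le_mul_of_nonneg_left ?_ (by positivity)
  have e3 : t ^ 2 / 2 * ((Nat.factorial 1 : ℝ) / (3 * t ^ 2 / 16) ^ 1 * heatKernel 0 (t / 2) u) =
      8 / 3 * heatKernel 0 (t / 2) u := by
    simp; field_simp; ring
  rw [e3]; simp; linarith

end StandardSemigroup
end SemigroupBMO

namespace SemigroupBMO

/-! ### Subordination of contraction semigroups -/

/-- A contraction semigroup `T` on `E` whose orbits can be integrated weakly against a separating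
family `Λ` of functionals. -/
structure SubordinationSystem (E : Type*) [NormedAddCommGroup E] [NormedSpace ℝ E] where
  T : ℝ → E →L[ℝ] E
  norm_T_le : ∀ r, 0 ≤ r → ‖T r‖ ≤ 1
  T_add : ∀ s t, 0 ≤ s → 0 ≤ t → T (s + t) = (T s).comp (T t)
  Λ : Set (E →L[ℝ] ℝ)
  separating : ∀ x, (∀ ω ∈ Λ, ω x = 0) → x = 0
  comp_mem : ∀ ω ∈ Λ, ∀ r, 0 ≤ r → ω.comp (T r) ∈ Λ
  measurable : ∀ ω ∈ Λ, ∀ x, Measurable fun u => ω (T (max u 0) x)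
  exists_integral : ∀ k : ℝ → ℝ, IntegrableOn k (Ioi 0) → ∀ x, ∃ y,
    ‖y‖ ≤ (∫ u in Ioi 0, |k u|) * ‖x‖ ∧ ∀ ω ∈ Λ, ω y = ∫ u in Ioi 0, k u * ω (T u x)

namespace SubordinationSystem

variable {E : Type*} [NormedAddCommGroup E] [NormedSpace ℝ E] (S : SubordinationSystem E)

lemma norm_T_apply_le {r : ℝ} (hr : 0 ≤ r) (x : E) : ‖S.T r x‖ ≤ ‖x‖ := by
  simpa using (S.T r).le_of_opNorm_le (S.norm_T_le r hr) x

lemma T_add_apply {s t : ℝ} (hs : 0 ≤ s) (ht : 0 ≤ t) (x : E) :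
    S.T (s + t) x = S.T s (S.T t x) := by
  rw [S.T_add s t hs ht]; rfl

lemma norm_map_T_le (ω : E →L[ℝ] ℝ) (x : E) (u : ℝ) : ‖ω (S.T (max u 0) x)‖ ≤ ‖ω‖ * ‖x‖ :=
  (ω.le_opNorm _).trans (mul_le_mul_of_nonneg_left (S.norm_T_apply_le (le_max_right _ _) x)
    (norm_nonneg _))

lemma integrableOn_mul {k : ℝ → ℝ} (hk : IntegrableOn k (Ioi 0)) {ω : E →L[ℝ] ℝ} (hω : ω ∈ S.Λ)
    (x : E) : IntegrableOn (fun u => k u * ω (S.T u x)) (Ioi 0) := by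
  have h : IntegrableOn (fun u => k u * ω (S.T (max u 0) x)) (Ioi 0) :=
    Integrable.mul_bdd (c := ‖ω‖ * ‖x‖) hk (S.measurable ω hω x).aestronglyMeasurable
      (ae_of_all _ (S.norm_map_T_le ω x))
  refine (integrableOn_congr_fun (fun u hu => ?_) measurableSet_Ioi).1 h
  simp only [max_eq_left (le_of_lt (mem_Ioi.1 hu))]

lemma ext {x y : E} (h : ∀ ω ∈ S.Λ, ω x = ω y) : x = y :=
  sub_eq_zero.1 (S.separating _ fun ω hω => by rw [map_sub, h ω hω, sub_self])

open Classical in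
/-- The operator `∫ k(u) T_u du`. -/
def integral (k : ℝ → ℝ) : E →L[ℝ] E :=
  if hk : IntegrableOn k (Ioi 0) then
    LinearMap.mkContinuous
      { toFun := fun x => (S.exists_integral k hk x).choose
        map_add' := fun x y => S.ext fun ω hω => by
          rw [map_add, (S.exists_integral k hk _).choose_spec.2 ω hω,
            (S.exists_integral k hk _).choose_spec.2 ω hω,
            (S.exists_integral k hk _).choose_spec.2 ω hω,
            ← integral_add (S.integrableOn_mul hk hω x) (S.integrableOn_mul hk hω y)]
          simp only [map_add, mul_add]
        map_smul' := fun c x => S.ext fun ω hω => by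
          rw [map_smul, (S.exists_integral k hk _).choose_spec.2 ω hω,
            (S.exists_integral k hk _).choose_spec.2 ω hω, ← integral_smul]
          simp only [map_smul, smul_eq_mul, RingHom.id_apply]
          congr 1; ext u; ring }
      (∫ u in Ioi 0, |k u|) fun x => (S.exists_integral k hk x).choose_spec.1
  else 0

variable {S} {k l m : ℝ → ℝ}

lemma map_integral (hk : IntegrableOn k (Ioi 0)) {ω : E →L[ℝ] ℝ} (hω : ω ∈ S.Λ) (x : E) :
    ω (S.integral k x) = ∫ u in Ioi 0, k u * ω (S.T u x) := by
  rw [integral, dif_pos hk]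
  exact (S.exists_integral k hk x).choose_spec.2 ω hω

lemma norm_integral_le (hk : IntegrableOn k (Ioi 0)) :
    ‖S.integral k‖ ≤ ∫ u in Ioi 0, |k u| := by
  rw [integral, dif_pos hk]
  exact LinearMap.mkContinuous_norm_le _ (integral_nonneg fun u => abs_nonneg _) _

lemma eq_integral (hk : IntegrableOn k (Ioi 0)) {x y : E}
    (h : ∀ ω ∈ S.Λ, ω y = ∫ u in Ioi 0, k u * ω (S.T u x)) : y = S.integral k x :=
  S.ext fun ω hω => by rw [h ω hω, map_integral hk hω]

lemma integral_sub_sub_smul (hk : IntegrableOn k (Ioi 0)) (hl : IntegrableOn l (Ioi 0))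
    (hm : IntegrableOn m (Ioi 0)) (c : ℝ) :
    S.integral k - S.integral l - c • S.integral m =
      S.integral fun u => k u - l u - c * m u := by
  ext x
  refine eq_integral ((hk.sub hl).sub (hm.const_mul c)) fun ω hω => ?_
  simp only [sub_apply, smul_apply, map_sub, map_smul, smul_eq_mul]
  have hi : IntegrableOn (fun u => k u * ω (S.T u x) - l u * ω (S.T u x)) (Ioi 0) :=
    (S.integrableOn_mul hk hω x).sub (S.integrableOn_mul hl hω x)
  rw [map_integral hk hω, map_integral hl hω, map_integral hm hω, ← integral_const_mul,
    ← integral_sub (S.integrableOn_mul hk hω x) (S.integrableOn_mul hl hω x),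
    ← integral_sub hi ((S.integrableOn_mul hm hω x).const_mul c)]
  congr 1; ext u
  simp only [Pi.sub_apply]
  ring

lemma norm_sub_sub_smul_le (hk : IntegrableOn k (Ioi 0)) (hl : IntegrableOn l (Ioi 0))
    (hm : IntegrableOn m (Ioi 0)) {c C : ℝ} {g : ℝ → ℝ} (hg : IntegrableOn g (Ioi 0))
    (h : ∀ u, 0 < u → |k u - l u - c * m u| ≤ g u * C) :
    ‖S.integral k - S.integral l - c • S.integral m‖ ≤ (∫ u in Ioi 0, g u) * C := by
  rw [integral_sub_sub_smul hk hl hm]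
  have hi := (hk.sub hl).sub (hm.const_mul c)
  refine (norm_integral_le hi).trans ?_
  rw [← integral_mul_const]
  exact setIntegral_mono_on hi.abs (hg.mul_const C) measurableSet_Ioi fun u hu => h u hu

lemma T_comp_integral (hk : IntegrableOn k (Ioi 0)) {r : ℝ} (hr : 0 ≤ r) :
    (S.T r).comp (S.integral k) = (S.integral k).comp (S.T r) := by
  ext x
  refine eq_integral hk fun ω hω => ?_
  have h := map_integral hk (S.comp_mem ω hω r hr) x
  simp only [ContinuousLinearMap.comp_apply] at h ⊢
  rw [h]
  refine setIntegral_congr_fun measurableSet_Ioi fun u hu => ?_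
  have hu' : 0 ≤ u := le_of_lt hu
  simp only [ContinuousLinearMap.coe_coe]
  rw [← S.T_add_apply hr hu', ← S.T_add_apply hu' hr, add_comm]

/-- Translates of kernels on the half line. -/
def shift (r : ℝ) (k : ℝ → ℝ) (u : ℝ) : ℝ := if r < u then k (u - r) else 0

lemma shift_eq (r : ℝ) (hr : 0 ≤ r) (k : ℝ → ℝ) :
    (Ioi 0).indicator (shift r k) = fun u => (Ioi 0).indicator k (u - r) := by
  ext u
  by_cases h : r < u
  · rw [indicator_of_mem (mem_Ioi.2 (hr.trans_lt h)), indicator_of_mem (mem_Ioi.2 (sub_pos.2 h)),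
      shift, if_pos h]
  · rw [indicator_of_notMem (s := Ioi (0 : ℝ)) (a := u - r) (by simpa using h)]
    by_cases h0 : 0 < u
    · rw [indicator_of_mem (mem_Ioi.2 h0), shift, if_neg h]
    · rw [indicator_of_notMem (by simpa using h0)]

lemma integrableOn_shift (hk : IntegrableOn k (Ioi 0)) {r : ℝ} (hr : 0 ≤ r) :
    IntegrableOn (shift r k) (Ioi 0) := by
  rw [← integrable_indicator_iff measurableSet_Ioi] at hk ⊢
  rw [shift_eq r hr]
  exact hk.comp_sub_right r

/-- A substitution u ↦ u − r in the scalar integrals, legitimate because ω ∘ T_r stays in Λ. It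
turns the difference quotients of the generator into difference quotients of densities. -/
lemma T_comp_integral_eq_shift (hk : IntegrableOn k (Ioi 0)) {r : ℝ} (hr : 0 ≤ r) :
    (S.T r).comp (S.integral k) = S.integral (shift r k) := by
  ext x
  refine eq_integral (integrableOn_shift hk hr) fun ω hω => ?_
  have h := map_integral hk (S.comp_mem ω hω r hr) x
  simp only [ContinuousLinearMap.comp_apply] at h ⊢
  rw [h, ← integral_indicator measurableSet_Ioi, ← integral_indicator measurableSet_Ioi,
    ← integral_sub_right_eq_self _ r]
  congr 1; ext u
  have e := congrFun (shift_eq r hr k) u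
  by_cases hu : r < u
  · have hu1 : u - r ∈ Ioi (0 : ℝ) := sub_pos.2 hu
    have hu2 : u ∈ Ioi (0 : ℝ) := hr.trans_lt hu
    rw [indicator_of_mem hu1, indicator_of_mem hu2]
    rw [indicator_of_mem hu1, indicator_of_mem hu2] at e
    rw [e, ← S.T_add_apply hr (le_of_lt hu1), add_sub_cancel]
  · have hu1 : u - r ∉ Ioi (0 : ℝ) := by simpa using hu
    rw [indicator_of_notMem hu1]
    by_cases hu2 : u ∈ Ioi (0 : ℝ)
    · rw [indicator_of_mem hu2, shift, if_neg hu, zero_mul]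
    · rw [indicator_of_notMem hu2]

/-- Fubini for scalar integrals: since ω ∘ T_u belongs to Λ, the inner integral can be evaluated,
and the double integral regroups by w = u + u'. -/
lemma integral_comp_integral (hk : IntegrableOn k (Ioi 0)) (hl : IntegrableOn l (Ioi 0))
    (hm : IntegrableOn m (Ioi 0))
    (h : ∀ w, 0 < w → ∫ u in Ioo 0 w, k u * l (w - u) = m w) :
    (S.integral k).comp (S.integral l) = S.integral m := by
  ext x
  refine eq_integral hm fun ω hω => ?_
  set K := (Ioi 0).indicator k with hK
  set L := (Ioi 0).indicator l with hL
  set g : ℝ → ℝ := fun u => ω (S.T (max u 0) x) with hg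
  have hKi : Integrable K := (integrable_indicator_iff measurableSet_Ioi).2 hk
  have hLi : Integrable L := (integrable_indicator_iff measurableSet_Ioi).2 hl
  have hint : Integrable (fun p : ℝ × ℝ => K p.2 * L (p.1 - p.2) * g p.1)
      (volume.prod volume) := by
    have h1 := hKi.convolution_integrand (ContinuousLinearMap.mul ℝ ℝ) hLi
    refine Integrable.mul_bdd (c := ‖ω‖ * ‖x‖) h1
      ((S.measurable ω hω x).comp measurable_fst).aestronglyMeasurable
      (ae_of_all _ fun p => S.norm_map_T_le ω x p.1)
  have h1 : ω (S.integral k (S.integral l x)) = ∫ u, ∫ w, K u * L (w - u) * g w := by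
    rw [map_integral hk hω, ← integral_indicator measurableSet_Ioi]
    congr 1; ext u
    by_cases hu : u ∈ Ioi (0 : ℝ)
    · have hu0 : 0 ≤ u := le_of_lt hu
      have h2 := map_integral hl (S.comp_mem ω hω u hu0) x
      simp only [ContinuousLinearMap.comp_apply] at h2
      rw [indicator_of_mem hu, h2, ← integral_const_mul, ← integral_indicator measurableSet_Ioi,
        ← integral_sub_right_eq_self _ u]
      congr 1; ext w
      rw [hK, hL, indicator_of_mem hu]
      by_cases hw : w - u ∈ Ioi (0 : ℝ)
      · have hw0 : 0 ≤ w - u := le_of_lt hw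
        rw [indicator_of_mem hw, indicator_of_mem hw, hg, mul_assoc, ← S.T_add_apply hu0 hw0,
          add_sub_cancel]
        simp only
        rw [max_eq_left (by linarith : 0 ≤ w)]
      · rw [indicator_of_notMem hw, indicator_of_notMem hw, mul_zero, zero_mul]
    · rw [hK, indicator_of_notMem hu, indicator_of_notMem hu]
      simp
  rw [ContinuousLinearMap.comp_apply, h1, ← integral_integral_swap hint,
    ← integral_indicator measurableSet_Ioi]
  congr 1; ext w
  rw [integral_mul_const]
  by_cases hw : w ∈ Ioi (0 : ℝ)
  · rw [indicator_of_mem hw, ← h w hw, ← integral_indicator measurableSet_Ioo, hg]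
    simp only
    rw [max_eq_left (le_of_lt hw)]
    congr 2; ext u
    rw [hK, hL]
    by_cases hu : u ∈ Ioo 0 w
    · rw [indicator_of_mem hu, indicator_of_mem (mem_Ioi.2 hu.1),
        indicator_of_mem (mem_Ioi.2 (sub_pos.2 hu.2))]
    · rw [indicator_of_notMem hu]
      by_cases h0 : 0 < u
      · rw [indicator_of_notMem (s := Ioi (0 : ℝ)) (a := w - u), mul_zero]
        simpa using fun h => hu ⟨h0, h⟩
      · rw [indicator_of_notMem (s := Ioi (0 : ℝ)) (a := u) (by simpa using h0), zero_mul]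
  · rw [indicator_of_notMem hw]
    have : ∀ u, K u * L (w - u) = 0 := fun u => by
      rw [hK, hL]
      by_cases h0 : 0 < u
      · rw [indicator_of_notMem (s := Ioi (0 : ℝ)) (a := w - u), mul_zero]
        simp only [mem_Ioi, not_lt] at hw ⊢
        linarith
      · rw [indicator_of_notMem (s := Ioi (0 : ℝ)) (a := u) (by simpa using h0), zero_mul]
    simp [this]

/-- Jensen's inequality for a positive form. -/
lemma form_integral_le (hk : IntegrableOn k (Ioi 0)) (hk0 : ∀ u, 0 < u → 0 ≤ k u)
    (hk1 : ∫ u in Ioi 0, k u = 1) (β : E → E → ℝ) (hβ : ∀ x, 0 ≤ β x x)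
    (hsub : ∀ x y, β (x - y) (x - y) = β x x - 2 * β x y + β y y)
    (x : E) (hΛ : ∃ ω ∈ S.Λ, ∀ y, β y (S.integral k x) = ω y) {b : ℝ → ℝ}
    (hb : IntegrableOn (fun u => k u * b u) (Ioi 0)) (hd : ∀ u, 0 < u → β (S.T u x) (S.T u x) ≤ b u) :
    β (S.integral k x) (S.integral k x) ≤ ∫ u in Ioi 0, k u * b u := by
  obtain ⟨ω, hω, h⟩ := hΛ
  set g := S.integral k x with hg
  have hi := S.integrableOn_mul hk hω x
  have h1 : ∫ u in Ioi 0, k u * ω (S.T u x) = β g g := by rw [← map_integral hk hω, ← h]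
  -- With g the average, integrate β(T_u x − g, T_u x − g) ≥ 0 against k. The cross term integrates
  -- to 2β(g,g) because β(·, g) is one of the functionals of Λ, and the last term to β(g,g).
  have h2 : 0 ≤ ∫ u in Ioi 0, (k u * b u - 2 * (k u * ω (S.T u x)) + k u * β g g) := by
    refine setIntegral_nonneg measurableSet_Ioi fun u hu => ?_
    have h3 := hβ (S.T u x - g)
    rw [hsub, h] at h3
    have h4 := mul_nonneg (hk0 u hu) (h3.trans (by linarith [hd u hu] :
      _ ≤ b u - 2 * ω (S.T u x) + β g g))
    linarith
  have hbi : IntegrableOn (fun u => k u * b u - 2 * (k u * ω (S.T u x))) (Ioi 0) :=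
    hb.sub (hi.const_mul 2)
  rw [integral_add hbi (hk.mul_const _), integral_sub hb (hi.const_mul 2),
    integral_const_mul, integral_mul_const, h1, hk1] at h2
  linarith

/-! ### The subordinated Poisson system -/

open StandardSemigroup

lemma hasDerivAt_of_norm_le {F : Type*} [NormedAddCommGroup F] [NormedSpace ℝ F] {f : ℝ → F}
    {f' : F} {t C : ℝ}
    (h : ∀ᶠ s in 𝓝 t, ‖f s - f t - (s - t) • f'‖ ≤ C * (s - t) ^ 2) : HasDerivAt f f' t := by
  rw [hasDerivAt_iff_isLittleO]
  refine Asymptotics.IsBigO.trans_isLittleO (g := fun s => ‖s - t‖ ^ 2) ?_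
    (Asymptotics.isLittleO_pow_sub_sub t one_lt_two)
  refine Asymptotics.IsBigO.of_bound C ?_
  filter_upwards [h] with s hs
  simpa using hs

variable (S)

/-- The Poisson semigroup subordinated to `T`. -/
def toPoissonSystem : PoissonSystem E where
  T := S.T
  P t := S.integral (subDensity t)
  dP t := S.integral (subDensityD t)
  ddP t := S.integral (subDensityDD t)
  norm_P_le t ht := by
    refine (norm_integral_le (integrableOn_subDensity ht)).trans (le_of_eq ?_)
    rw [← integral_subDensity ht]
    exact setIntegral_congr_fun measurableSet_Ioi fun u hu =>
      abs_of_nonneg (subDensity_nonneg ht.le hu)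
  P_add s t hs ht := by
    refine (integral_comp_integral (integrableOn_subDensity hs) (integrableOn_subDensity ht)
      (integrableOn_subDensity (add_pos hs ht)) fun w hw => ?_).symm
    rw [integral_eq_lintegral_of_nonneg_ae, lintegral_subDensity_mul hs ht hw,
      ENNReal.toReal_ofReal (subDensity_nonneg (add_pos hs ht).le hw)]
    · exact (ae_restrict_iff' measurableSet_Ioo).2 (ae_of_all _ fun u hu =>
        mul_nonneg (subDensity_nonneg hs.le hu.1) (subDensity_nonneg ht.le (sub_pos.2 hu.2)))
    · exact ((measurable_subDensity_right s).mul ((measurable_subDensity_right t).comp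
        (measurable_const.sub measurable_id))).aestronglyMeasurable
  comm r t hr ht := T_comp_integral (integrableOn_subDensity ht) hr
  hasDerivAt_P t ht := by
    obtain ⟨g, hg, h⟩ := exists_integrable_taylor_left ht
    refine hasDerivAt_of_norm_le (C := ∫ u in Ioi 0, g u) ?_
    filter_upwards [Icc_mem_nhds (half_lt_self ht) (by linarith : t < 2 * t)] with s hs
    exact norm_sub_sub_smul_le (integrableOn_subDensity (by linarith [hs.1]))
      (integrableOn_subDensity ht) (integrableOn_subDensityD ht) hg
      fun u hu => (h s u hs.1 hs.2 hu).1
  hasDerivAt_dP t ht := by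
    obtain ⟨g, hg, h⟩ := exists_integrable_taylor_left ht
    refine hasDerivAt_of_norm_le (C := ∫ u in Ioi 0, g u) ?_
    filter_upwards [Icc_mem_nhds (half_lt_self ht) (by linarith : t < 2 * t)] with s hs
    exact norm_sub_sub_smul_le (integrableOn_subDensityD (by linarith [hs.1]))
      (integrableOn_subDensityD ht) (integrableOn_subDensityDD ht) hg
      fun u hu => (h s u hs.1 hs.2 hu).2
  tendsto_dP := by
    refine squeeze_zero_norm' (a := fun t => 20 / t) ?_ (tendsto_const_nhds.div_atTop tendsto_id)
    filter_upwards [eventually_gt_atTop 0] with t ht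
    refine (norm_integral_le (integrableOn_subDensityD ht)).trans ?_
    calc _ ≤ ∫ u in Ioi 0, 20 / t * subDensity (t / 2) u :=
          setIntegral_mono_on (integrableOn_subDensityD ht).abs
            ((integrableOn_subDensity (half_pos ht)).const_mul _) measurableSet_Ioi
            fun u hu => abs_subDensityD_le_div ht hu
      _ = 20 / t := by rw [integral_const_mul, integral_subDensity (half_pos ht), mul_one]
  tendsto_gen t ht := by
    -- (1 − T_r)P_t has density k(u) − k(u−r) with k the density of P_t, so its first-order
    -- expansion in r is that of a translate.
    obtain ⟨g, hg, h⟩ := exists_integrable_taylor_right ht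
    rw [tendsto_iff_norm_sub_tendsto_zero]
    have hlim : Tendsto (fun r : ℝ => (∫ u in Ioi 0, g u) * r) (𝓝[>] 0) (𝓝 0) :=
      ((continuous_const.mul continuous_id).tendsto' 0 0 (by simp)).mono_left nhdsWithin_le_nhds
    refine squeeze_zero' (Eventually.of_forall fun r => norm_nonneg _) ?_ hlim
    filter_upwards [Ioo_mem_nhdsGT one_pos] with r hr
    have hi := integrableOn_subDensity ht
    have h1 := norm_sub_sub_smul_le (S := S) hi (integrableOn_shift hi hr.1.le)
      (integrableOn_subDensityDD ht) hg (c := r) (C := r ^ 2) fun u hu => h r u hr.1 hr.2 hu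
    rw [T_comp_integral_eq_shift hi hr.1.le]
    have e : r⁻¹ • (S.integral (subDensity t) - S.integral (shift r (subDensity t))) -
        S.integral (subDensityDD t) = r⁻¹ • (S.integral (subDensity t) -
          S.integral (shift r (subDensity t)) - r • S.integral (subDensityDD t)) := by
      rw [smul_sub r⁻¹ (_ - _), smul_smul, inv_mul_cancel₀ hr.1.ne', one_smul]
    rw [e, norm_smul, Real.norm_of_nonneg (inv_nonneg.2 hr.1.le)]
    calc _ ≤ r⁻¹ * ((∫ u in Ioi 0, g u) * r ^ 2) :=
          mul_le_mul_of_nonneg_left h1 (inv_nonneg.2 hr.1.le)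
      _ = _ := by have := hr.1.ne'; field_simp

end SubordinationSystem

/-- The transposed Poisson system. -/
def PoissonSystem.dual {E : Type*} [NormedAddCommGroup E] [NormedSpace ℝ E] (S : PoissonSystem E)
    (F : Type*) [NormedAddCommGroup F] [NormedSpace ℝ F] : PoissonSystem (E →L[ℝ] F) :=
  let D : (E →L[ℝ] E) →L[ℝ] ((E →L[ℝ] F) →L[ℝ] (E →L[ℝ] F)) :=
    (ContinuousLinearMap.compL ℝ E E F).flip
  { T := fun t => D (S.T t)
    P := fun t => D (S.P t)
    dP := fun t => D (S.dP t)
    ddP := fun t => D (S.ddP t)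
    norm_P_le := fun t ht => ContinuousLinearMap.opNorm_le_bound _ zero_le_one fun φ =>
      (ContinuousLinearMap.opNorm_comp_le φ (S.P t)).trans (by
        rw [one_mul]
        exact mul_le_of_le_one_right (norm_nonneg _) (S.norm_P_le t ht))
    P_add := fun s t hs ht => by
      -- Transposition reverses compositions, hence the exchange of s and t.
      rw [add_comm, S.P_add t s ht hs]; rfl
    comm := fun r t hr ht => by
      have := congrArg D (S.comm r t hr ht)
      exact this.symm
    hasDerivAt_P := fun t ht => D.hasFDerivAt.comp_hasDerivAt t (S.hasDerivAt_P t ht)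
    hasDerivAt_dP := fun t ht => D.hasFDerivAt.comp_hasDerivAt t (S.hasDerivAt_dP t ht)
    tendsto_dP := by
      have := (D.continuous.tendsto 0).comp S.tendsto_dP
      rwa [map_zero] at this
    tendsto_gen := fun t ht => by
      refine ((D.continuous.tendsto _).comp (S.tendsto_gen t ht)).congr' ?_
      filter_upwards [self_mem_nhdsWithin] with r hr
      simp only [Function.comp_apply, map_smul, map_sub]
      rw [S.comm r t (le_of_lt hr) ht]; rfl }

end SemigroupBMO

namespace SemigroupBMO

variable {H : Type u} [NormedAddCommGroup H] [InnerProductSpace ℂ H] [CompleteSpace H]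
variable {N : VonNeumannAlgebra H}

/-! ### Shortcut instances -/

instance : CStarAlgebra N := inferInstance
instance : SeminormedRing N := inferInstance
instance : NormedAddCommGroup N := inferInstance
instance : NormedSpace ℝ N := inferInstance
instance : Module ℝ N := inferInstance
instance : Algebra ℝ N := inferInstance
instance : Algebra ℝ≥0 N := inferInstance
instance : Module ℝ≥0 N := inferInstance
instance : SMulPosMono ℝ≥0 N := inferInstance
instance : PosSMulMono ℝ≥0 N := inferInstance
instance : AddRightMono N := inferInstance

namespace NSFTrace

variable (τ : NSFTrace N)

/-! ### The bimodule structure of `N ∩ L_2(N)` -/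

lemma apply_star_mul_self_mul_le (a x : N) :
    τ (star (a * x) * (a * x)) ≤ ENNReal.ofReal (‖a‖ ^ 2) * τ (star x * x) := by
  have h := star_left_conjugate_le_conjugate (CStarAlgebra.star_mul_le_algebraMap_norm_sq (a := a)) x
  have e : star x * algebraMap ℝ N (‖a‖ ^ 2) * x =
      (((‖a‖₊ ^ 2 : ℝ≥0) : ℝ) : ℂ) • (star x * x) := by
    rw [Algebra.algebraMap_eq_smul_one, mul_smul_comm, mul_one, smul_mul_assoc, Complex.coe_smul]
    simp
  rw [e] at h
  have e2 : star (a * x) * (a * x) = star x * (star a * a) * x := by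
    rw [star_mul]; simp only [mul_assoc]
  rw [e2]
  refine (τ.mono (by rw [← e2]; exact star_mul_self_nonneg _) h).trans_eq ?_
  refine (τ.map_smul' _ _ (star_mul_self_nonneg _)).trans ?_
  congr 1
  rw [ENNReal.ofReal_pow (norm_nonneg _), ofReal_norm, ENNReal.coe_pow]
  rfl

variable {τ}

/-- The element of `N ∩ L_2(N)` given by `x ∈ N` with `τ(x⋆x) < ∞`. -/
def PreL2.mk (x : N) (hx : τ (star x * x) < ∞) : τ.PreL2 := ⟨x, hx⟩

@[simp] lemma PreL2.val_mk (x : N) (hx : τ (star x * x) < ∞) : (PreL2.mk x hx).val = x := rfl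

lemma PreL2.ext {x y : τ.PreL2} (h : x.val = y.val) : x = y := Subtype.ext h

lemma PreL2.norm_le_of_le {x y : τ.PreL2} {c : ℝ} (hc : 0 ≤ c)
    (h : τ (star x.val * x.val) ≤ ENNReal.ofReal (c ^ 2) * τ (star y.val * y.val)) :
    ‖x‖ ≤ c * ‖y‖ := by
  have h1 := ENNReal.toReal_mono (ENNReal.mul_ne_top ENNReal.ofReal_ne_top y.lt_top.ne) h
  rw [ENNReal.toReal_mul, ENNReal.toReal_ofReal (sq_nonneg c), ← PreL2.norm_sq,
    ← PreL2.norm_sq] at h1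
  have h2 : 0 ≤ c * ‖y‖ := by positivity
  exact abs_le_of_sq_le_sq' (by nlinarith) h2 |>.2

lemma PreL2.star_lt_top (x : τ.PreL2) : τ (star (star x.val) * star x.val) < ∞ := by
  rw [star_star, ← τ.tracial']; exact x.lt_top

lemma PreL2.lmul_lt_top (a : N) (x : τ.PreL2) : τ (star (a * x.val) * (a * x.val)) < ∞ :=
  (τ.apply_star_mul_self_mul_le a x.val).trans_lt (ENNReal.mul_lt_top ENNReal.ofReal_lt_top x.lt_top)

lemma apply_star_mul_self_mul_le' (τ : NSFTrace N) (a x : N) :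
    τ (star (x * a) * (x * a)) ≤ ENNReal.ofReal (‖a‖ ^ 2) * τ (star x * x) := by
  have h := τ.apply_star_mul_self_mul_le (star a) (star x)
  rw [norm_star, ← star_mul, τ.tracial' (star x), τ.tracial' (x * a)] at *
  simpa using h

variable (τ) in
/-- Left multiplication on `N ∩ L_2(N)`. -/
def lmul : N →L[ℂ] τ.PreL2 →L[ℂ] τ.PreL2 :=
  LinearMap.mkContinuous₂
    (LinearMap.mk₂ ℂ (fun a x => PreL2.mk (a * x.val) (x.lmul_lt_top a))
      (fun a b x => PreL2.ext (add_mul a b x.val))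
      (fun c a x => PreL2.ext (smul_mul_assoc c a x.val))
      (fun a x y => PreL2.ext (mul_add a x.val y.val))
      (fun c a x => PreL2.ext (mul_smul_comm c a x.val))) 1
    (fun a x => by
      rw [one_mul]
      exact PreL2.norm_le_of_le (norm_nonneg _) (τ.apply_star_mul_self_mul_le a x.val))

variable (τ) in
/-- Right multiplication on `N ∩ L_2(N)`. -/
def rmulPre : N →L[ℂ] τ.PreL2 →L[ℂ] τ.PreL2 :=
  LinearMap.mkContinuous₂
    (LinearMap.mk₂ ℂ (fun a x => PreL2.mk (x.val * a)
        ((τ.apply_star_mul_self_mul_le' a x.val).trans_lt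
          (ENNReal.mul_lt_top ENNReal.ofReal_lt_top x.lt_top)))
      (fun a b x => PreL2.ext (mul_add x.val a b))
      (fun c a x => PreL2.ext (mul_smul_comm c x.val a))
      (fun a x y => PreL2.ext (add_mul x.val y.val a))
      (fun c a x => PreL2.ext (smul_mul_assoc c x.val a))) 1
    (fun a x => by
      rw [one_mul]
      exact PreL2.norm_le_of_le (norm_nonneg _) (τ.apply_star_mul_self_mul_le' a x.val))

/-- The involution of `N ∩ L_2(N)`. -/
def PreL2.adj (x : τ.PreL2) : τ.PreL2 := PreL2.mk (star x.val) x.star_lt_top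

@[simp] lemma val_lmul (a : N) (x : τ.PreL2) : (τ.lmul a x).val = a * x.val := rfl
@[simp] lemma val_rmulPre (a : N) (x : τ.PreL2) : (τ.rmulPre a x).val = x.val * a := rfl
@[simp] lemma PreL2.val_adj (x : τ.PreL2) : x.adj.val = star x.val := rfl

lemma lmul_mul (a b : N) (x : τ.PreL2) : τ.lmul (a * b) x = τ.lmul a (τ.lmul b x) :=
  PreL2.ext (mul_assoc a b x.val)

lemma rmulPre_mul (a b : N) (x : τ.PreL2) : τ.rmulPre (a * b) x = τ.rmulPre b (τ.rmulPre a x) :=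
  PreL2.ext (mul_assoc x.val a b).symm

lemma lmul_one (x : τ.PreL2) : τ.lmul 1 x = x := PreL2.ext (one_mul x.val)

lemma rmulPre_one (x : τ.PreL2) : τ.rmulPre 1 x = x := PreL2.ext (mul_one x.val)

lemma PreL2.norm_adj (x : τ.PreL2) : ‖x.adj‖ = ‖x‖ := by
  rw [PreL2.norm_def, PreL2.norm_def, PreL2.val_adj, star_star, ← τ.tracial']

lemma norm_lmul_le (a : N) (x : τ.PreL2) : ‖τ.lmul a x‖ ≤ ‖a‖ * ‖x‖ :=
  PreL2.norm_le_of_le (norm_nonneg _) (τ.apply_star_mul_self_mul_le a x.val)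

lemma norm_rmulPre_le (a : N) (x : τ.PreL2) : ‖τ.rmulPre a x‖ ≤ ‖a‖ * ‖x‖ :=
  PreL2.norm_le_of_le (norm_nonneg _) (τ.apply_star_mul_self_mul_le' a x.val)

/-- The inner product is defined by polarization, so only norms are accessible. Unitaries act
isometrically by left multiplication and span N, which gives the adjoint formula linearly. -/
lemma inner_lmul_left (a : N) (x y : τ.PreL2) :
    ⟪τ.lmul a x, y⟫_ℂ = ⟪x, τ.lmul (star a) y⟫_ℂ := by
  have ha : a ∈ Submodule.span ℂ (unitary N : Set N) := by
    rw [CStarAlgebra.span_unitary]; trivial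
  induction ha using Submodule.span_induction with
  | mem u hu =>
    have hiso : ∀ z : τ.PreL2, ‖τ.lmul u z‖ = ‖z‖ := fun z => by
      rw [PreL2.norm_def, PreL2.norm_def, val_lmul, star_mul, mul_assoc, ← mul_assoc (star u),
        Unitary.star_mul_self_of_mem hu, one_mul]
    have h := LinearIsometry.inner_map_map ⟨(τ.lmul u).toLinearMap, hiso⟩ x (τ.lmul (star u) y)
    rw [← h]
    change _ = ⟪τ.lmul u x, τ.lmul u (τ.lmul (star u) y)⟫_ℂ
    rw [← lmul_mul, Unitary.mul_star_self_of_mem hu, lmul_one]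
  | zero => simp
  | add a b _ _ ha hb => simp [ha, hb]
  | smul c a _ ha => simp [ha, mul_comm]

lemma inner_rmulPre_left (a : N) (x y : τ.PreL2) :
    ⟪τ.rmulPre a x, y⟫_ℂ = ⟪x, τ.rmulPre (star a) y⟫_ℂ := by
  have ha : a ∈ Submodule.span ℂ (unitary N : Set N) := by
    rw [CStarAlgebra.span_unitary]; trivial
  induction ha using Submodule.span_induction with
  | mem u hu =>
    have hiso : ∀ z : τ.PreL2, ‖τ.rmulPre u z‖ = ‖z‖ := fun z => by
      rw [PreL2.norm_def, PreL2.norm_def, val_rmulPre, τ.tracial', star_mul, mul_assoc,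
        ← mul_assoc u, Unitary.mul_star_self_of_mem hu, one_mul, τ.tracial']
    have h := LinearIsometry.inner_map_map ⟨(τ.rmulPre u).toLinearMap, hiso⟩ x
      (τ.rmulPre (star u) y)
    rw [← h]
    change _ = ⟪τ.rmulPre u x, τ.rmulPre u (τ.rmulPre (star u) y)⟫_ℂ
    rw [← rmulPre_mul, Unitary.star_mul_self_of_mem hu, rmulPre_one]
  | zero => simp
  | add a b _ _ ha hb => simp [ha, hb]
  | smul c a _ ha => simp [ha, mul_comm]

lemma PreL2.adj_add (x y : τ.PreL2) : (x + y).adj = x.adj + y.adj := PreL2.ext (star_add _ _)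
lemma PreL2.adj_sub (x y : τ.PreL2) : (x - y).adj = x.adj - y.adj := PreL2.ext (star_sub _ _)
lemma PreL2.adj_smul (c : ℂ) (x : τ.PreL2) : (c • x).adj = star c • x.adj :=
  PreL2.ext (star_smul _ _)

/-- The involution is an antilinear isometry by traciality; polarization then conjugates the inner
product. -/
lemma PreL2.inner_adj (x y : τ.PreL2) : ⟪x.adj, y.adj⟫_ℂ = ⟪y, x⟫_ℂ := by
  rw [inner_eq_sum_norm_sq_div_four x.adj, inner_eq_sum_norm_sq_div_four y, add_comm y x,
    norm_sub_rev y x]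
  have e1 : x.adj - (RCLike.I : ℂ) • y.adj = (x + (RCLike.I : ℂ) • y).adj := by
    rw [PreL2.adj_add, PreL2.adj_smul]; simp [sub_eq_add_neg]
  have e2 : x.adj + (RCLike.I : ℂ) • y.adj = (x - (RCLike.I : ℂ) • y).adj := by
    rw [PreL2.adj_sub, PreL2.adj_smul]; simp
  rw [e1, e2, ← PreL2.adj_add, ← PreL2.adj_sub]
  simp only [PreL2.norm_adj]
  have hI : ‖(RCLike.I : ℂ)‖ = 1 := by simp
  have f1 : ‖y - (RCLike.I : ℂ) • x‖ = ‖x + (RCLike.I : ℂ) • y‖ := by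
    have : y - (RCLike.I : ℂ) • x = -(RCLike.I : ℂ) • (x + (RCLike.I : ℂ) • y) := by
      rw [smul_add, smul_smul]; simp [sub_eq_add_neg, add_comm]
    rw [this, norm_smul]; simp
  have f2 : ‖y + (RCLike.I : ℂ) • x‖ = ‖x - (RCLike.I : ℂ) • y‖ := by
    have : y + (RCLike.I : ℂ) • x = (RCLike.I : ℂ) • (x - (RCLike.I : ℂ) • y) := by
      rw [smul_sub, smul_smul]; simp [add_comm]
    rw [this, norm_smul]; simp
  rw [f1, f2]

/-! ### Test functionals -/

variable (τ) in
/-- The functional `x ↦ ⟪c, x d⟫ = τ(c⋆ x d)`. -/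
def test (c d : τ.PreL2) : N →L[ℂ] ℂ := (innerSL ℂ c).comp (τ.lmul.flip d)

@[simp] lemma test_apply (c d : τ.PreL2) (x : N) : τ.test c d x = ⟪c, τ.lmul x d⟫_ℂ := rfl

lemma test_star_mul (c d : τ.PreL2) (a b : N) :
    τ.test c d (star a * b) = ⟪τ.lmul a c, τ.lmul b d⟫_ℂ := by
  rw [test_apply, lmul_mul, inner_lmul_left]

variable (τ) in
/-- The functional `x ↦ re τ(c⋆ x c)`. -/
def state (c : τ.PreL2) : N →L[ℝ] ℝ := Complex.reCLM.comp ((τ.test c c).restrictScalars ℝ)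

lemma state_apply (c : τ.PreL2) (x : N) : τ.state c x = (⟪c, τ.lmul x c⟫_ℂ).re := rfl

lemma state_star_mul_self (c : τ.PreL2) (a : N) : τ.state c (star a * a) = ‖τ.lmul a c‖ ^ 2 := by
  have := test_star_mul c c a a
  rw [test_apply] at this
  rw [state_apply, this, inner_self_eq_norm_sq_to_K]
  norm_cast

lemma exists_star_mul_self {x : N} (hx : 0 ≤ x) : ∃ a : N, 0 ≤ a ∧ x = star a * a :=
  ⟨CFC.sqrt x, CFC.sqrt_nonneg x, by
    rw [(CFC.sqrt_nonneg x).isSelfAdjoint.star_eq, CFC.sqrt_mul_sqrt_self x hx]⟩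

lemma state_nonneg (c : τ.PreL2) {x : N} (hx : 0 ≤ x) : 0 ≤ τ.state c x := by
  obtain ⟨a, -, rfl⟩ := exists_star_mul_self hx
  rw [state_star_mul_self]; positivity

lemma state_mono (c : τ.PreL2) {x y : N} (h : x ≤ y) : τ.state c x ≤ τ.state c y := by
  have := state_nonneg c (sub_nonneg.2 h)
  rw [map_sub] at this; linarith

lemma ofReal_state (c : τ.PreL2) {x : N} (hx : 0 ≤ x) :
    ENNReal.ofReal (τ.state c x) = τ (star c.val * x * c.val) := by
  obtain ⟨a, -, rfl⟩ := exists_star_mul_self hx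
  rw [state_star_mul_self, sq, PreL2.norm_sq, ENNReal.ofReal_toReal (τ.lmul a c).lt_top.ne, val_lmul,
    star_mul]
  simp only [mul_assoc]

lemma state_one (c : τ.PreL2) : τ.state c 1 = ‖c‖ ^ 2 := by
  have := state_star_mul_self c (1 : N)
  rwa [lmul_one, star_one, one_mul] at this

lemma state_lmul (c : τ.PreL2) (a x : N) : τ.state (τ.lmul a c) x = τ.state c (star a * x * a) := by
  rw [state_apply, state_apply, inner_lmul_left, ← lmul_mul, ← lmul_mul, mul_assoc]

/-- Semifiniteness gives a nonzero y ≤ x⋆x of finite trace. If x annihilated its square root, then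
y² = y^{1/2} y y^{1/2} ≤ 0 would force y = 0. -/
lemma exists_lmul_ne_zero {x : N} (hx : x ≠ 0) : ∃ c : τ.PreL2, τ.lmul x c ≠ 0 := by
  have h0 : star x * x ≠ 0 := fun h => hx ((CStarRing.star_mul_self_eq_zero_iff _).1 h)
  obtain ⟨y, hy0, hyx, hy, hfin⟩ := τ.semifinite' _ (star_mul_self_nonneg x) h0
  obtain ⟨s, hs0, hs⟩ := exists_star_mul_self hy0
  refine ⟨PreL2.mk s (by rwa [← hs]), fun h => hy ?_⟩
  have h1 : x * s = 0 := congrArg PreL2.val h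
  have h2 : star s * y * s ≤ 0 := by
    have := star_left_conjugate_le_conjugate hyx s
    rwa [mul_assoc (star s) (star x * x), mul_assoc (star x), h1, mul_zero, mul_zero] at this
  have h3 : 0 ≤ star s * y * s := star_left_conjugate_nonneg hy0 s
  have h4 : y * y = 0 := by
    have e : star s * y * s = y * y := by
      rw [hs, hs0.isSelfAdjoint.star_eq]; simp only [mul_assoc]
    rw [← e]; exact le_antisymm h2 h3
  have h5 : star y * y = 0 := by rwa [hy0.isSelfAdjoint.star_eq]
  exact (CStarRing.star_mul_self_eq_zero_iff _).1 h5

lemma eq_zero_of_test {x : N} (h : ∀ c d : τ.PreL2, τ.test c d x = 0) : x = 0 := by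
  by_contra hx
  obtain ⟨c, hc⟩ := exists_lmul_ne_zero (τ := τ) hx
  exact hc (inner_self_eq_zero.1 (h _ c))

lemma eq_zero_of_state {x : N} (hx : 0 ≤ x) (h : ∀ c : τ.PreL2, τ.state c x = 0) : x = 0 := by
  obtain ⟨a, -, rfl⟩ := exists_star_mul_self hx
  by_contra h0
  have ha : a ≠ 0 := fun h => h0 (by simp [h])
  obtain ⟨c, hc⟩ := exists_lmul_ne_zero (τ := τ) ha
  have := h c
  rw [state_star_mul_self] at this
  exact hc (norm_eq_zero.1 (pow_eq_zero_iff two_ne_zero |>.1 this))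

/-- Testing x at the vectors x⁻c gives −(x⁻)³, whose states are then both nonnegative and
nonpositive. Hence x⁻ = 0. -/
lemma nonneg_of_state {x : N} (hx : IsSelfAdjoint x) (h : ∀ c : τ.PreL2, 0 ≤ τ.state c x) :
    0 ≤ x := by
  have hn := CFC.negPart_nonneg x
  have e : x⁻ * x * x⁻ = -(x⁻ * x⁻ * x⁻) := by
    nth_rewrite 2 [← CFC.posPart_sub_negPart x hx]
    rw [mul_sub, CFC.negPart_mul_posPart, zero_sub, neg_mul]
  have h3 : 0 ≤ x⁻ * x⁻ * x⁻ := by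
    have := star_left_conjugate_nonneg hn x⁻
    rwa [hn.isSelfAdjoint.star_eq] at this
  have h1 : x⁻ * x⁻ * x⁻ = 0 := eq_zero_of_state (τ := τ) h3 fun c => by
    refine le_antisymm ?_ (state_nonneg c h3)
    have := h (τ.lmul x⁻ c)
    rw [state_lmul, hn.isSelfAdjoint.star_eq, e, map_neg] at this
    linarith
  have h2 : star (x⁻ * x⁻) * (x⁻ * x⁻) = 0 := by
    rw [star_mul, hn.isSelfAdjoint.star_eq]
    have : x⁻ * x⁻ * (x⁻ * x⁻) = x⁻ * x⁻ * x⁻ * x⁻ := by simp only [mul_assoc]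
    rw [this, h1, zero_mul]
  have h4 : star x⁻ * x⁻ = 0 := by
    rw [hn.isSelfAdjoint.star_eq]; exact (CStarRing.star_mul_self_eq_zero_iff _).1 h2
  rw [← CFC.posPart_sub_negPart x hx, (CStarRing.star_mul_self_eq_zero_iff _).1 h4, sub_zero]
  exact CFC.posPart_nonneg x

lemma le_of_state {x y : N} (hx : IsSelfAdjoint x) (hy : IsSelfAdjoint y)
    (h : ∀ c : τ.PreL2, τ.state c x ≤ τ.state c y) : x ≤ y :=
  sub_nonneg.1 (nonneg_of_state (τ := τ) (hy.sub hx) fun c => by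
    rw [map_sub]; exact sub_nonneg.2 (h c))

lemma norm_le_of_state {x : N} (hx : 0 ≤ x) {M : ℝ} (hM : 0 ≤ M)
    (h : ∀ c : τ.PreL2, ‖c‖ ≤ 1 → τ.state c x ≤ M) : ‖x‖ ≤ M := by
  rw [CStarAlgebra.norm_le_iff_le_algebraMap x hM hx]
  refine le_of_state (τ := τ) hx.isSelfAdjoint (IsSelfAdjoint.algebraMap N (.all M)) fun c => ?_
  rw [Algebra.algebraMap_eq_smul_one, map_smul, state_one, smul_eq_mul]
  rcases eq_or_ne c 0 with rfl | hc
  · simp [state_apply]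
  have hc' : 0 < ‖c‖ := norm_pos_iff.2 hc
  have h1 := h (((‖c‖⁻¹ : ℝ) : ℂ) • c) (by rw [norm_smul]; simp [hc'.ne'])
  have h2 : τ.state (((‖c‖⁻¹ : ℝ) : ℂ) • c) x = (‖c‖⁻¹) ^ 2 * τ.state c x := by
    rw [state_apply, state_apply, map_smul, inner_smul_left, inner_smul_right, Complex.conj_ofReal,
      ← mul_assoc, ← Complex.ofReal_mul, Complex.re_ofReal_mul, sq]
  rw [h2, inv_pow, inv_mul_le_iff₀ (by positivity)] at h1
  linarith

lemma state_le_norm (c : τ.PreL2) (hc : ‖c‖ ≤ 1) (x : N) : τ.state c x ≤ ‖x‖ := by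
  rw [state_apply]
  refine (Complex.re_le_norm _).trans ((norm_inner_le_norm _ _).trans ?_)
  have h := norm_lmul_le x c
  have h0 := norm_nonneg x
  have h1 := norm_nonneg c
  nlinarith [mul_le_mul_of_nonneg_left hc h0]

end NSFTrace
end SemigroupBMO

namespace SemigroupBMO

/-! ### The Kadison-Schwarz inequality -/

lemma exists_eq_star_mul_self {A : Type*} [NonUnitalCStarAlgebra A] [PartialOrder A]
    [StarOrderedRing A] {x : A} (hx : 0 ≤ x) : ∃ a, x = star a * a :=
  CStarAlgebra.nonneg_iff_eq_star_mul_self.1 hx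

/-- Complete positivity is used only for 2 × 2 matrices. The image of M⋆M, with first row (f, 1) in
M, has entries φ(f⋆f), φ(f⋆), φ(f), 1 and equals some Y⋆Y. -/
lemma kadison_schwarz {A B : Type*} [CStarAlgebra A] [CStarAlgebra B] [PartialOrder A]
    [PartialOrder B] [StarOrderedRing A] [StarOrderedRing B] (φ : A →CP B) (h1 : φ 1 = 1) (f : A) :
    star (φ f) * φ f ≤ φ (star f * f) := by
  set M : CStarMatrix (Fin 2) (Fin 2) A := CStarMatrix.ofMatrix !![f, 1; 0, 0] with hM
  have h := φ.map_cstarMatrix_nonneg (star M * M) (star_mul_self_nonneg M)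
  obtain ⟨Y, hY⟩ := exists_eq_star_mul_self h
  have e : ∀ i j, φ ((star M * M) i j) = ∑ k, star (Y k i) * Y k j := fun i j => by
    have h2 : φ ((star M * M) i j) = (star Y * Y) i j := congrFun (congrFun hY i) j
    rw [h2, CStarMatrix.mul_apply]
    simp [CStarMatrix.star_apply]
  have e00 := e 0 0
  have e01 := e 0 1
  have e10 := e 1 0
  have e11 := e 1 1
  simp [CStarMatrix.mul_apply, CStarMatrix.star_apply, hM, CStarMatrix.ofMatrix_apply,
    Fin.sum_univ_two, h1] at e00 e01 e10 e11
  have hs : star (φ f) = φ (star f) := by rw [e10, e01]; simp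
  -- The positive matrix Y⋆Y evaluated at the column (1, −φ f) is φ(f⋆f) − φ(f)⋆φ(f).
  have hz : 0 ≤ star (Y 0 0 - Y 0 1 * φ f) * (Y 0 0 - Y 0 1 * φ f) +
      star (Y 1 0 - Y 1 1 * φ f) * (Y 1 0 - Y 1 1 * φ f) :=
    add_nonneg (star_mul_self_nonneg _) (star_mul_self_nonneg _)
  have e' : star (Y 0 0 - Y 0 1 * φ f) * (Y 0 0 - Y 0 1 * φ f) +
      star (Y 1 0 - Y 1 1 * φ f) * (Y 1 0 - Y 1 1 * φ f) =
      (star (Y 0 0) * Y 0 0 + star (Y 1 0) * Y 1 0) -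
        (star (Y 0 0) * Y 0 1 + star (Y 1 0) * Y 1 1) * φ f -
        star (φ f) * (star (Y 0 1) * Y 0 0 + star (Y 1 1) * Y 1 0) +
        star (φ f) * (star (Y 0 1) * Y 0 1 + star (Y 1 1) * Y 1 1) * φ f := by
    simp only [star_sub, star_mul]; noncomm_ring
  rw [e', ← e00, ← e01, ← e10, ← e11, ← hs, mul_one, sub_add_cancel] at hz
  exact sub_nonneg.1 hz

variable {H : Type u} [NormedAddCommGroup H] [InnerProductSpace ℂ H] [CompleteSpace H]
variable {N : VonNeumannAlgebra H} {τ : NSFTrace N}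

/-! ### Contractivity, trace preservation and transposition of the semigroup -/

namespace StandardSemigroup

variable (S : StandardSemigroup τ)

lemma schwarz {t : ℝ} (ht : 0 ≤ t) (f : N) :
    star (S.T t f) * S.T t f ≤ S.T t (star f * f) :=
  kadison_schwarz _ (S.map_one' t ht) f

lemma T_nonneg (t : ℝ) {f : N} (hf : 0 ≤ f) : 0 ≤ S.T t f := map_nonneg _ hf

lemma T_mono (t : ℝ) {f g : N} (h : f ≤ g) : S.T t f ≤ S.T t g := OrderHomClass.mono (S.T t) h

lemma T_star (t : ℝ) (f : N) : S.T t (star f) = star (S.T t f) := map_star _ _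

lemma norm_T_apply_le {t : ℝ} (ht : 0 ≤ t) (f : N) : ‖S.T t f‖ ≤ ‖f‖ := by
  have h1 := S.T_mono t (CStarAlgebra.star_mul_le_algebraMap_norm_sq (a := f))
  have e : S.T t (algebraMap ℝ N (‖f‖ ^ 2)) = algebraMap ℝ N (‖f‖ ^ 2) := by
    rw [Algebra.algebraMap_eq_smul_one, ← Complex.coe_smul, map_smul, S.map_one' t ht]
  rw [e] at h1
  have h2 := (CStarAlgebra.norm_le_iff_le_algebraMap _ (sq_nonneg ‖f‖) (star_mul_self_nonneg _)).2
    ((S.schwarz ht f).trans h1)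
  rw [CStarRing.norm_star_mul_self] at h2
  have := norm_nonneg f
  exact abs_le_of_sq_le_sq' (by nlinarith) this |>.2

/-- `T_t` as a bounded operator, with `T_t` extended by the identity to `t ≤ 0`. -/
def TL (t : ℝ) : N →L[ℂ] N :=
  LinearMap.mkContinuous
    { toFun := fun f => S.T (max t 0) f
      map_add' := fun f g => map_add (S.T (max t 0)) f g
      map_smul' := fun c f => map_smul (S.T (max t 0)) c f } 1
    fun f => by rw [one_mul]; exact S.norm_T_apply_le (le_max_right _ _) f

lemma TL_apply {t : ℝ} (ht : 0 ≤ t) (f : N) : S.TL t f = S.T t f := by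
  change S.T (max t 0) f = _
  rw [max_eq_left ht]

lemma norm_TL_le (t : ℝ) : ‖S.TL t‖ ≤ 1 := LinearMap.mkContinuous_norm_le _ zero_le_one _

/-- Selfadjointness tested against b = 1, together with T_t(1) = 1. -/
lemma trace_T {t : ℝ} (ht : 0 ≤ t) {x : N} (hx : 0 ≤ x) : τ (S.T t x) = τ x := by
  obtain ⟨a, -, rfl⟩ := NSFTrace.exists_star_mul_self hx
  have h := S.selfadjoint' t ht a 1
  rwa [one_mul, star_one, mul_one, mul_one, S.map_one' t ht, mul_one, ← τ.tracial'] at h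

lemma T_finSq {t : ℝ} (ht : 0 ≤ t) (x : N) :
    τ (star (S.T t x) * S.T t x) ≤ τ (star x * x) :=
  (τ.mono (star_mul_self_nonneg _) (S.schwarz ht x)).trans_eq
    (S.trace_T ht (star_mul_self_nonneg x))

/-- `T_t` on `N ∩ L_2(N)`, with `T_t` extended by the identity to `t ≤ 0`. -/
def TPre (t : ℝ) : τ.PreL2 →L[ℂ] τ.PreL2 :=
  LinearMap.mkContinuous
    { toFun := fun x => NSFTrace.PreL2.mk (S.TL t x.val)
        ((S.T_finSq (le_max_right t 0) x.val).trans_lt x.lt_top)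
      map_add' := fun x y => NSFTrace.PreL2.ext (map_add (S.TL t) x.val y.val)
      map_smul' := fun c x => NSFTrace.PreL2.ext (map_smul (S.TL t) c x.val) } 1
    fun x => NSFTrace.PreL2.norm_le_of_le zero_le_one (by
      rw [one_pow, ENNReal.ofReal_one, one_mul]
      exact S.T_finSq (le_max_right t 0) x.val)

lemma val_TPre {t : ℝ} (ht : 0 ≤ t) (x : τ.PreL2) : (S.TPre t x).val = S.T t x.val :=
  S.TL_apply ht x.val

lemma norm_TPre_le (t : ℝ) : ‖S.TPre t‖ ≤ 1 := LinearMap.mkContinuous_norm_le _ zero_le_one _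

/-- The vector `T_t(c c⋆)^{1/2}`. -/
def push (t : ℝ) (c : τ.PreL2) : τ.PreL2 :=
  NSFTrace.PreL2.mk (CFC.sqrt (S.T (max t 0) (c.val * star c.val))) (by
    have h0 : 0 ≤ S.T (max t 0) (c.val * star c.val) := S.T_nonneg _ (mul_star_self_nonneg _)
    rw [(CFC.sqrt_nonneg _).isSelfAdjoint.star_eq, CFC.sqrt_mul_sqrt_self _ h0,
      S.trace_T (le_max_right _ _) (mul_star_self_nonneg _), ← τ.tracial']
    exact c.lt_top)

lemma norm_push (t : ℝ) (c : τ.PreL2) : ‖S.push t c‖ = ‖c‖ := by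
  have h0 : 0 ≤ S.T (max t 0) (c.val * star c.val) := S.T_nonneg _ (mul_star_self_nonneg _)
  rw [NSFTrace.PreL2.norm_def, NSFTrace.PreL2.norm_def]
  rw [push, NSFTrace.PreL2.val_mk, (CFC.sqrt_nonneg _).isSelfAdjoint.star_eq,
    CFC.sqrt_mul_sqrt_self _ h0, S.trace_T (le_max_right _ _) (mul_star_self_nonneg _),
    ← τ.tracial']

/-- Selfadjointness reads τ(T_t(x) cc⋆) = τ(x T_t(cc⋆)) for positive x, and positive elements span
N. Thus `push` transposes T_t at the level of vectors and keeps the pairings inside N ∩ L_2(N). -/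
lemma test_TL (t : ℝ) (c : τ.PreL2) (x : N) :
    τ.test c c (S.TL t x) = τ.test (S.push t c) (S.push t c) x := by
  have hx : x ∈ Submodule.span ℂ {a : N | 0 ≤ a} := by
    rw [CStarAlgebra.span_nonneg]; trivial
  induction hx using Submodule.span_induction with
  | mem x hx =>
    have hx : 0 ≤ x := hx
    obtain ⟨a, -, rfl⟩ := NSFTrace.exists_star_mul_self hx
    have h0 : 0 ≤ S.T (max t 0) (c.val * star c.val) := S.T_nonneg _ (mul_star_self_nonneg _)
    have hT : 0 ≤ S.TL t (star a * a) := S.T_nonneg _ hx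
    have key : τ.state c (S.TL t (star a * a)) = τ.state (S.push t c) (star a * a) := by
      have h := S.selfadjoint' (max t 0) (le_max_right _ _) a (star c.val)
      rw [star_star] at h
      have e : a * S.T (max t 0) (c.val * star c.val) * star a =
          star (star (S.push t c).val * star a) * (star (S.push t c).val * star a) := by
        have hq : (S.push t c).val * (S.push t c).val = S.T (max t 0) (c.val * star c.val) :=
          CFC.sqrt_mul_sqrt_self _ h0
        have hs : star (S.push t c).val = (S.push t c).val :=
          (CFC.sqrt_nonneg (S.T (max t 0) (c.val * star c.val))).isSelfAdjoint.star_eq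
        rw [star_mul, star_star, star_star, hs, ← hq]
        simp only [mul_assoc]
      rw [e, τ.tracial'] at h
      have h2 : ENNReal.ofReal (τ.state c (S.TL t (star a * a))) =
          ENNReal.ofReal (τ.state (S.push t c) (star a * a)) := by
        rw [τ.ofReal_state c hT, τ.ofReal_state _ hx]
        refine h.trans ?_
        simp only [star_mul, star_star, mul_assoc]
      rwa [ENNReal.ofReal_eq_ofReal_iff (τ.state_nonneg c hT) (τ.state_nonneg _ hx)] at h2
    have real : ∀ (d : τ.PreL2) (y : N), 0 ≤ y → τ.test d d y = (τ.state d y : ℂ) := by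
      intro d y hy
      obtain ⟨b, -, rfl⟩ := NSFTrace.exists_star_mul_self hy
      rw [NSFTrace.test_star_mul, NSFTrace.state_star_mul_self, inner_self_eq_norm_sq_to_K]
      simp
    rw [real c _ hT, real _ _ hx, key]
  | zero => simp
  | add a b _ _ ha hb => rw [map_add, map_add, map_add, ha, hb]
  | smul c a _ ha => rw [map_smul, map_smul, map_smul, ha]

lemma state_T {t : ℝ} (ht : 0 ≤ t) (c : τ.PreL2) (x : N) :
    τ.state c (S.T t x) = τ.state (S.push t c) x := by
  have := congrArg Complex.re (S.test_TL t c x)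
  rwa [S.TL_apply ht] at this

end StandardSemigroup
end SemigroupBMO

namespace SemigroupBMO

variable {H : Type u} [NormedAddCommGroup H] [InnerProductSpace ℂ H] [CompleteSpace H]
variable {N : VonNeumannAlgebra H}

/-! ### Strong limits and monotone sequences -/

variable (N) in
/-- The quadratic form `x ↦ re ⟪ξ, x ξ⟫` on `N`. -/
def vecState (ξ : H) (x : N) : ℝ := (⟪ξ, (x : H →L[ℂ] H) ξ⟫_ℂ).re

lemma coe_isSelfAdjoint {x : N} (hx : IsSelfAdjoint x) : IsSelfAdjoint (x : H →L[ℂ] H) :=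
  congrArg Subtype.val hx

lemma le_of_vecState {x y : N} (hx : IsSelfAdjoint x) (hy : IsSelfAdjoint y)
    (h : ∀ ξ, vecState N ξ x ≤ vecState N ξ y) : x ≤ y := by
  change (x : H →L[ℂ] H) ≤ y
  rw [ContinuousLinearMap.le_def, ContinuousLinearMap.isPositive_def']
  refine ⟨(coe_isSelfAdjoint hy).sub (coe_isSelfAdjoint hx), fun ξ => ?_⟩
  have h1 := h ξ
  rw [ContinuousLinearMap.reApplyInnerSelf_apply]
  rw [vecState, vecState] at h1
  rw [← inner_conj_symm, RCLike.conj_re, sub_apply, inner_sub_right, map_sub]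
  exact sub_nonneg.2 h1

lemma vecState_mono (ξ : H) {x y : N} (h : x ≤ y) : vecState N ξ x ≤ vecState N ξ y := by
  have h1 : (x : H →L[ℂ] H) ≤ y := h
  rw [ContinuousLinearMap.le_def] at h1
  have h2 := h1.2 ξ
  rw [ContinuousLinearMap.reApplyInnerSelf_apply, ← inner_conj_symm, RCLike.conj_re, sub_apply,
    inner_sub_right, map_sub] at h2
  exact sub_nonneg.1 h2

lemma vecState_star_mul_mul (ξ : H) (c x : N) :
    vecState N ξ (star c * x * c) = vecState N ((c : H →L[ℂ] H) ξ) x := by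
  rw [vecState, vecState]
  change (⟪ξ, ContinuousLinearMap.adjoint (c : H →L[ℂ] H)
    ((x : H →L[ℂ] H) ((c : H →L[ℂ] H) ξ))⟫_ℂ).re = _
  rw [ContinuousLinearMap.adjoint_inner_right]

lemma vecState_star_mul_self (ξ : H) (c : N) :
    vecState N ξ (star c * c) = ‖(c : H →L[ℂ] H) ξ‖ ^ 2 := by
  have := vecState_star_mul_mul ξ c 1
  rw [mul_one] at this
  rw [this, vecState]
  change (⟪(c : H →L[ℂ] H) ξ, (c : H →L[ℂ] H) ξ⟫_ℂ).re = _
  exact inner_self_eq_norm_sq (𝕜 := ℂ) _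

lemma vecState_add (ξ : H) (x y : N) : vecState N ξ (x + y) = vecState N ξ x + vecState N ξ y := by
  simp [vecState]

lemma vecState_sub (ξ : H) (x y : N) : vecState N ξ (x - y) = vecState N ξ x - vecState N ξ y := by
  simp [vecState]

lemma vecState_one (ξ : H) : vecState N ξ 1 = ‖ξ‖ ^ 2 := inner_self_eq_norm_sq (𝕜 := ℂ) ξ

lemma vecState_nonneg (ξ : H) {x : N} (hx : 0 ≤ x) : 0 ≤ vecState N ξ x := by
  have := vecState_mono ξ hx
  simpa [vecState] using this

lemma norm_sq_le_vecState (ξ : H) {x : N} (h0 : 0 ≤ x) (h1 : x ≤ 1) :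
    ‖(x : H →L[ℂ] H) ξ‖ ^ 2 ≤ vecState N ξ x := by
  obtain ⟨s, hs, hsx⟩ := NSFTrace.exists_star_mul_self h0
  rw [← vecState_star_mul_self]
  refine vecState_mono ξ ?_
  have := star_left_conjugate_le_conjugate h1 s
  rw [hs.isSelfAdjoint.star_eq] at hsx this
  have e : star x * x = s * x * s := by
    rw [h0.isSelfAdjoint.star_eq, hsx]; simp only [mul_assoc]
  rw [e]
  refine this.trans_eq ?_
  rw [mul_one, hsx]

/-- The limit operator is bounded by Banach–Steinhaus, and commutes with N' because each term does;
the double commutant theorem puts it in N. -/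
lemma exists_strong_limit {ι : Type*} {l : Filter ι} [l.IsCountablyGenerated] [l.NeBot]
    (a : ι → N) (h : ∀ ξ : H, ∃ η, Tendsto (fun i => (a i : H →L[ℂ] H) ξ) l (𝓝 η)) :
    ∃ x : N, ∀ ξ : H, Tendsto (fun i => (a i : H →L[ℂ] H) ξ) l (𝓝 ((x : H →L[ℂ] H) ξ)) := by
  choose f hf using h
  set g : H →L[ℂ] H := continuousLinearMapOfTendsto (fun i => (a i : H →L[ℂ] H))
    (f := f) (l := l) (tendsto_pi_nhds.2 hf) with hg
  have hgf : ∀ ξ, g ξ = f ξ := fun ξ => rfl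
  refine ⟨⟨g, ?_⟩, fun ξ => by simpa [hgf] using hf ξ⟩
  rw [← N.commutant_commutant, VonNeumannAlgebra.mem_commutant_iff]
  intro m hm
  ext ξ
  rw [VonNeumannAlgebra.mem_commutant_iff] at hm
  have h1 : Tendsto (fun i => m ((a i : H →L[ℂ] H) ξ)) l (𝓝 (m (g ξ))) :=
    (m.continuous.tendsto _).comp (hf ξ)
  refine tendsto_nhds_unique h1 ((hf (m ξ)).congr fun i => ?_)
  exact DFunLike.congr_fun (hm (a i) (a i).2) ξ

lemma isSelfAdjoint_of_tendsto {ι : Type*} {l : Filter ι} [l.NeBot] {a : ι → N} {x : N}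
    (ha : ∀ i, IsSelfAdjoint (a i))
    (h : ∀ ξ : H, Tendsto (fun i => (a i : H →L[ℂ] H) ξ) l (𝓝 ((x : H →L[ℂ] H) ξ))) :
    IsSelfAdjoint x := by
  apply Subtype.ext
  change star (x : H →L[ℂ] H) = x
  rw [← isSelfAdjoint_iff, ContinuousLinearMap.isSelfAdjoint_iff_isSymmetric]
  intro ξ η
  have h1 : Tendsto (fun i => ⟪(a i : H →L[ℂ] H) ξ, η⟫_ℂ) l (𝓝 ⟪(x : H →L[ℂ] H) ξ, η⟫_ℂ) :=
    (h ξ).inner tendsto_const_nhds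
  have h2 : Tendsto (fun i => ⟪ξ, (a i : H →L[ℂ] H) η⟫_ℂ) l (𝓝 ⟪ξ, (x : H →L[ℂ] H) η⟫_ℂ) :=
    tendsto_const_nhds.inner (h η)
  refine tendsto_nhds_unique h1 (h2.congr fun i => ?_)
  exact ((ContinuousLinearMap.isSelfAdjoint_iff_isSymmetric.1 (coe_isSelfAdjoint (ha i))) ξ η).symm

lemma tendsto_vecState {ι : Type*} {l : Filter ι} {a : ι → N} {x : N} {ξ : H}
    (h : Tendsto (fun i => (a i : H →L[ℂ] H) ξ) l (𝓝 ((x : H →L[ℂ] H) ξ))) :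
    Tendsto (fun i => vecState N ξ (a i)) l (𝓝 (vecState N ξ x)) :=
  (Complex.continuous_re.tendsto _).comp (tendsto_const_nhds.inner h)

/-- A bounded increasing sequence of positive elements has a strong limit. -/
lemma exists_limit_of_monotone {a : ℕ → N} (ha : Monotone a) (h0 : ∀ n, 0 ≤ a n)
    (h1 : ∀ n, a n ≤ 1) : ∃ x : N, 0 ≤ x ∧ x ≤ 1 ∧ (∀ n, a n ≤ x) ∧
      ∀ ξ : H, Tendsto (fun n => (a n : H →L[ℂ] H) ξ) atTop (𝓝 ((x : H →L[ℂ] H) ξ)) := by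
  have hlim : ∀ ξ : H, ∃ η, Tendsto (fun n => (a n : H →L[ℂ] H) ξ) atTop (𝓝 η) := by
    intro ξ
    have hm : Monotone fun n => vecState N ξ (a n) := fun m n h => vecState_mono ξ (ha h)
    have hb : BddAbove (range fun n => vecState N ξ (a n)) := by
      refine ⟨‖ξ‖ ^ 2, ?_⟩
      rintro _ ⟨n, rfl⟩
      exact (vecState_mono ξ (h1 n)).trans_eq (vecState_one ξ)
    have ht := (tendsto_atTop_ciSup hm hb).cauchySeq
    refine cauchySeq_tendsto_of_complete (Metric.cauchySeq_iff'.2 fun ε hε => ?_)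
    obtain ⟨n₀, hn₀⟩ := Metric.cauchySeq_iff'.1 ht (ε ^ 2) (by positivity)
    refine ⟨n₀, fun n hn => ?_⟩
    have hd := hn₀ n hn
    rw [dist_eq_norm] at hd ⊢
    have hle : a n₀ ≤ a n := ha hn
    have h2 : ‖((a n - a n₀ : N) : H →L[ℂ] H) ξ‖ ^ 2 ≤ vecState N ξ (a n - a n₀) :=
      norm_sq_le_vecState ξ (sub_nonneg.2 hle) ((sub_le_self _ (h0 _)).trans (h1 n))
    rw [vecState_sub] at h2
    have h3 : ‖((a n : H →L[ℂ] H)) ξ - (a n₀ : H →L[ℂ] H) ξ‖ ^ 2 < ε ^ 2 :=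
      (h2.trans (le_abs_self _)).trans_lt hd
    exact lt_of_pow_lt_pow_left₀ 2 hε.le h3
  obtain ⟨x, hx⟩ := exists_strong_limit a hlim
  have hxs := isSelfAdjoint_of_tendsto (fun n => (h0 n).isSelfAdjoint) hx
  have hle : ∀ n, a n ≤ x := fun n => le_of_vecState (h0 n).isSelfAdjoint hxs fun ξ =>
    ge_of_tendsto (tendsto_vecState (hx ξ)) (by
      filter_upwards [eventually_ge_atTop n] with m hm using vecState_mono ξ (ha hm))
  refine ⟨x, (h0 0).trans (hle 0), ?_, hle, hx⟩
  exact le_of_vecState hxs (.one _) fun ξ =>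
    le_of_tendsto (tendsto_vecState (hx ξ)) (Eventually.of_forall fun m => vecState_mono ξ (h1 m))

/-! ### Normality of the states of the trace -/

variable {τ : NSFTrace N}

namespace NSFTrace

/-- Compressing D by c gives a directed set with supremum c⋆xc, to which normality of τ applies.
That x is the supremum is only used through vector states. -/
lemma state_normal (c : τ.PreL2) {D : Set N} (hD : D.Nonempty) (hdir : DirectedOn (· ≤ ·) D)
    (h0 : ∀ d ∈ D, 0 ≤ d) {x : N} (hx : ∀ d ∈ D, d ≤ x)
    (hsup : ∀ ξ, ∀ δ > 0, ∃ d ∈ D, vecState N ξ x ≤ vecState N ξ d + δ) {ε : ℝ} (hε : 0 < ε) :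
    ∃ d ∈ D, τ.state c x ≤ τ.state c d + ε := by
  obtain ⟨d₀, hd₀⟩ := hD
  have hx0 : 0 ≤ x := (h0 d₀ hd₀).trans (hx d₀ hd₀)
  set D' : Set N := (fun d => star c.val * d * c.val) '' D with hD'
  have hlub : IsLUB D' (star c.val * x * c.val) := by
    constructor
    · rintro _ ⟨d, hd, rfl⟩
      exact star_left_conjugate_le_conjugate (hx d hd) _
    · intro b hb
      have hb0 : 0 ≤ b := (star_left_conjugate_nonneg (h0 d₀ hd₀) c.val).trans
        (hb ⟨d₀, hd₀, rfl⟩)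
      refine le_of_vecState (star_left_conjugate_nonneg hx0 c.val).isSelfAdjoint
        hb0.isSelfAdjoint fun ξ => le_of_forall_pos_le_add fun δ hδ => ?_
      obtain ⟨d, hd, h⟩ := hsup ((c.val : H →L[ℂ] H) ξ) δ hδ
      have h1 := vecState_mono ξ (hb ⟨d, hd, rfl⟩ : star c.val * d * c.val ≤ b)
      rw [vecState_star_mul_mul] at h1 ⊢
      linarith
  have hn := τ.normal' D' ⟨_, d₀, hd₀, rfl⟩ (by
    rintro _ ⟨d, hd, rfl⟩ _ ⟨e, he, rfl⟩
    obtain ⟨f, hf, hdf, hef⟩ := hdir d hd e he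
    exact ⟨_, ⟨f, hf, rfl⟩, star_left_conjugate_le_conjugate hdf _,
      star_left_conjugate_le_conjugate hef _⟩) (by
    rintro _ ⟨d, hd, rfl⟩
    exact star_left_conjugate_nonneg (h0 d hd) _) _ hlub
  by_contra! hcon
  have hpos : 0 < τ.state c x - ε := by
    linarith [hcon d₀ hd₀, state_nonneg c (h0 d₀ hd₀)]
  have h1 : τ (star c.val * x * c.val) ≤ ENNReal.ofReal (τ.state c x - ε) := by
    rw [hn]
    refine iSup₂_le ?_
    rintro _ ⟨d, hd, rfl⟩
    rw [← ofReal_state c (h0 d hd)]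
    exact ENNReal.ofReal_le_ofReal (by linarith [hcon d hd])
  rw [← ofReal_state c hx0, ENNReal.ofReal_le_ofReal_iff hpos.le] at h1
  linarith

lemma state_normal_seq (c : τ.PreL2) {a : ℕ → N} (ha : Monotone a) (h0 : ∀ n, 0 ≤ a n) {x : N}
    (hx : ∀ n, a n ≤ x)
    (hlim : ∀ ξ : H, Tendsto (fun n => (a n : H →L[ℂ] H) ξ) atTop (𝓝 ((x : H →L[ℂ] H) ξ)))
    {ε : ℝ} (hε : 0 < ε) : ∃ n, τ.state c x ≤ τ.state c (a n) + ε := by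
  obtain ⟨_, ⟨n, rfl⟩, h⟩ := state_normal c (D := range a) (range_nonempty a)
    (by
      rintro _ ⟨m, rfl⟩ _ ⟨n, rfl⟩
      exact ⟨_, ⟨max m n, rfl⟩, ha (le_max_left _ _), ha (le_max_right _ _)⟩)
    (by rintro _ ⟨n, rfl⟩; exact h0 n) (by rintro _ ⟨n, rfl⟩; exact hx n)
    (fun ξ δ hδ => by
      obtain ⟨n, hn⟩ := ((tendsto_vecState (hlim ξ)).eventually
        (lt_mem_nhds (sub_lt_self _ hδ))).exists
      exact ⟨_, ⟨n, rfl⟩, by linarith⟩) hε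
  exact ⟨n, h⟩

end NSFTrace

/-! ### Cyclic projections -/

variable (N) in
/-- The closure of `N' F`. -/
def cyclicSpace (F : Set H) : Submodule ℂ H :=
  (Submodule.span ℂ {η | ∃ m ∈ N.commutant, ∃ ξ ∈ F, η = m ξ}).topologicalClosure

instance (F : Set H) : (cyclicSpace N F).HasOrthogonalProjection :=
  haveI : CompleteSpace (cyclicSpace N F) :=
    (Submodule.isClosed_topologicalClosure _).completeSpace_coe
  inferInstance

lemma subset_cyclicSpace {F : Set H} {ξ : H} (hξ : ξ ∈ F) : ξ ∈ cyclicSpace N F :=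
  Submodule.le_topologicalClosure _ (Submodule.subset_span ⟨1, one_mem _, ξ, hξ, rfl⟩)

lemma cyclicSpace_mono {F G : Set H} (h : F ⊆ G) : cyclicSpace N F ≤ cyclicSpace N G :=
  Submodule.topologicalClosure_mono (Submodule.span_mono fun _ ⟨m, hm, ξ, hξ, e⟩ =>
    ⟨m, hm, ξ, h hξ, e⟩)

variable (N) in
/-- The projection onto the closure of `N' F`, an element of `N`. -/
def cyclicProj (F : Set H) : N :=
  ⟨(cyclicSpace N F).starProjection, by
    -- A projection belongs to N as soon as its range is invariant under the commutant.
    rw [VonNeumannAlgebra.IsStarProjection.mem_iff isStarProjection_starProjection]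
    intro y hy
    rw [Submodule.range_starProjection, Module.End.mem_invtSubmodule, ← Submodule.map_le_iff_le_comap]
    refine (Submodule.topologicalClosure_map y _).trans
      (Submodule.topologicalClosure_mono ?_)
    rw [Submodule.map_span_le]
    rintro _ ⟨m, hm, ξ, hξ, rfl⟩
    exact Submodule.subset_span ⟨y * m, mul_mem hy hm, ξ, hξ, rfl⟩⟩

lemma cyclicProj_mul_self (F : Set H) : cyclicProj N F * cyclicProj N F = cyclicProj N F :=
  Subtype.ext (isStarProjection_starProjection (U := cyclicSpace N F)).isIdempotentElem.eq

lemma cyclicProj_isSelfAdjoint (F : Set H) : IsSelfAdjoint (cyclicProj N F) :=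
  Subtype.ext (isStarProjection_starProjection (U := cyclicSpace N F)).isSelfAdjoint.star_eq

lemma cyclicProj_nonneg (F : Set H) : 0 ≤ cyclicProj N F := by
  have := star_mul_self_nonneg (cyclicProj N F)
  rwa [(cyclicProj_isSelfAdjoint F).star_eq, cyclicProj_mul_self] at this

lemma cyclicProj_le_one (F : Set H) : cyclicProj N F ≤ 1 := by
  have := star_mul_self_nonneg (1 - cyclicProj N F)
  rw [star_sub, star_one, (cyclicProj_isSelfAdjoint F).star_eq, sub_mul, one_mul, mul_sub, mul_one,
    cyclicProj_mul_self, sub_self, sub_zero] at this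
  exact sub_nonneg.1 this

lemma cyclicProj_mono {F G : Set H} (h : F ⊆ G) : cyclicProj N F ≤ cyclicProj N G := by
  have e1 : cyclicProj N G * cyclicProj N F = cyclicProj N F := by
    apply Subtype.ext
    ext ξ
    change (cyclicSpace N G).starProjection ((cyclicSpace N F).starProjection ξ) =
      (cyclicSpace N F).starProjection ξ
    rw [Submodule.starProjection_eq_self_iff]
    exact cyclicSpace_mono h (Submodule.starProjection_apply_mem _ _)
  have h2 := star_left_conjugate_le_conjugate (cyclicProj_le_one (N := N) F) (cyclicProj N G)
  have e2 : cyclicProj N F * cyclicProj N G = cyclicProj N F := by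
    have := congrArg star e1
    rwa [star_mul, (cyclicProj_isSelfAdjoint F).star_eq, (cyclicProj_isSelfAdjoint G).star_eq]
      at this
  rwa [(cyclicProj_isSelfAdjoint G).star_eq, e1, e2, mul_one, cyclicProj_mul_self] at h2

/-- The kernel of y is closed and invariant under the commutant, hence contains the whole cyclic
space once it contains F. -/
lemma mul_cyclicProj_eq_zero {F : Set H} {y : N} (h : ∀ ξ ∈ F, (y : H →L[ℂ] H) ξ = 0) :
    y * cyclicProj N F = 0 := by
  apply Subtype.ext
  ext η
  have hle : cyclicSpace N F ≤ LinearMap.ker (y : H →L[ℂ] H).toLinearMap := by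
    refine Submodule.topologicalClosure_minimal _ ?_ (y : H →L[ℂ] H).isClosed_ker
    rw [Submodule.span_le]
    rintro _ ⟨m, hm, ξ, hξ, rfl⟩
    rw [VonNeumannAlgebra.mem_commutant_iff] at hm
    have := DFunLike.congr_fun (hm y y.2) ξ
    change (y : H →L[ℂ] H) (m ξ) = 0
    change (y : H →L[ℂ] H) (m ξ) = m ((y : H →L[ℂ] H) ξ) at this
    rw [this, h ξ hξ, map_zero]
  exact hle (Submodule.starProjection_apply_mem _ η)

namespace NSFTrace

/-- The cyclic projections of finite sets form an increasing net with supremum 1, since each vector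
lies in its own cyclic space. Order normality of the state does the rest. -/
lemma exists_finset_state_compl_le (c : τ.PreL2) {ε : ℝ} (hε : 0 < ε) :
    ∃ F : Finset H, τ.state c (1 - cyclicProj N (F : Set H)) ≤ ε := by
  obtain ⟨_, ⟨F, rfl⟩, h⟩ := state_normal c (x := 1)
    (D := range fun F : Finset H => cyclicProj N (F : Set H)) (range_nonempty _)
    (by
      classical
      rintro _ ⟨F, rfl⟩ _ ⟨G, rfl⟩
      exact ⟨_, ⟨F ∪ G, rfl⟩, cyclicProj_mono (by simp), cyclicProj_mono (by simp)⟩)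
    (by rintro _ ⟨F, rfl⟩; exact cyclicProj_nonneg _)
    (by rintro _ ⟨F, rfl⟩; exact cyclicProj_le_one _)
    (fun ξ δ hδ => by
      refine ⟨_, ⟨{ξ}, rfl⟩, ?_⟩
      have e : ((cyclicProj N (({ξ} : Finset H) : Set H) : N) : H →L[ℂ] H) ξ = ξ :=
        Submodule.starProjection_eq_self_iff.2 (subset_cyclicSpace (by simp))
      have : vecState N ξ (cyclicProj N (({ξ} : Finset H) : Set H)) = vecState N ξ 1 := by
        rw [vecState, e]; rfl
      simp only
      rw [this]; linarith) hε
  exact ⟨F, by rw [map_sub]; linarith⟩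

end NSFTrace

/-! ### Domination of the states of the trace by vector states -/

/-- The function `x / (1 + x)` of a positive element. -/
def damp (x : N) : N := cfcₙ (fun t : ℝ≥0 => 1 - (1 + t)⁻¹) x

lemma damp_nonneg (x : N) : 0 ≤ damp x := cfcₙ_nonneg fun _ _ => zero_le

lemma damp_le_one (x : N) : damp x ≤ 1 :=
  (CStarAlgebra.norm_le_one_iff_of_nonneg _ (damp_nonneg x)).1
    (norm_cfcₙ_one_sub_one_add_inv_lt_one x).le

lemma damp_mono {x y : N} (hx : 0 ≤ x) (h : x ≤ y) : damp x ≤ damp y :=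
  CFC.monotoneOn_one_sub_one_add_inv (mem_Ici.2 hx) (mem_Ici.2 (hx.trans h)) h

lemma continuous_damp : Continuous fun t : ℝ≥0 => 1 - (1 + t)⁻¹ := by
  refine continuous_const.sub ((continuous_const.add continuous_id).inv₀ fun t => ?_)
  simp

lemma damp_le_self {x : N} (hx : 0 ≤ x) : damp x ≤ x := by
  conv_rhs => rw [← cfcₙ_id ℝ≥0 x]
  refine cfcₙ_mono (fun t _ => ?_) continuous_damp.continuousOn
  rw [id, tsub_le_iff_right, ← NNReal.coe_le_coe]
  push_cast
  have : (0 : ℝ) ≤ t := t.2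
  have h1 : 0 < 1 + (t : ℝ) := by linarith
  have e : (t : ℝ) + (1 + (t : ℝ))⁻¹ - 1 = (t : ℝ) ^ 2 / (1 + (t : ℝ)) := by field_simp; ring
  have : 0 ≤ (t : ℝ) ^ 2 / (1 + t) := by positivity
  linarith

lemma le_two_smul_damp {x : N} (hx : 0 ≤ x) (h1 : x ≤ 1) : x ≤ (2 : ℝ≥0) • damp x := by
  conv_lhs => rw [← cfcₙ_id ℝ≥0 x]
  rw [damp, ← cfcₙ_const_mul (2 : ℝ≥0) _ x continuous_damp.continuousOn]
  refine cfcₙ_mono (fun t ht => ?_) continuous_id.continuousOn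
    (continuous_const.mul continuous_damp).continuousOn
  have ht1 : (t : ℝ) ≤ 1 := by
    have h2 : ‖t‖₊ ≤ ‖x‖₊ := CStarAlgebra.le_nnnorm_of_mem_quasispectrum ht
    have h3 := (CStarAlgebra.norm_le_one_iff_of_nonneg x hx).2 h1
    have h4 : (‖t‖₊ : ℝ) ≤ ‖x‖ := h2
    simpa using h4.trans h3
  have ht0 : (0 : ℝ) ≤ t := t.2
  have h5 : (1 + t)⁻¹ ≤ (1 : ℝ≥0) := inv_le_one_of_one_le₀ (by simp)
  rw [id, ← NNReal.coe_le_coe, NNReal.coe_mul, NNReal.coe_sub h5]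
  push_cast
  have e : 2 * (1 - (1 + (t : ℝ))⁻¹) - t = t * (1 - t) / (1 + t) := by
    field_simp; ring
  have : 0 ≤ (t : ℝ) * (1 - t) / (1 + t) := by
    have : 0 ≤ 1 - (t : ℝ) := by linarith
    positivity
  linarith

namespace NSFTrace

/-- An absolute continuity statement proved in the manner of Borel–Cantelli. If it failed with C =
2^n for every n, there would be x_n of state at least ε whose vector states on F are O(2^{−n}). A
noncommutative limsup of the x_n then has state at least 3ε/8 but lives under 1 − p_F, of state at
most ε/4. -/
lemma exists_state_le (c : τ.PreL2) {ε : ℝ} (hε : 0 < ε) : ∃ (F : Finset H) (C : ℝ), 0 ≤ C ∧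
    ∀ x : N, 0 ≤ x → x ≤ 1 → τ.state c x ≤ ε + C * ∑ ξ ∈ F, vecState N ξ x := by
  obtain ⟨F, hF⟩ := exists_finset_state_compl_le c (show 0 < ε / 4 by positivity)
  by_contra! hcon
  have hcon' : ∀ n : ℕ, ∃ x : N, 0 ≤ x ∧ x ≤ 1 ∧ ε + 2 ^ n * ∑ ξ ∈ F, vecState N ξ x <
      τ.state c x := fun n => hcon F (2 ^ n) (by positivity)
  choose x hx0 hx1 hx using hcon'
  have hsum : ∀ n, ∀ ξ ∈ F, vecState N ξ (x n) ≤ ‖c‖ ^ 2 * (1 / 2) ^ n := fun n ξ hξ => by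
    have h1 := (hx n).trans_le ((state_mono c (hx1 n)).trans_eq (state_one c))
    have h2 : vecState N ξ (x n) ≤ ∑ ξ ∈ F, vecState N ξ (x n) :=
      Finset.single_le_sum (f := fun ξ => vecState N ξ (x n))
        (fun η _ => vecState_nonneg η (hx0 n)) hξ
    rw [one_div, inv_pow, ← div_eq_mul_inv, le_div_iff₀ (by positivity)]
    have h3 : (0 : ℝ) < 2 ^ n := by positivity
    nlinarith
  -- Tail sums may be unbounded; the operator monotone function x/(1+x) brings them back into the
  -- unit ball while preserving their order. This replaces the missing supremum of the x_n.
  set S : ℕ → ℕ → N := fun m M => ∑ n ∈ Finset.Ico m M, x n with hS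
  have hS0 : ∀ m M, 0 ≤ S m M := fun m M => Finset.sum_nonneg fun n _ => hx0 n
  have hSmono : ∀ m, Monotone (S m) := fun m M M' h =>
    Finset.sum_le_sum_of_subset_of_nonneg (Finset.Ico_subset_Ico_right h) fun n _ _ => hx0 n
  have hSanti : ∀ m m' M, m ≤ m' → S m' M ≤ S m M := fun m m' M h =>
    Finset.sum_le_sum_of_subset_of_nonneg (Finset.Ico_subset_Ico_left h) fun n _ _ => hx0 n
  have hSvec : ∀ m M, ∀ ξ ∈ F, vecState N ξ (S m M) ≤ 2 * ‖c‖ ^ 2 * (1 / 2) ^ m := by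
    intro m M ξ hξ
    have hs : vecState N ξ (S m M) = ∑ n ∈ Finset.Ico m M, vecState N ξ (x n) := by
      let φ : N →+ ℝ := AddMonoidHom.mk' (vecState N ξ) (vecState_add ξ)
      exact map_sum φ _ _
    rw [hs]
    refine (Finset.sum_le_sum fun n _ => hsum n ξ hξ).trans ?_
    rw [← Finset.mul_sum]
    have hg : ∀ k, ∑ n ∈ Finset.Ico m (m + k), (1 / 2 : ℝ) ^ n ≤
        2 * (1 / 2) ^ m - 2 * (1 / 2) ^ (m + k) := by
      intro k
      induction k with
      | zero => simp
      | succ k ih =>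
        rw [← add_assoc, Finset.sum_Ico_succ_top (by omega), pow_succ]
        linarith
    have hg' : ∑ n ∈ Finset.Ico m M, (1 / 2 : ℝ) ^ n ≤ 2 * (1 / 2) ^ m := by
      rcases le_total M m with h | h
      · rw [Finset.Ico_eq_empty_of_le h, Finset.sum_empty]; positivity
      · obtain ⟨k, rfl⟩ := Nat.exists_eq_add_of_le h
        have := hg k
        have h0 : (0 : ℝ) < (1 / 2) ^ (m + k) := by positivity
        linarith
    have := mul_le_mul_of_nonneg_left hg' (sq_nonneg ‖c‖)
    linarith
  have hlim : ∀ m, ∃ y : N, 0 ≤ y ∧ y ≤ 1 ∧ (∀ M, damp (S m M) ≤ y) ∧ ∀ ξ : H,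
      Tendsto (fun M => (damp (S m M) : H →L[ℂ] H) ξ) atTop (𝓝 ((y : H →L[ℂ] H) ξ)) := fun m =>
    exists_limit_of_monotone (fun M M' h => damp_mono (hS0 m M) (hSmono m h))
      (fun M => damp_nonneg _) fun M => damp_le_one _
  choose y hy0 hy1 hyS hylim using hlim
  have hyanti : ∀ m m', m ≤ m' → y m' ≤ y m := fun m m' h =>
    le_of_vecState (hy0 m').isSelfAdjoint (hy0 m).isSelfAdjoint fun ξ =>
      le_of_tendsto_of_tendsto' (tendsto_vecState (hylim m' ξ)) (tendsto_vecState (hylim m ξ))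
        fun M => vecState_mono ξ (damp_mono (hS0 _ _) (hSanti m m' M h))
  have hyvec : ∀ m, ∀ ξ ∈ F, vecState N ξ (y m) ≤ 2 * ‖c‖ ^ 2 * (1 / 2) ^ m := fun m ξ hξ =>
    le_of_tendsto' (tendsto_vecState (hylim m ξ)) fun M =>
      (vecState_mono ξ (damp_le_self (hS0 m M))).trans (hSvec m M ξ hξ)
  -- On the unit ball x/(1+x) is at least x/2, so half of the lower bound ε survives.
  have hystate : ∀ m, ε / 2 ≤ τ.state c (y m) := fun m => by
    have h1 : x m ≤ (2 : ℝ≥0) • damp (x m) := le_two_smul_damp (hx0 m) (hx1 m)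
    have h2 := state_mono c h1
    have h3 : damp (x m) ≤ y m := by
      have : S m (m + 1) = x m := by simp [hS]
      rw [← this]; exact hyS m (m + 1)
    have h4 := state_mono c h3
    have h5 : τ.state c ((2 : ℝ≥0) • damp (x m)) = 2 * τ.state c (damp (x m)) := by
      have : (2 : ℝ≥0) • damp (x m) = damp (x m) + damp (x m) := two_smul _ _
      rw [this, map_add]; ring
    have h6 : 0 ≤ 2 ^ m * ∑ ξ ∈ F, vecState N ξ (x m) :=
      mul_nonneg (by positivity) (Finset.sum_nonneg fun ξ _ => vecState_nonneg ξ (hx0 m))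
    have h7 := hx m
    linarith
  -- The limsup is 1 − z, the decreasing limit of the y_m; it is obtained from the increasing
  -- sequence 1 − y_m so that normality applies.
  obtain ⟨z, hz0, hz1, hzy, hzlim⟩ := exists_limit_of_monotone (a := fun m => 1 - y m)
    (fun m m' h => sub_le_sub_left (hyanti m m' h) 1) (fun m => sub_nonneg.2 (hy1 m))
    (fun m => sub_le_self _ (hy0 m))
  obtain ⟨m, hm⟩ := state_normal_seq c
    (fun m m' h => sub_le_sub_left (hyanti m m' h) 1) (fun m => sub_nonneg.2 (hy1 m)) hzy hzlim
    (show 0 < ε / 8 by positivity)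
  have hw0 : 0 ≤ 1 - z := sub_nonneg.2 hz1
  have hwy : ∀ m, 1 - z ≤ y m := fun m => by
    have := hzy m
    rw [sub_le_comm]; exact this
  have hwvec : ∀ ξ ∈ F, ((1 - z : N) : H →L[ℂ] H) ξ = 0 := fun ξ hξ => by
    have h1 := norm_sq_le_vecState ξ hw0 (sub_le_self _ hz0)
    have h2 : ‖((1 - z : N) : H →L[ℂ] H) ξ‖ ^ 2 ≤ 0 := by
      refine ge_of_tendsto' (x := atTop) (f := fun m : ℕ => 2 * ‖c‖ ^ 2 * (1 / 2 : ℝ) ^ m) ?_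
        fun m => h1.trans ((vecState_mono ξ (hwy m)).trans (hyvec m ξ hξ))
      simpa using (tendsto_pow_atTop_nhds_zero_of_lt_one (by norm_num : (0 : ℝ) ≤ 1 / 2)
        (by norm_num)).const_mul (2 * ‖c‖ ^ 2)
    have := sq_nonneg ‖((1 - z : N) : H →L[ℂ] H) ξ‖
    exact norm_eq_zero.1 (pow_eq_zero_iff two_ne_zero |>.1 (le_antisymm h2 this))
  have hwp : (1 - z) * cyclicProj N (F : Set H) = 0 := mul_cyclicProj_eq_zero hwvec
  have hpw : cyclicProj N (F : Set H) * (1 - z) = 0 := by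
    have := congrArg star hwp
    rwa [star_mul, hw0.isSelfAdjoint.star_eq, (cyclicProj_isSelfAdjoint _).star_eq, star_zero]
      at this
  -- Since 1 − z vanishes on F, it is unchanged by compression with 1 − p_F; compress 1 − z ≤ 1.
  have hwle : 1 - z ≤ 1 - cyclicProj N (F : Set H) := by
    set p := cyclicProj N (F : Set H)
    have hps : star (1 - p) = 1 - p := by
      rw [star_sub, star_one, (cyclicProj_isSelfAdjoint _).star_eq]
    have h1 := star_left_conjugate_le_conjugate (sub_le_self 1 hz0 : 1 - z ≤ 1) (1 - p)
    have e1 : (1 - p) * (1 - z) * (1 - p) = 1 - z := by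
      rw [sub_mul 1 p, one_mul, hpw, sub_zero, mul_sub, mul_one, hwp, sub_zero]
    have e2 : (1 - p) * 1 * (1 - p) = 1 - p := by
      have hpp : p * p = p := cyclicProj_mul_self _
      rw [mul_one, mul_sub, mul_one, sub_mul, one_mul, hpp]; simp
    rwa [hps, e1, e2] at h1
  have h1 := state_mono c hwle
  have h2 := hystate m
  simp only [map_sub] at h1 hm hF
  linarith

lemma exists_norm_lmul_le (c : τ.PreL2) {ε : ℝ} (hε : 0 < ε) : ∃ (F : Finset H) (C : ℝ), 0 ≤ C ∧
    ∀ x : N, ‖x‖ ≤ 1 → ‖τ.lmul x c‖ ^ 2 ≤ ε + C * ∑ ξ ∈ F, ‖(x : H →L[ℂ] H) ξ‖ ^ 2 := by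
  obtain ⟨F, C, hC, h⟩ := exists_state_le c hε
  refine ⟨F, C, hC, fun x hx => ?_⟩
  have hxx : star x * x ≤ 1 := by
    rw [← CStarAlgebra.norm_le_one_iff_of_nonneg _ (star_mul_self_nonneg x),
      CStarRing.norm_star_mul_self]
    exact mul_le_one₀ hx (norm_nonneg _) hx
  have := h (star x * x) (star_mul_self_nonneg x) hxx
  simpa only [state_star_mul_self, vecState_star_mul_self] using this

/-- On bounded sets, strong convergence implies convergence in the norm of `L_2(N)`. -/
lemma tendsto_lmul {ι : Type*} {l : Filter ι} {a : ι → N} {x : N} {M : ℝ} (hM : ∀ i, ‖a i‖ ≤ M)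
    (h : ∀ ξ : H, Tendsto (fun i => (a i : H →L[ℂ] H) ξ) l (𝓝 ((x : H →L[ℂ] H) ξ)))
    (c : τ.PreL2) : Tendsto (fun i => τ.lmul (a i) c) l (𝓝 (τ.lmul x c)) := by
  set K : ℝ := |M| + ‖x‖ + 1 with hK
  have hK0 : 0 < K := by positivity
  rw [tendsto_iff_norm_sub_tendsto_zero, Metric.tendsto_nhds]
  intro δ hδ
  obtain ⟨F, C, hC, hd⟩ := exists_norm_lmul_le c (show 0 < (δ / K) ^ 2 / 2 by positivity)
  have hs : Tendsto (fun i => C * ∑ ξ ∈ F, ‖((((K⁻¹ : ℝ) : ℂ) • (a i - x) : N) : H →L[ℂ] H) ξ‖ ^ 2) l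
      (𝓝 (C * ∑ ξ ∈ F, 0)) := by
    refine (tendsto_finsetSum _ fun ξ _ => ?_).const_mul C
    have h1 : Tendsto (fun i => ((K⁻¹ : ℝ) : ℂ) • ((a i : H →L[ℂ] H) ξ - (x : H →L[ℂ] H) ξ)) l
        (𝓝 (((K⁻¹ : ℝ) : ℂ) • ((x : H →L[ℂ] H) ξ - (x : H →L[ℂ] H) ξ))) :=
      ((h ξ).sub tendsto_const_nhds).const_smul _
    simpa using h1.norm.pow 2
  rw [Finset.sum_const_zero, mul_zero] at hs
  filter_upwards [hs.eventually (gt_mem_nhds (show 0 < (δ / K) ^ 2 / 2 by positivity))] with i hi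
  have hn : ‖((K⁻¹ : ℝ) : ℂ) • (a i - x)‖ ≤ 1 := by
    rw [norm_smul, Complex.norm_real, Real.norm_of_nonneg (by positivity), inv_mul_le_iff₀ hK0]
    have := (norm_sub_le (a i) x).trans (add_le_add_left (hM i) _)
    have := le_abs_self M
    linarith
  have h2 := hd _ hn
  have h3 : ‖τ.lmul (((K⁻¹ : ℝ) : ℂ) • (a i - x)) c‖ = K⁻¹ * ‖τ.lmul (a i) c - τ.lmul x c‖ := by
    rw [map_smul, smul_apply, norm_smul, map_sub, sub_apply, Complex.norm_real,
      Real.norm_of_nonneg (by positivity)]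
  rw [h3] at h2
  have h4 : (K⁻¹ * ‖τ.lmul (a i) c - τ.lmul x c‖) ^ 2 < (δ / K) ^ 2 := by linarith
  have h5 := lt_of_pow_lt_pow_left₀ 2 (by positivity) h4
  rw [div_eq_inv_mul, mul_lt_mul_iff_right₀ (by positivity)] at h5
  simpa using h5

end NSFTrace

end SemigroupBMO

namespace SemigroupBMO

/-! ### Right continuous functions -/

/-- The least multiple of `1 / (n + 1)` that exceeds `u`. -/
def stepAbove (n : ℕ) (u : ℝ) : ℝ := ((⌊u * (n + 1)⌋ : ℤ) + 1) / ((n : ℝ) + 1)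

lemma lt_stepAbove (n : ℕ) (u : ℝ) : u < stepAbove n u := by
  rw [stepAbove, lt_div_iff₀ (by positivity)]
  exact Int.lt_floor_add_one _

lemma stepAbove_le (n : ℕ) (u : ℝ) : stepAbove n u ≤ u + 1 / ((n : ℝ) + 1) := by
  have : (0 : ℝ) < (n : ℝ) + 1 := by positivity
  rw [stepAbove, div_le_iff₀ this, add_mul, div_mul_cancel₀ _ this.ne']
  linarith [Int.floor_le (u * ((n : ℝ) + 1))]

lemma tendsto_stepAbove (u : ℝ) : Tendsto (fun n => stepAbove n u) atTop (𝓝[>] u) := by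
  refine tendsto_nhdsWithin_iff.2 ⟨?_, Eventually.of_forall fun n => lt_stepAbove n u⟩
  refine tendsto_of_tendsto_of_tendsto_of_le_of_le tendsto_const_nhds ?_
    (fun n => (lt_stepAbove n u).le) (fun n => stepAbove_le n u)
  simpa using tendsto_one_div_add_atTop_nhds_zero_nat.const_add u

lemma stronglyMeasurable_comp_stepAbove {E : Type*} [TopologicalSpace E]
    [TopologicalSpace.PseudoMetrizableSpace E] (f : ℝ → E) (n : ℕ) :
    StronglyMeasurable fun u => f (stepAbove n u) := by
  have h : StronglyMeasurable fun m : ℤ => f (((m : ℝ) + 1) / ((n : ℝ) + 1)) :=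
    StronglyMeasurable.of_discrete
  exact h.comp_measurable (Int.measurable_floor.comp (measurable_id.mul_const ((n : ℝ) + 1)))

/-- Approximation from the right by functions taking countably many values. This suits the
semigroup, whose strong continuity is assumed only from the right at 0. -/
lemma stronglyMeasurable_of_tendsto_right {E : Type*} [TopologicalSpace E]
    [TopologicalSpace.PseudoMetrizableSpace E] {f : ℝ → E}
    (h : ∀ u, Tendsto (fun n => f (stepAbove n u)) atTop (𝓝 (f u))) : StronglyMeasurable f :=
  stronglyMeasurable_of_tendsto atTop (fun n => stronglyMeasurable_comp_stepAbove f n)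
    (tendsto_pi_nhds.2 h)

variable {H : Type u} [NormedAddCommGroup H] [InnerProductSpace ℂ H] [CompleteSpace H]
variable {N : VonNeumannAlgebra H} {τ : NSFTrace N}

/-- Functionals that are continuous along bounded strongly convergent sequences. -/
def SeqNormal (ω : N →L[ℝ] ℝ) : Prop := ∀ (a : ℕ → N) (x : N) (M : ℝ), (∀ n, ‖a n‖ ≤ M) →
  (∀ ξ : H, Tendsto (fun n => (a n : H →L[ℂ] H) ξ) atTop (𝓝 ((x : H →L[ℂ] H) ξ))) →
  Tendsto (fun n => ω (a n)) atTop (𝓝 (ω x))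

variable (N) in
/-- Evaluation at a vector. -/
def evalVec (ξ : H) : N →L[ℝ] H :=
  LinearMap.mkContinuous
    { toFun := fun x => (x : H →L[ℂ] H) ξ
      map_add' := fun _ _ => rfl
      map_smul' := fun c x => by
        change ((c • x : N) : H →L[ℂ] H) ξ = c • (x : H →L[ℂ] H) ξ
        rw [← Complex.coe_smul, ← Complex.coe_smul]; rfl } ‖ξ‖
    fun x => by rw [mul_comm]; exact (x : H →L[ℂ] H).le_opNorm ξ

lemma norm_le_of_forall_vec {x : N} {M : ℝ} (hM : 0 ≤ M) (h : ∀ ξ, ‖(x : H →L[ℂ] H) ξ‖ ≤ M * ‖ξ‖) :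
    ‖x‖ ≤ M := ContinuousLinearMap.opNorm_le_bound _ hM h

/-! ### Strong integrals of the semigroup on N -/

namespace StandardSemigroup

variable (S : StandardSemigroup τ)

/-- `T_t` as a real linear bounded operator. -/
def TR (t : ℝ) : N →L[ℝ] N := (S.TL t).restrictScalars ℝ

lemma TR_apply {t : ℝ} (ht : 0 ≤ t) (f : N) : S.TR t f = S.T t f := S.TL_apply ht f

lemma TR_max (t : ℝ) : S.TR (max t 0) = S.TR t := by
  ext1 f
  change S.T (max (max t 0) 0) f = S.T (max t 0) f
  rw [max_eq_left (le_max_right _ _)]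

lemma norm_TR_apply_le (t : ℝ) (f : N) : ‖S.TR t f‖ ≤ ‖f‖ := by
  have := (S.TL t).le_of_opNorm_le (S.norm_TL_le t) f
  rw [one_mul] at this
  exact this

lemma TR_add {s t : ℝ} (hs : 0 ≤ s) (ht : 0 ≤ t) (f : N) : S.TR (s + t) f = S.TR s (S.TR t f) := by
  rw [S.TR_apply (add_nonneg hs ht), S.TR_apply hs, S.TR_apply ht, S.map_add' s t hs ht]

lemma TR_of_nonpos {t : ℝ} (ht : t ≤ 0) (f : N) : S.TR t f = f := by
  change S.T (max t 0) f = f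
  rw [max_eq_right ht, S.map_zero']

lemma tendsto_TR (f : N) (ξ : H) (u : ℝ) : Tendsto (fun n => (S.TR (stepAbove n u) f : H →L[ℂ] H) ξ)
    atTop (𝓝 ((S.TR u f : H →L[ℂ] H) ξ)) := by
  rcases lt_or_ge u 0 with hu | hu
  · refine tendsto_const_nhds.congr' ?_
    have h := (tendsto_stepAbove u).mono_right nhdsWithin_le_nhds
    filter_upwards [h.eventually (gt_mem_nhds hu)] with n hn
    rw [S.TR_of_nonpos hu.le, S.TR_of_nonpos hn.le]
  · have h1 : Tendsto (fun n => stepAbove n u - u) atTop (𝓝[>] 0) := by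
      refine tendsto_nhdsWithin_iff.2 ⟨?_, Eventually.of_forall fun n => sub_pos.2 (lt_stepAbove n u)⟩
      simpa using ((tendsto_stepAbove u).mono_right nhdsWithin_le_nhds).sub_const u
    refine ((S.continuous' (S.TR u f) ξ).comp h1).congr fun n => ?_
    have h0 : 0 ≤ stepAbove n u - u := (sub_pos.2 (lt_stepAbove n u)).le
    simp only [Function.comp_apply]
    rw [← S.TR_apply h0, ← S.TR_add h0 hu, sub_add_cancel]

lemma measurable_map_TR {ω : N →L[ℝ] ℝ} (hω : SeqNormal ω) (f : N) :
    Measurable fun u => ω (S.TR u f) :=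
  (stronglyMeasurable_of_tendsto_right (f := fun u => ω (S.TR u f)) fun u =>
    hω (fun n => S.TR (stepAbove n u) f) (S.TR u f) ‖f‖ (fun _ => S.norm_TR_apply_le _ f)
    fun ξ => S.tendsto_TR f ξ u).measurable

lemma stronglyMeasurable_TR_apply (f : N) (ξ : H) :
    StronglyMeasurable fun u => (S.TR u f : H →L[ℂ] H) ξ :=
  stronglyMeasurable_of_tendsto_right fun u => S.tendsto_TR f ξ u

/-- The orbit need not be norm measurable, so it is replaced by step functions, for which the
Bochner integral in N exists. These integrals are bounded and converge strongly by dominated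
convergence, and every `SeqNormal` functional passes to the limit with them. -/
lemma exists_integral {k : ℝ → ℝ} (hk : IntegrableOn k (Ioi 0)) (f : N) : ∃ g : N,
    ‖g‖ ≤ (∫ u in Ioi 0, |k u|) * ‖f‖ ∧
    (∀ ξ : H, (g : H →L[ℂ] H) ξ = ∫ u in Ioi 0, k u • (S.TR u f : H →L[ℂ] H) ξ) ∧
    ∀ ω : N →L[ℝ] ℝ, SeqNormal ω → ω g = ∫ u in Ioi 0, k u * ω (S.TR u f) := by
  have hi : ∀ n, IntegrableOn (fun u => k u • S.TR (stepAbove n u) f) (Ioi 0) := fun n =>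
    (hk.abs.mul_const ‖f‖).mono' (hk.aestronglyMeasurable.smul
      (stronglyMeasurable_comp_stepAbove (fun u => S.TR u f) n).aestronglyMeasurable)
      (ae_of_all _ fun u => by
        rw [norm_smul]
        exact mul_le_mul_of_nonneg_left (S.norm_TR_apply_le _ f) (norm_nonneg _))
  set a : ℕ → N := fun n => ∫ u in Ioi 0, k u • S.TR (stepAbove n u) f with ha
  have hka : IntegrableOn (fun u => |k u| * ‖f‖) (Ioi 0) := hk.abs.mul_const _
  have han : ∀ n, ‖a n‖ ≤ (∫ u in Ioi 0, |k u|) * ‖f‖ := fun n => by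
    refine (norm_integral_le_integral_norm _).trans ?_
    rw [← integral_mul_const]
    refine setIntegral_mono_on (hi n).norm hka measurableSet_Ioi fun u _ => ?_
    rw [norm_smul]
    exact mul_le_mul_of_nonneg_left (S.norm_TR_apply_le _ f) (norm_nonneg _)
  have hξ : ∀ ξ : H, Tendsto (fun n => (a n : H →L[ℂ] H) ξ) atTop
      (𝓝 (∫ u in Ioi 0, k u • (S.TR u f : H →L[ℂ] H) ξ)) := fun ξ => by
    have e : ∀ n, (a n : H →L[ℂ] H) ξ =
        ∫ u in Ioi 0, k u • (S.TR (stepAbove n u) f : H →L[ℂ] H) ξ := fun n => by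
      have := (evalVec N ξ).integral_comp_comm (hi n)
      refine this.symm.trans (integral_congr_ae (ae_of_all _ fun u => ?_))
      simp only [map_smul]; rfl
    simp only [e]
    refine tendsto_integral_of_dominated_convergence (fun u => |k u| * (‖f‖ * ‖ξ‖))
      (fun n => ?_) (hk.abs.mul_const _) (fun n => ae_of_all _ fun u => ?_)
      (ae_of_all _ fun u => (S.tendsto_TR f ξ u).const_smul _)
    · exact hk.aestronglyMeasurable.smul
        (stronglyMeasurable_comp_stepAbove (fun u => (S.TR u f : H →L[ℂ] H) ξ) n).aestronglyMeasurable
    · rw [norm_smul]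
      refine mul_le_mul_of_nonneg_left (((S.TR (stepAbove n u) f : N) : H →L[ℂ] H).le_of_opNorm_le
        (S.norm_TR_apply_le _ f) ξ) (norm_nonneg _)
  obtain ⟨g, hg⟩ := exists_strong_limit a fun ξ => ⟨_, hξ ξ⟩
  have hgn : ‖g‖ ≤ (∫ u in Ioi 0, |k u|) * ‖f‖ := by
    refine norm_le_of_forall_vec (mul_nonneg (integral_nonneg fun u => abs_nonneg _) (norm_nonneg _))
      fun ξ => le_of_tendsto' (hg ξ).norm fun n => ?_
    exact (a n : H →L[ℂ] H).le_of_opNorm_le (han n) ξ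
  refine ⟨g, hgn, fun ξ => tendsto_nhds_unique (hg ξ) (hξ ξ), fun ω hω => ?_⟩
  refine tendsto_nhds_unique (hω a g _ han hg) ?_
  have e : ∀ n, ω (a n) = ∫ u in Ioi 0, k u * ω (S.TR (stepAbove n u) f) := fun n => by
    refine (ω.integral_comp_comm (hi n)).symm.trans (integral_congr_ae (ae_of_all _ fun u => ?_))
    simp only [map_smul, smul_eq_mul]
  simp only [e]
  refine tendsto_integral_of_dominated_convergence (fun u => |k u| * (‖ω‖ * ‖f‖))
    (fun n => ?_) (hk.abs.mul_const _) (fun n => ae_of_all _ fun u => ?_)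
    (ae_of_all _ fun u => (hω (fun n => S.TR (stepAbove n u) f) (S.TR u f) ‖f‖
      (fun n => S.norm_TR_apply_le _ f) fun ξ => S.tendsto_TR f ξ u).const_mul _)
  · exact hk.aestronglyMeasurable.mul
      (stronglyMeasurable_comp_stepAbove (fun u => ω (S.TR u f)) n).aestronglyMeasurable
  · rw [norm_mul]
    exact mul_le_mul_of_nonneg_left ((ω.le_opNorm _).trans
      (mul_le_mul_of_nonneg_left (S.norm_TR_apply_le _ f) (norm_nonneg _))) (norm_nonneg _)

lemma norm_lmul_T_le {r : ℝ} (hr : 0 ≤ r) (c : τ.PreL2) (x : N) :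
    ‖τ.lmul (S.T r x) c‖ ≤ ‖τ.lmul x (S.push r c)‖ := by
  have h := NSFTrace.state_mono c (S.schwarz hr x)
  rw [NSFTrace.state_star_mul_self, S.state_T hr, NSFTrace.state_star_mul_self] at h
  exact abs_le_of_sq_le_sq' h (norm_nonneg _) |>.2

lemma tendsto_lmul_T {ι : Type*} {l : Filter ι} {a : ι → N} {x : N} {M : ℝ}
    (hM : ∀ i, ‖a i‖ ≤ M)
    (h : ∀ ξ : H, Tendsto (fun i => (a i : H →L[ℂ] H) ξ) l (𝓝 ((x : H →L[ℂ] H) ξ)))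
    {r : ℝ} (hr : 0 ≤ r) (c : τ.PreL2) :
    Tendsto (fun i => τ.lmul (S.T r (a i)) c) l (𝓝 (τ.lmul (S.T r x) c)) := by
  have h1 := NSFTrace.tendsto_lmul hM h (S.push r c)
  rw [tendsto_iff_norm_sub_tendsto_zero] at h1 ⊢
  refine squeeze_zero (fun i => norm_nonneg _) (fun i => ?_) h1
  rw [← sub_apply, ← map_sub, ← sub_apply, ← map_sub, ← map_sub]
  exact S.norm_lmul_T_le hr c _

/-- The functionals all of whose translates by the semigroup are continuous along bounded strongly
convergent sequences. -/
def normalFunctionals : Set (N →L[ℝ] ℝ) := {ω | ∀ r, 0 ≤ r → SeqNormal (ω.comp (S.TR r))}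

variable {S} in
lemma seqNormal_of_mem {ω : N →L[ℝ] ℝ} (hω : ω ∈ S.normalFunctionals) : SeqNormal ω := by
  have h := hω 0 le_rfl
  have e : ω.comp (S.TR 0) = ω := by
    ext x; simp [S.TR_of_nonpos le_rfl]
  rwa [e] at h

lemma mem_normalFunctionals_of_test (c d : τ.PreL2) {ω : N →L[ℝ] ℝ}
    (h : ∀ x, ω x = (⟪c, τ.lmul x d⟫_ℂ).re) : ω ∈ S.normalFunctionals := by
  intro r hr a x M hM ha
  simp only [ContinuousLinearMap.comp_apply, h, S.TR_apply hr]
  exact (Complex.continuous_re.tendsto _).comp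
    (tendsto_const_nhds.inner (S.tendsto_lmul_T hM ha hr d))

lemma state_mem_normalFunctionals (c : τ.PreL2) : τ.state c ∈ S.normalFunctionals :=
  S.mem_normalFunctionals_of_test c c fun _ => rfl

/-- The subordination system of `(T_t)` on `N`. -/
def sub : SubordinationSystem N where
  T := S.TR
  norm_T_le r _ := ContinuousLinearMap.opNorm_le_bound _ zero_le_one fun f => by
    rw [one_mul]; exact S.norm_TR_apply_le r f
  T_add s t hs ht := by
    ext1 f; exact S.TR_add hs ht f
  Λ := S.normalFunctionals
  separating x hx := by
    refine NSFTrace.eq_zero_of_test (τ := τ) fun c d => ?_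
    have key : ∀ e : τ.PreL2, (⟪e, τ.lmul x d⟫_ℂ).re = 0 := fun e => by
      exact hx (Complex.reCLM.comp ((τ.test e d).restrictScalars ℝ))
        (S.mem_normalFunctionals_of_test e d fun _ => rfl)
    have h1 := key c
    have h2 := key (Complex.I • c)
    rw [inner_smul_left, Complex.conj_I] at h2
    refine Complex.ext h1 ?_
    simpa using h2
  comp_mem ω hω r hr s hs := by
    have e : (ω.comp (S.TR r)).comp (S.TR s) = ω.comp (S.TR (r + s)) := by
      ext x; simp [S.TR_add hr hs]
    rw [e]; exact hω _ (add_nonneg hr hs)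
  measurable ω hω x := by
    simp only [TR_max]
    exact S.measurable_map_TR (seqNormal_of_mem hω) x
  exists_integral k hk x := by
    obtain ⟨g, h1, -, h3⟩ := S.exists_integral hk x
    exact ⟨g, h1, fun ω hω => h3 ω (seqNormal_of_mem hω)⟩

/-- The Poisson system on `N`. -/
def poisson : PoissonSystem N := S.sub.toPoissonSystem

lemma integral_apply {k : ℝ → ℝ} (hk : IntegrableOn k (Ioi 0)) (f : N) (ξ : H) :
    (S.sub.integral k f : H →L[ℂ] H) ξ = ∫ u in Ioi 0, k u • (S.TR u f : H →L[ℂ] H) ξ := by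
  obtain ⟨g, -, h2, h3⟩ := S.exists_integral hk f
  have : g = S.sub.integral k f :=
    SubordinationSystem.eq_integral (S := S.sub) hk fun ω hω => h3 ω (seqNormal_of_mem hω)
  rw [← this, h2]

lemma P_eq {t : ℝ} (ht : 0 < t) (f : N) : S.P t f = S.poisson.P t f := by
  have h : ∃ g : N, ∀ ξ : H, (g : H →L[ℂ] H) ξ =
      ∫ u in Ioi (0 : ℝ), (subDensity t u : ℂ) • (S.T u f : H →L[ℂ] H) ξ := by
    refine ⟨S.poisson.P t f, fun ξ => (S.integral_apply (integrableOn_subDensity ht) f ξ).trans ?_⟩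
    refine setIntegral_congr_fun measurableSet_Ioi fun u hu => ?_
    simp only [Complex.coe_smul, S.TR_apply (le_of_lt (mem_Ioi.1 hu))]
  rw [P, dif_pos h]
  apply Subtype.ext
  ext ξ
  rw [h.choose_spec ξ]
  refine Eq.trans ?_ (S.integral_apply (integrableOn_subDensity ht) f ξ).symm
  refine setIntegral_congr_fun measurableSet_Ioi fun u hu => ?_
  simp only [Complex.coe_smul, S.TR_apply (le_of_lt (mem_Ioi.1 hu))]

end StandardSemigroup
end SemigroupBMO

namespace SemigroupBMO

variable {H : Type u} [NormedAddCommGroup H] [InnerProductSpace ℂ H] [CompleteSpace H]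
variable {N : VonNeumannAlgebra H} {τ : NSFTrace N}

/-! ### Continuity of the semigroup on `L_1` and `L_2` -/

lemma mul_self_le_self {x : N} (h0 : 0 ≤ x) (h1 : x ≤ 1) : x * x ≤ x :=
  le_of_vecState (by simpa [pow_two] using h0.isSelfAdjoint.pow 2) h0.isSelfAdjoint fun ξ => by
    have := vecState_star_mul_self ξ x
    rw [h0.isSelfAdjoint.star_eq] at this
    rw [this]
    exact norm_sq_le_vecState ξ h0 h1

lemma damp_add_damp_mul {y : N} (hy : 0 ≤ y) : damp y + damp y * y = y := by
  have h : cfcₙ (fun t : ℝ≥0 => (1 - (1 + t)⁻¹) + (1 - (1 + t)⁻¹) * id t) y = y := by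
    conv_rhs => rw [← cfcₙ_id ℝ≥0 y]
    refine cfcₙ_congr fun t _ => ?_
    have h5 : (1 + t)⁻¹ ≤ (1 : ℝ≥0) := inv_le_one_of_one_le₀ (by simp)
    have : 0 < 1 + (t : ℝ) := by have : (0 : ℝ) ≤ t := t.2; linarith
    rw [id, ← NNReal.coe_inj, NNReal.coe_add, NNReal.coe_mul, NNReal.coe_sub h5]
    push_cast
    field_simp
    ring
  rw [cfcₙ_add (fun t : ℝ≥0 => 1 - (1 + t)⁻¹) (fun t : ℝ≥0 => (1 - (1 + t)⁻¹) * id t) y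
    continuous_damp.continuousOn (by simp) (continuous_damp.mul continuous_id).continuousOn
    (by simp), cfcₙ_mul (fun t : ℝ≥0 => 1 - (1 + t)⁻¹) id y continuous_damp.continuousOn (by simp)
    continuous_id.continuousOn rfl, cfcₙ_id ℝ≥0 y] at h
  exact h

namespace NSFTrace

/-- Products of elements of `N ∩ L_2(N)` are dense. -/
lemma exists_norm_sub_lmul_lt (k : τ.PreL2) {ε : ℝ} (hε : 0 < ε) :
    ∃ e : τ.PreL2, ‖k - τ.rmulPre e.val k‖ < ε := by
  set x : N := star k.val * k.val with hx
  have hx0 : 0 ≤ x := star_mul_self_nonneg _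
  have hnx : ∀ n : ℕ, 0 ≤ (n : ℝ≥0) • x := fun n => smul_nonneg zero_le hx0
  -- The elements nx/(1+nx) with x = k⋆k increase to the support of x, and e_n² ≤ nx shows that they
  -- belong to L_2(N).
  set e : ℕ → N := fun n => damp ((n : ℝ≥0) • x) with he
  have he0 : ∀ n, 0 ≤ e n := fun n => damp_nonneg _
  have he1 : ∀ n, e n ≤ 1 := fun n => damp_le_one _
  have hfin : ∀ n, τ (star (e n) * e n) < ∞ := fun n => by
    rw [(he0 n).isSelfAdjoint.star_eq]
    have h1 : e n * e n ≤ (n : ℝ≥0) • x :=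
      (mul_self_le_self (he0 n) (he1 n)).trans (damp_le_self (hnx n))
    have h0 : 0 ≤ e n * e n := by
      have := star_mul_self_nonneg (e n)
      rwa [(he0 n).isSelfAdjoint.star_eq] at this
    refine (τ.mono h0 h1).trans_lt ?_
    have h2 : τ ((n : ℝ≥0) • x) = (n : ℝ≥0) * τ x := τ.map_smul' n x hx0
    rw [h2]
    exact ENNReal.mul_lt_top (by simp) k.lt_top
  obtain ⟨p, hp0, hp1, -, hlim⟩ := exists_limit_of_monotone (a := e)
    (fun m n h => damp_mono (hnx m) (smul_le_smul_of_nonneg_right (by exact_mod_cast h) hx0)) he0 he1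
  have hqx : (1 - p) * x = 0 := by
    -- From e = nx/(1+nx) one has n(1−e)x = e, hence the bound 1/n.
    have hnorm : ∀ n : ℕ, ‖(1 - e (n + 1)) * x‖ ≤ 1 / ((n : ℝ) + 1) := fun n => by
      have h := damp_add_damp_mul (hnx (n + 1))
      have h1 : ((n + 1 : ℕ) : ℝ≥0) • ((1 - e (n + 1)) * x) = e (n + 1) := by
        have h' : e (n + 1) * ((n + 1 : ℕ) : ℝ≥0) • x = ((n + 1 : ℕ) : ℝ≥0) • (e (n + 1) * x) :=
          mul_smul_comm _ _ _
        rw [sub_mul, one_mul, smul_sub, ← h', sub_eq_iff_eq_add]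
        exact h.symm
      have h2 : ‖e (n + 1)‖ ≤ 1 := (CStarAlgebra.norm_le_one_iff_of_nonneg _ (he0 _)).2 (he1 _)
      rw [← h1] at h2
      have h3 : ‖((n + 1 : ℕ) : ℝ≥0) • ((1 - e (n + 1)) * x)‖ =
          ((n : ℝ) + 1) * ‖(1 - e (n + 1)) * x‖ := by
        have := norm_smul ((n + 1 : ℕ) : ℝ) ((1 - e (n + 1)) * x)
        rw [Real.norm_of_nonneg (by positivity)] at this
        push_cast at this
        rw [← this]
        congr 1
        rw [NNReal.smul_def]
        push_cast
        rfl
      rw [h3] at h2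
      rwa [le_div_iff₀' (by positivity)]
    have hz : ∀ ξ : H, (((1 - p) * x : N) : H →L[ℂ] H) ξ = 0 := fun ξ => by
      have t1 : Tendsto (fun n => (((1 - e (n + 1)) * x : N) : H →L[ℂ] H) ξ) atTop
          (𝓝 ((((1 - p) * x : N) : H →L[ℂ] H) ξ)) :=
        tendsto_const_nhds.sub ((hlim ((x : H →L[ℂ] H) ξ)).comp (tendsto_add_atTop_nat 1))
      refine tendsto_nhds_unique t1 (squeeze_zero_norm (a := fun n : ℕ => 1 / ((n : ℝ) + 1) * ‖ξ‖)
        (fun n => ?_) ?_)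
      · refine (ContinuousLinearMap.le_opNorm _ _).trans ?_
        exact mul_le_mul_of_nonneg_right (hnorm n) (norm_nonneg _)
      · simpa using (tendsto_one_div_add_atTop_nhds_zero_nat (𝕜 := ℝ)).mul_const ‖ξ‖
    exact Subtype.ext (ContinuousLinearMap.ext hz)
  have hps : star (1 - p) = 1 - p := by rw [star_sub, star_one, hp0.isSelfAdjoint.star_eq]
  have hkq : k.val * (1 - p) = 0 := by
    rw [← CStarRing.star_mul_self_eq_zero_iff, star_mul, hps]
    have : (1 - p) * star k.val * (k.val * (1 - p)) = (1 - p) * x * (1 - p) := by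
      simp only [hx, mul_assoc]
    rw [this, hqx, zero_mul]
  -- The convergence result concerns left multiplication, so k e_n → k is proved after taking
  -- adjoints.
  have hqk : τ.lmul p k.adj = k.adj := by
    refine PreL2.ext ?_
    have := congrArg star hkq
    rw [star_mul, hps, star_zero, sub_mul, one_mul, sub_eq_zero] at this
    exact this.symm
  have ht := tendsto_lmul (τ := τ) (M := 1)
    (fun n => (CStarAlgebra.norm_le_one_iff_of_nonneg _ (he0 n)).2 (he1 n)) hlim k.adj
  rw [hqk, tendsto_iff_norm_sub_tendsto_zero] at ht
  obtain ⟨n, hn⟩ := (ht.eventually (gt_mem_nhds hε)).exists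
  refine ⟨PreL2.mk (e n) (hfin n), ?_⟩
  rw [norm_sub_rev, ← PreL2.norm_adj, PreL2.adj_sub]
  have : (τ.rmulPre (PreL2.mk (e n) (hfin n)).val k).adj = τ.lmul (e n) k.adj := by
    refine PreL2.ext ?_
    simp [(he0 n).isSelfAdjoint.star_eq]
  rwa [this]

lemma abs_state_sub_state_le (a b : τ.PreL2) (x : N) :
    |τ.state a x - τ.state b x| ≤ (‖a‖ + ‖b‖) * ‖a - b‖ * ‖x‖ := by
  have e : τ.state a x - τ.state b x = (⟪a - b, τ.lmul x a⟫_ℂ + ⟪b, τ.lmul x (a - b)⟫_ℂ).re := by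
    rw [state_apply, state_apply, map_sub, inner_sub_left, inner_sub_right, ← Complex.sub_re]
    congr 1
    ring
  rw [e]
  refine (Complex.abs_re_le_norm _).trans ((norm_add_le _ _).trans ?_)
  have h1 := (norm_inner_le_norm (𝕜 := ℂ) (a - b) (τ.lmul x a)).trans
    (mul_le_mul_of_nonneg_left (norm_lmul_le x a) (norm_nonneg _))
  have h2 := (norm_inner_le_norm (𝕜 := ℂ) b (τ.lmul x (a - b))).trans
    (mul_le_mul_of_nonneg_left (norm_lmul_le x (a - b)) (norm_nonneg _))
  linarith

end NSFTrace

namespace StandardSemigroup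

open NSFTrace

variable (S : StandardSemigroup τ)

lemma tendsto_TR_zero (f : N) (ξ : H) : Tendsto (fun h => (S.TR h f : H →L[ℂ] H) ξ) (𝓝[>] 0)
    (𝓝 ((f : H →L[ℂ] H) ξ)) := by
  refine (S.continuous' f ξ).congr' ?_
  filter_upwards [self_mem_nhdsWithin] with h hh
  rw [S.TR_apply (le_of_lt hh)]

lemma tendsto_lmul_TR_zero (f : N) (c : τ.PreL2) :
    Tendsto (fun h => τ.lmul (S.TR h f) c) (𝓝[>] 0) (𝓝 (τ.lmul f c)) :=
  tendsto_lmul (fun h => S.norm_TR_apply_le h f) (S.tendsto_TR_zero f) c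

/-- When k is replaced by ke with e in N ∩ L_2(N), the pairing becomes ⟨k, (T_h j) e⋆⟩, where
`tendsto_lmul` turns strong continuity into L_2 convergence. Such ke are dense and T_h is
contractive. -/
lemma tendsto_inner_TPre (k j : τ.PreL2) :
    Tendsto (fun h => ⟪k, S.TPre h j⟫_ℂ) (𝓝[>] 0) (𝓝 ⟪k, j⟫_ℂ) := by
  rw [tendsto_iff_norm_sub_tendsto_zero, Metric.tendsto_nhds]
  intro ε hε
  obtain ⟨e, he⟩ := exists_norm_sub_lmul_lt k (show 0 < ε / (4 * (‖j‖ + 1)) by positivity)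
  have hb : ∀ h, 0 < h → ⟪τ.rmulPre e.val k, S.TPre h j⟫_ℂ = ⟪k, τ.lmul (S.TR h j.val) e.adj⟫_ℂ := by
    intro h hh
    rw [inner_rmulPre_left]
    congr 1
  have hb0 : ⟪τ.rmulPre e.val k, j⟫_ℂ = ⟪k, τ.lmul j.val e.adj⟫_ℂ := by
    rw [inner_rmulPre_left]; rfl
  have ht : Tendsto (fun h => ‖⟪k, τ.lmul (S.TR h j.val) e.adj⟫_ℂ - ⟪k, τ.lmul j.val e.adj⟫_ℂ‖)
      (𝓝[>] 0) (𝓝 0) := by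
    rw [← tendsto_iff_norm_sub_tendsto_zero]
    exact tendsto_const_nhds.inner (S.tendsto_lmul_TR_zero _ _)
  filter_upwards [ht.eventually (gt_mem_nhds (show 0 < ε / 2 by positivity)), self_mem_nhdsWithin]
    with h h1 h0
  have h0 : 0 < h := h0
  rw [← hb h h0, ← hb0] at h1
  rw [dist_zero_right, norm_norm]
  set d := k - τ.rmulPre e.val k with hd
  have e1 : ⟪k, S.TPre h j⟫_ℂ - ⟪k, j⟫_ℂ = ⟪d, S.TPre h j⟫_ℂ - ⟪d, j⟫_ℂ +
      (⟪τ.rmulPre e.val k, S.TPre h j⟫_ℂ - ⟪τ.rmulPre e.val k, j⟫_ℂ) := by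
    rw [hd, inner_sub_left, inner_sub_left]; ring
  have h2 : ‖⟪d, S.TPre h j⟫_ℂ‖ ≤ ‖d‖ * ‖j‖ := (norm_inner_le_norm _ _).trans
    (mul_le_mul_of_nonneg_left (((S.TPre h).le_of_opNorm_le (S.norm_TPre_le h) j).trans_eq
      (one_mul _)) (norm_nonneg _))
  have h3 : ‖⟪d, j⟫_ℂ‖ ≤ ‖d‖ * ‖j‖ := norm_inner_le_norm _ _
  have h4 : ‖d‖ * ‖j‖ ≤ ε / 4 := by
    have : ‖d‖ * (‖j‖ + 1) ≤ ε / (4 * (‖j‖ + 1)) * (‖j‖ + 1) := by gcongr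
    have e2 : ε / (4 * (‖j‖ + 1)) * (‖j‖ + 1) = ε / 4 := by field_simp
    nlinarith [norm_nonneg d]
  rw [e1]
  refine ((norm_add_le _ _).trans (add_le_add (norm_sub_le _ _) le_rfl)).trans_lt ?_
  linarith

/-- Weak convergence together with ‖T_h k‖ ≤ ‖k‖ implies norm convergence in a Hilbert space. -/
lemma tendsto_TPre (k : τ.PreL2) : Tendsto (fun h => S.TPre h k) (𝓝[>] 0) (𝓝 k) := by
  rw [tendsto_iff_norm_sub_tendsto_zero]
  have h1 : Tendsto (fun h => 2 * ‖k‖ ^ 2 - 2 * (⟪k, S.TPre h k⟫_ℂ).re) (𝓝[>] 0) (𝓝 0) := by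
    have := ((Complex.continuous_re.tendsto _).comp (S.tendsto_inner_TPre k k)).const_mul 2
    have e : 2 * (⟪k, k⟫_ℂ).re = 2 * ‖k‖ ^ 2 := by
      congr 1; exact inner_self_eq_norm_sq (𝕜 := ℂ) k
    rw [e] at this
    have := (tendsto_const_nhds (x := 2 * ‖k‖ ^ 2)).sub this
    rw [sub_self] at this
    exact this
  have h2 : Tendsto (fun h => Real.sqrt (2 * ‖k‖ ^ 2 - 2 * (⟪k, S.TPre h k⟫_ℂ).re)) (𝓝[>] 0)
      (𝓝 0) := by
    have := (Real.continuous_sqrt.tendsto _).comp h1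
    rwa [Real.sqrt_zero] at this
  refine squeeze_zero (fun _ => norm_nonneg _) (fun h => ?_) h2
  refine Real.le_sqrt_of_sq_le ?_
  have h3 : ‖S.TPre h k‖ ≤ ‖k‖ := ((S.TPre h).le_of_opNorm_le (S.norm_TPre_le h) k).trans_eq
    (one_mul _)
  rw [norm_sub_sq (𝕜 := ℂ)]
  have h4 : ‖S.TPre h k‖ ^ 2 ≤ ‖k‖ ^ 2 := pow_le_pow_left₀ (norm_nonneg _) h3 2
  have h5 : (RCLike.re ⟪S.TPre h k, k⟫_ℂ) = (⟪k, S.TPre h k⟫_ℂ).re := inner_re_symm ..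
  rw [h5]
  linarith

/-- Kadison–Schwarz (T_h k)² ≤ T_h(k²), read through densities: the pairing of T_h(k²) with x is the
state of k at T_h x. -/
lemma state_T_nonneg_sub {h : ℝ} (hh : 0 ≤ h) {k : τ.PreL2} (hk : IsSelfAdjoint k.val) {x : N}
    (hx : 0 ≤ x) : τ.state (S.TPre h k) x ≤ τ.state k (S.T h x) := by
  have hT : 0 ≤ S.T h x := S.T_nonneg h hx
  obtain ⟨a, ha, rfl⟩ := exists_star_mul_self hx
  rw [← ENNReal.ofReal_le_ofReal_iff (τ.state_nonneg k hT), τ.ofReal_state _ hx,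
    τ.ofReal_state _ hT, S.val_TPre hh]
  have e1 : star (S.T h k.val) * (star a * a) * S.T h k.val =
      star (a * S.T h k.val) * (a * S.T h k.val) := by
    rw [star_mul]; simp only [mul_assoc]
  have h2 := S.selfadjoint' h hh a k.val
  rw [hk.star_eq] at h2 ⊢
  rw [e1, τ.tracial', h2]
  refine τ.mono (mul_star_self_nonneg _) ?_
  have h3 := star_left_conjugate_le_conjugate (S.schwarz hh k.val) (star a)
  rw [star_star, hk.star_eq] at h3
  have e2 : a * S.T h k.val * star (a * S.T h k.val) =
      a * (star (S.T h k.val) * S.T h k.val) * star a := by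
    rw [star_mul, ← S.T_star, hk.star_eq]
    simp only [mul_assoc]
  rwa [e2]

/-- Continuity of the semigroup in L_1(N). The L_1 norm of T_h(k²) − (T_h k)² is ‖k‖² − ‖T_h k‖²,
and (T_h k)² → k² in L_1 because T_h k → k in L_2. The bound is uniform in x, which strong
continuity alone would not give. -/
lemma exists_abs_state_T_sub_le (c : τ.PreL2) {ε : ℝ} (hε : 0 < ε) : ∃ δ > 0, ∀ h ∈ Ioo 0 δ,
    ∀ x : N, 0 ≤ x → |τ.state c (S.T h x) - τ.state c x| ≤ ε * ‖x‖ := by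
  -- This replaces c by (cc⋆)^{1/2}, which defines the same state and is selfadjoint.
  set k := S.push 0 c with hk
  have hks : IsSelfAdjoint k.val := (CFC.sqrt_nonneg _).isSelfAdjoint
  have hck : ∀ y, τ.state c y = τ.state k y := fun y => by
    have := S.state_T le_rfl c y
    rwa [S.map_zero'] at this
  have h1 : Tendsto (fun h => (‖k‖ ^ 2 - ‖S.TPre h k‖ ^ 2) + 2 * ‖k‖ * ‖S.TPre h k - k‖) (𝓝[>] 0)
      (𝓝 0) := by
    have a := S.tendsto_TPre k
    have b := (tendsto_const_nhds (x := ‖k‖ ^ 2)).sub (a.norm.pow 2)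
    have d := (tendsto_iff_norm_sub_tendsto_zero.1 a).const_mul (2 * ‖k‖)
    simpa using b.add d
  obtain ⟨δ, hδ, hs⟩ := mem_nhdsGT_iff_exists_Ioo_subset.1 (h1.eventually (gt_mem_nhds hε))
  refine ⟨δ, hδ, fun h hh x hx => ?_⟩
  have h2 : ‖k‖ ^ 2 - ‖S.TPre h k‖ ^ 2 + 2 * ‖k‖ * ‖S.TPre h k - k‖ < ε := hs hh
  rw [hck, hck]
  have hn : ‖S.TPre h k‖ ≤ ‖k‖ := ((S.TPre h).le_of_opNorm_le (S.norm_TPre_le h) k).trans_eq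
    (one_mul _)
  have a1 := S.state_T_nonneg_sub hh.1.le hks hx
  -- The difference of the two states is a positive functional, so its norm is its value at 1.
  -- Concretely, the inequality is tested at ‖x‖1 − x.
  have a2 : τ.state k (S.T h x) - τ.state (S.TPre h k) x ≤
      (‖k‖ ^ 2 - ‖S.TPre h k‖ ^ 2) * ‖x‖ := by
    have hx' : 0 ≤ algebraMap ℝ N ‖x‖ - x :=
      sub_nonneg.2 (CStarAlgebra.norm_le_iff_le_algebraMap x (norm_nonneg _) hx |>.1 le_rfl)
    have := S.state_T_nonneg_sub hh.1.le hks hx'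
    have e : (algebraMap ℝ N ‖x‖ : N) = ‖x‖ • (1 : N) := Algebra.algebraMap_eq_smul_one _
    rw [← S.TR_apply hh.1.le, map_sub, map_sub, map_sub, S.TR_apply hh.1.le, S.TR_apply hh.1.le] at this
    have e1 : S.T h (‖x‖ • (1 : N)) = ‖x‖ • (1 : N) := by
      rw [← S.TR_apply hh.1.le, map_smul, S.TR_apply hh.1.le, S.map_one' h hh.1.le]
    rw [e, e1, map_smul, map_smul, state_one, state_one] at this
    simp only [smul_eq_mul] at this
    linarith
  have a3 := abs_state_sub_state_le (S.TPre h k) k x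
  have a4 : (‖S.TPre h k‖ + ‖k‖) * ‖S.TPre h k - k‖ * ‖x‖ ≤ 2 * ‖k‖ * ‖S.TPre h k - k‖ * ‖x‖ := by
    have : ‖S.TPre h k‖ + ‖k‖ ≤ 2 * ‖k‖ := by linarith
    gcongr
  have a5 : (‖k‖ ^ 2 - ‖S.TPre h k‖ ^ 2 + 2 * ‖k‖ * ‖S.TPre h k - k‖) * ‖x‖ ≤ ε * ‖x‖ := by
    gcongr
  have a6 := abs_le.1 a3
  rw [abs_le]
  constructor <;> nlinarith

end StandardSemigroup
end SemigroupBMO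

namespace SemigroupBMO

variable {H : Type u} [NormedAddCommGroup H] [InnerProductSpace ℂ H] [CompleteSpace H]
variable {N : VonNeumannAlgebra H} {τ : NSFTrace N}

namespace StandardSemigroup

open NSFTrace

variable (S : StandardSemigroup τ)

/-! ### The deviation `T_h |u|² - |T_h u|²` -/

/-- `T_h |u|² - |T_h u|²`. -/
def dev (h : ℝ) (u : N) : N := S.T h (star u * u) - star (S.T h u) * S.T h u

lemma dev_nonneg {h : ℝ} (hh : 0 ≤ h) (u : N) : 0 ≤ S.dev h u := sub_nonneg.2 (S.schwarz hh u)

/-- `τ(c⋆ T_{b-s}|T_s g|² c)`. -/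
def energy (c : τ.PreL2) (b : ℝ) (g : N) (s : ℝ) : ℝ :=
  τ.state c (S.T (b - s) (star (S.T s g) * S.T s g))

lemma T_T {s t : ℝ} (hs : 0 ≤ s) (ht : 0 ≤ t) (f : N) : S.T s (S.T t f) = S.T (s + t) f :=
  (S.map_add' s t hs ht f).symm

lemma T_sub (t : ℝ) (f g : N) : S.T t (f - g) = S.T t f - S.T t g := map_sub (S.T t) f g

/-- Increments of the energy in s are Schwarz defects transported by the semigroup; hence the energy
decreases and its slope is governed by Γ. -/
lemma state_T_dev (c : τ.PreL2) (g : N) {a h s : ℝ} (ha : 0 ≤ a) (hh : 0 ≤ h) (hs : 0 ≤ s) :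
    τ.state c (S.T a (S.dev h (S.T s g))) =
      S.energy c (a + h + s) g s - S.energy c (a + h + s) g (s + h) := by
  rw [dev, energy, energy, T_sub, S.T_T ha hh, S.T_T hh hs, map_sub]
  have e1 : a + h + s - s = a + h := by ring
  have e2 : a + h + s - (s + h) = a := by ring
  rw [e1, e2, add_comm h s]

lemma norm_lmul_le_of_push {a : ℝ} (ha : 0 ≤ a) (c : τ.PreL2) (x : N) :
    ‖τ.lmul x (S.push a c)‖ ^ 2 = τ.state c (S.T a (star x * x)) := by
  rw [S.state_T ha, state_star_mul_self]

/-- The increment splits into a change of outer time, handled by L_1 continuity, and a change of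
inner time, handled by L_2 continuity. Both estimates must be uniform in s. -/
lemma exists_energy_sub_le (c : τ.PreL2) {b : ℝ} (hb : 0 ≤ b) (g : N) {ε : ℝ} (hε : 0 < ε) :
    ∃ δ > 0, ∀ h ∈ Ioo 0 δ, ∀ s, 0 ≤ s → s + h ≤ b →
      S.energy c b g s - S.energy c b g (s + h) ≤ ε := by
  set M : ℝ := ‖g‖ + ‖c‖ + 1 with hM
  have hg : ‖g‖ ≤ M := by rw [hM]; linarith [norm_nonneg g, norm_nonneg c]
  have hc : ‖c‖ ≤ M := by rw [hM]; linarith [norm_nonneg g, norm_nonneg c]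
  have hM0 : 0 < M := by positivity
  set ε' : ℝ := (ε / (4 * M ^ 2)) ^ 2 / 2 with hε'
  have hε'0 : 0 < ε' := by positivity
  obtain ⟨δ₁, hδ₁, h1⟩ := S.exists_abs_state_T_sub_le c
    (show 0 < min (ε / 2 / M ^ 2) (ε' / (4 * M ^ 2)) by positivity)
  have h2 : Tendsto (fun h => ‖τ.lmul (g - S.TR h g) (S.push b c)‖ ^ 2) (𝓝[>] 0) (𝓝 0) := by
    have := ((S.tendsto_lmul_TR_zero g (S.push b c)).const_sub (τ.lmul g (S.push b c))).norm.pow 2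
    simpa using this
  obtain ⟨δ₂, hδ₂, h3⟩ := mem_nhdsGT_iff_exists_Ioo_subset.1 (h2.eventually (gt_mem_nhds hε'0))
  refine ⟨min δ₁ δ₂, lt_min hδ₁ hδ₂, fun h hh s hs hsb => ?_⟩
  have hh1 : h ∈ Ioo 0 δ₁ := ⟨hh.1, hh.2.trans_le (min_le_left _ _)⟩
  have hh2 : h ∈ Ioo 0 δ₂ := ⟨hh.1, hh.2.trans_le (min_le_right _ _)⟩
  have h0 : 0 ≤ h := hh.1.le
  set a : ℝ := b - s - h with ha
  have ha0 : 0 ≤ a := by linarith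
  set u := S.T s g with hu
  set w := S.T h u with hw
  have hun : ‖u‖ ≤ M := (S.norm_T_apply_le hs g).trans hg
  have hwn : ‖w‖ ≤ M := (S.norm_T_apply_le h0 u).trans hun
  have hnsq : ∀ x : N, ‖x‖ ≤ M → ‖star x * x‖ ≤ M ^ 2 := fun x hx => by
    rw [CStarRing.norm_star_mul_self, ← pow_two]
    exact pow_le_pow_left₀ (norm_nonneg _) hx 2
  have e0 : S.energy c b g s - S.energy c b g (s + h) =
      (τ.state c (S.T h (S.T a (star u * u))) - τ.state c (S.T a (star u * u))) +
        (τ.state c (S.T a (star u * u)) - τ.state c (S.T a (star w * w))) := by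
    rw [energy, energy, S.T_T h0 ha0, hw, hu, S.T_T h0 hs, add_comm h s]
    have e1 : b - s = h + a := by rw [ha]; ring
    have e2 : b - (s + h) = a := by rw [ha]; ring
    rw [e1, e2]; ring
  have b1 : τ.state c (S.T h (S.T a (star u * u))) - τ.state c (S.T a (star u * u)) ≤ ε / 2 := by
    refine (le_abs_self _).trans ((h1 h hh1 _ (S.T_nonneg a (star_mul_self_nonneg u))).trans ?_)
    have h4 := (S.norm_T_apply_le ha0 (star u * u)).trans (hnsq u hun)
    have h5 : min (ε / 2 / M ^ 2) (ε' / (4 * M ^ 2)) * ‖S.T a (star u * u)‖ ≤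
        ε / 2 / M ^ 2 * M ^ 2 := by
      gcongr
      exact min_le_left _ _
    rwa [div_mul_cancel₀ _ (by positivity)] at h5
  have b2 : τ.state c (S.T a (star u * u)) - τ.state c (S.T a (star w * w)) ≤ ε / 2 := by
    rw [← S.norm_lmul_le_of_push ha0, ← S.norm_lmul_le_of_push ha0]
    set z := star (g - S.T h g) * (g - S.T h g) with hz
    have hz0 : 0 ≤ z := star_mul_self_nonneg _
    have hzn : ‖z‖ ≤ 4 * M ^ 2 := by
      have := (norm_sub_le g (S.T h g)).trans (add_le_add hg ((S.norm_T_apply_le h0 g).trans hg))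
      rw [hz, CStarRing.norm_star_mul_self]
      nlinarith [norm_nonneg (g - S.T h g)]
    -- The dependence on s is removed as follows. Schwarz moves T_s outside, to total time a + s;
    -- applying T_h costs only ε' and raises the total time to b. There the vector `push b c` is
    -- fixed, and only g − T_h g matters.
    have d1 : ‖τ.lmul (u - w) (S.push a c)‖ ^ 2 ≤ τ.state c (S.T (a + s) z) := by
      rw [S.norm_lmul_le_of_push ha0, ← S.T_T ha0 hs]
      refine τ.state_mono c (S.T_mono a ?_)
      have : u - w = S.T s (g - S.T h g) := by
        rw [T_sub, hw, hu, S.T_T h0 hs, S.T_T hs h0, add_comm]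
      rw [this]
      exact S.schwarz hs _
    have d2 : |τ.state c (S.T h (S.T (a + s) z)) - τ.state c (S.T (a + s) z)| ≤ ε' := by
      refine (h1 h hh1 _ (S.T_nonneg _ hz0)).trans ?_
      have h4 := (S.norm_T_apply_le (add_nonneg ha0 hs) z).trans hzn
      have h5 : min (ε / 2 / M ^ 2) (ε' / (4 * M ^ 2)) * ‖S.T (a + s) z‖ ≤
          ε' / (4 * M ^ 2) * (4 * M ^ 2) := by
        gcongr
        exact min_le_right _ _
      rwa [div_mul_cancel₀ _ (by positivity)] at h5
    have d3 : τ.state c (S.T h (S.T (a + s) z)) < ε' := by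
      rw [S.T_T h0 (add_nonneg ha0 hs)]
      have e1 : h + (a + s) = b := by rw [ha]; ring
      have : ‖τ.lmul (g - S.TR h g) (S.push b c)‖ ^ 2 < ε' := h3 hh2
      rwa [e1, hz, ← S.norm_lmul_le_of_push hb, ← S.TR_apply h0]
    have d4 : ‖τ.lmul (u - w) (S.push a c)‖ ≤ ε / (4 * M ^ 2) := by
      have h6 := (abs_le.1 d2).1
      have h7 : ‖τ.lmul (u - w) (S.push a c)‖ ^ 2 ≤ (ε / (4 * M ^ 2)) ^ 2 := by
        have : 2 * ε' = (ε / (4 * M ^ 2)) ^ 2 := by rw [hε']; ring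
        linarith
      exact le_of_sq_le_sq h7 (by positivity)
    have d5 : ‖τ.lmul u (S.push a c)‖ ≤ ‖τ.lmul w (S.push a c)‖ + ε / (4 * M ^ 2) := by
      have : τ.lmul u (S.push a c) = τ.lmul w (S.push a c) + τ.lmul (u - w) (S.push a c) := by
        rw [map_sub, sub_apply]; abel
      rw [this]
      exact (norm_add_le _ _).trans (add_le_add le_rfl d4)
    have d6 : ∀ x : N, ‖x‖ ≤ M → ‖τ.lmul x (S.push a c)‖ ≤ M ^ 2 := fun x hx => by
      refine (norm_lmul_le _ _).trans ?_
      rw [S.norm_push, pow_two]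
      exact mul_le_mul hx hc (norm_nonneg _) hM0.le
    have d7 := d6 u hun
    have d8 := d6 w hwn
    have d9 : 0 < ε / (4 * M ^ 2) := by positivity
    have d10 : ε / (4 * M ^ 2) * (2 * M ^ 2) = ε / 2 := by field_simp; ring
    have e4 : ‖τ.lmul u (S.push a c)‖ ^ 2 - ‖τ.lmul w (S.push a c)‖ ^ 2 =
      (‖τ.lmul u (S.push a c)‖ - ‖τ.lmul w (S.push a c)‖) *
        (‖τ.lmul u (S.push a c)‖ + ‖τ.lmul w (S.push a c)‖) := by ring
    rw [e4, ← d10]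
    exact mul_le_mul (by linarith) (by linarith) (by positivity) d9.le
  rw [e0]
  linarith

lemma energy_anti (c : τ.PreL2) {b : ℝ} (g : N) {s h : ℝ} (hs : 0 ≤ s) (hh : 0 ≤ h)
    (hb : s + h ≤ b) : S.energy c b g (s + h) ≤ S.energy c b g s := by
  have h1 := S.state_T_dev c g (a := b - s - h) (by linarith) hh hs
  have h2 := τ.state_nonneg c (S.T_nonneg (b - s - h) (S.dev_nonneg hh (S.T s g)))
  rw [show b - s - h + h + s = b by ring] at h1
  linarith

lemma continuousOn_energy (c : τ.PreL2) {b : ℝ} (hb : 0 ≤ b) (g : N) :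
    ContinuousOn (S.energy c b g) (Icc 0 b) := by
  rw [Metric.continuousOn_iff]
  intro x hx ε hε
  obtain ⟨δ, hδ, h⟩ := S.exists_energy_sub_le c hb g (half_pos hε)
  have key : ∀ x ∈ Icc 0 b, ∀ y ∈ Icc 0 b, x ≤ y → y - x < δ →
      |S.energy c b g x - S.energy c b g y| < ε := by
    intro x hx y hy hxy hd
    rcases hxy.eq_or_lt with rfl | hlt
    · simpa using hε
    have h1 := h (y - x) ⟨sub_pos.2 hlt, hd⟩ x hx.1 (by linarith [hy.2])
    have h2 := S.energy_anti c g (b := b) hx.1 (sub_nonneg.2 hxy) (by linarith [hy.2])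
    rw [add_sub_cancel] at h1 h2
    rw [abs_of_nonneg (by linarith)]
    linarith
  refine ⟨δ, hδ, fun y hy hd => ?_⟩
  rw [Real.dist_eq] at hd ⊢
  rcases le_total x y with hxy | hxy
  · rw [abs_sub_comm]
    exact key x hx y hy hxy ((le_abs_self _).trans_lt hd)
  · exact key y hy x hx hxy (by rw [abs_sub_comm] at hd; exact (le_abs_self _).trans_lt hd)

end StandardSemigroup
end SemigroupBMO

namespace SemigroupBMO

variable {H : Type u} [NormedAddCommGroup H] [InnerProductSpace ℂ H] [CompleteSpace H]
variable {N : VonNeumannAlgebra H} {τ : NSFTrace N}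

/-! ### Small elements of `L_p` are small on bounded sets -/

lemma continuous_sqrt_tsub_div_max {δ : ℝ≥0} (hδ : 0 < δ) :
    Continuous fun t : ℝ≥0 => NNReal.sqrt (t - δ) / max t δ :=
  (NNReal.continuous_sqrt.comp (continuous_id.sub continuous_const)).div₀
    (continuous_id.max continuous_const) fun t => (hδ.trans_le (le_max_right t δ)).ne'

lemma continuous_sqrt_tsub (δ : ℝ≥0) : Continuous fun t : ℝ≥0 => NNReal.sqrt (t - δ) :=
  NNReal.continuous_sqrt.comp (continuous_id.sub continuous_const)

/-- Truncation of `|e|` at height `δ`: with `r = ρ(|e|)` and `y = (|e| - δ)₊^{1/2}` one has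
`|e| r = y` and `‖e - e r y‖ ≤ δ`. -/
lemma exists_truncation (e : N) {δ : ℝ≥0} (hδ : 0 < δ) : ∃ r y : N, 0 ≤ y ∧
    star (e * r) * (e * r) = y * y ∧ ‖e - e * r * y‖ ≤ δ ∧
    y * y = cfcₙ (fun t : ℝ≥0 => t - δ) (CFC.abs e) := by
  set a := CFC.abs e with ha
  have ha0 : 0 ≤ a := CFC.abs_nonneg e
  set r := cfcₙ (fun t : ℝ≥0 => NNReal.sqrt (t - δ) / max t δ) a with hr
  set y := cfcₙ (fun t : ℝ≥0 => NNReal.sqrt (t - δ)) a with hy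
  have hr0 : 0 ≤ r := cfcₙ_nonneg fun _ _ => zero_le
  have hy0 : 0 ≤ y := cfcₙ_nonneg fun _ _ => zero_le
  have cr := continuous_sqrt_tsub_div_max hδ
  have cy := continuous_sqrt_tsub δ
  have hmul : ∀ t : ℝ≥0, t * (NNReal.sqrt (t - δ) / max t δ) = NNReal.sqrt (t - δ) := fun t => by
    rcases le_total t δ with h | h
    · rw [tsub_eq_zero_of_le h]; simp
    · rw [max_eq_left h, mul_div_cancel₀ _ (hδ.trans_le h).ne']
  have har : a * r = y := by
    conv_lhs => rw [← cfcₙ_id ℝ≥0 a]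
    rw [hr, ← cfcₙ_mul id _ a continuous_id.continuousOn rfl cr.continuousOn (by simp)]
    exact cfcₙ_congr fun t _ => hmul t
  have hra : r * a = y := by
    conv_lhs => rw [← cfcₙ_id ℝ≥0 a]
    rw [hr, ← cfcₙ_mul _ id a cr.continuousOn (by simp) continuous_id.continuousOn rfl]
    exact cfcₙ_congr fun t _ => (mul_comm _ _).trans (hmul t)
  have hyy : y * y = cfcₙ (fun t : ℝ≥0 => t - δ) a := by
    rw [hy, ← cfcₙ_mul _ _ a cy.continuousOn (by simp) cy.continuousOn (by simp)]
    exact cfcₙ_congr fun t _ => NNReal.mul_self_sqrt _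
  refine ⟨r, y, hy0, ?_, ?_, hyy⟩
  · rw [star_mul, hr0.isSelfAdjoint.star_eq]
    have : r * star e * (e * r) = (r * a) * (a * r) := by
      have := CFC.abs_mul_abs e
      rw [← ha] at this
      calc r * star e * (e * r) = r * (star e * e) * r := by simp only [mul_assoc]
        _ = _ := by rw [← this]; simp only [mul_assoc]
    rw [this, har, hra]
  · have hnorm : ∀ x : N, ‖e * x‖ = ‖a * x‖ := fun x => by
      have : ‖e * x‖ * ‖e * x‖ = ‖a * x‖ * ‖a * x‖ := by
        rw [← CStarRing.norm_star_mul_self, ← CStarRing.norm_star_mul_self, star_mul, star_mul,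
          ha0.isSelfAdjoint.star_eq]
        congr 1
        have := CFC.abs_mul_abs e
        rw [← ha] at this
        calc star x * star e * (e * x) = star x * (star e * e) * x := by simp only [mul_assoc]
          _ = _ := by rw [← this]; simp only [mul_assoc]
      nlinarith [norm_nonneg (e * x), norm_nonneg (a * x)]
    have e1 : e - e * r * y = e * (1 - r * y) := by rw [mul_sub, mul_one, mul_assoc]
    have e2 : a * (1 - r * y) = a - y * y := by rw [mul_sub, mul_one, ← mul_assoc, har]
    have e3 : a - y * y = cfcₙ (fun t : ℝ≥0 => min t δ) a := by
      rw [sub_eq_iff_eq_add, hyy, ← cfcₙ_add (fun t : ℝ≥0 => min t δ) (fun t : ℝ≥0 => t - δ) a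
        (continuous_id.min continuous_const).continuousOn (by simp)
        (continuous_id.sub continuous_const).continuousOn (by simp)]
      conv_lhs => rw [← cfcₙ_id ℝ≥0 a]
      refine cfcₙ_congr fun t _ => ?_
      rcases le_total t δ with h | h
      · simp [h, tsub_eq_zero_of_le h]
      · simp [h]
    rw [e1, hnorm, e2, e3]
    exact nnnorm_cfcₙ_nnreal_le fun t _ => min_le_right _ _

lemma cfcₙ_tsub_le (a : N) {δ : ℝ≥0} (hδ : 0 < δ) {p : ℝ≥0} (hp : 1 ≤ p) :
    cfcₙ (fun t : ℝ≥0 => t - δ) a ≤ (δ / δ ^ (p : ℝ)) • a ^ p := by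
  have hp0 : 0 < p := zero_lt_one.trans_le hp
  have hc : Continuous fun t : ℝ≥0 => NNReal.nnrpow t p :=
    NNReal.continuous_rpow_const (by positivity)
  have h0 : NNReal.nnrpow 0 p = 0 := NNReal.zero_rpow (by exact_mod_cast hp0.ne')
  rw [CFC.nnrpow_def, ← cfcₙ_const_mul (δ / δ ^ (p : ℝ)) _ a hc.continuousOn h0]
  refine cfcₙ_mono (fun t _ => ?_) (continuous_id.sub continuous_const).continuousOn
    (continuous_const.mul hc).continuousOn (by simp) (by simp [h0])
  rcases le_total t δ with h | h
  · rw [tsub_eq_zero_of_le h]; exact zero_le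
  · refine tsub_le_self.trans ?_
    have h1 : 1 ≤ t / δ := by rwa [one_le_div hδ]
    have h2 : t / δ ≤ (t / δ) ^ (p : ℝ) := by
      have := NNReal.rpow_le_rpow_of_exponent_le h1 (show (1 : ℝ) ≤ p by exact_mod_cast hp)
      rwa [NNReal.rpow_one] at this
    rw [NNReal.div_rpow] at h2
    have h3 : t = δ * (t / δ) := by field_simp
    calc t = δ * (t / δ) := h3
      _ ≤ δ * (t ^ (p : ℝ) / δ ^ (p : ℝ)) := mul_le_mul_right h2 _
      _ = δ / δ ^ (p : ℝ) * NNReal.nnrpow t p := by rw [NNReal.nnrpow_def]; ring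

namespace NSFTrace

/-- The elements of `N ∩ L_2(N)` with both norms at most `K`. -/
def ball (τ : NSFTrace N) (K : ℝ) : Set τ.PreL2 := {b | ‖b.val‖ ≤ K ∧ ‖b‖ ≤ K}

lemma exists_mem_ball (c : τ.PreL2) : ∃ K : ℝ, 0 < K ∧ c ∈ τ.ball K :=
  ⟨‖c.val‖ + ‖c‖ + 1, by positivity, by constructor <;> linarith [norm_nonneg c.val, norm_nonneg c]⟩

lemma lmul_mem_ball {b : τ.PreL2} {K C : ℝ} (hb : b ∈ τ.ball K) {x : N} (hx : ‖x‖ ≤ C) :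
    τ.lmul x b ∈ τ.ball (C * K) := by
  have hC : 0 ≤ C := (norm_nonneg _).trans hx
  refine ⟨(norm_mul_le _ _).trans ?_, (norm_lmul_le _ _).trans ?_⟩
  · exact mul_le_mul hx hb.1 (norm_nonneg _) hC
  · exact mul_le_mul hx hb.2 (norm_nonneg _) hC

lemma ball_mono {K L : ℝ} (h : K ≤ L) : τ.ball K ⊆ τ.ball L := fun _ hb =>
  ⟨hb.1.trans h, hb.2.trans h⟩

/-- Split e into a part of operator norm at most δ and the product (er)y of two elements of L_2(N),
each of squared norm τ((|e|−δ)₊) ≤ δ^{1−p} τ(|e|^p). The operator norms of b₁, b₂ serve the second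
part, their L_2 norms the first. -/
lemma norm_inner_lmul_le_of_truncation (e : N) {δ : ℝ≥0} (hδ : 0 < δ) {p : ℝ≥0} (hp : 1 ≤ p)
    (hfin : τ (CFC.abs e ^ p) < ∞) {K : ℝ} {b₁ b₂ : τ.PreL2} (h₁ : b₁ ∈ τ.ball K)
    (h₂ : b₂ ∈ τ.ball K) :
    ‖⟪b₁, τ.lmul e b₂⟫_ℂ‖ ≤ K ^ 2 * (δ + (δ / δ ^ (p : ℝ) : ℝ≥0) * (τ (CFC.abs e ^ p)).toReal) := by
  have hK : 0 ≤ K := (norm_nonneg _).trans h₁.1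
  obtain ⟨r, y, hy0, her, hdist, hyy⟩ := exists_truncation e hδ
  have hys : star y * y = y * y := by rw [hy0.isSelfAdjoint.star_eq]
  have hz : τ (y * y) ≤ (δ / δ ^ (p : ℝ) : ℝ≥0) * τ (CFC.abs e ^ p) := by
    rw [← τ.map_smul' _ _ CFC.nnrpow_nonneg]
    refine τ.mono (by rw [← hys]; exact star_mul_self_nonneg y) ?_
    rw [hyy]
    exact cfcₙ_tsub_le _ hδ hp
  have hzfin : τ (y * y) < ∞ := hz.trans_lt (ENNReal.mul_lt_top (by simp) hfin)
  set Y : τ.PreL2 := PreL2.mk y (by rwa [hys])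
  set X : τ.PreL2 := PreL2.mk (e * r) (by rwa [her])
  have hY : ‖Y‖ ^ 2 = (τ (y * y)).toReal := by rw [pow_two, PreL2.norm_sq, PreL2.val_mk, hys]
  have hX : ‖X‖ ^ 2 = (τ (y * y)).toReal := by rw [pow_two, PreL2.norm_sq, PreL2.val_mk, her]
  have hXY : ‖X‖ = ‖Y‖ := by
    have : ‖X‖ ^ 2 = ‖Y‖ ^ 2 := by rw [hX, hY]
    exact (pow_left_inj₀ (norm_nonneg _) (norm_nonneg _) two_ne_zero).1 this
  have e1 : ⟪b₁, τ.lmul e b₂⟫_ℂ = ⟪b₁, τ.lmul (e - e * r * y) b₂⟫_ℂ +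
      ⟪τ.rmulPre b₁.val X.adj, τ.rmulPre b₂.val Y⟫_ℂ := by
    have : τ.rmulPre b₁.val X.adj = τ.lmul (star (e * r)) b₁ := PreL2.ext rfl
    rw [this, inner_lmul_left, star_star]
    have : τ.lmul (e * r) (τ.rmulPre b₂.val Y) = τ.lmul (e * r * y) b₂ :=
      PreL2.ext (mul_assoc _ _ _).symm
    rw [this, ← inner_add_right, ← add_apply, ← map_add, sub_add_cancel]
  rw [e1, mul_add]
  refine (norm_add_le _ _).trans (add_le_add ?_ ?_)
  · refine (norm_inner_le_norm _ _).trans ?_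
    have := (norm_lmul_le (e - e * r * y) b₂).trans
      (mul_le_mul hdist h₂.2 (norm_nonneg _) δ.2)
    refine (mul_le_mul h₁.2 this (norm_nonneg _) hK).trans_eq ?_
    ring
  · refine (norm_inner_le_norm _ _).trans ?_
    have g1 := (norm_rmulPre_le b₁.val X.adj).trans
      (mul_le_mul_of_nonneg_right h₁.1 (norm_nonneg _))
    have g2 := (norm_rmulPre_le b₂.val Y).trans (mul_le_mul_of_nonneg_right h₂.1 (norm_nonneg _))
    refine (mul_le_mul g1 g2 (norm_nonneg _) (by positivity)).trans ?_
    rw [PreL2.norm_adj, hXY]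
    have h3 : ‖Y‖ ^ 2 ≤ (δ / δ ^ (p : ℝ) : ℝ≥0) * (τ (CFC.abs e ^ p)).toReal := by
      rw [hY]
      have := ENNReal.toReal_mono (ENNReal.mul_lt_top (by simp) hfin).ne hz
      rwa [ENNReal.toReal_mul, ENNReal.coe_toReal] at this
    calc K * ‖Y‖ * (K * ‖Y‖) = K ^ 2 * ‖Y‖ ^ 2 := by ring
      _ ≤ _ := by gcongr

/-- Turns smallness in any L_p(N) into smallness of one kind of pairing. This is needed because
different elements of the algebra may lie in domains with different exponents p. -/
lemma exists_lpNorm_inner_le {p : ℝ≥0∞} (hp : 1 ≤ p) (K : ℝ) {ε : ℝ} (hε : 0 < ε) :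
    ∃ η : ℝ≥0∞, 0 < η ∧ ∀ e : N, τ.lpNorm p e < η → ∀ b₁ ∈ τ.ball K, ∀ b₂ ∈ τ.ball K,
      ‖⟪b₁, τ.lmul e b₂⟫_ℂ‖ ≤ ε := by
  by_cases hpt : p = ∞
  · refine ⟨ENNReal.ofReal (ε / (K ^ 2 + 1)), by simp; positivity, fun e he b₁ h₁ b₂ h₂ => ?_⟩
    have hK : 0 ≤ K := (norm_nonneg _).trans h₁.1
    rw [lpNorm, if_pos hpt, ← ofReal_norm, ENNReal.ofReal_lt_ofReal_iff (by positivity)] at he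
    have h3 := (norm_lmul_le e b₂).trans (mul_le_mul he.le h₂.2 (norm_nonneg _) (by positivity))
    refine ((norm_inner_le_norm _ _).trans (mul_le_mul h₁.2 h3 (norm_nonneg _) hK)).trans ?_
    have : K * (ε / (K ^ 2 + 1) * K) = ε * (K ^ 2 / (K ^ 2 + 1)) := by field_simp
    rw [this]
    refine mul_le_of_le_one_right hε.le ?_
    rw [div_le_one (by positivity)]
    linarith
  · set q : ℝ≥0 := p.toNNReal with hq
    have hpq : (q : ℝ≥0∞) = p := ENNReal.coe_toNNReal hpt
    have hq1 : 1 ≤ q := by rw [← hpq] at hp; exact_mod_cast hp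
    have hpr : p.toReal = q := rfl
    have hq0 : (0 : ℝ) < q := by exact_mod_cast zero_lt_one.trans_le hq1
    -- The truncation height and then the size m of the p-th moment are chosen so that each part of
    -- the estimate is at most ε/(2(K²+1)).
    set δ : ℝ≥0 := (ε / (2 * (K ^ 2 + 1))).toNNReal with hδ
    have hδr : (δ : ℝ) = ε / (2 * (K ^ 2 + 1)) := Real.coe_toNNReal _ (by positivity)
    have hδ0 : 0 < δ := by rw [← NNReal.coe_pos, hδr]; positivity
    set C : ℝ := ((δ / δ ^ (q : ℝ) : ℝ≥0) : ℝ) with hC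
    have hC0 : 0 < C := by
      rw [hC, NNReal.coe_pos]; exact div_pos hδ0 (NNReal.rpow_pos hδ0)
    set m : ℝ := ε / (2 * (K ^ 2 + 1)) / C with hm
    have hm0 : 0 < m := by positivity
    refine ⟨ENNReal.ofReal m ^ (1 / p.toReal), ?_, fun e he b₁ h₁ b₂ h₂ => ?_⟩
    · exact ENNReal.rpow_pos (by simpa using hm0) ENNReal.ofReal_ne_top
    rw [lpNorm, if_neg hpt, ENNReal.rpow_lt_rpow_iff (by rw [hpr]; positivity)] at he
    refine (norm_inner_lmul_le_of_truncation e hδ0 hq1 (he.trans ENNReal.ofReal_lt_top) h₁ h₂).trans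
      ?_
    have h3 : (τ (CFC.abs e ^ q)).toReal ≤ m := ENNReal.toReal_le_of_le_ofReal hm0.le he.le
    have h4 : C * (τ (CFC.abs e ^ q)).toReal ≤ C * m := by gcongr
    have h5 : C * m = ε / (2 * (K ^ 2 + 1)) := by rw [hm]; field_simp
    have h6 : K ^ 2 * (δ + C * (τ (CFC.abs e ^ q)).toReal) ≤ K ^ 2 * (ε / (K ^ 2 + 1)) := by
      refine mul_le_mul_of_nonneg_left ?_ (by positivity)
      rw [hδr]
      have : ε / (K ^ 2 + 1) = ε / (2 * (K ^ 2 + 1)) + ε / (2 * (K ^ 2 + 1)) := by field_simp; ring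
      linarith
    refine h6.trans ?_
    have : K ^ 2 * (ε / (K ^ 2 + 1)) = ε * (K ^ 2 / (K ^ 2 + 1)) := by field_simp
    rw [this]
    refine mul_le_of_le_one_right hε.le ?_
    rw [div_le_one (by positivity)]
    linarith

end NSFTrace

end SemigroupBMO

namespace SemigroupBMO

variable {H : Type u} [NormedAddCommGroup H] [InnerProductSpace ℂ H] [CompleteSpace H]
variable {N : VonNeumannAlgebra H} {τ : NSFTrace N}

namespace StandardSemigroup

open NSFTrace

variable (S : StandardSemigroup τ)

/-! ### The gradient form on the domain -/

lemma gradApprox_self (r : ℝ) (u : N) : S.gradApprox r u u =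
    ((r⁻¹ / 2 : ℝ) : ℂ) • (star (u - S.T r u) * (u - S.T r u) + S.dev r u) := by
  rw [gradApprox, diffQuot, diffQuot, diffQuot, dev, S.T_star]
  have : ((r⁻¹ / 2 : ℝ) : ℂ) = (1 / 2 : ℂ) * ((r⁻¹ : ℝ) : ℂ) := by push_cast; ring
  rw [this, mul_smul]
  congr 1
  rw [smul_mul_assoc, mul_smul_comm, ← smul_add, ← smul_sub]
  congr 1
  simp only [star_sub]
  noncomm_ring

lemma gradApprox_nonneg {r : ℝ} (hr : 0 ≤ r) (u : N) : 0 ≤ S.gradApprox r u u := by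
  rw [gradApprox_self]
  have h : 0 ≤ star (u - S.T r u) * (u - S.T r u) + S.dev r u :=
    add_nonneg (star_mul_self_nonneg _) (S.dev_nonneg hr u)
  obtain ⟨a, -, ha⟩ := exists_star_mul_self h
  have e : ((r⁻¹ / 2 : ℝ) : ℂ) • (star a * a) =
      star (((Real.sqrt (r⁻¹ / 2) : ℝ) : ℂ) • a) * (((Real.sqrt (r⁻¹ / 2) : ℝ) : ℂ) • a) := by
    rw [star_smul, smul_mul_smul_comm, Complex.star_def, Complex.conj_ofReal, ← Complex.ofReal_mul,
      Real.mul_self_sqrt (by positivity)]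
  rw [ha, e]
  exact star_mul_self_nonneg _

lemma state_smul (c : τ.PreL2) (r : ℝ) (x : N) :
    τ.state c ((r : ℂ) • x) = r * τ.state c x := by
  have : ((r : ℂ) • x) = r • x := Complex.coe_smul r x
  rw [this, map_smul, smul_eq_mul]

/-- `push` preserves the L_2 norm and does not increase the bound on the operator norm. Estimates
uniform on balls therefore remain uniform along the moving vectors that occur in the differentiation
argument. -/
lemma push_mem_ball (t : ℝ) {c : τ.PreL2} {K : ℝ} (hc : c ∈ τ.ball K) :
    S.push t c ∈ τ.ball K := by
  refine ⟨?_, by rw [S.norm_push]; exact hc.2⟩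
  have h0 : 0 ≤ S.T (max t 0) (c.val * star c.val) := S.T_nonneg _ (mul_star_self_nonneg _)
  have h1 : ‖(S.push t c).val‖ * ‖(S.push t c).val‖ ≤ K * K := by
    rw [← CStarRing.norm_star_mul_self]
    have hq : (S.push t c).val * (S.push t c).val = S.T (max t 0) (c.val * star c.val) :=
      CFC.sqrt_mul_sqrt_self _ h0
    have hs : star (S.push t c).val = (S.push t c).val :=
      (CFC.sqrt_nonneg (S.T (max t 0) (c.val * star c.val))).isSelfAdjoint.star_eq
    rw [hs, hq]
    refine (S.norm_T_apply_le (le_max_right _ _) _).trans ((norm_mul_le _ _).trans ?_)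
    rw [norm_star]
    exact mul_le_mul hc.1 hc.1 (norm_nonneg _) ((norm_nonneg _).trans hc.1)
  exact le_of_sq_le_sq (by rwa [pow_two, pow_two]) ((norm_nonneg _).trans hc.1)

lemma exists_diffQuot_sub_le {u : N} (hu : ∃ p : ℝ≥0∞, 1 ≤ p ∧ S.InDomain p u) (K : ℝ) {ε : ℝ}
    (hε : 0 < ε) : ∃ δ > 0, ∀ r ∈ Ioo 0 δ, ∀ s ∈ Ioo 0 δ, ∀ b₁ ∈ τ.ball K, ∀ b₂ ∈ τ.ball K,
      ‖⟪b₁, τ.lmul (S.diffQuot r u - S.diffQuot s u) b₂⟫_ℂ‖ ≤ ε := by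
  obtain ⟨p, hp, -, h⟩ := hu
  obtain ⟨η, hη, h'⟩ := τ.exists_lpNorm_inner_le hp K hε
  obtain ⟨δ, hδ, hd⟩ := h η hη
  exact ⟨δ, hδ, fun r hr s hs => h' _ (hd r hr s hs)⟩

/-- `r⁻¹ |u - T_r u|²` tends to zero, uniformly on balls. -/
lemma exists_state_sub_sq_le {u : N} (hu : ∃ p : ℝ≥0∞, 1 ≤ p ∧ S.InDomain p u) (K : ℝ) {ε : ℝ}
    (hε : 0 < ε) : ∃ δ > 0, ∀ r ∈ Ioo 0 δ, ∀ b ∈ τ.ball K,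
      r⁻¹ * τ.state b (star (u - S.T r u) * (u - S.T r u)) ≤ ε := by
  by_cases hK : K < 0
  · exact ⟨1, one_pos, fun r _ b hb => absurd ((norm_nonneg _).trans hb.1) (not_le.2 hK)⟩
  rw [not_lt] at hK
  set L : ℝ := (2 * ‖u‖ + 1) * K with hL
  obtain ⟨δ, hδ, h⟩ := S.exists_diffQuot_sub_le hu L (half_pos hε)
  -- A fixed reference step: its difference quotient is a bounded element of N and approximates all
  -- quotients of smaller step up to ε/2.
  set s : ℝ := δ / 2 with hs
  have hsI : s ∈ Ioo 0 δ := ⟨by positivity, by rw [hs]; linarith⟩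
  set α : ℝ := ‖S.diffQuot s u‖ * K with hα
  have hα0 : 0 ≤ α := by positivity
  set κ : ℝ := ε / 2 / (α + 1) with hκ
  have hκ0 : 0 < κ := by positivity
  refine ⟨min δ (κ ^ 2 / (ε / 2 + α * L + 1)), by positivity, fun r hr b hb => ?_⟩
  have hr0 : 0 < r := hr.1
  have hrδ : r ∈ Ioo 0 δ := ⟨hr.1, hr.2.trans_le (min_le_left _ _)⟩
  rw [state_star_mul_self]
  set d := u - S.T r u with hd
  set X := ‖τ.lmul d b‖ with hX
  have hdn : ‖d‖ ≤ 2 * ‖u‖ := by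
    have := (norm_sub_le u (S.T r u)).trans (add_le_add le_rfl (S.norm_T_apply_le hr0.le u))
    linarith
  have hdb : τ.lmul d b ∈ τ.ball L := lmul_mem_ball hb (by linarith)
  have hbL : b ∈ τ.ball L := ball_mono (by rw [hL]; nlinarith [norm_nonneg u]) hb
  have hXL : X ≤ L := hdb.2
  -- One factor u − T_r u is absorbed into the difference quotient: r^{−1}‖db‖² = ⟨db, (A_r u)b⟩.
  have e1 : r⁻¹ * X ^ 2 = (⟪τ.lmul d b, τ.lmul (S.diffQuot r u - S.diffQuot s u) b⟫_ℂ).re +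
      (⟪τ.lmul d b, τ.lmul (S.diffQuot s u) b⟫_ℂ).re := by
    rw [← Complex.add_re, ← inner_add_right, ← add_apply, ← map_add, sub_add_cancel, diffQuot,
      map_smul, smul_apply, inner_smul_right, Complex.re_ofReal_mul]
    congr 1
    exact (inner_self_eq_norm_sq (𝕜 := ℂ) _).symm
  have h1 := (Complex.re_le_norm _).trans (h r hrδ s hsI _ hdb _ hbL)
  have h2 : (⟪τ.lmul d b, τ.lmul (S.diffQuot s u) b⟫_ℂ).re ≤ X * α :=
    (Complex.re_le_norm _).trans ((norm_inner_le_norm _ _).trans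
      (mul_le_mul_of_nonneg_left ((norm_lmul_le _ _).trans
        (mul_le_mul_of_nonneg_left hb.2 (norm_nonneg _))) (norm_nonneg _)))
  have hX0 : 0 ≤ X := norm_nonneg _
  -- Bootstrap: the crude bound X ≤ L first gives X² = O(r), so X ≤ κ for small r, and reinserting
  -- this makes the term Xα at most ε/2.
  have h3 : X ^ 2 ≤ r * (ε / 2 + α * L) := by
    have : r⁻¹ * X ^ 2 ≤ ε / 2 + α * L := by
      have : X * α ≤ L * α := by gcongr
      linarith
    rwa [inv_mul_le_iff₀ hr0] at this
  have h4 : X ^ 2 ≤ κ ^ 2 := by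
    have hp : 0 ≤ ε / 2 + α * L := by positivity
    have h5 : r * (ε / 2 + α * L + 1) ≤ κ ^ 2 := by
      rw [← le_div_iff₀ (by positivity)]
      exact hr.2.le.trans (min_le_right _ _)
    nlinarith
  have h6 : X ≤ κ := le_of_sq_le_sq h4 hκ0.le
  have h7 : X * α ≤ ε / 2 := by
    have h8 : κ * (α + 1) = ε / 2 := by rw [hκ]; field_simp
    nlinarith
  rw [e1]
  linarith

/-- The difference quotients of the gradient form are uniformly Cauchy on balls. -/
lemma exists_gradApprox_sub_le {u : N} (hu : ∃ p : ℝ≥0∞, 1 ≤ p ∧ S.InDomain p u)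
    (hu' : ∃ p : ℝ≥0∞, 1 ≤ p ∧ S.InDomain p (star u))
    (huu : ∃ p : ℝ≥0∞, 1 ≤ p ∧ S.InDomain p (star u * u)) (K : ℝ) {ε : ℝ}
    (hε : 0 < ε) : ∃ δ > 0, ∀ r ∈ Ioo 0 δ, ∀ s ∈ Ioo 0 δ, ∀ b ∈ τ.ball K,
      |τ.state b (S.gradApprox r u u) - τ.state b (S.gradApprox s u u)| ≤ ε := by
  by_cases hK : K < 0
  · exact ⟨1, one_pos, fun r _ s _ b hb => absurd ((norm_nonneg _).trans hb.1) (not_le.2 hK)⟩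
  rw [not_lt] at hK
  set L : ℝ := (‖u‖ + 1) * K with hL
  obtain ⟨δ₁, hδ₁, h₁⟩ := S.exists_diffQuot_sub_le hu L (half_pos hε)
  obtain ⟨δ₂, hδ₂, h₂⟩ := S.exists_diffQuot_sub_le hu' L (half_pos hε)
  obtain ⟨δ₃, hδ₃, h₃⟩ := S.exists_diffQuot_sub_le huu L (half_pos hε)
  refine ⟨min δ₁ (min δ₂ δ₃), by positivity, fun r hr s hs b hb => ?_⟩
  have hbL : b ∈ τ.ball L := ball_mono (by rw [hL]; nlinarith [norm_nonneg u]) hb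
  have hub : τ.lmul u b ∈ τ.ball L := lmul_mem_ball hb (by linarith)
  have i : ∀ {x}, x ∈ Ioo 0 (min δ₁ (min δ₂ δ₃)) → x ∈ Ioo 0 δ₁ ∧ x ∈ Ioo 0 δ₂ ∧ x ∈ Ioo 0 δ₃ :=
    fun {x} hx => ⟨⟨hx.1, hx.2.trans_le (min_le_left _ _)⟩,
      ⟨hx.1, hx.2.trans_le ((min_le_right _ _).trans (min_le_left _ _))⟩,
      ⟨hx.1, hx.2.trans_le ((min_le_right _ _).trans (min_le_right _ _))⟩⟩
  have k₁ := h₁ r (i hr).1 s (i hs).1 _ hub _ hbL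
  have k₂ := h₂ r (i hr).2.1 s (i hs).2.1 _ hbL _ hub
  have k₃ := h₃ r (i hr).2.2 s (i hs).2.2 _ hbL _ hbL
  have e : τ.state b (S.gradApprox r u u) - τ.state b (S.gradApprox s u u) =
      ((1 / 2 : ℂ) * (⟪b, τ.lmul (S.diffQuot r (star u) - S.diffQuot s (star u)) (τ.lmul u b)⟫_ℂ +
        ⟪τ.lmul u b, τ.lmul (S.diffQuot r u - S.diffQuot s u) b⟫_ℂ -
        ⟪b, τ.lmul (S.diffQuot r (star u * u) - S.diffQuot s (star u * u)) b⟫_ℂ)).re := by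
    rw [← map_sub, state_apply, inner_lmul_left u b, ← lmul_mul, ← lmul_mul, ← inner_add_right,
      ← inner_sub_right, ← inner_smul_right]
    congr 2
    rw [← add_apply, ← sub_apply, ← smul_apply, ← map_add, ← map_sub, ← map_smul]
    congr 2
    simp only [gradApprox, ← smul_sub, sub_mul, mul_sub]
    congr 1
    abel
  rw [e]
  refine (Complex.abs_re_le_norm _).trans ?_
  rw [norm_mul]
  have := (norm_sub_le _ _).trans (add_le_add (norm_add_le
    ⟪b, τ.lmul (S.diffQuot r (star u) - S.diffQuot s (star u)) (τ.lmul u b)⟫_ℂ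
    ⟪τ.lmul u b, τ.lmul (S.diffQuot r u - S.diffQuot s u) b⟫_ℂ)
    (le_refl ‖⟪b, τ.lmul (S.diffQuot r (star u * u) - S.diffQuot s (star u * u)) b⟫_ℂ‖))
  have e2 : ‖(1 / 2 : ℂ)‖ = 1 / 2 := by simp
  rw [e2]
  linarith

/-- The limit of `(2 r)⁻¹ (T_r |u|² - |T_r u|²)` is the gradient form, uniformly on balls. -/
lemma exists_grad {u : N} (hu : ∃ p : ℝ≥0∞, 1 ≤ p ∧ S.InDomain p u)
    (hu' : ∃ p : ℝ≥0∞, 1 ≤ p ∧ S.InDomain p (star u))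
    (huu : ∃ p : ℝ≥0∞, 1 ≤ p ∧ S.InDomain p (star u * u)) :
    ∃ γ : τ.PreL2 → ℝ, (∀ b, S.gradPairing u b.val = ENNReal.ofReal (γ b)) ∧
      (∀ v, 0 ≤ v → ∀ b, S.semigroupGradPairing v u b.val = ENNReal.ofReal (γ (S.push v b))) ∧
      (∀ b, 0 ≤ γ b) ∧
      ∀ K ε, 0 < ε → ∃ δ > 0, ∀ r ∈ Ioo 0 δ, ∀ b ∈ τ.ball K,
        |(r⁻¹ / 2) * τ.state b (S.dev r u) - γ b| ≤ ε := by
  have hlim : ∀ b, ∃ x, Tendsto (fun r => τ.state b (S.gradApprox r u u)) (𝓝[>] 0) (𝓝 x) := by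
    intro b
    obtain ⟨K, -, hb⟩ := exists_mem_ball b
    refine cauchy_map_iff_exists_tendsto.1 (Metric.cauchy_iff.2 ⟨inferInstance, fun ε hε => ?_⟩)
    obtain ⟨δ, hδ, h⟩ := S.exists_gradApprox_sub_le hu hu' huu K (half_pos hε)
    refine ⟨_, image_mem_map (Ioo_mem_nhdsGT hδ), ?_⟩
    rintro _ ⟨r, hr, rfl⟩ _ ⟨s, hs, rfl⟩
    rw [Real.dist_eq]
    exact (h r hr s hs b hb).trans_lt (half_lt_self hε)
  choose γ hγ using hlim
  have hγ0 : ∀ b, 0 ≤ γ b := fun b => ge_of_tendsto (hγ b) (by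
    filter_upwards [self_mem_nhdsWithin] with r hr
    exact τ.state_nonneg b (S.gradApprox_nonneg (le_of_lt hr) u))
  have hof : ∀ b, Tendsto (fun r => ENNReal.ofReal (τ.state b (S.gradApprox r u u))) (𝓝[>] 0)
      (𝓝 (ENNReal.ofReal (γ b))) := fun b => (ENNReal.continuous_ofReal.tendsto _).comp (hγ b)
  refine ⟨γ, fun b => ?_, fun v hv b => ?_, hγ0, fun K ε hε => ?_⟩
  · refine Tendsto.limUnder_eq ((hof b).congr' ?_)
    filter_upwards [self_mem_nhdsWithin] with r hr
    rw [τ.ofReal_state b (S.gradApprox_nonneg (le_of_lt hr) u)]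
  · refine Tendsto.limUnder_eq ((hof (S.push v b)).congr' ?_)
    filter_upwards [self_mem_nhdsWithin] with r hr
    rw [← S.state_T hv, τ.ofReal_state b (S.T_nonneg v (S.gradApprox_nonneg (le_of_lt hr) u))]
  · obtain ⟨δ₁, hδ₁, h₁⟩ := S.exists_gradApprox_sub_le hu hu' huu K (half_pos hε)
    obtain ⟨δ₂, hδ₂, h₂⟩ := S.exists_state_sub_sq_le hu K hε
    refine ⟨min δ₁ δ₂, by positivity, fun r hr b hb => ?_⟩
    have hr1 : r ∈ Ioo 0 δ₁ := ⟨hr.1, hr.2.trans_le (min_le_left _ _)⟩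
    have hr2 : r ∈ Ioo 0 δ₂ := ⟨hr.1, hr.2.trans_le (min_le_right _ _)⟩
    have k1 : |τ.state b (S.gradApprox r u u) - γ b| ≤ ε / 2 := by
      refine le_of_tendsto ((tendsto_const_nhds.sub (hγ b)).abs) ?_
      filter_upwards [Ioo_mem_nhdsGT hδ₁] with s hs using h₁ r hr1 s hs b hb
    have k2 := h₂ r hr2 b hb
    have k3 := τ.state_nonneg b (star_mul_self_nonneg (u - S.T r u))
    have k4 : 0 ≤ r⁻¹ * τ.state b (star (u - S.T r u) * (u - S.T r u)) :=
      mul_nonneg (inv_nonneg.2 hr.1.le) k3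
    rw [gradApprox_self, state_smul, map_add, mul_add, abs_le] at k1
    rw [abs_le]
    constructor <;> linarith [k1.1, k1.2]

/-! ### The condition `Γ² ≥ 0` on the algebra -/

/-- A continuous function whose right Dini derivatives are at most ε grows at most at rate ε.
One-sided information suffices, since Γ is only a right limit. -/
lemma le_of_forall_eventually_le {Φ : ℝ → ℝ} {v ε : ℝ} (hv : 0 ≤ v) (hc : ContinuousOn Φ (Icc 0 v))
    (h : ∀ s ∈ Ico 0 v, ∃ δ > 0, ∀ h ∈ Ioo 0 δ, s + h ≤ v → Φ (s + h) ≤ Φ s + ε * h) :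
    Φ v ≤ Φ 0 + ε * v := by
  refine image_le_of_liminf_slope_right_le_deriv_boundary (B := fun x => Φ 0 + ε * x)
    (B' := fun _ => ε) hc (by simp) (by fun_prop) (fun x _ => ?_) (fun x hx r hr => ?_)
    (right_mem_Icc.2 hv)
  · exact (((hasDerivAt_id x).const_mul ε).const_add (Φ 0)).hasDerivWithinAt.congr_deriv (mul_one ε)
  · obtain ⟨δ, hδ, hs⟩ := h x hx
    have hpos : 0 < min δ (v - x) := lt_min hδ (sub_pos.2 hx.2)
    refine Eventually.frequently ?_
    filter_upwards [Ioo_mem_nhdsGT (show x < x + min δ (v - x) by linarith)] with z hz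
    have hz0 : 0 < z - x := by linarith [hz.1]
    have hz1 := min_le_left δ (v - x)
    have hz2 := min_le_right δ (v - x)
    have h1 := hs (z - x) ⟨hz0, by linarith [hz.2]⟩ (by linarith [hz.2])
    rw [add_sub_cancel] at h1
    refine lt_of_le_of_lt ?_ hr
    rw [slope_def_field, div_le_iff₀ hz0]
    linarith

/-- The discrete form of `Γ² ≥ 0`. -/
lemma state_dev_T_le {𝒜 : NonUnitalStarSubalgebra ℂ N}
    (hT : ∀ s : ℝ, 0 ≤ s → ∀ f ∈ 𝒜, S.T s f ∈ 𝒜)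
    (hdom : ∀ f ∈ 𝒜, ∃ p : ℝ≥0∞, 1 ≤ p ∧ S.InDomain p f)
    (hΓ : ∀ v : ℝ, 0 < v → ∀ f ∈ 𝒜, ∀ b ∈ τ.finSq,
      S.gradPairing (S.T v f) b ≤ S.semigroupGradPairing v f b)
    {g : N} (hg : g ∈ 𝒜) {a v : ℝ} (ha : 0 < a) (hv : 0 ≤ v) (c : τ.PreL2) :
    τ.state c (S.dev v (S.T a g)) ≤ τ.state c (S.T a (S.dev v g)) := by
  have hgrad := fun {u : N} (hu : u ∈ 𝒜) => S.exists_grad (hdom u hu) (hdom _ (star_mem hu))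
    (hdom _ (mul_mem (star_mem hu) hu))
  -- Φ compares the energy of g at total time v + a with that of T_a g at total time v. Its right
  -- derivative is a state, transported by T_{v−s}, of 2Γ(T_a T_s g) − 2T_a Γ(T_s g), nonpositive by
  -- Γ² ≥ 0. The inequality Φ(v) ≤ Φ(0) is the claim.
  set Φ : ℝ → ℝ := fun s => S.energy c (v + a) g s - S.energy c v (S.T a g) s with hΦ
  have hcont : ContinuousOn Φ (Icc 0 v) :=
    ((S.continuousOn_energy c (add_nonneg hv ha.le) g).mono
      (Icc_subset_Icc_right (by linarith))).sub (S.continuousOn_energy c hv (S.T a g))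
  obtain ⟨K, -, hcK⟩ := exists_mem_ball c
  have key : ∀ ε, 0 < ε → Φ v ≤ Φ 0 + ε * v := fun ε hε => by
    refine le_of_forall_eventually_le hv hcont fun s hs => ?_
    have hu : S.T s g ∈ 𝒜 := hT s hs.1 g hg
    obtain ⟨γ, -, hγv, hγ0, hγ⟩ := hgrad hu
    obtain ⟨γ', hγ'b, -, hγ'0, hγ'⟩ := hgrad (hT a ha.le _ hu)
    obtain ⟨δ₁, hδ₁, h₁⟩ := hγ K (ε / 4) (by positivity)
    obtain ⟨δ₂, hδ₂, h₂⟩ := hγ' K (ε / 4) (by positivity)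
    refine ⟨min δ₁ δ₂, by positivity, fun h hh hsv => ?_⟩
    have hh1 : h ∈ Ioo 0 δ₁ := ⟨hh.1, hh.2.trans_le (min_le_left _ _)⟩
    have hh2 : h ∈ Ioo 0 δ₂ := ⟨hh.1, hh.2.trans_le (min_le_right _ _)⟩
    have h0 : 0 < h := hh.1
    have hd0 : 0 ≤ v - s - h := by linarith
    have e1 := S.state_T_dev c g (a := (v - s - h) + a) (h := h) (s := s) (by linarith) h0.le hs.1
    have e2 := S.state_T_dev c (S.T a g) (a := v - s - h) (h := h) (s := s) hd0 h0.le hs.1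
    rw [show v - s - h + a + h + s = v + a by ring] at e1
    rw [show v - s - h + h + s = v by ring] at e2
    rw [← S.T_T hd0 ha.le, S.state_T hd0] at e1
    rw [S.T_T hs.1 ha.le, add_comm s a, ← S.T_T ha.le hs.1, S.state_T hd0] at e2
    -- The test vector depends on h, so pointwise limits defining Γ would not suffice; the
    -- uniformity on balls in `exists_grad` is used here.
    set b := S.push (v - s - h) c
    have hb : b ∈ τ.ball K := S.push_mem_ball _ hcK
    rw [S.state_T ha.le] at e1
    have hab : S.push a b ∈ τ.ball K := S.push_mem_ball a hb
    have l1 := (abs_le.1 (h₁ h hh1 _ hab)).1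
    have l2 := (abs_le.1 (h₂ h hh2 _ hb)).2
    have l3 : γ' b ≤ γ (S.push a b) := by
      have := hΓ a ha _ hu b.val b.2
      rw [hγ'b, hγv a ha.le, ENNReal.ofReal_le_ofReal_iff (hγ0 _)] at this
      exact this
    have l4 : h⁻¹ / 2 * (τ.state b (S.dev h (S.T a (S.T s g))) -
        τ.state (S.push a b) (S.dev h (S.T s g))) ≤ ε / 2 := by linarith
    have l5 : τ.state b (S.dev h (S.T a (S.T s g))) -
        τ.state (S.push a b) (S.dev h (S.T s g)) ≤ ε * h := by
      rw [div_mul_eq_mul_div, div_le_div_iff_of_pos_right two_pos, inv_mul_le_iff₀ h0] at l4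
      linarith
    simp only [hΦ]
    linarith
  have hfin : Φ v ≤ Φ 0 := by
    refine le_of_forall_pos_le_add fun ε hε => ?_
    have h1 := key (ε / (v + 1)) (by positivity)
    have h2 : ε / (v + 1) * v ≤ ε := by
      rw [div_mul_eq_mul_div, div_le_iff₀ (by linarith)]; nlinarith
    linarith
  have e1 := S.state_T_dev c g (a := a) (h := v) (s := 0) ha.le hv le_rfl
  have e2 := S.state_T_dev c (S.T a g) (a := 0) (h := v) (s := 0) le_rfl hv le_rfl
  rw [S.map_zero', zero_add, add_zero, add_comm a v] at e1
  rw [S.map_zero', S.map_zero', zero_add, add_zero] at e2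
  simp only [hΦ] at hfin
  linarith

end StandardSemigroup
end SemigroupBMO

namespace SemigroupBMO

variable {H : Type u} [NormedAddCommGroup H] [InnerProductSpace ℂ H] [CompleteSpace H]
variable {N : VonNeumannAlgebra H} {τ : NSFTrace N}

/-! ### Approximation by elements of a weak⋆ dense algebra -/

/-- The bounded transform `Y = i μ y (y + i μ)⁻¹` of a selfadjoint element `y`. -/
lemma exists_resolvent_transform {y : N} (hy : IsSelfAdjoint y) {μ : ℝ} (hμ : 0 < μ) :
    ∃ Y ∈ NonUnitalStarAlgebra.elemental ℂ y, ‖Y‖ ≤ μ ∧ ‖y - Y‖ ≤ ‖y‖ ^ 2 / μ ∧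
      (y + (Complex.I * μ) • 1) * Y = (Complex.I * μ) • y ∧
      Y * (y + (Complex.I * μ) • 1) = (Complex.I * μ) • y := by
  set m : ℂ := Complex.I * μ with hm
  have hn : IsStarNormal y := hy.isStarNormal
  have hspec : ∀ t ∈ quasispectrum ℂ y, t.im = 0 ∧ ‖t‖ ≤ ‖y‖ := fun t ht => by
    rw [quasispectrum_eq_spectrum_union_zero] at ht
    rcases ht with ht | ht
    · refine ⟨hy.im_eq_zero_of_mem_spectrum ht, (spectrum.norm_le_norm_mul_of_mem ht).trans ?_⟩
      exact mul_le_of_le_one_right (norm_nonneg _) ContinuousLinearMap.norm_id_le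
    · rw [mem_singleton_iff.1 ht]; simp
  -- The spectrum of y is real, so |t + iμ| dominates both |t| and μ. All the norm bounds follow
  -- from this.
  have hlow : ∀ t ∈ quasispectrum ℂ y, ‖t‖ ≤ ‖t + m‖ ∧ μ ≤ ‖t + m‖ := fun t ht => by
    have h1 := (hspec t ht).1
    have hre : (t + m).re = t.re := by simp [hm]
    have him : (t + m).im = μ := by simp [hm, h1]
    constructor
    · have : ‖t‖ = |t.re| := by
        conv_lhs => rw [← Complex.re_add_im t, h1]
        simp
      rw [this, ← hre]
      exact Complex.abs_re_le_norm _
    · rw [← him]; exact Complex.im_le_norm _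
  have hne : ∀ t ∈ quasispectrum ℂ y, t + m ≠ 0 := fun t ht h0 => by
    have := (hlow t ht).2
    rw [h0, norm_zero] at this
    linarith
  have hmn : ‖m‖ = μ := by simp [hm, abs_of_pos hμ]
  set f : ℂ → ℂ := fun t => m * t / (t + m) with hf
  have hfc : ContinuousOn f (quasispectrum ℂ y) :=
    (continuousOn_const.mul continuousOn_id).div (continuousOn_id.add continuousOn_const) hne
  have hf0 : f 0 = 0 := by simp [hf]
  have hyf : y * cfcₙ f y + m • cfcₙ f y = m • y := by
    have e1 : y * cfcₙ f y = cfcₙ (fun t => id t * f t) y := by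
      rw [cfcₙ_mul id f y continuousOn_id rfl hfc hf0, cfcₙ_id ℂ y]
    have e2 : m • cfcₙ f y = cfcₙ (fun t => m * f t) y := (cfcₙ_const_mul m f y hfc hf0).symm
    have e3 : m • y = cfcₙ (fun t => m * id t) y := by
      rw [cfcₙ_const_mul m id y continuousOn_id rfl, cfcₙ_id ℂ y]
    rw [e1, e2, e3, ← cfcₙ_add (fun t => id t * f t) (fun t => m * f t) y
      (continuousOn_id.mul hfc) (by simp) (continuousOn_const.mul hfc) (by simp [hf0])]
    refine cfcₙ_congr fun t ht => ?_
    simp only [hf, id]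
    have := hne t ht
    field_simp
  have hcomm : cfcₙ f y * y = y * cfcₙ f y := by
    conv_lhs => rw [← cfcₙ_id ℂ y]
    conv_rhs => rw [← cfcₙ_id ℂ y]
    rw [cfcₙ_id ℂ y]
    conv_lhs => rw [← cfcₙ_id ℂ y]
    conv_rhs => rw [← cfcₙ_id ℂ y]
    rw [cfcₙ_id ℂ y]
    have := cfcₙ_commute_cfcₙ f id y
    rw [cfcₙ_id ℂ y] at this
    exact this.eq
  refine ⟨cfcₙ f y, cfcₙ_mem_elemental f y, norm_cfcₙ_le fun t ht => ?_, ?_, ?_, ?_⟩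
  · have h1 := hlow t ht
    rw [norm_div, norm_mul, hmn, div_le_iff₀ (hμ.trans_le h1.2)]
    exact mul_le_mul_of_nonneg_left h1.1 hμ.le
  · have e : m • (y - cfcₙ f y) = y * cfcₙ f y := by rw [smul_sub, ← hyf]; abel
    have h1 : ‖cfcₙ f y‖ ≤ ‖y‖ := norm_cfcₙ_le fun t ht => by
      have h1 := hlow t ht
      rw [norm_div, norm_mul, hmn, div_le_iff₀ (hμ.trans_le h1.2), mul_comm]
      exact mul_le_mul (hspec t ht).2 h1.2 hμ.le (norm_nonneg _)
    have h2 : μ * ‖y - cfcₙ f y‖ ≤ ‖y‖ ^ 2 := by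
      rw [← hmn, ← norm_smul, e, pow_two]
      exact (norm_mul_le _ _).trans (mul_le_mul_of_nonneg_left h1 (norm_nonneg _))
    rwa [le_div_iff₀' hμ]
  · rw [add_mul, smul_mul_assoc, one_mul, hyf]
  · rw [mul_add, mul_smul_comm, mul_one, hcomm, hyf]

lemma continuous_sum_add {X : Type*} [TopologicalSpace X] {n : ℕ} (f g : Fin n → X → ℂ)
    (hf : ∀ j, Continuous (f j)) (hg : ∀ j, Continuous (g j)) :
    Continuous fun x => ∑ j, (f j x + g j x) := by
  fun_prop

lemma continuous_vector_functional (ζ η : H) :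
    @Continuous N ℂ (weakStarTopology N) _ fun x : N => ⟪ζ, (x : H →L[ℂ] H) η⟫_ℂ := by
  have h1 : @Continuous N ((lp (fun _ : ℕ => H) 2 × lp (fun _ : ℕ => H) 2) → ℂ) (weakStarTopology N)
      _ _ := continuous_induced_dom
  have h2 := @Continuous.comp _ _ _ (weakStarTopology N) _ _ _ _
    (continuous_apply (lp.single 2 0 ζ, lp.single 2 0 η)) h1
  refine (congrArg (@Continuous N ℂ (weakStarTopology N) _) (funext fun x => ?_)).mp h2
  simp only [Function.comp]
  rw [tsum_eq_single 0]
  · simp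
  · intro k hk
    simp [lp.single_apply, hk]

/-- Strong density of the selfadjoint part of a weak⋆ dense ⋆-algebra. -/
lemma exists_selfAdjoint_near {𝒜 : NonUnitalStarSubalgebra ℂ N}
    (hd : @Dense N (weakStarTopology N) (𝒜 : Set N)) {g : N} (hg : IsSelfAdjoint g) (n : ℕ)
    (η : Fin n → H) {ε : ℝ} (hε : 0 < ε) :
    ∃ y ∈ 𝒜, IsSelfAdjoint y ∧ ∀ j, ‖((y - g : N) : H →L[ℂ] H) (η j)‖ < ε := by
  let E := PiLp 2 fun _ : Fin n => H
  let iE : InnerProductSpace ℂ E := PiLp.innerProductSpace fun _ : Fin n => H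
  let iR : InnerProductSpace ℝ E := InnerProductSpace.complexToReal
  let ev : N → E := fun x => WithLp.toLp 2 fun j => (x : H →L[ℂ] H) (η j)
  -- The selfadjoint elements of the algebra form only a real subspace, so the Hilbert space of
  -- n-tuples is treated over ℝ.
  let W : @Submodule ℝ E _ _ (InnerProductSpace.toNormedSpace (𝕜 := ℝ)).toModule :=
    { carrier := {w | ∃ y ∈ 𝒜, IsSelfAdjoint y ∧ w = ev y}
      zero_mem' := ⟨0, zero_mem _, .zero _, by ext j; simp [ev]⟩
      add_mem' := by
        rintro _ _ ⟨y, hy, hys, rfl⟩ ⟨z, hz, hzs, rfl⟩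
        exact ⟨y + z, add_mem hy hz, hys.add hzs, rfl⟩
      smul_mem' := by
        rintro r _ ⟨y, hy, hys, rfl⟩
        refine ⟨(r : ℂ) • y, SMulMemClass.smul_mem _ hy, ?_, ?_⟩
        · rw [isSelfAdjoint_iff, star_smul, hys.star_eq, Complex.star_def, Complex.conj_ofReal]
        · rfl }
  have hmem : ev g ∈ W.topologicalClosure := by
    rw [← Submodule.orthogonal_orthogonal_eq_closure]
    rw [Submodule.mem_orthogonal]
    intro ζ hζ
    rw [Submodule.mem_orthogonal] at hζ
    have hinner : ∀ x : N, ⟪ζ, ev x⟫_ℝ = (∑ j, ⟪ζ j, (x : H →L[ℂ] H) (η j)⟫_ℂ).re := fun x => by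
      rfl
    -- A complex linear weak⋆ continuous functional which on selfadjoint elements equals twice the
    -- real inner product with ζ. Vanishing on the selfadjoint part of the algebra, it vanishes on
    -- the algebra and hence on N, so ev g is orthogonal to ζ.
    let Λ : N → ℂ := fun x => ∑ j, (⟪ζ j, (x : H →L[ℂ] H) (η j)⟫_ℂ + ⟪η j, (x : H →L[ℂ] H) (ζ j)⟫_ℂ)
    have hΛsa : ∀ x : N, IsSelfAdjoint x → Λ x = ((2 * ⟪ζ, ev x⟫_ℝ : ℝ) : ℂ) := fun x hx => by
      have hsym : ∀ j, ⟪η j, (x : H →L[ℂ] H) (ζ j)⟫_ℂ =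
          (starRingEnd ℂ) ⟪ζ j, (x : H →L[ℂ] H) (η j)⟫_ℂ := fun j => by
        rw [inner_conj_symm]
        have := ContinuousLinearMap.adjoint_inner_left (x : H →L[ℂ] H) (ζ j) (η j)
        rw [(coe_isSelfAdjoint hx).adjoint_eq] at this
        exact this.symm
      simp only [Λ, hsym]
      rw [hinner, Finset.sum_add_distrib, ← map_sum, Complex.add_conj]
    have hΛ0 : ∀ x ∈ 𝒜, IsSelfAdjoint x → Λ x = 0 := fun x hx hxs => by
      rw [hΛsa x hxs, real_inner_comm, hζ _ ⟨x, hx, hxs, rfl⟩]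
      simp
    have hΛadd : ∀ (x y : N) (c : ℂ), Λ (x + c • y) = Λ x + c * Λ y := fun x y c => by
      simp only [Λ, Finset.mul_sum, ← Finset.sum_add_distrib]
      refine Finset.sum_congr rfl fun j _ => ?_
      have e : ∀ ξ, ((x + c • y : N) : H →L[ℂ] H) ξ = (x : H →L[ℂ] H) ξ + c • (y : H →L[ℂ] H) ξ :=
        fun _ => rfl
      rw [e, e, inner_add_right, inner_add_right, inner_smul_right, inner_smul_right]
      ring
    have hΛ𝒜 : ∀ x ∈ 𝒜, Λ x = 0 := fun x hx => by
      have h1 : ((1 / 2 : ℂ) • (x + star x)) ∈ 𝒜 :=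
        SMulMemClass.smul_mem _ (add_mem hx (star_mem hx))
      have h2 : ((-Complex.I / 2 : ℂ) • (x - star x)) ∈ 𝒜 :=
        SMulMemClass.smul_mem _ (sub_mem hx (star_mem hx))
      have e : x = (1 / 2 : ℂ) • (x + star x) + Complex.I • ((-Complex.I / 2 : ℂ) • (x - star x)) := by
        rw [smul_smul]
        have : Complex.I * (-Complex.I / 2) = 1 / 2 := by
          rw [mul_div_assoc', mul_neg, Complex.I_mul_I, neg_neg]
        rw [this, ← smul_add]
        have : x + star x + (x - star x) = (2 : ℂ) • x := by rw [two_smul]; abel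
        rw [this, smul_smul]
        norm_num
      rw [e, hΛadd, hΛ0 _ h1, hΛ0 _ h2]
      · simp
      · rw [isSelfAdjoint_iff, star_smul, star_sub, star_star, Complex.star_def]
        simp only [map_div₀, map_neg, Complex.conj_I, map_ofNat, neg_neg]
        rw [neg_div, neg_smul, ← smul_neg, neg_sub]
      · rw [isSelfAdjoint_iff, star_smul, star_add, star_star, Complex.star_def, add_comm]
        simp only [map_div₀, map_one, map_ofNat]
    have hcont : @Continuous N ℂ (weakStarTopology N) _ Λ := by
      exact @continuous_sum_add N (weakStarTopology N) n
        (fun j x => ⟪ζ j, (x : H →L[ℂ] H) (η j)⟫_ℂ) (fun j x => ⟪η j, (x : H →L[ℂ] H) (ζ j)⟫_ℂ)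
        (fun _ => continuous_vector_functional _ _) fun _ => continuous_vector_functional _ _
    have hclosed := @IsClosed.preimage _ _ (weakStarTopology N) _ Λ hcont {0} isClosed_singleton
    have hg0 : Λ g = 0 := by
      have h1 := @closure_minimal _ (weakStarTopology N) (𝒜 : Set N) _ hΛ𝒜 hclosed
      exact h1 (hd g)
    have := hΛsa g hg
    rw [hg0] at this
    have h2 : 2 * ⟪ζ, ev g⟫_ℝ = 0 := by exact_mod_cast this.symm
    simpa using h2
  have hmem' : ev g ∈ closure (W : Set E) := hmem
  obtain ⟨w, ⟨y, hy, hys, rfl⟩, hw⟩ := Metric.mem_closure_iff.1 hmem' ε hε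
  refine ⟨y, hy, hys, fun j => ?_⟩
  rw [dist_comm, dist_eq_norm] at hw
  exact (PiLp.norm_apply_le (ev y - ev g) j).trans_lt hw

namespace NSFTrace

/-- Strong approximants y of g need not be bounded, while domination by vector states requires
bounded differences. The transforms Y of y and G of g have norm at most μ, with G near g for large μ
and Y − G controlled through a resolvent identity. This plays the role of Kaplansky's density
theorem. -/
lemma exists_selfAdjoint_norm_lmul_lt {𝒜 : NonUnitalStarSubalgebra ℂ N}
    (hd : @Dense N (weakStarTopology N) (𝒜 : Set N)) {g : N} (hg : IsSelfAdjoint g)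
    (s : Finset τ.PreL2) {ε : ℝ} (hε : 0 < ε) :
    ∃ y ∈ 𝒜, ∀ c ∈ s, ‖τ.lmul (y - g) c‖ < ε := by
  obtain ⟨B, hB0, hB⟩ : ∃ B : ℝ, 0 < B ∧ ∀ c ∈ s, ‖c‖ ≤ B :=
    ⟨∑ c ∈ s, ‖c‖ + 1, by positivity, fun c hc => by
      linarith [Finset.single_le_sum (f := fun c => ‖c‖) (fun _ _ => norm_nonneg _) hc]⟩
  set μ : ℝ := (‖g‖ ^ 2 + 1) * (4 * B / ε) with hμ
  have hμ0 : 0 < μ := by positivity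
  obtain ⟨G, -, hGn, hGg, hG1, hG2⟩ := exists_resolvent_transform hg hμ0
  set m : ℂ := Complex.I * μ with hm
  have hmn : ‖m‖ = μ := by simp [hm, abs_of_pos hμ0]
  have hsmall : ‖g - G‖ * B ≤ ε / 4 := by
    have h1 : ‖g‖ ^ 2 / μ ≤ ε / (4 * B) := by
      rw [div_le_iff₀ hμ0, hμ]
      have : ε / (4 * B) * ((‖g‖ ^ 2 + 1) * (4 * B / ε)) = ‖g‖ ^ 2 + 1 := by field_simp
      linarith
    calc ‖g - G‖ * B ≤ ε / (4 * B) * B := by gcongr; exact hGg.trans h1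
      _ = ε / 4 := by field_simp
  set ε' : ℝ := (ε / 4 / (2 * μ)) ^ 2 / 2 with hε'
  have hε'0 : 0 < ε' := by positivity
  choose F C hC hFC using fun c : τ.PreL2 => exists_norm_lmul_le c hε'0
  classical
  set F₀ : Finset H := s.biUnion F with hF₀
  obtain ⟨δ, hδ0, hδ⟩ : ∃ δ : ℝ, 0 < δ ∧ ∀ c ∈ s, C c * ((F c).card * δ ^ 2) < ε' := by
    have : ∀ᶠ δ : ℝ in 𝓝[>] 0, ∀ c ∈ s, C c * ((F c).card * δ ^ 2) < ε' := by
      rw [Filter.eventually_all_finset]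
      intro c _
      have h : Tendsto (fun δ : ℝ => C c * ((F c).card * δ ^ 2)) (𝓝[>] 0)
          (𝓝 (C c * ((F c).card * (0 : ℝ) ^ 2))) :=
        ((by fun_prop : Continuous fun δ : ℝ => C c * ((F c).card * δ ^ 2)).tendsto 0).mono_left
          nhdsWithin_le_nhds
      refine h.eventually (gt_mem_nhds ?_)
      simpa using hε'0
    obtain ⟨δ, h1, h2⟩ := (this.and self_mem_nhdsWithin).exists
    exact ⟨δ, h2, h1⟩
  -- The vectors at which y must be close to g are (m − G)ξ, as the identity `hdiff` requires.
  set η : Fin F₀.card → H := fun j => ((m • 1 - G : N) : H →L[ℂ] H) (F₀.equivFin.symm j) with hη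
  obtain ⟨y, hy, hys, hyη⟩ := exists_selfAdjoint_near hd hg _ η (show 0 < μ ^ 2 * δ by positivity)
  have hyF : ∀ ξ ∈ F₀, ‖((y - g : N) : H →L[ℂ] H) (((m • 1 - G : N) : H →L[ℂ] H) ξ)‖ <
      μ ^ 2 * δ := fun ξ hξ => by
    have := hyη (F₀.equivFin ⟨ξ, hξ⟩)
    simpa [hη] using this
  obtain ⟨Y, hYel, hYn, -, hY1, hY2⟩ := exists_resolvent_transform hys hμ0
  rw [← hm] at hY1 hY2
  have hm2 : m * m = -(μ ^ 2 : ℝ) := by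
    rw [hm]; push_cast; linear_combination (μ : ℂ) ^ 2 * Complex.I_mul_I
  -- The second resolvent identity: (m − Y)(y + m) = m² = (g + m)(m − G) and m² = −μ². Only one
  -- factor m − Y, of norm at most 2μ, involves y besides g − y itself.
  have hdiff : (m • 1 - Y) * (g - y) * (m • 1 - G) = ((μ ^ 2 : ℝ) : ℂ) • (Y - G) := by
    have a1 : (m • 1 - Y) * (y + m • 1) = (m * m) • (1 : N) := by
      rw [sub_mul, hY2, smul_mul_assoc, one_mul, smul_add, smul_smul]; abel
    have a2 : (g + m • 1) * (m • 1 - G) = (m * m) • (1 : N) := by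
      rw [mul_sub, hG1, mul_smul_comm, mul_one, smul_add, smul_smul]; abel
    have a3 : g - y = (g + m • 1) - (y + m • 1) := by abel
    have gen : ∀ A B C D : N, A * (C - D) * B = A * (C * B) - A * D * B := fun A B C D => by
      rw [mul_sub, sub_mul, mul_assoc]
    rw [a3, gen, a2, a1, mul_smul_comm, mul_one,
      smul_mul_assoc, one_mul, ← smul_sub, hm2, neg_smul, ← smul_neg]
    congr 1
    abel
  have hYG : ∀ ξ ∈ F₀, ‖((Y - G : N) : H →L[ℂ] H) ξ‖ ≤ 2 * μ * δ := fun ξ hξ => by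
    have h1 : ‖m • (1 : N) - Y‖ ≤ 2 * μ := by
      refine (norm_sub_le _ _).trans ?_
      have : ‖m • (1 : N)‖ ≤ μ := by
        rw [norm_smul, hmn]
        refine mul_le_of_le_one_right hμ0.le ?_
        exact ContinuousLinearMap.norm_id_le
      linarith
    have h2 : ‖((((μ ^ 2 : ℝ) : ℂ) • (Y - G) : N) : H →L[ℂ] H) ξ‖ ≤ 2 * μ * (μ ^ 2 * δ) := by
      rw [← hdiff]
      have e : (((m • 1 - Y) * (g - y) * (m • 1 - G) : N) : H →L[ℂ] H) ξ =
          ((m • 1 - Y : N) : H →L[ℂ] H) (-((y - g : N) : H →L[ℂ] H)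
            (((m • 1 - G : N) : H →L[ℂ] H) ξ)) := by
        have : (m • 1 - Y) * (g - y) * (m • 1 - G) = (m • 1 - Y) * (-((y - g) * (m • 1 - G))) := by
          rw [mul_assoc, ← neg_mul, neg_sub]
        rw [this]; rfl
      rw [e]
      refine (ContinuousLinearMap.le_opNorm _ _).trans ?_
      rw [norm_neg]
      exact mul_le_mul h1 (hyF ξ hξ).le (norm_nonneg _) (by positivity)
    have h3 : ‖((((μ ^ 2 : ℝ) : ℂ) • (Y - G) : N) : H →L[ℂ] H) ξ‖ =
        μ ^ 2 * ‖((Y - G : N) : H →L[ℂ] H) ξ‖ := by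
      have : ((((μ ^ 2 : ℝ) : ℂ) • (Y - G) : N) : H →L[ℂ] H) ξ =
        ((μ ^ 2 : ℝ) : ℂ) • ((Y - G : N) : H →L[ℂ] H) ξ := rfl
      rw [this, norm_smul, Complex.norm_real, Real.norm_of_nonneg (by positivity)]
    rw [h3] at h2
    have : μ ^ 2 * ‖((Y - G : N) : H →L[ℂ] H) ξ‖ ≤ μ ^ 2 * (2 * μ * δ) := by linarith
    exact le_of_mul_le_mul_left this (by positivity)
  have hYGc : ∀ c ∈ s, ‖τ.lmul (Y - G) c‖ ≤ ε / 4 := fun c hc => by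
    set x : N := (((2 * μ)⁻¹ : ℝ) : ℂ) • (Y - G) with hx
    have hcoef : ‖(((2 * μ)⁻¹ : ℝ) : ℂ)‖ = (2 * μ)⁻¹ := by
      rw [Complex.norm_real, Real.norm_of_nonneg (by positivity)]
    have hx1 : ‖x‖ ≤ 1 := by
      rw [hx, norm_smul, hcoef, inv_mul_le_iff₀ (by positivity)]
      have := norm_sub_le Y G
      linarith
    have h1 := hFC c x hx1
    have h2 : ∀ ξ ∈ F c, ‖(x : H →L[ℂ] H) ξ‖ ^ 2 ≤ δ ^ 2 := fun ξ hξ => by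
      have e : (x : H →L[ℂ] H) ξ = (((2 * μ)⁻¹ : ℝ) : ℂ) • ((Y - G : N) : H →L[ℂ] H) ξ := rfl
      refine pow_le_pow_left₀ (norm_nonneg _) ?_ 2
      rw [e, norm_smul, hcoef, inv_mul_le_iff₀ (by positivity)]
      exact hYG ξ (Finset.mem_biUnion.2 ⟨c, hc, hξ⟩)
    have h3 : C c * ∑ ξ ∈ F c, ‖(x : H →L[ℂ] H) ξ‖ ^ 2 ≤ C c * ((F c).card * δ ^ 2) := by
      refine mul_le_mul_of_nonneg_left ?_ (hC c)
      rw [← nsmul_eq_mul]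
      exact Finset.sum_le_card_nsmul _ _ _ h2
    have h4 := hδ c hc
    have h5 : ‖τ.lmul x c‖ ^ 2 ≤ (ε / 4 / (2 * μ)) ^ 2 := by
      have : 2 * ε' = (ε / 4 / (2 * μ)) ^ 2 := by rw [hε']; ring
      linarith
    have h6 := le_of_sq_le_sq h5 (by positivity)
    rw [hx, map_smul, smul_apply, norm_smul, hcoef, div_eq_inv_mul (ε / 4)] at h6
    exact le_of_mul_le_mul_left h6 (by positivity)
  -- Y lies in the C⋆-algebra generated by y, hence in the norm closure of the algebra, and can be
  -- replaced by a nearby element of the algebra itself.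
  have hYcl : Y ∈ closure (𝒜 : Set N) := by
    have hc : IsClosed (𝒜.topologicalClosure : Set N) := 𝒜.isClosed_topologicalClosure
    have h1 : y ∈ 𝒜.topologicalClosure := 𝒜.le_topologicalClosure hy
    have h2 := NonUnitalStarAlgebra.elemental.le_of_mem hc h1 hYel
    exact h2
  obtain ⟨z, hz, hzY⟩ := Metric.mem_closure_iff.1 hYcl (ε / 4 / B) (by positivity)
  refine ⟨z, hz, fun c hc => ?_⟩
  have e : z - g = (z - Y) + (Y - G) + (G - g) := by abel
  have n1 : ‖τ.lmul (z - Y) c‖ ≤ ε / 4 := by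
    refine (norm_lmul_le _ _).trans ?_
    rw [dist_comm, dist_eq_norm] at hzY
    calc ‖z - Y‖ * ‖c‖ ≤ ε / 4 / B * B := by gcongr; exact hB c hc
      _ = ε / 4 := by field_simp
  have n2 := hYGc c hc
  have n3 : ‖τ.lmul (G - g) c‖ ≤ ε / 4 := by
    refine (norm_lmul_le _ _).trans (le_trans ?_ hsmall)
    rw [norm_sub_rev]
    gcongr
    exact hB c hc
  rw [e, map_add, map_add, add_apply, add_apply]
  refine ((norm_add_le _ _).trans (add_le_add (norm_add_le _ _) le_rfl)).trans_lt ?_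
  linarith

lemma exists_norm_lmul_sub_lt {𝒜 : NonUnitalStarSubalgebra ℂ N}
    (hd : @Dense N (weakStarTopology N) (𝒜 : Set N)) (g : N)
    (s : Finset τ.PreL2) {ε : ℝ} (hε : 0 < ε) :
    ∃ y ∈ 𝒜, ∀ c ∈ s, ‖τ.lmul (y - g) c‖ < ε := by
  obtain ⟨y₁, hy₁, h₁⟩ := exists_selfAdjoint_norm_lmul_lt hd (realPart g).2 s (half_pos hε)
  obtain ⟨y₂, hy₂, h₂⟩ := exists_selfAdjoint_norm_lmul_lt hd (imaginaryPart g).2 s (half_pos hε)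
  refine ⟨y₁ + Complex.I • y₂, add_mem hy₁ (SMulMemClass.smul_mem _ hy₂), fun c hc => ?_⟩
  have e : y₁ + Complex.I • y₂ - g =
      (y₁ - (realPart g : N)) + Complex.I • (y₂ - (imaginaryPart g : N)) := by
    conv_lhs => rw [← realPart_add_I_smul_imaginaryPart g]
    rw [smul_sub]; abel
  rw [e, map_add, add_apply, map_smul, smul_apply]
  refine (norm_add_le _ _).trans_lt ?_
  rw [norm_smul, Complex.norm_I, one_mul]
  linarith [h₁ c hc, h₂ c hc]

end NSFTrace

/-! ### The discrete form of Γ² ≥ 0 on all of N -/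

namespace StandardSemigroup

open NSFTrace

variable (S : StandardSemigroup τ)

lemma state_dev (c : τ.PreL2) {v : ℝ} (hv : 0 ≤ v) (g : N) :
    τ.state c (S.dev v g) = ‖τ.lmul g (S.push v c)‖ ^ 2 - ‖τ.lmul (S.T v g) c‖ ^ 2 := by
  rw [dev, map_sub, S.state_T hv, state_star_mul_self, state_star_mul_self]

lemma norm_sub_lmul_T_le {r : ℝ} (hr : 0 ≤ r) (c : τ.PreL2) (x y : N) :
    ‖τ.lmul (S.T r x) c - τ.lmul (S.T r y) c‖ ≤ ‖τ.lmul (x - y) (S.push r c)‖ := by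
  rw [← sub_apply, ← map_sub, ← T_sub]
  exact S.norm_lmul_T_le hr c _

/-- The discrete form of `Γ² ≥ 0` on all of `N`. -/
lemma GammaSqNonneg.state_dev_T_le (hS : S.GammaSqNonneg) (g : N) {a v : ℝ} (ha : 0 ≤ a)
    (hv : 0 ≤ v) (c : τ.PreL2) :
    τ.state c (S.dev v (S.T a g)) ≤ τ.state c (S.T a (S.dev v g)) := by
  rcases ha.eq_or_lt with rfl | ha'
  · rw [S.map_zero', S.map_zero']
  obtain ⟨𝒜, hd, hT, hdom, hΓ⟩ := hS
  classical
  -- Both sides of the inequality are differences of squared L_2 norms. Transposing T_a, T_{v+a} and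
  -- T_v onto vectors, closeness of y to g at these three vectors makes all four norms converge.
  set c₁ := S.push a (S.push v c)
  set c₂ := S.push (v + a) c
  set c₃ := S.push v (S.push a c)
  choose y hy𝒜 hy using fun n : ℕ => exists_norm_lmul_sub_lt (τ := τ) hd g {c₁, c₂, c₃}
    (show (0 : ℝ) < 1 / ((n : ℝ) + 1) by positivity)
  have hlim : ∀ d ∈ ({c₁, c₂, c₃} : Finset τ.PreL2),
      Tendsto (fun n => ‖τ.lmul (y n - g) d‖) atTop (𝓝 0) := fun d hd =>
    squeeze_zero (fun _ => norm_nonneg _) (fun n => (hy n d hd).le)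
      (tendsto_one_div_add_atTop_nhds_zero_nat (𝕜 := ℝ))
  have h1 := hlim c₁ (by simp)
  have h2 := hlim c₂ (by simp)
  have h3 := hlim c₃ (by simp)
  have hTlim : ∀ {r : ℝ} (hr : 0 ≤ r) {d : τ.PreL2},
      Tendsto (fun n => ‖τ.lmul (y n - g) (S.push r d)‖) atTop (𝓝 0) →
      Tendsto (fun n => ‖τ.lmul (S.T r (y n)) d‖ ^ 2) atTop (𝓝 (‖τ.lmul (S.T r g) d‖ ^ 2)) :=
    fun {r} hr {d} h => (tendsto_iff_norm_sub_tendsto_zero.2 (squeeze_zero (fun _ => norm_nonneg _)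
      (fun n => S.norm_sub_lmul_T_le hr d (y n) g) h)).norm.pow 2
  have l1 := hTlim ha h1
  have l2 := hTlim (add_nonneg hv ha) h2
  have l3 : Tendsto (fun n => ‖τ.lmul (y n) c₃‖ ^ 2) atTop (𝓝 (‖τ.lmul g c₃‖ ^ 2)) :=
    (tendsto_iff_norm_sub_tendsto_zero.2 (by simpa using h3)).norm.pow 2
  have l4 := hTlim hv h3
  rw [S.state_T ha, S.state_dev c hv, S.state_dev _ hv, S.T_T hv ha]
  refine le_of_tendsto_of_tendsto' (l1.sub l2) (l3.sub l4) fun n => ?_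
  have := S.state_dev_T_le hT hdom hΓ (hy𝒜 n) ha' hv c
  rwa [S.state_T ha, S.state_dev c hv, S.state_dev _ hv, S.T_T hv ha] at this

end StandardSemigroup
end SemigroupBMO

namespace SemigroupBMO

/-! ### The subordination densities as an approximate identity -/

lemma subDensity_scale {ε v : ℝ} (hε : 0 < ε) (hv : 0 < v) :
    ε ^ 2 * StandardSemigroup.subDensity ε (ε ^ 2 * v) = StandardSemigroup.subDensity 1 v := by
  rw [StandardSemigroup.subDensity_eq ε (by positivity), StandardSemigroup.subDensity_eq 1 hv,
    Real.sqrt_mul (by positivity), Real.sqrt_sq hε.le]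
  have e : -ε ^ 2 / (4 * (ε ^ 2 * v)) = -1 ^ 2 / (4 * v) := by field_simp
  rw [e]
  have : √v ≠ 0 := (Real.sqrt_pos.2 hv).ne'
  field_simp

/-- The substitution u = ε²v turns the density at time ε into the fixed density at time 1; dominated
convergence applies. -/
lemma tendsto_integral_subDensity {F : Type*} [NormedAddCommGroup F] [NormedSpace ℝ F]
    [CompleteSpace F] {φ : ℝ → F} (hφ : StronglyMeasurable φ) {M : ℝ} (hM : ∀ u, ‖φ u‖ ≤ M) {x : F}
    (h : Tendsto φ (𝓝[>] 0) (𝓝 x)) :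
    Tendsto (fun ε => ∫ u in Ioi 0, StandardSemigroup.subDensity ε u • φ u) (𝓝[>] 0) (𝓝 x) := by
  have e0 : x = ∫ v in Ioi 0, StandardSemigroup.subDensity 1 v • x := by
    rw [integral_smul_const, StandardSemigroup.integral_subDensity one_pos, one_smul]
  have h1 : Tendsto (fun ε => ∫ v in Ioi 0, StandardSemigroup.subDensity 1 v • φ (ε ^ 2 * v))
      (𝓝[>] 0) (𝓝 (∫ v in Ioi 0, StandardSemigroup.subDensity 1 v • x)) := by
    refine tendsto_integral_filter_of_dominated_convergence
      (fun v => StandardSemigroup.subDensity 1 v * M) ?_ ?_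
      ((StandardSemigroup.integrableOn_subDensity one_pos).mul_const M) ?_
    · exact Eventually.of_forall fun ε =>
        ((StandardSemigroup.measurable_subDensity_right 1).stronglyMeasurable.smul
          (hφ.comp_measurable (measurable_const_mul _))).aestronglyMeasurable
    · refine Eventually.of_forall fun ε => (ae_restrict_iff' measurableSet_Ioi).2
        (ae_of_all _ fun v hv => ?_)
      have := StandardSemigroup.subDensity_nonneg zero_le_one hv
      rw [norm_smul, Real.norm_of_nonneg this]
      exact mul_le_mul_of_nonneg_left (hM _) this
    · refine (ae_restrict_iff' measurableSet_Ioi).2 (ae_of_all _ fun v hv => ?_)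
      refine (h.comp (tendsto_nhdsWithin_iff.2 ⟨?_, ?_⟩)).const_smul _
      · have : Tendsto (fun ε : ℝ => ε ^ 2 * v) (𝓝 0) (𝓝 (0 ^ 2 * v)) :=
          (by fun_prop : Continuous fun ε : ℝ => ε ^ 2 * v).tendsto 0
        simpa using this.mono_left nhdsWithin_le_nhds
      · filter_upwards [self_mem_nhdsWithin] with ε hε
        exact mul_pos (pow_pos (mem_Ioi.1 hε) 2) (mem_Ioi.1 hv)
  rw [← e0] at h1
  refine h1.congr' ?_
  filter_upwards [self_mem_nhdsWithin] with ε hε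
  have hε : 0 < ε := hε
  have h2 := integral_comp_mul_left_Ioi (fun u => StandardSemigroup.subDensity ε u • φ u) 0
    (show 0 < ε ^ 2 by positivity)
  rw [mul_zero, eq_inv_smul_iff₀ (by positivity), ← integral_smul] at h2
  rw [← h2]
  refine setIntegral_congr_fun measurableSet_Ioi fun v hv => ?_
  rw [smul_smul, subDensity_scale hε hv]

/-- The density of `2 P_t - P_{2t}`. -/
def reflectedDensity (t u : ℝ) : ℝ := StandardSemigroup.subDensity t u -
  StandardSemigroup.subDensity (2 * t) u - -1 * StandardSemigroup.subDensity t u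

lemma integrableOn_reflectedDensity {t : ℝ} (ht : 0 < t) :
    IntegrableOn (reflectedDensity t) (Ioi 0) :=
  ((StandardSemigroup.integrableOn_subDensity ht).sub
    (StandardSemigroup.integrableOn_subDensity (by positivity : 0 < 2 * t))).sub
      ((StandardSemigroup.integrableOn_subDensity ht).const_mul _)

lemma reflectedDensity_nonneg {t u : ℝ} (ht : 0 < t) (hu : 0 < u) : 0 ≤ reflectedDensity t u := by
  have := StandardSemigroup.subDensity_le ht (by linarith : t ≤ 2 * t) hu
  rw [mul_div_cancel_right₀ _ ht.ne'] at this
  rw [reflectedDensity]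
  linarith

lemma integral_reflectedDensity {t : ℝ} (ht : 0 < t) : ∫ u in Ioi 0, reflectedDensity t u = 1 := by
  have hi := StandardSemigroup.integrableOn_subDensity ht
  have hi2 := StandardSemigroup.integrableOn_subDensity (by positivity : 0 < 2 * t)
  have h1 : IntegrableOn (fun u => StandardSemigroup.subDensity t u -
      StandardSemigroup.subDensity (2 * t) u) (Ioi 0) := hi.sub hi2
  simp only [reflectedDensity]
  rw [MeasureTheory.integral_sub h1 (hi.const_mul _), MeasureTheory.integral_sub hi hi2,
    integral_const_mul, StandardSemigroup.integral_subDensity ht,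
    StandardSemigroup.integral_subDensity (by positivity : 0 < 2 * t)]
  norm_num

lemma SubordinationSystem.two_smul_sub_eq {E : Type*} [NormedAddCommGroup E] [NormedSpace ℝ E]
    (S : SubordinationSystem E) {t : ℝ} (ht : 0 < t) (x : E) :
    (2 : ℝ) • S.toPoissonSystem.P t x - S.toPoissonSystem.P (2 * t) x =
      S.integral (reflectedDensity t) x := by
  have hI := S.integral_sub_sub_smul (StandardSemigroup.integrableOn_subDensity ht)
    (StandardSemigroup.integrableOn_subDensity (by positivity : 0 < 2 * t))
    (StandardSemigroup.integrableOn_subDensity ht) (-1)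
  have e : ∀ s, S.toPoissonSystem.P s = S.integral (StandardSemigroup.subDensity s) := fun _ => rfl
  have : S.integral (reflectedDensity t) = S.integral fun u => StandardSemigroup.subDensity t u -
    StandardSemigroup.subDensity (2 * t) u - -1 * StandardSemigroup.subDensity t u := rfl
  rw [this, ← hI, e, e]
  simp only [sub_apply, smul_apply]
  module

variable {H : Type u} [NormedAddCommGroup H] [InnerProductSpace ℂ H] [CompleteSpace H]
variable {N : VonNeumannAlgebra H} {τ : NSFTrace N}

namespace StandardSemigroup

open NSFTrace

variable (S : StandardSemigroup τ)

/-! ### Positivity of the subordinated maps -/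

lemma sub_normalFunctionals {ω ω' : N →L[ℝ] ℝ} (h : ω ∈ S.normalFunctionals)
    (h' : ω' ∈ S.normalFunctionals) : ω - ω' ∈ S.normalFunctionals :=
  fun r hr a x M hM ha => (h r hr a x M hM ha).sub (h' r hr a x M hM ha)

/-- The functional `x ↦ re ⟪c, x d⟫`. -/
def reTest (c d : τ.PreL2) : N →L[ℝ] ℝ := Complex.reCLM.comp ((τ.test c d).restrictScalars ℝ)

lemma reTest_mem (c d : τ.PreL2) : reTest c d ∈ S.normalFunctionals :=
  S.mem_normalFunctionals_of_test c d fun _ => rfl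

lemma integral_star {k : ℝ → ℝ} (hk : IntegrableOn k (Ioi 0)) (f : N) :
    S.sub.integral k (star f) = star (S.sub.integral k f) := by
  have hre : ∀ c d : τ.PreL2, reTest c d (S.sub.integral k (star f)) =
      reTest c d (star (S.sub.integral k f)) := fun c d => by
    have hsymm : ∀ x : N, reTest c d (star x) = reTest d c x := fun x => by
      change (⟪c, τ.lmul (star x) d⟫_ℂ).re = (⟪d, τ.lmul x c⟫_ℂ).re
      rw [← inner_lmul_left, ← inner_conj_symm, Complex.conj_re]
    rw [hsymm, S.sub.map_integral hk (S.reTest_mem c d), S.sub.map_integral hk (S.reTest_mem d c)]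
    refine setIntegral_congr_fun measurableSet_Ioi fun u hu => ?_
    have : S.sub.T u (star f) = star (S.sub.T u f) := S.T_star _ _
    simp only [this, hsymm]
  rw [← sub_eq_zero]
  refine eq_zero_of_test (τ := τ) fun c d => Complex.ext ?_ ?_
  · have := hre c d
    rw [← sub_eq_zero, ← map_sub] at this
    exact this
  · have h2 := hre (Complex.I • c) d
    rw [← sub_eq_zero, ← map_sub] at h2
    have h2 : (⟪Complex.I • c, τ.lmul (S.sub.integral k (star f) - star (S.sub.integral k f)) d⟫_ℂ).re
      = 0 := h2
    rw [inner_smul_left, Complex.conj_I, neg_mul, Complex.neg_re, Complex.I_mul_re, neg_neg] at h2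
    exact h2

lemma isSelfAdjoint_integral {k : ℝ → ℝ} (hk : IntegrableOn k (Ioi 0)) {f : N}
    (hf : IsSelfAdjoint f) : IsSelfAdjoint (S.sub.integral k f) := by
  rw [isSelfAdjoint_iff, ← S.integral_star hk, hf.star_eq]

lemma integral_nonneg {k : ℝ → ℝ} (hk : IntegrableOn k (Ioi 0)) (hk0 : ∀ u, 0 < u → 0 ≤ k u) {f : N}
    (hf : 0 ≤ f) : 0 ≤ S.sub.integral k f := by
  refine nonneg_of_state (τ := τ) (S.isSelfAdjoint_integral hk hf.isSelfAdjoint) fun c => ?_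
  rw [S.sub.map_integral hk (S.state_mem_normalFunctionals c)]
  refine setIntegral_nonneg measurableSet_Ioi fun u hu => mul_nonneg (hk0 u hu) ?_
  exact τ.state_nonneg c (S.T_nonneg _ hf)

lemma sub_T {u : ℝ} (hu : 0 ≤ u) (f : N) : S.sub.T u f = S.T u f := S.TR_apply hu f

/-- The Kadison–Schwarz inequality for averages of the semigroup. -/
lemma integral_schwarz {k : ℝ → ℝ} (hk : IntegrableOn k (Ioi 0)) (hk0 : ∀ u, 0 < u → 0 ≤ k u)
    (hk1 : ∫ u in Ioi 0, k u = 1) (f : N) :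
    star (S.sub.integral k f) * S.sub.integral k f ≤ S.sub.integral k (star f * f) := by
  refine le_of_state (τ := τ) (.star_mul_self _)
    (S.isSelfAdjoint_integral hk (.star_mul_self f)) fun c => ?_
  rw [S.sub.map_integral hk (S.state_mem_normalFunctionals c)]
  refine S.sub.form_integral_le hk hk0 hk1 (fun x y => τ.state c (star x * y))
    (fun x => τ.state_nonneg c (star_mul_self_nonneg x)) (fun x y => ?_) f
    ⟨reTest (τ.lmul (S.sub.integral k f) c) c, S.reTest_mem _ _, fun y => ?_⟩
    (S.sub.integrableOn_mul hk (S.state_mem_normalFunctionals c) _) fun u hu => ?_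
  · have e : star (x - y) * (x - y) = star x * x - star x * y - star y * x + star y * y := by
      rw [star_sub]; noncomm_ring
    have h : τ.state c (star y * x) = τ.state c (star x * y) := by
      change (τ.test c c _).re = (τ.test c c _).re
      rw [test_star_mul, test_star_mul, ← inner_conj_symm, Complex.conj_re]
    rw [e, map_add, map_sub, map_sub, h]
    ring
  · change (τ.test c c _).re = (⟪_, τ.lmul y c⟫_ℂ).re
    rw [test_star_mul, ← inner_conj_symm, Complex.conj_re]
  · rw [S.sub_T hu.le, S.sub_T hu.le]
    exact τ.state_mono c (S.schwarz hu.le f)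

lemma state_dev_eq (c : τ.PreL2) {r : ℝ} (hr : 0 ≤ r) (x : N) :
    τ.state c (S.dev r x) = (⟪τ.lmul x (S.push r c), τ.lmul x (S.push r c)⟫_ℂ).re -
      (⟪τ.lmul (S.T r x) c, τ.lmul (S.T r x) c⟫_ℂ).re := by
  rw [S.state_dev c hr]
  congr 1 <;> exact (inner_self_eq_norm_sq (𝕜 := ℂ) _).symm

/-- The condition `Γ² ≥ 0` for averages of the semigroup. -/
lemma GammaSqNonneg.dev_integral_le (hS : S.GammaSqNonneg) {k : ℝ → ℝ} (hk : IntegrableOn k (Ioi 0))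
    (hk0 : ∀ u, 0 < u → 0 ≤ k u) (hk1 : ∫ u in Ioi 0, k u = 1) {r : ℝ} (hr : 0 ≤ r) (f : N) :
    S.dev r (S.sub.integral k f) ≤ S.sub.integral k (S.dev r f) := by
  refine le_of_state (τ := τ) (S.dev_nonneg hr _).isSelfAdjoint
    (S.isSelfAdjoint_integral hk (S.dev_nonneg hr _).isSelfAdjoint) fun c => ?_
  rw [S.sub.map_integral hk (S.state_mem_normalFunctionals c)]
  have hβ := S.state_dev_eq c hr
  set p := S.push r c
  -- The Schwarz defect of T_r is a quadratic form in f, positive by Kadison–Schwarz. Jensen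
  -- therefore reduces the inequality for the average to the pointwise one for T_u.
  have key := S.sub.form_integral_le hk hk0 hk1
    (fun x y => (⟪τ.lmul x p, τ.lmul y p⟫_ℂ).re - (⟪τ.lmul (S.T r x) c, τ.lmul (S.T r y) c⟫_ℂ).re)
    (fun x => by rw [← hβ]; exact τ.state_nonneg c (S.dev_nonneg hr x)) (fun x y => ?_) f
    ⟨reTest (τ.lmul (S.sub.integral k f) p) p -
      (reTest (τ.lmul (S.T r (S.sub.integral k f)) c) c).comp (S.sub.T r),
      S.sub_normalFunctionals (S.reTest_mem _ _) (S.sub.comp_mem _ (S.reTest_mem _ _) r hr),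
      fun y => ?_⟩
    (S.sub.integrableOn_mul hk (S.state_mem_normalFunctionals c) (S.dev r f)) fun u hu => ?_
  · rwa [← hβ] at key
  · have h : ∀ a b : τ.PreL2, (⟪a - b, a - b⟫_ℂ).re =
        (⟪a, a⟫_ℂ).re - 2 * (⟪a, b⟫_ℂ).re + (⟪b, b⟫_ℂ).re := fun a b => by
      rw [inner_sub_left, inner_sub_right, inner_sub_right, ← inner_conj_symm b a]
      simp only [Complex.sub_re, Complex.conj_re]
      ring
    simp only [map_sub, sub_apply, h]
    ring
  · rw [sub_apply, ContinuousLinearMap.comp_apply, S.sub_T hr]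
    congr 1
    · rw [← inner_conj_symm, Complex.conj_re]; rfl
    · rw [← inner_conj_symm, Complex.conj_re]; rfl
  · rw [← hβ, S.sub_T hu.le, S.sub_T hu.le]
    exact hS.state_dev_T_le S f hu.le hr c

/-! ### Strong continuity of the Poisson semigroup at `0` -/

lemma tendsto_poisson (f : N) (ξ : H) : Tendsto (fun ε => (S.poisson.P ε f : H →L[ℂ] H) ξ) (𝓝[>] 0)
    (𝓝 ((f : H →L[ℂ] H) ξ)) := by
  have h := tendsto_integral_subDensity (S.stronglyMeasurable_TR_apply f ξ) (M := ‖f‖ * ‖ξ‖)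
    (fun u => ((S.TR u f : H →L[ℂ] H).le_opNorm ξ).trans
      (mul_le_mul_of_nonneg_right (S.norm_TR_apply_le u f) (norm_nonneg _))) (S.tendsto_TR_zero f ξ)
  refine h.congr' ?_
  filter_upwards [self_mem_nhdsWithin] with ε hε
  exact (S.integral_apply (integrableOn_subDensity hε) f ξ).symm

lemma norm_poisson_le {ε : ℝ} (hε : 0 < ε) (f : N) : ‖S.poisson.P ε f‖ ≤ ‖f‖ :=
  S.poisson.P_apply_norm_le hε f

lemma tendsto_lmul_poisson (f : N) (c : τ.PreL2) :
    Tendsto (fun ε => τ.lmul (S.poisson.P ε f) c) (𝓝[>] 0) (𝓝 (τ.lmul f c)) := by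
  have h := tendsto_lmul (τ := τ) (l := 𝓝[>] (0 : ℝ)) (M := ‖f‖) (x := f)
    (a := fun ε => if 0 < ε then S.poisson.P ε f else f) (fun ε => ?_) (fun ξ => ?_) c
  · refine h.congr' ?_
    filter_upwards [self_mem_nhdsWithin] with ε hε
    rw [if_pos (mem_Ioi.1 hε)]
  · split_ifs with hε
    · exact S.norm_poisson_le hε f
    · exact le_rfl
  · refine (S.tendsto_poisson f ξ).congr' ?_
    filter_upwards [self_mem_nhdsWithin] with ε hε
    rw [if_pos (mem_Ioi.1 hε)]

lemma state_poisson (c : τ.PreL2) {t : ℝ} (ht : 0 < t) (f : N) :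
    τ.state c (S.poisson.P t (star f * f)) =
      ∫ u in Ioi 0, subDensity t u * ‖τ.lmul f (S.push u c)‖ ^ 2 := by
  refine (S.sub.map_integral (integrableOn_subDensity ht) (S.state_mem_normalFunctionals c) _).trans
    (setIntegral_congr_fun measurableSet_Ioi fun u hu => ?_)
  have hu : 0 ≤ u := le_of_lt hu
  rw [S.sub_T hu, S.norm_lmul_le_of_push hu]

lemma integrableOn_subDensity_mul_norm_sq (c : τ.PreL2) {t : ℝ} (ht : 0 < t) (f : N) :
    IntegrableOn (fun u => subDensity t u * ‖τ.lmul f (S.push u c)‖ ^ 2) (Ioi 0) := by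
  refine (S.sub.integrableOn_mul (integrableOn_subDensity ht) (S.state_mem_normalFunctionals c)
    (star f * f)).congr_fun (fun u hu => ?_) measurableSet_Ioi
  have hu : 0 ≤ u := le_of_lt hu
  simp only
  rw [S.sub_T hu, S.norm_lmul_le_of_push hu]

/-- Writing the state of P_t as an average of the states of the vectors `push u c` reduces the claim
to L_2 convergence of P_ε f at each vector, under a dominating constant. -/
lemma tendsto_state_poisson_sq (c : τ.PreL2) {t : ℝ} (ht : 0 < t) (f : N) :
    Tendsto (fun ε => τ.state c (S.poisson.P t (star (S.poisson.P ε f) * S.poisson.P ε f))) (𝓝[>] 0)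
      (𝓝 (τ.state c (S.poisson.P t (star f * f)))) := by
  simp only [S.state_poisson c ht]
  refine tendsto_integral_filter_of_dominated_convergence
    (fun u => subDensity t u * (‖f‖ * ‖c‖) ^ 2) ?_ ?_
    ((integrableOn_subDensity ht).mul_const _) ?_
  · exact Eventually.of_forall fun ε =>
      (S.integrableOn_subDensity_mul_norm_sq c ht _).aestronglyMeasurable
  · filter_upwards [self_mem_nhdsWithin] with ε hε
    refine (ae_restrict_iff' measurableSet_Ioi).2 (ae_of_all _ fun u hu => ?_)
    have h0 := subDensity_nonneg ht.le hu
    rw [Real.norm_of_nonneg (by positivity)]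
    refine mul_le_mul_of_nonneg_left (pow_le_pow_left₀ (norm_nonneg _) ?_ 2) h0
    refine (norm_lmul_le _ _).trans ?_
    rw [S.norm_push]
    exact mul_le_mul_of_nonneg_right (S.norm_poisson_le hε f) (norm_nonneg _)
  · refine (ae_restrict_iff' measurableSet_Ioi).2 (ae_of_all _ fun u hu => ?_)
    exact ((S.tendsto_lmul_poisson f (S.push u c)).norm.pow 2).const_mul _

/-! ### The gradient system of `N` -/

lemma poisson_eq_integral (t : ℝ) : S.poisson.P t = S.sub.integral (subDensity t) := rfl

lemma poisson_T {r : ℝ} (hr : 0 ≤ r) (f : N) : S.poisson.T r f = S.T r f := S.TR_apply hr f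

/-- The form `f⋆ g` on `N`. -/
def starMulL : N →L[ℝ] N →L[ℝ] N := (ContinuousLinearMap.mul ℝ N).comp
  ((starL' ℝ : N ≃L[ℝ] N) : N →L[ℝ] N)

@[simp] lemma starMulL_apply (f g : N) : starMulL f g = star f * g := rfl

lemma poisson_schwarz {t : ℝ} (ht : 0 < t) (f : N) :
    star (S.poisson.P t f) * S.poisson.P t f ≤ S.poisson.P t (star f * f) :=
  S.integral_schwarz (integrableOn_subDensity ht) (fun _ hu => subDensity_nonneg ht.le hu)
    (integral_subDensity ht) f

/-- The gradient system of the Poisson semigroup on `N`. -/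
def gradientSystem (hS : S.GammaSqNonneg) : GradientSystem N N where
  dom := S.poisson
  val := S.poisson
  B := starMulL
  Pos x := 0 ≤ x
  Ω := {ω | ∃ c : τ.PreL2, ‖c‖ ≤ 1 ∧ ω = τ.state c}
  pos_add _ _ := add_nonneg
  pos_smul c x hc hx := by
    obtain ⟨a, -, rfl⟩ := exists_star_mul_self hx
    have : c • (star a * a) = star ((√c : ℝ) • a) * ((√c : ℝ) • a) := by
      rw [star_smul, smul_mul_smul_comm, star_trivial (√c), Real.mul_self_sqrt hc]
    rw [this]
    exact star_mul_self_nonneg _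
  pos_P t x ht hx := S.integral_nonneg (integrableOn_subDensity ht)
    (fun _ hu => subDensity_nonneg ht.le hu) hx
  nonneg := by
    rintro _ ⟨c, -, rfl⟩ x hx
    exact τ.state_nonneg c hx
  pos_B f := star_mul_self_nonneg f
  schwarz_P t f ht := sub_nonneg.2 (S.poisson_schwarz ht f)
  schwarz_T r f hr := by
    rw [starMulL_apply, starMulL_apply, S.poisson_T hr.le, S.poisson_T hr.le]
    exact S.dev_nonneg hr.le f
  schwarz_R t f ht := by
    have e : ∀ x, (2 : ℝ) • S.poisson.P t x - S.poisson.P (2 * t) x =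
      S.sub.integral (reflectedDensity t) x := S.sub.two_smul_sub_eq ht
    rw [sub_nonneg, e, e]
    exact S.integral_schwarz (integrableOn_reflectedDensity ht)
      (fun _ hu => reflectedDensity_nonneg ht hu) (integral_reflectedDensity ht) f
  -- (t/s)P_s − P_t is the average of the semigroup against a density that is nonnegative by
  -- `subDensity_le`.
  quasi_mono s t y hs hst hy := by
    have ht := hs.trans_le hst
    have hI := S.sub.integral_sub_sub_smul (integrableOn_subDensity hs)
      (integrableOn_subDensity ht) (integrableOn_subDensity hs) (1 - t / s)
    have hk : IntegrableOn (fun u => subDensity s u - subDensity t u - (1 - t / s) * subDensity s u)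
        (Ioi 0) := ((integrableOn_subDensity hs).sub (integrableOn_subDensity ht)).sub
      ((integrableOn_subDensity hs).const_mul _)
    have e : (t / s) • S.poisson.P s y - S.poisson.P t y = S.sub.integral
        (fun u => subDensity s u - subDensity t u - (1 - t / s) * subDensity s u) y := by
      rw [← hI, S.poisson_eq_integral, S.poisson_eq_integral]
      simp only [sub_apply, smul_apply]
      module
    rw [e]
    refine S.integral_nonneg hk (fun u hu => ?_) hy
    have := subDensity_le hs hst hu
    linarith
  gamma_two w r h hw hr := by
    rw [sub_nonneg]
    simp only [starMulL_apply, S.poisson_T hr.le]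
    exact hS.dev_integral_le S (integrableOn_subDensity hw)
      (fun _ hu => subDensity_nonneg hw.le hu) (integral_subDensity hw) hr.le h
  tendsto_B := by
    rintro _ ⟨c, -, rfl⟩ t f ht
    exact S.tendsto_state_poisson_sq c ht f
  tendsto_P := by
    rintro _ ⟨c, -, rfl⟩ f
    exact (Complex.continuous_re.tendsto _).comp
      (tendsto_const_nhds.inner (S.tendsto_lmul_poisson _ c))

end StandardSemigroup
end SemigroupBMO

namespace SemigroupBMO

/-! ### Comparison of the seminorms -/

lemma iSup₂_rpow_half (a : ℝ → ℝ≥0∞) : ⨆ (t : ℝ) (_ : 0 < t), a t ^ (1 / 2 : ℝ) =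
    (⨆ (t : ℝ) (_ : 0 < t), a t) ^ (1 / 2 : ℝ) :=
  ((ENNReal.orderIsoRpow (1 / 2) (by norm_num)).map_iSup₂ _).symm

lemma rpow_half_le {a b : ℝ≥0∞} (h : a ≤ 10000 * b) :
    a ^ (1 / 2 : ℝ) ≤ (100 : ℝ≥0) * b ^ (1 / 2 : ℝ) := by
  have h1 := ENNReal.rpow_le_rpow h (show (0 : ℝ) ≤ 1 / 2 by norm_num)
  rw [ENNReal.mul_rpow_of_nonneg _ _ (by norm_num)] at h1
  have h2 : (10000 : ℝ≥0∞) ^ (1 / 2 : ℝ) = (100 : ℝ≥0) := by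
    have : (10000 : ℝ≥0∞) = ((100 : ℝ≥0) : ℝ≥0∞) ^ (2 : ℝ) := by
      rw [ENNReal.rpow_ofNat]; norm_num
    rw [this, ← ENNReal.rpow_mul]
    norm_num
  rwa [h2] at h1

/-- The seminorms of a gradient system are equivalent. -/
lemma GradientSystem.seminorms_equivalent {V X : Type*} [NormedAddCommGroup V] [NormedSpace ℝ V]
    [NormedAddCommGroup X] [NormedSpace ℝ X] (S : GradientSystem V X) (f : V) {a b d : ℝ≥0∞}
    (ha : a = S.bmoSq f ^ (1 / 2 : ℝ)) (hb : b = S.BMOSq f ^ (1 / 2 : ℝ))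
    (hd : d = S.areaSq f ^ (1 / 2 : ℝ)) :
    b ≤ (100 : ℝ≥0) * a ∧ a ≤ (100 : ℝ≥0) * b ∧ d ≤ (100 : ℝ≥0) * a ∧ a ≤ (100 : ℝ≥0) * d ∧
      d ≤ (100 : ℝ≥0) * b ∧ b ≤ (100 : ℝ≥0) * d := by
  have h1 := S.areaSq_le_bmoSq f
  have h2 := S.bmoSq_le_areaSq f
  have h3 := S.BMOSq_le_bmoSq f
  have h4 := S.bmoSq_le_BMOSq f
  have key : ∀ {x y : ℝ≥0∞} (m n : ℝ≥0∞), x ≤ m * y → m ≤ n → x ≤ n * y := fun m n h hmn =>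
    h.trans (mul_le_mul_left hmn _)
  subst ha hb hd
  refine ⟨rpow_half_le (key 5 _ h3 (by norm_num)), rpow_half_le (key 2025 _ h4 (by norm_num)),
    rpow_half_le (key 4 _ h1 (by norm_num)), rpow_half_le (key 1000 _ h2 (by norm_num)),
    -- The direct comparisons compose through bmo. The largest resulting constant for squares is 4 ·
    -- 2025 = 8100, below 100².
    rpow_half_le (key (4 * 2025) _ ?_ (by norm_num)),
    rpow_half_le (key (5 * 1000) _ ?_ (by norm_num))⟩
  · rw [mul_assoc]
    exact h1.trans (mul_le_mul_right h4 _)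
  · rw [mul_assoc]
    exact h3.trans (mul_le_mul_right h2 _)

/-! ### Norming families of states and norms of weak integrals -/

variable {H : Type u} [NormedAddCommGroup H] [InnerProductSpace ℂ H] [CompleteSpace H]
variable {N : VonNeumannAlgebra H} {τ : NSFTrace N}

/-- `vecState` as a continuous functional. -/
def vecStateL (ξ : H) : N →L[ℝ] ℝ :=
  Complex.reCLM.comp (((innerSL ℂ ξ).restrictScalars ℝ).comp (evalVec N ξ))

lemma enorm_le_iSup_ofReal {ι : Type*} {p : ι → Prop} {a : ι → ℝ} {x : N}
    (h : ∀ M : ℝ, 0 ≤ M → (∀ i, p i → a i ≤ M) → ‖x‖ ≤ M) :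
    ‖x‖ₑ ≤ ⨆ (i : ι) (_ : p i), ENNReal.ofReal (a i) := by
  rcases eq_or_ne (⨆ (i : ι) (_ : p i), ENNReal.ofReal (a i)) ∞ with ht | ht
  · rw [ht]; exact le_top
  · rw [← ENNReal.ofReal_toReal ht, ← ofReal_norm]
    refine ENNReal.ofReal_le_ofReal (h _ ENNReal.toReal_nonneg fun i hi => ?_)
    rw [← ENNReal.ofReal_le_ofReal_iff ENNReal.toReal_nonneg, ENNReal.ofReal_toReal ht]
    exact le_iSup₂ (f := fun i (_ : p i) => ENNReal.ofReal (a i)) i hi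

lemma norm_le_of_vecState {x : N} (hx : 0 ≤ x) {M : ℝ} (hM : 0 ≤ M)
    (h : ∀ ξ : H, ‖ξ‖ ≤ 1 → vecState N ξ x ≤ M) : ‖x‖ ≤ M := by
  obtain ⟨a, -, rfl⟩ := NSFTrace.exists_star_mul_self hx
  have h1 : ‖(a : H →L[ℂ] H)‖ ≤ √M :=
    ContinuousLinearMap.opNorm_le_of_unit_norm (Real.sqrt_nonneg _) fun ξ hξ => by
      have := h ξ hξ.le
      rw [vecState_star_mul_self] at this
      exact Real.le_sqrt_of_sq_le this
  rw [CStarRing.norm_star_mul_self, ← Real.mul_self_sqrt hM]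
  exact mul_le_mul h1 h1 (norm_nonneg _) (Real.sqrt_nonneg _)

lemma enorm_eq_iSup_vecState {x : N} (hx : 0 ≤ x) :
    ‖x‖ₑ = ⨆ (ξ : H) (_ : ‖ξ‖ ≤ 1), ENNReal.ofReal (vecStateL ξ x) := by
  refine le_antisymm ?_ (iSup₂_le fun ξ hξ => ?_)
  · exact enorm_le_iSup_ofReal fun M hM h => norm_le_of_vecState hx hM h
  · rw [← ofReal_norm]
    refine ENNReal.ofReal_le_ofReal ?_
    refine (Complex.re_le_norm _).trans ((norm_inner_le_norm (𝕜 := ℂ) ξ _).trans ?_)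
    have h := (x : H →L[ℂ] H).le_opNorm ξ
    have h0 := norm_nonneg ξ
    have h1 : 0 ≤ ‖x‖ := norm_nonneg x
    have h2 : ‖(x : H →L[ℂ] H) ξ‖ ≤ ‖x‖ := h.trans (mul_le_of_le_one_right h1 hξ)
    exact (mul_le_mul hξ h2 (norm_nonneg _) zero_le_one).trans_eq (one_mul _)

lemma enorm_eq_iSup_state {x : N} (hx : 0 ≤ x) :
    ‖x‖ₑ = ⨆ (c : τ.PreL2) (_ : ‖c‖ ≤ 1), ENNReal.ofReal (τ.state c x) := by
  refine le_antisymm ?_ (iSup₂_le fun c hc => ?_)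
  · exact enorm_le_iSup_ofReal fun M hM h => NSFTrace.norm_le_of_state hx hM h
  · rw [← ofReal_norm]
    exact ENNReal.ofReal_le_ofReal (τ.state_le_norm c hc x)

lemma setLIntegral_Ioo_eq_iSup (φ : ℝ → ℝ≥0∞) {t : ℝ} (ht : 0 < t) :
    ∫⁻ v in Ioo 0 t, φ v = ⨆ n : ℕ, ∫⁻ v in Icc (t / (n + 3)) (t - t / (n + 3)), φ v := by
  have hmono : Monotone fun n : ℕ => Icc (t / ((n : ℝ) + 3)) (t - t / (n + 3)) := fun m n h => by
    have h1 : t / ((n : ℝ) + 3) ≤ t / (m + 3) := by gcongr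
    exact Icc_subset_Icc h1 (by linarith)
  have e : Ioo 0 t = ⋃ n : ℕ, Icc (t / ((n : ℝ) + 3)) (t - t / (n + 3)) := by
    ext v
    rw [mem_iUnion]
    constructor
    · intro hv
      have hpos : 0 < min v (t - v) := lt_min hv.1 (sub_pos.2 hv.2)
      obtain ⟨n, hn⟩ := exists_nat_gt (t / min v (t - v))
      rw [div_lt_iff₀ hpos] at hn
      have h1 : t / ((n : ℝ) + 3) ≤ min v (t - v) := by
        rw [div_le_iff₀ (by positivity)]; nlinarith
      have h2 := min_le_left v (t - v)
      have h3 := min_le_right v (t - v)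
      exact ⟨n, by linarith, by linarith⟩
    · rintro ⟨n, h1, h2⟩
      have : 0 < t / ((n : ℝ) + 3) := by positivity
      exact ⟨by linarith, by linarith⟩
  rw [e, setLIntegral_iUnion_of_directed _ hmono.directed_le]

/-- The norm of a weak integral does not depend on the norming family of states. -/
lemma iSup_lintegral_eq {ι : Type*} {p : ι → Prop} {ω : ι → N →L[ℝ] ℝ}
    (hω : ∀ i, p i → ∀ x, 0 ≤ x → 0 ≤ ω i x)
    (hn : ∀ x : N, 0 ≤ x → ‖x‖ₑ = ⨆ (i : ι) (_ : p i), ENNReal.ofReal (ω i x)) {g : ℝ → N} {t : ℝ}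
    (ht : 0 < t) (hg : ContinuousOn g (Ioi 0)) (hg0 : ∀ v, 0 < v → 0 ≤ g v) :
    ⨆ (i : ι) (_ : p i), ∫⁻ v in Ioo 0 t, ENNReal.ofReal (ω i (g v) * v) =
      ⨆ n : ℕ, ‖∫ v in Icc (t / (n + 3)) (t - t / (n + 3)), v • g v‖ₑ := by
  have hpos : ∀ n : ℕ, ∀ v ∈ Icc (t / ((n : ℝ) + 3)) (t - t / (n + 3)), 0 < v := fun n v hv =>
    lt_of_lt_of_le (by positivity) hv.1
  have hi : ∀ n : ℕ, IntegrableOn (fun v => v • g v) (Icc (t / ((n : ℝ) + 3)) (t - t / (n + 3))) :=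
    fun n => ContinuousOn.integrableOn_compact isCompact_Icc
      (continuousOn_id.smul (hg.mono fun v hv => hpos n v hv))
  -- On compact subintervals of (0, t) the integrand is norm continuous, so the weak integral is a
  -- Bochner integral of positive elements whose norm is computed by the given family. Monotone
  -- exhaustion then recovers the full interval.
  simp only [setLIntegral_Ioo_eq_iSup _ ht]
  have hnn : ∀ n : ℕ, 0 ≤ ∫ v in Icc (t / ((n : ℝ) + 3)) (t - t / (n + 3)), v • g v := fun n => by
    refine integral_nonneg_of_ae (E := N) ((ae_restrict_iff' measurableSet_Icc).2
      (ae_of_all _ fun v hv => ?_))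
    exact smul_nonneg (hpos n v hv).le (hg0 v (hpos n v hv))
  simp only [hn _ (hnn _)]
  rw [iSup_comm]
  refine iSup_congr fun i => ?_
  rw [iSup_comm]
  refine iSup_congr fun n => iSup_congr fun hi' => ?_
  rw [← ContinuousLinearMap.integral_comp_comm _ (hi n), ofReal_integral_eq_lintegral_ofReal
    ((ω i).integrable_comp (hi n))]
  · simp only [map_smul, smul_eq_mul, mul_comm]
  · refine (ae_restrict_iff' measurableSet_Icc).2 (ae_of_all _ fun v hv => ?_)
    exact hω i hi' _ (smul_nonneg (hpos n v hv).le (hg0 v (hpos n v hv)))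

/-! ### Identification of the seminorms on N -/

namespace StandardSemigroup

open NSFTrace

variable (S : StandardSemigroup τ) (hS : S.GammaSqNonneg)

lemma iSup_Ω (F : (N →L[ℝ] ℝ) → ℝ≥0∞) : ⨆ ω ∈ (S.gradientSystem hS).Ω, F ω =
    ⨆ (c : τ.PreL2) (_ : ‖c‖ ≤ 1), F (τ.state c) := by
  refine le_antisymm (iSup₂_le ?_) (iSup₂_le fun c hc => ?_)
  · rintro _ ⟨c, hc, rfl⟩
    exact le_iSup₂ (f := fun (c : τ.PreL2) (_ : ‖c‖ ≤ 1) => F (τ.state c)) c hc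
  · exact le_iSup₂ (f := fun ω (_ : ω ∈ (S.gradientSystem hS).Ω) => F ω) _ ⟨c, hc, rfl⟩

lemma bmo_eq (f : N) : S.bmo f = (S.gradientSystem hS).bmoSq f ^ (1 / 2 : ℝ) := by
  rw [bmo, iSup₂_rpow_half fun t => ‖S.P t (star f * f) - star (S.P t f) * S.P t f‖ₑ]
  congr 1
  refine iSup_congr fun t => iSup_congr fun ht => ?_
  rw [S.iSup_Ω hS, S.P_eq ht, S.P_eq ht]
  exact enorm_eq_iSup_state (sub_nonneg.2 (S.poisson_schwarz ht f))

lemma BMO_eq (f : N) : S.BMO f = (S.gradientSystem hS).BMOSq f ^ (1 / 2 : ℝ) := by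
  rw [BMO, iSup₂_rpow_half fun t => ‖S.P t (star (f - S.P t f) * (f - S.P t f))‖ₑ]
  congr 1
  refine iSup_congr fun t => iSup_congr fun ht => ?_
  rw [S.iSup_Ω hS, S.P_eq ht, S.P_eq ht]
  exact enorm_eq_iSup_state ((S.gradientSystem hS).pos_P t _ ht (star_mul_self_nonneg _))

lemma gradQuot_eq {r : ℝ} (hr : 0 < r) (h : N) :
    (S.gradientSystem hS).gradQuot r h = S.gradApprox r h h := by
  have h1 : ∀ x : N, ((r⁻¹ : ℝ) : ℂ) • x = r⁻¹ • x := fun x => Complex.coe_smul _ _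
  have h2 : ∀ x : N, (1 / 2 : ℂ) • x = (1 / 2 : ℝ) • x := fun x => by
    have := Complex.coe_smul (1 / 2) x
    push_cast at this
    exact this
  rw [gradApprox, diffQuot, diffQuot, diffQuot, h1, h1, h1, h2, GradientSystem.gradQuot]
  have e : ∀ f, (S.gradientSystem hS).dom.T r f = S.T r f := S.poisson_T hr.le
  have e' : ∀ f, (S.gradientSystem hS).val.T r f = S.T r f := S.poisson_T hr.le
  have eB : ∀ f g, (S.gradientSystem hS).B f g = star f * g := fun _ _ => rfl
  rw [eB, eB, eB, e, e', star_smul, star_sub, S.T_star, star_trivial (r⁻¹)]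

lemma PGradHat_eq {t s : ℝ} (ht : 0 < t) (hs : 0 < s) (f : N) :
    S.PGradHat t s f = (S.gradientSystem hS).gradHat f t s := by
  have h1 : deriv (fun s' => S.P s' f) s = S.poisson.dP s f := by
    refine ((S.poisson.hasDerivAt_P_apply hs f).congr_of_eventuallyEq ?_).deriv
    filter_upwards [lt_mem_nhds hs] with a ha using S.P_eq ha f
  have h2 : S.PGrad t s f = (S.gradientSystem hS).grad f t s := by
    refine Tendsto.limUnder_eq (((S.gradientSystem hS).tendsto_gradQuot f ht hs).congr' ?_)
    filter_upwards [self_mem_nhdsWithin] with r hr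
    rw [S.gradQuot_eq hS hr, S.P_eq ht, S.P_eq hs]
    rfl
  rw [PGradHat, h1, h2, S.P_eq ht]
  rfl

lemma gradHat_nonneg (f : N) {t v : ℝ} (ht : 0 < t) (hv : 0 < v) :
    0 ≤ (S.gradientSystem hS).gradHat f t v := by
  have h := ((S.gradientSystem hS).tendsto_gradQuot f ht hv).add_const
    (S.poisson.P t (star (S.poisson.dP v f) * S.poisson.dP v f))
  refine ge_of_tendsto h ?_
  filter_upwards [self_mem_nhdsWithin] with r hr
  rw [S.gradQuot_eq hS hr]
  exact add_nonneg ((S.gradientSystem hS).pos_P t _ ht (S.gradApprox_nonneg (le_of_lt hr) _))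
    ((S.gradientSystem hS).pos_P t _ ht (star_mul_self_nonneg _))

lemma BMOGammaHat_eq (f : N) :
    S.BMOGammaHat f = (S.gradientSystem hS).areaSq f ^ (1 / 2 : ℝ) := by
  rw [BMOGammaHat, iSup₂_rpow_half fun t => ⨆ (ξ : H) (_ : ‖ξ‖ ≤ 1), ∫⁻ s in Ioo 0 t,
    ENNReal.ofReal ((⟪ξ, (S.PGradHat t s f : H →L[ℂ] H) ξ⟫_ℂ).re * s)]
  congr 1
  refine iSup_congr fun t => iSup_congr fun ht => ?_
  rw [S.iSup_Ω hS]
  have hg : ContinuousOn (fun v => (S.gradientSystem hS).gradHat f t v) (Ioi 0) :=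
    ((S.gradientSystem hS).continuousOn_gradHat f).comp (f := fun v : ℝ => (t, v))
      (by fun_prop) fun v hv => ⟨ht, hv⟩
  -- The seminorm is defined with vector states of H, the gradient system with states of the trace.
  -- Both suprema equal the same supremum of norms of truncated integrals.
  have h1 := iSup_lintegral_eq (fun (ξ : H) (_ : ‖ξ‖ ≤ 1) x hx => vecState_nonneg ξ hx)
    (ω := fun ξ => vecStateL ξ) (fun x hx => enorm_eq_iSup_vecState hx) ht hg
    fun v hv => S.gradHat_nonneg hS f ht hv
  have h2 := iSup_lintegral_eq (fun (c : τ.PreL2) (_ : ‖c‖ ≤ 1) x hx => τ.state_nonneg c hx)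
    (fun x hx => enorm_eq_iSup_state hx) ht hg fun v hv => S.gradHat_nonneg hS f ht hv
  rw [h2, ← h1]
  refine iSup_congr fun ξ => iSup_congr fun hξ => setLIntegral_congr_fun measurableSet_Ioo fun v hv => ?_
  simp only [S.PGradHat_eq hS ht hv.1]
  rfl

end StandardSemigroup
end SemigroupBMO

namespace SemigroupBMO

/-! ### Strongly continuous contraction semigroups -/

namespace SubordinationSystem

variable {E : Type*} [NormedAddCommGroup E] [NormedSpace ℝ E]

lemma stronglyMeasurable_of_tendsto_zero {T : ℝ → E →L[ℝ] E}
    (add : ∀ s t, 0 ≤ s → 0 ≤ t → T (s + t) = (T s).comp (T t))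
    (zero : ∀ x, Tendsto (fun h => T h x) (𝓝[>] 0) (𝓝 x)) (x : E) :
    StronglyMeasurable fun u => T (max u 0) x := by
  refine stronglyMeasurable_of_tendsto_right fun u => ?_
  rcases lt_or_ge u 0 with hu | hu
  · refine tendsto_const_nhds.congr' ?_
    have h := (tendsto_stepAbove u).mono_right nhdsWithin_le_nhds
    filter_upwards [h.eventually (gt_mem_nhds hu)] with n hn
    rw [max_eq_right hu.le, max_eq_right hn.le]
  · have h1 : Tendsto (fun n => stepAbove n u - u) atTop (𝓝[>] 0) := by
      refine tendsto_nhdsWithin_iff.2 ⟨?_, Eventually.of_forall fun n => sub_pos.2 (lt_stepAbove n u)⟩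
      simpa using ((tendsto_stepAbove u).mono_right nhdsWithin_le_nhds).sub_const u
    refine ((zero (T (max u 0) x)).comp h1).congr fun n => ?_
    have h0 : 0 ≤ stepAbove n u - u := (sub_pos.2 (lt_stepAbove n u)).le
    have := add _ _ h0 hu
    rw [sub_add_cancel] at this
    rw [max_eq_left (hu.trans (lt_stepAbove n u).le), this, max_eq_left hu]
    rfl

lemma integrableOn_smul_of_tendsto_zero {T : ℝ → E →L[ℝ] E} (norm_le : ∀ r, 0 ≤ r → ‖T r‖ ≤ 1)
    (add : ∀ s t, 0 ≤ s → 0 ≤ t → T (s + t) = (T s).comp (T t))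
    (zero : ∀ x, Tendsto (fun h => T h x) (𝓝[>] 0) (𝓝 x)) {k : ℝ → ℝ}
    (hk : IntegrableOn k (Ioi 0)) (x : E) :
    IntegrableOn (fun u => k u • T (max u 0) x) (Ioi 0) :=
  (hk.abs.mul_const ‖x‖).mono' (hk.aestronglyMeasurable.smul
    (stronglyMeasurable_of_tendsto_zero add zero x).aestronglyMeasurable)
    (ae_of_all _ fun u => by
      rw [norm_smul]
      refine mul_le_mul_of_nonneg_left ?_ (norm_nonneg _)
      simpa using (T (max u 0)).le_of_opNorm_le (norm_le _ (le_max_right u 0)) x)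

/-- The subordination system of a strongly continuous contraction semigroup. -/
def ofContinuous [CompleteSpace E] (T : ℝ → E →L[ℝ] E) (norm_le : ∀ r, 0 ≤ r → ‖T r‖ ≤ 1)
    (add : ∀ s t, 0 ≤ s → 0 ≤ t → T (s + t) = (T s).comp (T t))
    (zero : ∀ x, Tendsto (fun h => T h x) (𝓝[>] 0) (𝓝 x)) : SubordinationSystem E where
  T := T
  norm_T_le := norm_le
  T_add := add
  Λ := univ
  separating x hx := by
    by_contra h
    obtain ⟨g, -, hg⟩ := exists_dual_vector ℝ x (norm_ne_zero_iff.2 h)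
    have := hx g trivial
    rw [hg] at this
    exact h (norm_eq_zero.1 (by simpa using this))
  comp_mem _ _ _ _ := trivial
  measurable ω _ x := (ω.continuous.comp_stronglyMeasurable
    (stronglyMeasurable_of_tendsto_zero add zero x)).measurable
  exists_integral k hk x := by
    have hi := integrableOn_smul_of_tendsto_zero norm_le add zero hk x
    refine ⟨∫ u in Ioi 0, k u • T (max u 0) x, ?_, fun ω _ => ?_⟩
    · refine (norm_integral_le_integral_norm _).trans ?_
      rw [← integral_mul_const]
      refine setIntegral_mono_on hi.norm (hk.abs.mul_const ‖x‖) measurableSet_Ioi fun u _ => ?_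
      rw [norm_smul]
      refine mul_le_mul_of_nonneg_left ?_ (norm_nonneg _)
      simpa using (T (max u 0)).le_of_opNorm_le (norm_le _ (le_max_right u 0)) x
    · rw [← ω.integral_comp_comm hi]
      refine setIntegral_congr_fun measurableSet_Ioi fun u hu => ?_
      simp only [map_smul, smul_eq_mul, max_eq_left (le_of_lt (mem_Ioi.1 hu))]

lemma ofContinuous_integral [CompleteSpace E] {T : ℝ → E →L[ℝ] E}
    (norm_le : ∀ r, 0 ≤ r → ‖T r‖ ≤ 1)
    (add : ∀ s t, 0 ≤ s → 0 ≤ t → T (s + t) = (T s).comp (T t))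
    (zero : ∀ x, Tendsto (fun h => T h x) (𝓝[>] 0) (𝓝 x)) {k : ℝ → ℝ}
    (hk : IntegrableOn k (Ioi 0)) (x : E) :
    (ofContinuous T norm_le add zero).integral k x = ∫ u in Ioi 0, k u • T (max u 0) x := by
  have hi := integrableOn_smul_of_tendsto_zero norm_le add zero hk x
  refine (eq_integral hk fun ω _ => ?_).symm
  rw [← ω.integral_comp_comm hi]
  refine setIntegral_congr_fun measurableSet_Ioi fun u hu => ?_
  simp only [map_smul, smul_eq_mul, max_eq_left (le_of_lt (mem_Ioi.1 hu))]
  rfl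

end SubordinationSystem

variable {H : Type u} [NormedAddCommGroup H] [InnerProductSpace ℂ H] [CompleteSpace H]
variable {N : VonNeumannAlgebra H} {τ : NSFTrace N}

namespace NSFTrace

open UniformSpace

/-! ### Operators on `L_2(N)` -/

/-- The extension to `L_2(N)` of a bounded operator of `N ∩ L_2(N)`. -/
def extL2 (A : τ.PreL2 →L[ℂ] τ.PreL2) : τ.L2 →L[ℂ] τ.L2 :=
  ((Completion.toComplL : τ.PreL2 →L[ℂ] τ.L2).comp A).extend Completion.toComplL

lemma extL2_coe (A : τ.PreL2 →L[ℂ] τ.PreL2) (x : τ.PreL2) : extL2 A (x : τ.L2) = (A x : τ.L2) :=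
  ContinuousLinearMap.extend_eq (e := (Completion.toComplL : τ.PreL2 →L[ℂ] τ.L2)) _
    Completion.denseRange_coe (Completion.isUniformInducing_coe _) x

lemma norm_extL2_apply_le {A : τ.PreL2 →L[ℂ] τ.PreL2} {M : ℝ} (h : ∀ x, ‖A x‖ ≤ M * ‖x‖) (f : τ.L2) :
    ‖extL2 A f‖ ≤ M * ‖f‖ := by
  induction f using Completion.induction_on with
  | hp => exact isClosed_le (by fun_prop) (by fun_prop)
  | ih x => rw [extL2_coe, Completion.norm_coe, Completion.norm_coe]; exact h x

lemma ext_coe {F : Type*} [TopologicalSpace F] [T2Space F] {φ ψ : τ.L2 → F} (hφ : Continuous φ)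
    (hψ : Continuous ψ) (h : ∀ x : τ.PreL2, φ x = ψ x) (f : τ.L2) : φ f = ψ f := by
  induction f using Completion.induction_on with
  | hp => exact isClosed_eq hφ hψ
  | ih x => exact h x

lemma clm_ext {F : Type*} [NormedAddCommGroup F] [NormedSpace ℂ F] {A B : τ.L2 →L[ℂ] F}
    (h : ∀ x : τ.PreL2, A x = B x) : A = B :=
  ContinuousLinearMap.ext (ext_coe A.continuous B.continuous h)

lemma extL2_add (A B : τ.PreL2 →L[ℂ] τ.PreL2) : extL2 (A + B) = extL2 A + extL2 B :=
  clm_ext fun x => by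
    rw [add_apply, extL2_coe, extL2_coe, extL2_coe, add_apply, Completion.coe_add]

lemma extL2_smul (c : ℂ) (A : τ.PreL2 →L[ℂ] τ.PreL2) : extL2 (c • A) = c • extL2 A :=
  clm_ext fun x => by
    rw [smul_apply, extL2_coe, extL2_coe, smul_apply, Completion.coe_smul]

lemma toL2_val (x : τ.PreL2) : τ.toL2 x.val = (x : τ.L2) := by
  rw [toL2, dif_pos (show x.val ∈ τ.finSq from x.lt_top)]; rfl

/-- Identifies the continuous extensions appearing in the definitions with extensions of bounded
operators of N ∩ L_2(N). -/
lemma extension_toL2 {φ : N → N} {A : τ.PreL2 →L[ℂ] τ.PreL2} (h : ∀ x, (A x).val = φ x.val) :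
    Completion.extension (fun x : τ.PreL2 => τ.toL2 (φ x.val)) = extL2 A := by
  have e : (fun x : τ.PreL2 => τ.toL2 (φ x.val)) = fun x => ((A x : τ.PreL2) : τ.L2) := by
    funext x; rw [← h, toL2_val]
  rw [e]
  refine Completion.extension_unique ?_ (extL2 A).uniformContinuous fun x => (extL2_coe A x).symm
  exact (Completion.uniformContinuous_coe _).comp A.uniformContinuous

variable (τ) in
/-- Right multiplication on `L_2(N)`. -/
def rmulL : N →L[ℂ] τ.L2 →L[ℂ] τ.L2 :=
  LinearMap.mkContinuous
    { toFun := fun a => extL2 (τ.rmulPre a)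
      map_add' := fun a b => by rw [map_add, extL2_add]
      map_smul' := fun c a => by rw [map_smul, extL2_smul]; rfl } 1
    fun a => by
      rw [one_mul]
      exact ContinuousLinearMap.opNorm_le_bound _ (norm_nonneg a)
        (norm_extL2_apply_le (norm_rmulPre_le a))

lemma rmulL_apply (a : N) : τ.rmulL a = extL2 (τ.rmulPre a) := rfl

lemma rmulL_coe (a : N) (x : τ.PreL2) : τ.rmulL a (x : τ.L2) = (τ.rmulPre a x : τ.L2) := by
  rw [rmulL_apply, extL2_coe]

lemma rmul_eq (f : τ.L2) (y : N) : τ.rmul f y = τ.rmulL y f := by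
  rw [rmulL_apply]
  exact congrFun (extension_toL2 (φ := (· * y)) (A := τ.rmulPre y) fun x => val_rmulPre y x) f

lemma norm_rmulL_le (a : N) (f : τ.L2) : ‖τ.rmulL a f‖ ≤ ‖a‖ * ‖f‖ := by
  rw [rmulL_apply]
  exact norm_extL2_apply_le (norm_rmulPre_le a) f

lemma rmulL_mul (a b : N) (f : τ.L2) : τ.rmulL (a * b) f = τ.rmulL b (τ.rmulL a f) :=
  DFunLike.congr_fun (clm_ext (A := τ.rmulL (a * b)) (B := (τ.rmulL b).comp (τ.rmulL a)) fun x => by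
    rw [ContinuousLinearMap.comp_apply, rmulL_coe, rmulL_coe, rmulL_coe, rmulPre_mul]) f

lemma inner_rmulL_left (a : N) (f g : τ.L2) :
    ⟪τ.rmulL a f, g⟫_ℂ = ⟪f, τ.rmulL (star a) g⟫_ℂ := by
  induction f, g using Completion.induction_on₂ with
  | hp => exact isClosed_eq (by fun_prop) (by fun_prop)
  | ih x y => rw [rmulL_coe, rmulL_coe, Completion.inner_coe, Completion.inner_coe,
      inner_rmulPre_left]

/-! ### The form `f⋆ g` -/

lemma starMul_eq (f g : τ.L2) (y : N) : τ.starMul f g y = ⟪f, τ.rmulL y g⟫_ℂ := by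
  rw [starMul, rmul_eq]

variable (τ) in
/-- The form `f⋆ g` on `L_2(N)` with values in the dual of `N`. -/
def starMul₂ : τ.L2 →L[ℝ] τ.L2 →L[ℝ] N →L[ℝ] ℂ :=
  LinearMap.mkContinuous₂
    (LinearMap.mk₂ ℝ (fun f g => ((innerSL ℂ f).comp (τ.rmulL.flip g)).restrictScalars ℝ)
      (fun f f' g => by ext y; exact inner_add_left f f' (τ.rmulL y g))
      (fun c f g => by
        ext y
        change ⟪c • f, τ.rmulL y g⟫_ℂ = c • ⟪f, τ.rmulL y g⟫_ℂ
        rw [← Complex.coe_smul, inner_smul_left, Complex.conj_ofReal, Complex.real_smul])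
      (fun f g g' => by
        ext y
        change ⟪f, τ.rmulL y (g + g')⟫_ℂ = ⟪f, τ.rmulL y g⟫_ℂ + ⟪f, τ.rmulL y g'⟫_ℂ
        rw [map_add, inner_add_right])
      (fun c f g => by
        ext y
        change ⟪f, τ.rmulL y (c • g)⟫_ℂ = c • ⟪f, τ.rmulL y g⟫_ℂ
        rw [← Complex.coe_smul, map_smul, inner_smul_right, Complex.real_smul])) 1
    fun f g => ContinuousLinearMap.opNorm_le_bound _ (by positivity) fun y => by
      refine (norm_inner_le_norm (𝕜 := ℂ) f (τ.rmulL y g)).trans ?_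
      rw [one_mul, mul_assoc, mul_comm ‖g‖]
      exact mul_le_mul_of_nonneg_left (norm_rmulL_le y g) (norm_nonneg _)

lemma starMul₂_apply (f g : τ.L2) (y : N) : τ.starMul₂ f g y = ⟪f, τ.rmulL y g⟫_ℂ := rfl

/-- By traciality τ(x⋆ y a) = τ(y a x⋆), so on the dense part the functional x⋆y is a test
functional built from the adjoints. -/
lemma starMul₂_coe (x y : τ.PreL2) (a : N) : τ.starMul₂ x y a = τ.test y.adj x.adj a := by
  have e : (τ.rmulPre a y).adj = τ.lmul (star a) y.adj := PreL2.ext (star_mul _ _)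
  rw [starMul₂_apply, rmulL_coe, Completion.inner_coe, test_apply, ← PreL2.inner_adj, e,
    inner_lmul_left, star_star]

lemma re_starMul₂_coe (x : τ.PreL2) (a : N) : (τ.starMul₂ x x a).re = τ.state x.adj a := by
  rw [starMul₂_coe]; rfl

lemma re_starMul₂_self_nonneg (f : τ.L2) {y : N} (hy : 0 ≤ y) : 0 ≤ (τ.starMul₂ f f y).re := by
  obtain ⟨a, ha, rfl⟩ := exists_star_mul_self hy
  rw [ha.isSelfAdjoint.star_eq, starMul₂_apply, rmulL_mul]
  have := inner_rmulL_left a f (τ.rmulL a f)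
  rw [ha.isSelfAdjoint.star_eq] at this
  rw [← this]
  exact inner_self_nonneg (𝕜 := ℂ)

lemma starMul₂_swap (f g : τ.L2) (y : N) :
    τ.starMul₂ g f (star y) = starRingEnd ℂ (τ.starMul₂ f g y) := by
  rw [starMul₂_apply, starMul₂_apply, ← inner_rmulL_left, inner_conj_symm]

/-- Comparison of normal functionals through their densities. -/
lemma state_add_le {a b c d : τ.PreL2} (h : a.val * star a.val + b.val * star b.val ≤
    c.val * star c.val + d.val * star d.val) {y : N} (hy : 0 ≤ y) :
    τ.state a y + τ.state b y ≤ τ.state c y + τ.state d y := by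
  obtain ⟨z, -, rfl⟩ := exists_star_mul_self hy
  have key : ∀ a : τ.PreL2, ENNReal.ofReal (τ.state a (star z * z)) =
      τ (z * (a.val * star a.val) * star z) := fun a => by
    have := τ.tracial' (z * a.val)
    rw [τ.ofReal_state a (star_mul_self_nonneg z)]
    convert this using 2 <;> simp only [star_mul, mul_assoc]
  have hn : ∀ a : τ.PreL2, 0 ≤ τ.state a (star z * z) := fun a =>
    τ.state_nonneg a (star_mul_self_nonneg z)
  have hz : ∀ a : τ.PreL2, 0 ≤ z * (a.val * star a.val) * star z := fun a =>
    star_right_conjugate_nonneg (mul_star_self_nonneg _) z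
  rw [← ENNReal.ofReal_le_ofReal_iff (add_nonneg (hn _) (hn _)), ENNReal.ofReal_add (hn _) (hn _),
    ENNReal.ofReal_add (hn _) (hn _), key, key, key, key, ← τ.map_add' _ _ (hz a) (hz b),
    ← τ.map_add' _ _ (hz c) (hz d), ← add_mul, ← add_mul, ← mul_add, ← mul_add]
  refine τ.mono (star_right_conjugate_nonneg (add_nonneg (mul_star_self_nonneg _)
    (mul_star_self_nonneg _)) z) (star_right_conjugate_le_conjugate h z)

end NSFTrace

namespace StandardSemigroup

open NSFTrace UniformSpace

variable (S : StandardSemigroup τ)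

/-! ### The semigroups on `L_2(N)` -/

/-- `T_t` on `L_2(N)`. -/
def TL2 (t : ℝ) : τ.L2 →L[ℝ] τ.L2 := (extL2 (S.TPre t)).restrictScalars ℝ

lemma TL2_coe (t : ℝ) (x : τ.PreL2) : S.TL2 t (x : τ.L2) = (S.TPre t x : τ.L2) := extL2_coe _ x

lemma T2_eq {t : ℝ} (ht : 0 ≤ t) (f : τ.L2) : S.T2 t f = S.TL2 t f :=
  congrFun (extension_toL2 (φ := S.T t) fun x => S.val_TPre ht x) f

lemma norm_TL2_apply_le (t : ℝ) (f : τ.L2) : ‖S.TL2 t f‖ ≤ ‖f‖ := by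
  have := norm_extL2_apply_le (A := S.TPre t) (fun x => (S.TPre t).le_of_opNorm_le
    (S.norm_TPre_le t) x) f
  rwa [one_mul] at this

lemma TPre_add {s t : ℝ} (hs : 0 ≤ s) (ht : 0 ≤ t) (x : τ.PreL2) :
    S.TPre (s + t) x = S.TPre s (S.TPre t x) := PreL2.ext (by
  rw [S.val_TPre (add_nonneg hs ht), S.val_TPre hs, S.val_TPre ht, S.map_add' s t hs ht])

lemma TL2_add {s t : ℝ} (hs : 0 ≤ s) (ht : 0 ≤ t) : S.TL2 (s + t) = (S.TL2 s).comp (S.TL2 t) := by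
  ext1 f
  exact ext_coe (φ := S.TL2 (s + t)) (ψ := (S.TL2 s).comp (S.TL2 t))
    (ContinuousLinearMap.continuous _) (ContinuousLinearMap.continuous _) (fun x => by
      rw [ContinuousLinearMap.comp_apply, TL2_coe, TL2_coe, TL2_coe, S.TPre_add hs ht]) f

lemma tendsto_TL2 (f : τ.L2) : Tendsto (fun h => S.TL2 h f) (𝓝[>] 0) (𝓝 f) := by
  refine Metric.tendsto_nhds.2 fun ε hε => ?_
  obtain ⟨x, hx⟩ := (Completion.denseRange_coe (α := τ.PreL2)).exists_dist_lt f
    (show 0 < ε / 3 by positivity)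
  have h := Metric.tendsto_nhds.1 (S.tendsto_TPre x) (ε / 3) (by positivity)
  filter_upwards [h] with r hr
  have h1 := S.norm_TL2_apply_le r (f - x)
  rw [dist_eq_norm] at hx hr ⊢
  rw [← Completion.norm_coe, Completion.coe_sub, ← TL2_coe] at hr
  have e : S.TL2 r f - f = S.TL2 r (f - x) + (S.TL2 r x - x) - (f - x) := by
    rw [map_sub]; abel
  rw [e]
  refine ((norm_sub_le _ _).trans (add_le_add (norm_add_le _ _) le_rfl)).trans_lt ?_
  linarith

/-- The subordination system of `(T_t)` on `L_2(N)`. -/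
def subL2 : SubordinationSystem τ.L2 := .ofContinuous S.TL2
  (fun r _ => ContinuousLinearMap.opNorm_le_bound _ zero_le_one fun f => by
    rw [one_mul]; exact S.norm_TL2_apply_le r f)
  (fun _ _ hs ht => S.TL2_add hs ht) S.tendsto_TL2

/-- The Poisson system on `L_2(N)`. -/
def poissonL2 : PoissonSystem τ.L2 := S.subL2.toPoissonSystem

lemma integral_L2 {k : ℝ → ℝ} (hk : IntegrableOn k (Ioi 0)) (f : τ.L2) :
    S.subL2.integral k f = ∫ u in Ioi 0, k u • S.TL2 (max u 0) f :=
  SubordinationSystem.ofContinuous_integral _ _ _ hk f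

lemma P2_eq {t : ℝ} (ht : 0 < t) (f : τ.L2) : S.P2 t f = S.poissonL2.P t f := by
  refine Eq.trans ?_ (S.integral_L2 (integrableOn_subDensity ht) f).symm
  refine setIntegral_congr_fun measurableSet_Ioi fun u hu => ?_
  have hu : 0 ≤ u := le_of_lt hu
  simp only [Complex.coe_smul, S.T2_eq hu, max_eq_left hu]

lemma tendsto_poissonL2 (f : τ.L2) :
    Tendsto (fun ε => S.poissonL2.P ε f) (𝓝[>] 0) (𝓝 f) := by
  have h0 : Tendsto (fun u => S.TL2 (max u 0) f) (𝓝[>] 0) (𝓝 f) := by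
    refine (S.tendsto_TL2 f).congr' ?_
    filter_upwards [self_mem_nhdsWithin] with u hu
    rw [max_eq_left (le_of_lt hu)]
  have h := tendsto_integral_subDensity
    (SubordinationSystem.stronglyMeasurable_of_tendsto_zero (fun _ _ hs ht => S.TL2_add hs ht)
      S.tendsto_TL2 f) (M := ‖f‖) (fun u => S.norm_TL2_apply_le _ f) h0
  refine h.congr' ?_
  filter_upwards [self_mem_nhdsWithin] with ε hε
  exact (S.integral_L2 (integrableOn_subDensity hε) f).symm

end StandardSemigroup
end SemigroupBMO

/-! ### Normality of the functionals f⋆g -/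

namespace SemigroupBMO
variable {H : Type u} [NormedAddCommGroup H] [InnerProductSpace ℂ H] [CompleteSpace H]
variable {N : VonNeumannAlgebra H} {τ : NSFTrace N}

/-- The sequences tested are bounded, so a small perturbation of the functional in norm moves all
values uniformly little. -/
lemma isClosed_seqNormal : IsClosed {ω : N →L[ℝ] ℝ | SeqNormal ω} := by
  refine isClosed_of_closure_subset fun ω hω a x M hM ha => ?_
  refine Metric.tendsto_nhds.2 fun ε hε => ?_
  have hK : 0 < |M| + ‖x‖ + 1 := by positivity
  obtain ⟨ω', hω', hd⟩ := Metric.mem_closure_iff.1 hω (ε / 2 / (|M| + ‖x‖ + 1)) (by positivity)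
  filter_upwards [Metric.tendsto_nhds.1 (hω' a x M hM ha) (ε / 2) (by positivity)] with n hn
  rw [dist_eq_norm] at hd hn ⊢
  have h1 : ‖(ω - ω') (a n - x)‖ ≤ ε / 2 := by
    refine ((ω - ω').le_opNorm _).trans ?_
    rw [lt_div_iff₀ hK] at hd
    refine le_trans (mul_le_mul_of_nonneg_left ?_ (norm_nonneg _)) hd.le
    exact (norm_sub_le _ _).trans (by linarith [hM n, le_abs_self M])
  have e : ω (a n) - ω x = (ω - ω') (a n - x) + (ω' (a n) - ω' x) := by
    simp only [sub_apply, map_sub]; ring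
  rw [e]
  exact (norm_add_le _ _).trans_lt (by linarith)

namespace StandardSemigroup

open NSFTrace UniformSpace

variable (S : StandardSemigroup τ)

lemma isClosed_normalFunctionals : IsClosed S.normalFunctionals := by
  simp only [normalFunctionals, ofPred_forall]
  refine isClosed_iInter fun r => isClosed_iInter fun _ => ?_
  exact isClosed_seqNormal.preimage (f := fun ω : N →L[ℝ] ℝ => ω.comp (S.TR r)) (by fun_prop)

lemma re_starMul₂_mem (f g : τ.L2) : Complex.reCLM.comp (τ.starMul₂ f g) ∈ S.normalFunctionals := by
  induction f, g using Completion.induction_on₂ with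
  | hp =>
    exact S.isClosed_normalFunctionals.preimage (f := fun p : τ.L2 × τ.L2 => Complex.reCLM.comp (τ.starMul₂ p.1 p.2)) (by fun_prop)
  | ih x y =>
    have : Complex.reCLM.comp (τ.starMul₂ (x : τ.L2) y) = reTest y.adj x.adj := by
      ext a
      exact congrArg Complex.re (starMul₂_coe x y a)
    rw [this]
    exact S.reTest_mem _ _

lemma re_starMul₂_integral {k : ℝ → ℝ} (hk : IntegrableOn k (Ioi 0)) (f g : τ.L2) (y : N) :
    (τ.starMul₂ f g (S.sub.integral k y)).re =
      ∫ u in Ioi 0, k u * (τ.starMul₂ f g (S.sub.T u y)).re :=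
  S.sub.map_integral hk (S.re_starMul₂_mem f g) y

lemma push_mul_star (t : ℝ) (c : τ.PreL2) : (S.push t c).val * star (S.push t c).val =
    S.T (max t 0) (c.val * star c.val) := by
  have h0 : 0 ≤ S.T (max t 0) (c.val * star c.val) := S.T_nonneg _ (mul_star_self_nonneg _)
  have hs : star (S.push t c).val = (S.push t c).val :=
    (CFC.sqrt_nonneg (S.T (max t 0) (c.val * star c.val))).isSelfAdjoint.star_eq
  rw [hs]
  exact CFC.sqrt_mul_sqrt_self _ h0

/-! ### Inequalities for the form `f⋆ f` on `L_2(N)` -/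

/-- On N ∩ L_2(N) both sides are states whose densities are |T_r x|² and T_r|x|², compared by
Kadison–Schwarz; the rest is continuity. -/
lemma re_starMul₂_schwarz {r : ℝ} (hr : 0 ≤ r) (f : τ.L2) {y : N} (hy : 0 ≤ y) :
    (τ.starMul₂ (S.TL2 r f) (S.TL2 r f) y).re ≤ (τ.starMul₂ f f (S.T r y)).re := by
  induction f using Completion.induction_on with
  | hp => exact isClosed_le (by fun_prop) (by fun_prop)
  | ih x =>
    rw [TL2_coe, re_starMul₂_coe, re_starMul₂_coe, S.state_T hr]
    have h := state_add_le (a := (S.TPre r x).adj) (b := 0) (c := S.push r x.adj) (d := 0) (y := y) ?_ hy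
    · linarith
    · refine add_le_add_left ?_ _
      rw [S.push_mul_star, max_eq_left hr, PreL2.val_adj, S.val_TPre hr, star_star, PreL2.val_adj,
        star_star]
      exact S.schwarz hr _

lemma GammaSqNonneg.dev_T_le (hS : S.GammaSqNonneg) {w r : ℝ} (hw : 0 ≤ w) (hr : 0 ≤ r) (g : N) :
    S.dev r (S.T w g) ≤ S.T w (S.dev r g) :=
  le_of_state (τ := τ) (S.dev_nonneg hr _).isSelfAdjoint
    (S.T_nonneg w (S.dev_nonneg hr g)).isSelfAdjoint fun c => hS.state_dev_T_le S g hw hr c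

/-- The discrete Γ² inequality for x in N ∩ L_2(N), with subtracted terms moved across, is an
inequality between sums of two densities. Pairing with y ≥ 0 and transposing T onto y gives the
claim, which extends by density. -/
lemma GammaSqNonneg.re_starMul₂_T_le (hS : S.GammaSqNonneg) {w r : ℝ} (hw : 0 ≤ w) (hr : 0 ≤ r)
    (f : τ.L2) {y : N} (hy : 0 ≤ y) :
    (τ.starMul₂ (S.TL2 w f) (S.TL2 w f) (S.T r y)).re -
        (τ.starMul₂ (S.TL2 r (S.TL2 w f)) (S.TL2 r (S.TL2 w f)) y).re ≤
      (τ.starMul₂ f f (S.T r (S.T w y))).re -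
        (τ.starMul₂ (S.TL2 r f) (S.TL2 r f) (S.T w y)).re := by
  induction f using Completion.induction_on with
  | hp => exact isClosed_le (by fun_prop) (by fun_prop)
  | ih x =>
    simp only [TL2_coe, re_starMul₂_coe]
    rw [S.state_T hr, S.state_T hr, S.state_T hw, S.state_T hw]
    have h := state_add_le (a := S.push r (S.TPre w x).adj) (b := S.push w (S.TPre r x).adj)
      (c := S.push w (S.push r x.adj)) (d := (S.TPre r (S.TPre w x)).adj) (y := y) ?_ hy
    · linarith
    · have h := hS.dev_T_le S hw hr x.val
      rw [dev, dev, S.T_sub, S.T_T hr hw, sub_le_sub_iff] at h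
      simp only [S.push_mul_star, max_eq_left hr, max_eq_left hw, PreL2.val_adj, S.val_TPre hr,
        S.val_TPre hw, star_star]
      rw [S.T_T hr hw]
      exact h

lemma re_starMul₂_sub_self (f g : τ.L2) {y : N} (hy : IsSelfAdjoint y) :
    (τ.starMul₂ (f - g) (f - g) y).re =
      (τ.starMul₂ f f y).re - 2 * (τ.starMul₂ f g y).re + (τ.starMul₂ g g y).re := by
  have h : (τ.starMul₂ g f y).re = (τ.starMul₂ f g y).re := by
    have := starMul₂_swap f g y
    rw [hy.star_eq] at this
    rw [this, Complex.conj_re]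
  simp only [map_sub, sub_apply, Complex.sub_re, h]
  ring

lemma re_starMul₂_integral_schwarz {k : ℝ → ℝ} (hk : IntegrableOn k (Ioi 0))
    (hk0 : ∀ u, 0 < u → 0 ≤ k u) (hk1 : ∫ u in Ioi 0, k u = 1) (f : τ.L2) {y : N} (hy : 0 ≤ y) :
    (τ.starMul₂ (S.subL2.integral k f) (S.subL2.integral k f) y).re ≤
      (τ.starMul₂ f f (S.sub.integral k y)).re := by
  rw [S.re_starMul₂_integral hk]
  refine S.subL2.form_integral_le hk hk0 hk1 (fun x z => (τ.starMul₂ x z y).re)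
    (fun x => re_starMul₂_self_nonneg x hy)
    (fun x z => re_starMul₂_sub_self x z hy.isSelfAdjoint) f
    ⟨Complex.reCLM.comp ((ContinuousLinearMap.apply ℝ ℂ y).comp
      (τ.starMul₂.flip (S.subL2.integral k f))), trivial, fun _ => rfl⟩
    (S.sub.integrableOn_mul hk (S.re_starMul₂_mem f f) y) fun u hu => ?_
  rw [S.sub_T hu.le]
  exact S.re_starMul₂_schwarz hu.le f hy

lemma GammaSqNonneg.re_starMul₂_integral_le (hS : S.GammaSqNonneg) {k : ℝ → ℝ}
    (hk : IntegrableOn k (Ioi 0)) (hk0 : ∀ u, 0 < u → 0 ≤ k u) (hk1 : ∫ u in Ioi 0, k u = 1) {r : ℝ}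
    (hr : 0 ≤ r) (f : τ.L2) {y : N} (hy : 0 ≤ y) :
    (τ.starMul₂ (S.subL2.integral k f) (S.subL2.integral k f) (S.sub.T r y)).re -
        (τ.starMul₂ (S.TL2 r (S.subL2.integral k f)) (S.TL2 r (S.subL2.integral k f)) y).re ≤
      (τ.starMul₂ f f (S.sub.T r (S.sub.integral k y))).re -
        (τ.starMul₂ (S.TL2 r f) (S.TL2 r f) (S.sub.integral k y)).re := by
  have hω := S.sub_normalFunctionals (S.sub.comp_mem _ (S.re_starMul₂_mem f f) r hr)
    (S.re_starMul₂_mem (S.TL2 r f) (S.TL2 r f))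
  refine le_of_le_of_eq ?_ (S.sub.map_integral hk hω y).symm
  refine S.subL2.form_integral_le hk hk0 hk1 (fun x z => (τ.starMul₂ x z (S.sub.T r y)).re -
      (τ.starMul₂ (S.TL2 r x) (S.TL2 r z) y).re)
    (fun x => ?_) (fun x z => ?_) f
    ⟨Complex.reCLM.comp ((ContinuousLinearMap.apply ℝ ℂ (S.sub.T r y)).comp
        (τ.starMul₂.flip (S.subL2.integral k f))) -
      Complex.reCLM.comp ((ContinuousLinearMap.apply ℝ ℂ y).comp
        ((τ.starMul₂.flip (S.TL2 r (S.subL2.integral k f))).comp (S.TL2 r))), trivial, fun _ => rfl⟩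
    (S.sub.integrableOn_mul hk hω y) fun u hu => ?_
  · rw [S.sub_T hr, sub_nonneg]
    exact S.re_starMul₂_schwarz hr x hy
  · have h1 : IsSelfAdjoint (S.sub.T r y) := by
      rw [S.sub_T hr]; exact (S.T_nonneg r hy).isSelfAdjoint
    rw [map_sub (S.TL2 r), re_starMul₂_sub_self _ _ h1, re_starMul₂_sub_self _ _ hy.isSelfAdjoint]
    ring
  · have := hS.re_starMul₂_T_le S hu.le hr f hy
    rw [← S.sub_T hr, ← S.sub_T hu.le, ← S.sub_T hr] at this
    exact this

/-! ### The gradient system of `L_2(N)` -/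

variable (N) in
/-- The functional `φ ↦ re φ(y)`. -/
def evalRe (y : N) : (N →L[ℝ] ℂ) →L[ℝ] ℝ := Complex.reCLM.comp (ContinuousLinearMap.apply ℝ ℂ y)

/-- The gradient system of the Poisson semigroup on `L_2(N)`. -/
def gradientSystemL2 (hS : S.GammaSqNonneg) : GradientSystem τ.L2 (N →L[ℝ] ℂ) where
  dom := S.poissonL2
  val := S.poisson.dual ℂ
  B := τ.starMul₂
  Pos φ := ∀ y, 0 ≤ y → 0 ≤ (φ y).re
  Ω := {ω | ∃ c : N, τ (star c * c) ≤ 1 ∧ ω = evalRe N (c * star c)}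
  pos_add φ ψ h h' y hy := add_nonneg (h y hy) (h' y hy)
  pos_smul c φ hc h y hy := by
    rw [smul_apply, Complex.smul_re]
    exact mul_nonneg hc (h y hy)
  pos_P t φ ht h y hy := h _ ((S.gradientSystem hS).pos_P t y ht hy)
  nonneg := by
    rintro _ ⟨c, -, rfl⟩ φ h
    exact h _ (mul_star_self_nonneg c)
  pos_B f y hy := re_starMul₂_self_nonneg f hy
  schwarz_P t f ht y hy := by
    rw [sub_apply, Complex.sub_re, sub_nonneg]
    exact S.re_starMul₂_integral_schwarz (integrableOn_subDensity ht)
      (fun _ hu => subDensity_nonneg ht.le hu) (integral_subDensity ht) f hy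
  schwarz_T r f hr y hy := by
    rw [sub_apply, Complex.sub_re, sub_nonneg]
    have := S.re_starMul₂_schwarz hr.le f hy
    rw [← S.poisson_T hr.le] at this
    exact this
  schwarz_R t f ht y hy := by
    rw [sub_apply, Complex.sub_re, sub_nonneg]
    have h := S.re_starMul₂_integral_schwarz (integrableOn_reflectedDensity ht)
      (fun _ hu => reflectedDensity_nonneg ht hu) (integral_reflectedDensity ht) f hy
    rw [← S.sub.two_smul_sub_eq ht, ← S.subL2.two_smul_sub_eq ht, map_sub (τ.starMul₂ f f),
      map_smul (τ.starMul₂ f f)] at h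
    exact h
  quasi_mono s t φ hs hst h y hy := by
    have := h _ ((S.gradientSystem hS).quasi_mono s t y hs hst hy)
    rw [map_sub, map_smul] at this
    exact this
  gamma_two w r f hw hr y hy := by
    rw [sub_apply, Complex.sub_re, sub_nonneg]
    have := hS.re_starMul₂_integral_le S (integrableOn_subDensity hw)
      (fun _ hu => subDensity_nonneg hw.le hu) (integral_subDensity hw) hr.le f hy
    exact this
  tendsto_B := by
    rintro _ ⟨c, -, rfl⟩ t f ht
    have hc : Continuous fun g : τ.L2 =>
        evalRe N (c * star c) ((S.poisson.dual ℂ).P t (τ.starMul₂ g g)) := by fun_prop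
    exact (hc.tendsto f).comp (S.tendsto_poissonL2 f)
  tendsto_P := by
    rintro _ ⟨c, -, rfl⟩ f
    -- The functional f⋆f is known to be continuous only along sequences, so the limit ε → 0 is
    -- tested on sequences.
    refine tendsto_of_seq_tendsto fun ε hε => ?_
    have hω := seqNormal_of_mem (S.re_starMul₂_mem f f)
    have hpos := hε.eventually self_mem_nhdsWithin
    -- The default value at the finitely many n with ε n ≤ 0 keeps the whole sequence bounded, as
    -- `SeqNormal` demands.
    refine (hω (fun n => if 0 < ε n then S.poisson.P (ε n) (c * star c) else c * star c)
      (c * star c) ‖c * star c‖ (fun n => ?_) fun ξ => ?_).congr' ?_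
    · split_ifs with h
      · exact S.norm_poisson_le h _
      · exact le_rfl
    · refine ((S.tendsto_poisson (c * star c) ξ).comp hε).congr' ?_
      filter_upwards [hpos] with n hn
      rw [if_pos (mem_Ioi.1 hn)]; rfl
    · filter_upwards [hpos] with n hn
      rw [if_pos (mem_Ioi.1 hn)]; rfl

end StandardSemigroup
end SemigroupBMO

/-! ### Identification of the seminorms on L_2(N) -/

namespace SemigroupBMO
variable {H : Type u} [NormedAddCommGroup H] [InnerProductSpace ℂ H] [CompleteSpace H]
variable {N : VonNeumannAlgebra H} {τ : NSFTrace N}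

namespace NSFTrace

/-- The operator norm of a positive functional is attained on the diagonal. -/
lemma opNorm_eq {φ : N →L[ℝ] ℂ} (hsmul : ∀ (c : ℂ) (y : N), φ (c • y) = c * φ y)
    (hstar : ∀ y, (φ (star y)).re = (φ y).re) (hpos : ∀ y, 0 ≤ y → 0 ≤ (φ y).re) :
    τ.opNorm φ = ⨆ (c : N) (_ : τ (star c * c) ≤ 1), ENNReal.ofReal (φ (c * star c)).re := by
  refine le_antisymm (iSup₂_le fun b hb => iSup₂_le fun c hc => ?_) (iSup₂_le fun c hc => ?_)
  -- A phase makes the value real and nonnegative. It can be absorbed into c without changing the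
  -- L_2 norm.
  · obtain ⟨u, hu, hφ⟩ : ∃ u : ℂ, ‖u‖ = 1 ∧ (u * φ (c * star b)).re = ‖φ (c * star b)‖ := by
      rcases eq_or_ne (φ (c * star b)) 0 with h0 | h0
      · exact ⟨1, by simp, by simp [h0]⟩
      · have hn := norm_ne_zero_iff.2 h0
        refine ⟨starRingEnd ℂ (φ (c * star b)) / ‖φ (c * star b)‖, ?_, ?_⟩
        · rw [norm_div, RCLike.norm_conj, Complex.norm_real, norm_norm, div_self hn]
        · rw [div_mul_eq_mul_div, Complex.conj_mul', ← Complex.ofReal_pow, ← Complex.ofReal_div,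
            Complex.ofReal_re, sq, mul_div_cancel_right₀ _ hn]
    have hc' : τ (star (u • c) * (u • c)) ≤ 1 := by
      rw [τ.map_smul_sq, hu]; simpa using hc
    rw [← ofReal_norm, ← hφ, ← hsmul, ← smul_mul_assoc]
    set c' := u • c
    -- Positivity at (c'−b)(c'−b)⋆ gives 2 re φ(c'b⋆) ≤ φ(c'c'⋆) + φ(bb⋆), so one of the two
    -- diagonal values dominates.
    have h0 := hpos _ (mul_star_self_nonneg (c' - b))
    have hs := hstar (c' * star b)
    rw [star_mul, star_star] at hs
    rw [star_sub, sub_mul, mul_sub, mul_sub, map_sub, map_sub, map_sub, Complex.sub_re,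
      Complex.sub_re, Complex.sub_re, hs] at h0
    have hle : (φ (c' * star b)).re ≤ max (φ (c' * star c')).re (φ (b * star b)).re := by
      rcases le_total (φ (c' * star c')).re (φ (b * star b)).re with h | h
      · exact le_max_of_le_right (by linarith)
      · exact le_max_of_le_left (by linarith)
    refine (ENNReal.ofReal_le_ofReal hle).trans ?_
    rw [ENNReal.ofReal_max]
    exact max_le
      (le_iSup₂ (f := fun (c : N) (_ : τ (star c * c) ≤ 1) => ENNReal.ofReal (φ (c * star c)).re)
        c' hc')
      (le_iSup₂ (f := fun (c : N) (_ : τ (star c * c) ≤ 1) => ENNReal.ofReal (φ (c * star c)).re)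
        b hb)
  · refine le_trans ?_ (le_iSup₂_of_le c hc (le_iSup₂_of_le c hc le_rfl))
    rw [← ofReal_norm]
    exact ENNReal.ofReal_le_ofReal (Complex.re_le_norm _)

lemma starMul₂_smul (f g : τ.L2) (c : ℂ) (y : N) :
    τ.starMul₂ f g (c • y) = c * τ.starMul₂ f g y := by
  rw [starMul₂_apply, starMul₂_apply, map_smul, smul_apply, inner_smul_right]

lemma re_starMul₂_star (f : τ.L2) (y : N) :
    (τ.starMul₂ f f (star y)).re = (τ.starMul₂ f f y).re := by
  rw [starMul₂_swap, Complex.conj_re]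

end NSFTrace

namespace StandardSemigroup

open NSFTrace

variable (S : StandardSemigroup τ) (hS : S.GammaSqNonneg)

/-- The Poisson system is built over ℝ; complex homogeneity is recovered from the strong integral
and is needed for the phase argument in `opNorm_eq`. -/
lemma poisson_smul {t : ℝ} (ht : 0 < t) (c : ℂ) (y : N) :
    S.poisson.P t (c • y) = c • S.poisson.P t y := by
  apply Subtype.ext
  ext ξ
  have h1 := S.integral_apply (integrableOn_subDensity ht) (c • y) ξ
  have h2 := S.integral_apply (integrableOn_subDensity ht) y ξ
  refine h1.trans (Eq.trans ?_ (congrArg (c • ·) h2.symm))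
  rw [← integral_smul]
  refine setIntegral_congr_fun measurableSet_Ioi fun u hu => ?_
  have : S.TR u (c • y) = c • S.TR u y := map_smul (S.TL u) c y
  simp only [this]
  exact smul_comm _ _ _

lemma poisson_star {t : ℝ} (ht : 0 < t) (y : N) :
    S.poisson.P t (star y) = star (S.poisson.P t y) :=
  S.integral_star (integrableOn_subDensity ht) y

lemma iSup_ΩL2 (F : ((N →L[ℝ] ℂ) →L[ℝ] ℝ) → ℝ≥0∞) : ⨆ ω ∈ (S.gradientSystemL2 hS).Ω, F ω =
    ⨆ (c : N) (_ : τ (star c * c) ≤ 1), F (evalRe N (c * star c)) := by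
  refine le_antisymm (iSup₂_le ?_) (iSup₂_le fun c hc => ?_)
  · rintro _ ⟨c, hc, rfl⟩
    exact le_iSup₂ (f := fun (c : N) (_ : τ (star c * c) ≤ 1) => F (evalRe N (c * star c))) c hc
  · exact le_iSup₂ (f := fun ω (_ : ω ∈ (S.gradientSystemL2 hS).Ω) => F ω) _ ⟨c, hc, rfl⟩

lemma bmo2_eq (f : τ.L2) : S.bmo2 f = (S.gradientSystemL2 hS).bmoSq f ^ (1 / 2 : ℝ) := by
  rw [bmo2, iSup₂_rpow_half fun t => τ.opNorm fun y =>
    τ.starMul f f (S.P t y) - τ.starMul (S.P2 t f) (S.P2 t f) y]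
  congr 1
  refine iSup_congr fun t => iSup_congr fun ht => ?_
  have e : (fun y => τ.starMul f f (S.P t y) - τ.starMul (S.P2 t f) (S.P2 t f) y) =
      (S.gradientSystemL2 hS).variance t f := by
    funext y
    rw [starMul_eq, starMul_eq, S.P_eq ht, S.P2_eq ht]
    rfl
  rw [S.iSup_ΩL2 hS, e]
  refine opNorm_eq (fun c y => ?_) (fun y => ?_) ((S.gradientSystemL2 hS).schwarz_P t f ht)
  · change τ.starMul₂ f f (S.poisson.P t (c • y)) - τ.starMul₂ _ _ (c • y) =
      c * (τ.starMul₂ f f (S.poisson.P t y) - τ.starMul₂ _ _ y)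
    rw [S.poisson_smul ht, starMul₂_smul, starMul₂_smul, mul_sub]
  · set g := S.poissonL2.P t f
    change (τ.starMul₂ f f (S.poisson.P t (star y)) - τ.starMul₂ g g (star y)).re =
      (τ.starMul₂ f f (S.poisson.P t y) - τ.starMul₂ g g y).re
    rw [S.poisson_star ht, Complex.sub_re, Complex.sub_re, re_starMul₂_star, re_starMul₂_star]

lemma BMO2_eq (f : τ.L2) : S.BMO2 f = (S.gradientSystemL2 hS).BMOSq f ^ (1 / 2 : ℝ) := by
  rw [BMO2, iSup₂_rpow_half fun t => τ.opNorm fun y =>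
    τ.starMul (f - S.P2 t f) (f - S.P2 t f) (S.P t y)]
  congr 1
  refine iSup_congr fun t => iSup_congr fun ht => ?_
  set g := f - S.poissonL2.P t f with hg
  have e : (fun y => τ.starMul (f - S.P2 t f) (f - S.P2 t f) (S.P t y)) =
      (S.poisson.dual ℂ).P t (τ.starMul₂ g g) := by
    funext y
    rw [starMul_eq, S.P_eq ht, S.P2_eq ht]
    rfl
  rw [S.iSup_ΩL2 hS, e]
  refine opNorm_eq (fun c y => ?_) (fun y => ?_)
    ((S.gradientSystemL2 hS).pos_P t _ ht ((S.gradientSystemL2 hS).pos_B g))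
  · change τ.starMul₂ g g (S.poisson.P t (c • y)) = c * τ.starMul₂ g g (S.poisson.P t y)
    rw [S.poisson_smul ht, starMul₂_smul]
  · change (τ.starMul₂ g g (S.poisson.P t (star y))).re = (τ.starMul₂ g g (S.poisson.P t y)).re
    rw [S.poisson_star ht, re_starMul₂_star]

lemma gradQuotL2_eq {r : ℝ} (hr : 0 < r) (f : τ.L2) (y : N) :
    (S.gradientSystemL2 hS).gradQuot r f y = S.gradApprox2 r f f y := by
  have h1 : S.diffQuot2 r f = r⁻¹ • (f - S.TL2 r f) := by
    rw [diffQuot2, S.T2_eq hr.le, Complex.coe_smul]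
  have h2 : (1 / 2 : ℂ) = ((1 / 2 : ℝ) : ℂ) := by norm_num
  rw [gradApprox2, h1, starMul_eq, starMul_eq, starMul_eq, starMul_eq, h2, ← Complex.real_smul,
    ← Complex.real_smul, ← S.poisson_T hr.le]
  rfl

lemma PGradHat2_eq {t s : ℝ} (ht : 0 < t) (hs : 0 < s) (f : τ.L2) (y : N) :
    S.PGradHat2 t s f y = (S.gradientSystemL2 hS).gradHat f t s y := by
  have h1 : deriv (fun s' => S.P2 s' f) s = S.poissonL2.dP s f := by
    refine ((S.poissonL2.hasDerivAt_P_apply hs f).congr_of_eventuallyEq ?_).deriv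
    filter_upwards [lt_mem_nhds hs] with a ha using S.P2_eq ha f
  have h2 : S.PGrad2 t s f y = (S.gradientSystemL2 hS).grad f t s y := by
    refine Tendsto.limUnder_eq ((((ContinuousLinearMap.apply ℝ ℂ y).continuous.tendsto _).comp
      ((S.gradientSystemL2 hS).tendsto_gradQuot f ht hs)).congr' ?_)
    filter_upwards [self_mem_nhdsWithin] with r hr
    rw [← S.gradQuotL2_eq hS hr, S.P_eq ht, S.P2_eq hs]
    rfl
  rw [PGradHat2, h1, h2, starMul_eq, S.P_eq ht]
  rfl

lemma BMOGammaHat2_eq (f : τ.L2) :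
    S.BMOGammaHat2 f = (S.gradientSystemL2 hS).areaSq f ^ (1 / 2 : ℝ) := by
  rw [BMOGammaHat2, iSup₂_rpow_half fun t => ⨆ (b : N) (_ : τ (star b * b) ≤ 1), ∫⁻ s in Ioo 0 t,
    ENNReal.ofReal ((S.PGradHat2 t s f (b * star b)).re * s)]
  congr 1
  refine iSup_congr fun t => iSup_congr fun ht => ?_
  rw [S.iSup_ΩL2 hS]
  refine iSup_congr fun b => iSup_congr fun _ =>
    setLIntegral_congr_fun measurableSet_Ioo fun v hv => ?_
  simp only [S.PGradHat2_eq hS ht hv.1]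
  rfl

end StandardSemigroup
end SemigroupBMO

end

theorem mainTheorem7 :
    ∃ C : ℝ≥0, 0 < C ∧
      ∀ (H : Type u) [NormedAddCommGroup H] [InnerProductSpace ℂ H] [CompleteSpace H]
        (N : VonNeumannAlgebra H) (τ : SemigroupBMO.NSFTrace N)
        (S : SemigroupBMO.StandardSemigroup τ), S.GammaSqNonneg →
        (∀ f : N,
          S.BMO f ≤ C * S.bmo f ∧ S.bmo f ≤ C * S.BMO f ∧
          S.BMOGammaHat f ≤ C * S.bmo f ∧ S.bmo f ≤ C * S.BMOGammaHat f ∧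
          S.BMOGammaHat f ≤ C * S.BMO f ∧ S.BMO f ≤ C * S.BMOGammaHat f) ∧
        (∀ f : τ.L2,
          S.BMO2 f ≤ C * S.bmo2 f ∧ S.bmo2 f ≤ C * S.BMO2 f ∧
          S.BMOGammaHat2 f ≤ C * S.bmo2 f ∧ S.bmo2 f ≤ C * S.BMOGammaHat2 f ∧
          S.BMOGammaHat2 f ≤ C * S.BMO2 f ∧ S.BMO2 f ≤ C * S.BMOGammaHat2 f) := by
  -- The constant comes from the abstract comparison alone, so it is the same for N and L_2(N) and
  -- for all semigroups.
  exact ⟨100, by norm_num, fun H _ _ _ N τ S hS =>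
    ⟨fun f => (S.gradientSystem hS).seminorms_equivalent f (S.bmo_eq hS f) (S.BMO_eq hS f)
      (S.BMOGammaHat_eq hS f),
    fun f => (S.gradientSystemL2 hS).seminorms_equivalent f (S.bmo2_eq hS f) (S.BMO2_eq hS f)
      (S.BMOGammaHat2_eq hS f)⟩⟩
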